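/- Let $R$ be a commutative ring containing an element $i$ with $i^2=-1$. A *bi-web* is a circle with two vertices that divide it into two edges, both oriented from one vertex to the other. A *singular 2-cobordism* is a compact smooth surface $\Sigma$ with a properly embedded 1-dimensional submanifold (the *singular arcs and circles*) and an orientation of its complement such that the orientations on the two sides of each singular arc or circle disagree; its collared boundary is identified with a source $\mathbf n$ and a target $\mathbf m$, which are finite sequences of clockwise oriented circles (written $0$) and bi-webs (written $1$; the vertices are the ends of singular arcs). Two such cobordisms are *equivalent*, written $\Sigma\cong\Sigma'$, if there is a diffeomorphism between them that preserves the singular set and the orientations and is the identity near the boundary. $\textbf{Sing-2Cob}$ has as objects these sequences and as morphisms equivalence classes of singular 2-cobordisms; composition is gluing, the monoidal product $\amalg$ is disjoint union together with concatenation of sequences (strictly associative and unital), and the symmetry $\tau$ is given by permuted cylinders. Write $C=(0)$, $W=(1)$. Let $m_C,\iota_C,\Delta_C,\epsilon_C$ be the pair of pants $C\amalg C\to C$, the disc $\emptyset\to C$, and these two surfaces upside down. Let $m_W\colon W\amalg W\to W$ be the pair of pants with three singular arcs, one joining each pair of boundary components, which cut it into two hexagons; let $\iota_W\colon\emptyset\to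 W$ be the disc with one singular arc; and let $\Delta_W,\epsilon_W$ be these upside down. Let the *zipper* $z\colon C\to W$ be the annulus with one singular arc that has both ends on the bi-web and cuts off a half disc, and let the *cozipper* $z^*\colon W\to C$ be the zipper upside down. Then: 1. $(C,m_C,\iota_C,\Delta_C,\epsilon_C)$ is a commutative Frobenius algebra object in $\textbf{Sing-2Cob}$: $m_C(\mathrm{id}\amalg m_C)\cong m_C(m_C\amalg\mathrm{id})$, $m_C(\mathrm{id}\amalg\iota_C)\cong\mathrm{id}\cong m_C(\iota_C\amalg\mathrm{id})$, $(\mathrm{id}\amalg\Delta_C)\Delta_C\cong(\Delta_C\amalg\mathrm{id})\Delta_C$, $(\mathrm{id}\amalg\epsilon_C)\Delta_C\cong\mathrm{id}\cong(\epsilon_C\amalg\mathrm{id})\Delta_C$, $(m_C\amalg\mathrm{id})(\mathrm{id}\amalg\Delta_C)\cong\Delta_C m_C\cong(\mathrm{id}\amalg m_C)(\Delta_C\amalg\mathrm{id})$, and $m_C\tau_{C,C}\cong m_C$. 2. $(W,m_W,\iota_W,\Delta_W,\epsilon_W)$ is a symmetric Frobenius algebra object: the same relations hold with $W$ in place of $C$,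 except the last one, which is replaced by $\epsilon_W m_W\cong\epsilon_W m_W\tau_{W,W}$. 3. $z$ is a homomorphism of algebra objects: $z\,m_C\cong m_W(z\amalg z)$ and $z\,\iota_C\cong\iota_W$. 4. $z^*$ is dual to $z$: $\epsilon_C m_C(\mathrm{id}_C\amalg z^*)\cong\epsilon_W m_W(z\amalg\mathrm{id}_W)$. 5. Centrality: $m_W(\mathrm{id}_W\amalg z)\cong m_W\tau_{W,W}(\mathrm{id}_W\amalg z)$. 6. Allow $R$-linear combinations of morphisms, extend composition and disjoint union bilinearly, and impose the local relations $z\circ z^*=-i\,\mathrm{id}_W$ and $z^*\circ z=-i\,\mathrm{id}_C$, that is, divide by the smallest family of submodules that contains them and is stable under composition and disjoint union with arbitrary morphisms. In the resulting category $z$ and $i z^*$ are mutually inverse: $(i z^*)\circ z=\mathrm{id}_C$ and $z\circ(i z^*)=\mathrm{id}_W$. -/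

import Mathlib

open Set Topology
open scoped ContDiff Manifold

universe u

noncomputable section

namespace SingCob

/-- The two kinds of closed connected one-manifolds: the (clockwise oriented) circle, and the
bi-web, a circle with two bivalent vertices at which the orientations of the two edges disagree. -/
inductive Web : Type
  | circle
  | biweb

/-- The piecewise orientation of the plane attached to a kind of web, recorded by a weight `w`:
at `z` the plane is oriented clockwise if `w z > 0` and counterclockwise if `w z < 0`, and `z` is
a singular point if `w z = 0`. -/
def Web.weight : Web → ℂ → ℝ
  | .circle => fun _ => 1
  | .biweb => fun z => z.im

/-- `f` is a smooth local diffeomorphism on `s` that maps singular points, and only these, to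
singular points and preserves the orientation away from them, where source and target are
piecewise oriented by the weights `w` and `w'`. -/
def SignedSmoothOn (w w' : ℂ → ℝ) (f : ℂ → ℂ) (s : Set ℂ) : Prop :=
  ContDiffOn ℝ ∞ f s ∧ ∀ z ∈ s, (fderiv ℝ f z).det ≠ 0 ∧ (w' (f z) = 0 ↔ w z = 0) ∧
    (w z ≠ 0 → 0 < w z * w' (f z) * (fderiv ℝ f z).det)

theorem SignedSmoothOn.comp {w w' w'' : ℂ → ℝ} {f g : ℂ → ℂ} {s t : Set ℂ}
    (hg : SignedSmoothOn w' w'' g t) (hf : SignedSmoothOn w w' f s) (hs : IsOpen s)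
    (ht : IsOpen t) : SignedSmoothOn w w'' (g ∘ f) (s ∩ f ⁻¹' t) := by
  refine ⟨hg.1.comp (hf.1.mono inter_subset_left) inter_subset_right, fun z hz => ?_⟩
  have df : DifferentiableAt ℝ f z :=
    (hf.1.contDiffAt (hs.mem_nhds hz.1)).differentiableAt (by simp)
  have dg : DifferentiableAt ℝ g (f z) :=
    (hg.1.contDiffAt (ht.mem_nhds hz.2)).differentiableAt (by simp)
  have hdet : (fderiv ℝ (g ∘ f) z).det = (fderiv ℝ g (f z)).det * (fderiv ℝ f z).det := by
    rw [fderiv_comp z dg df]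
    simp [ContinuousLinearMap.det, LinearMap.det_comp]
  obtain ⟨f1, f2, f3⟩ := hf.2 z hz.1
  obtain ⟨g1, g2, g3⟩ := hg.2 (f z) hz.2
  refine ⟨by rw [hdet]; exact mul_ne_zero g1 f1, by simp [g2, f2], fun hw => ?_⟩
  have hw' : w' (f z) ≠ 0 := fun h => hw (f2.1 h)
  have h1 := f3 hw
  have h2 := g3 hw'
  have h3 : 0 < w' (f z) ^ 2 := by positivity
  rw [hdet]
  have h4 := mul_pos h1 h2
  have h5 : w z * w' (f z) * (fderiv ℝ f z).det *
      (w' (f z) * w'' (g (f z)) * (fderiv ℝ g (f z)).det) = w' (f z) ^ 2 *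
      (w z * w'' ((g ∘ f) z) * ((fderiv ℝ g (f z)).det * (fderiv ℝ f z).det)) := by
    simp only [Function.comp]; ring
  rw [h5] at h4
  exact pos_of_mul_pos_right h4 h3.le

theorem SignedSmoothOn.congr {w w' : ℂ → ℝ} {f g : ℂ → ℂ} {s : Set ℂ}
    (hf : SignedSmoothOn w w' f s) (hs : IsOpen s) (h : ∀ z ∈ s, g z = f z) :
    SignedSmoothOn w w' g s := by
  refine ⟨hf.1.congr h, fun z hz => ?_⟩
  have : fderiv ℝ g z = fderiv ℝ f z :=
    Filter.EventuallyEq.fderiv_eq (Filter.eventuallyEq_of_mem (hs.mem_nhds hz) h)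
  rw [this, h z hz]
  exact hf.2 z hz

theorem SignedSmoothOn.mono {w w' : ℂ → ℝ} {f : ℂ → ℂ} {s t : Set ℂ}
    (hf : SignedSmoothOn w w' f s) (h : t ⊆ s) : SignedSmoothOn w w' f t :=
  ⟨hf.1.mono h, fun z hz => hf.2 z (h hz)⟩

theorem SignedSmoothOn.neg {w w' : ℂ → ℝ} {f : ℂ → ℂ} {s : Set ℂ}
    (hf : SignedSmoothOn w w' f s) : SignedSmoothOn (-w) (-w') f s := by
  refine ⟨hf.1, fun z hz => ?_⟩
  simpa using hf.2 z hz

theorem SignedSmoothOn.symm {w w' : ℂ → ℝ} (e : OpenPartialHomeomorph ℂ ℂ)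
    (he : SignedSmoothOn w w' e e.source) : SignedSmoothOn w' w e.symm e.target := by
  have key : ∀ y ∈ e.target, ContDiffAt ℝ ∞ e.symm y ∧
      (fderiv ℝ e (e.symm y)).det * (fderiv ℝ e.symm y).det = 1 := by
    intro y hy
    have hx := e.map_target hy
    have hc : ContDiffAt ℝ ∞ e (e.symm y) := he.1.contDiffAt (e.open_source.mem_nhds hx)
    have hd : DifferentiableAt ℝ e (e.symm y) := hc.differentiableAt (by simp)
    have hs : ContDiffAt ℝ ∞ e.symm y :=
      e.contDiffAt_symm (f₀' := (fderiv ℝ e (e.symm y)).toContinuousLinearEquivOfDetNeZero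
        (he.2 _ hx).1) hy (by simpa using hd.hasFDerivAt) hc
    refine ⟨hs, ?_⟩
    have h1 : fderiv ℝ (e ∘ e.symm) y = fderiv ℝ id y :=
      Filter.EventuallyEq.fderiv_eq (Filter.eventuallyEq_of_mem (e.open_target.mem_nhds hy)
        fun z hz => e.right_inv hz)
    rw [fderiv_comp y hd (hs.differentiableAt (by simp)), fderiv_id] at h1
    have h2 := congrArg ContinuousLinearMap.det h1
    simpa [ContinuousLinearMap.det, LinearMap.det_comp] using h2
  refine ⟨fun y hy => (key y hy).1.contDiffWithinAt, fun y hy => ?_⟩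
  obtain ⟨-, h⟩ := key y hy
  obtain ⟨h1, h2, h3⟩ := he.2 _ (e.map_target hy)
  rw [e.right_inv hy] at h2 h3
  refine ⟨right_ne_zero_of_mul_eq_one h, h2.symm, fun hw => ?_⟩
  have h4 := h3 (fun h => hw (h2.2 h))
  have h5 : w' y * w (e.symm y) * (fderiv ℝ e.symm y).det =
      w (e.symm y) * w' y * (fderiv ℝ e (e.symm y)).det * (fderiv ℝ e.symm y).det ^ 2 := by
    linear_combination (-(w' y * w (e.symm y) * (fderiv ℝ e.symm y).det)) * h
  rw [h5]
  have h6 := right_ne_zero_of_mul_eq_one h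
  positivity

theorem SignedSmoothOn.id_on (w : ℂ → ℝ) (s : Set ℂ) : SignedSmoothOn w w id s := by
  refine ⟨contDiff_id.contDiffOn, fun z _ => ?_⟩
  have : (fderiv ℝ (id : ℂ → ℂ) z).det = 1 := by
    rw [fderiv_id]; simp [ContinuousLinearMap.det]
  rw [this]
  refine ⟨one_ne_zero, Iff.rfl, fun h => ?_⟩
  simpa using mul_self_pos.2 h

/-- The groupoid of local coordinate changes of piecewise oriented smooth surfaces. The local
model is the plane with the real axis as singular line, the open upper half plane being oriented
clockwise and the open lower half plane counterclockwise. Charts around nonsingular points are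
those that avoid the real axis. The orientations of the two facets that meet at a singular line
disagree, hence they induce the same orientation on it, and the members of the groupoid
preserve this orientation as well. -/
def singGroupoid : StructureGroupoid ℂ :=
  Pregroupoid.groupoid
    { property := SignedSmoothOn Complex.im Complex.im
      comp := fun hf hg hu hv _ => hg.comp hf hu hv
      id_mem := SignedSmoothOn.id_on _ _
      locality := by
        intro f u hu h
        refine ⟨fun z hz => ?_, fun z hz => ?_⟩
        · obtain ⟨v, hv, hzv, hf⟩ := h z hz
          exact (hf.1.contDiffAt ((hu.inter hv).mem_nhds ⟨hz, hzv⟩)).contDiffWithinAt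
        · obtain ⟨v, hv, hzv, hf⟩ := h z hz
          exact hf.2 z ⟨hz, hzv⟩
      congr := fun hu h hf => hf.congr hu h }

theorem mem_singGroupoid {e : OpenPartialHomeomorph ℂ ℂ} :
    e ∈ singGroupoid ↔ SignedSmoothOn Complex.im Complex.im e e.source := by
  refine mem_groupoid_of_pregroupoid.trans ⟨fun h => h.1, fun h => ⟨h, ?_⟩⟩
  exact h.symm e

instance : ClosedUnderRestriction singGroupoid := by
  refine (closedUnderRestriction_iff_id_le _).2 ?_
  refine StructureGroupoid.le_iff.2 ?_
  rintro e ⟨s, hs, hes⟩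
  refine singGroupoid.mem_of_eqOnSource ?_ hes
  exact mem_singGroupoid.2 (SignedSmoothOn.id_on _ _)

theorem mem_singGroupoid_of_empty {e : OpenPartialHomeomorph ℂ ℂ} (h : ∀ z, z ∉ e.source) :
    e ∈ singGroupoid :=
  singGroupoid.locality fun z hz => absurd hz (h z)

/-! ### Standard coordinates -/

theorem det_eq (L : ℂ →L[ℝ] ℂ) :
    L.det = (L 1).re * (L Complex.I).im - (L Complex.I).re * (L 1).im := by
  rw [ContinuousLinearMap.det, ← LinearMap.det_toMatrix Complex.basisOneI, Matrix.det_fin_two]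
  simp [LinearMap.toMatrix_apply, Complex.basisOneI]

/-- The standard coordinate of the plane that is piecewise oriented by `b.weight`: the identity
for the bi-web, and an embedding in the upper half plane for the circle. -/
def flatten : Web → ℂ → ℂ
  | .circle => fun z => ⟨z.re, Real.exp z.im⟩
  | .biweb => fun z => z

theorem flatten_circle : flatten .circle =
    fun z => Complex.equivRealProdCLM.symm (z.re, Real.exp z.im) := by
  funext z
  apply Complex.ext
  · simp [flatten, Complex.equivRealProdCLM_symm_apply]
  · simp only [flatten, Complex.equivRealProdCLM_symm_apply]
    simp [-Complex.ofReal_exp]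

theorem flatten_isOpenEmbedding (b : Web) : IsOpenEmbedding (flatten b) := by
  cases b with
  | biweb => exact IsOpenEmbedding.id
  | circle =>
    have h : IsOpenEmbedding (Prod.map (id : ℝ → ℝ) Real.exp) :=
      IsOpenEmbedding.id.prodMap Real.isOpenEmbedding_exp
    have := Complex.equivRealProdCLM.symm.toHomeomorph.isOpenEmbedding.comp
      (h.comp Complex.equivRealProdCLM.toHomeomorph.isOpenEmbedding)
    rw [flatten_circle]
    exact this

theorem flatten_signedSmooth (b : Web) :
    SignedSmoothOn b.weight Complex.im (flatten b) univ := by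
  cases b with
  | biweb => exact SignedSmoothOn.id_on _ _
  | circle =>
    have hre (z : ℂ) : HasFDerivAt (fun z : ℂ => z.re) Complex.reCLM z :=
      Complex.reCLM.hasFDerivAt
    have him (z : ℂ) : HasFDerivAt (fun z : ℂ => z.im) Complex.imCLM z :=
      Complex.imCLM.hasFDerivAt
    have h : ∀ z : ℂ, HasFDerivAt (flatten .circle)
        ((Complex.equivRealProdCLM.symm : ℝ × ℝ →L[ℝ] ℂ).comp
          (Complex.reCLM.prod (Real.exp z.im • Complex.imCLM))) z := by
      intro z
      rw [flatten_circle]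
      exact (Complex.equivRealProdCLM.symm : ℝ × ℝ →L[ℝ] ℂ).hasFDerivAt.comp z
        ((hre z).prodMk (him z).exp)
    constructor
    · rw [flatten_circle]
      exact (Complex.equivRealProdCLM.symm.contDiff.comp
        (Complex.reCLM.contDiff.prodMk
          (Real.contDiff_exp.comp Complex.imCLM.contDiff))).contDiffOn
    · intro z _
      have hdet : (fderiv ℝ (flatten .circle) z).det = Real.exp z.im := by
        rw [(h z).fderiv, det_eq]
        simp [Complex.equivRealProdCLM_symm_apply, -Complex.ofReal_exp]
      rw [hdet]
      have := Real.exp_pos z.im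
      refine ⟨this.ne', by simp [flatten, Web.weight], fun _ => ?_⟩
      simp only [flatten, Web.weight]
      positivity

/-- The underlying space of the bi-infinite cylinder over a circle or a bi-web: the punctured
plane, in which `(u, t)` with `|u| = 1` and `t` real is the point `exp t • u`. The circle or
bi-web itself is the unit circle `t = 0`; the two vertices of the bi-web are `1` and `-1`. -/
abbrev Cyl : Type := ({0}ᶜ : Set ℂ)

instance : Nonempty Cyl := ⟨⟨1, by simp⟩⟩

theorem isOpenEmbedding_coe_of_isOpen {U : Set ℂ} (hU : IsOpen U) (b : Web) :
    IsOpenEmbedding (fun z : U => flatten b z) :=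
  (flatten_isOpenEmbedding b).comp hU.isOpenEmbedding_subtypeVal

/-- The global coordinate of the cylinder over `b`; it makes the cylinder a piecewise oriented
smooth surface. -/
def cylChart (b : Web) : OpenPartialHomeomorph Cyl ℂ :=
  (isOpenEmbedding_coe_of_isOpen isOpen_compl_singleton b).toOpenPartialHomeomorph _

/-! ### Singular cobordisms -/

/-- `e` is a smooth, orientation preserving open embedding of the cylinder over `b` in the
piecewise oriented smooth surface `M`. -/
def IsCollar (b : Web) {M : Type} [TopologicalSpace M] [ChartedSpace ℂ M] (e : Cyl → M) : Prop :=
  ∃ h : IsOpenEmbedding e, ∀ c ∈ atlas ℂ M,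
    (cylChart b).symm ≫ₕ h.toOpenPartialHomeomorph e ≫ₕ c ∈ singGroupoid

/-- A collared singular 2-cobordism from `n` to `m`. `M` is the surface `Σ` with an open outer
collar glued to each boundary component, so that `M` is a piecewise oriented smooth surface
without boundary. `src j` and `tgt j` are the two-sided collars of the `j`-th source and target
boundary component, which is the unit circle `‖z‖ = 1` of the collar. In both cases `‖z‖` grows
in the direction from the source to the target, so that the outer part is `‖z‖ < 1` in a source
collar and `1 < ‖z‖` in a target collar. The cobordism `Σ` itself, the complement of the outer
parts, is compact. -/
structure Cob (n m : List Web) : Type 1 where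
  M : Type
  [top : TopologicalSpace M]
  [charted : ChartedSpace ℂ M]
  [groupoid : HasGroupoid M singGroupoid]
  [t2 : T2Space M]
  src : Fin n.length → Cyl → M
  tgt : Fin m.length → Cyl → M
  src_collar : ∀ j, IsCollar (n.get j) (src j)
  tgt_collar : ∀ j, IsCollar (m.get j) (tgt j)
  src_inj : ∀ i j z w, src i z = src j w → i = j ∧ z = w
  tgt_inj : ∀ i j z w, tgt i z = tgt j w → i = j ∧ z = w
  src_ne_tgt : ∀ i j z w, src i z ≠ tgt j w
  src_closed : ∀ j, IsClosed (src j '' {z | ‖(z : ℂ)‖ ≤ 1})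
  tgt_closed : ∀ j, IsClosed (tgt j '' {z | 1 ≤ ‖(z : ℂ)‖})
  compact : IsCompact {x : M | (∀ j z, src j z = x → 1 ≤ ‖(z : ℂ)‖) ∧
    (∀ j z, tgt j z = x → ‖(z : ℂ)‖ ≤ 1)}

attribute [instance] Cob.top Cob.charted Cob.groupoid Cob.t2

namespace Cob

/-- Two singular cobordisms are equivalent if there is an orientation preserving diffeomorphism
between them that is the identity on a collar neighbourhood of the boundary (hence on the
boundary; by the uniqueness of collars up to isotopy, this is no restriction). -/
def Equivalent {n m : List Web} (A B : Cob n m) : Prop :=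
  ∃ Φ : Structomorph singGroupoid A.M B.M, ∃ δ : ℝ, 0 < δ ∧
    (∀ j (z : Cyl), ‖(z : ℂ)‖ < 1 + δ → Φ.toHomeomorph (A.src j z) = B.src j z) ∧
    (∀ j (z : Cyl), 1 - δ < ‖(z : ℂ)‖ → Φ.toHomeomorph (A.tgt j z) = B.tgt j z)

/-! ### Disjoint union -/

end Cob

theorem IsCollar.comp_lift {b : Web} {M X : Type} [TopologicalSpace M] [ChartedSpace ℂ M]
    [TopologicalSpace X] {e : Cyl → M} (he : IsCollar b e) {f : M → X} (hf : IsOpenEmbedding f)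
    (h : IsOpenEmbedding (f ∘ e)) {c : OpenPartialHomeomorph M ℂ} (hc : c ∈ atlas ℂ M) :
    (cylChart b).symm ≫ₕ h.toOpenPartialHomeomorph (f ∘ e) ≫ₕ c.lift_openEmbedding hf
      ∈ singGroupoid := by
  obtain ⟨h', he⟩ := he
  refine singGroupoid.mem_of_eqOnSource (he c hc) ⟨?_, ?_⟩
  · ext z
    simp [hf.injective.eq_iff]
  · intro z _
    simp [hf.injective.extend_apply]

theorem IsCollar.comp_lift_empty {b : Web} {M N X : Type} [TopologicalSpace M]
    [TopologicalSpace N] [TopologicalSpace X] {e : Cyl → M} {f : M → X} {g : N → X}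
    (hg : IsOpenEmbedding g) (h : IsOpenEmbedding (f ∘ e)) (c : OpenPartialHomeomorph N ℂ)
    (hne : ∀ z y, f (e z) ≠ g y) :
    (cylChart b).symm ≫ₕ h.toOpenPartialHomeomorph (f ∘ e) ≫ₕ c.lift_openEmbedding hg
      ∈ singGroupoid := by
  refine mem_singGroupoid_of_empty fun z hz => ?_
  simp only [OpenPartialHomeomorph.trans_source, mem_inter_iff, mem_preimage,
    OpenPartialHomeomorph.lift_openEmbedding_source] at hz
  obtain ⟨-, -, y, -, hy⟩ := hz
  exact hne _ y hy.symm

/-- The components of a concatenation are those of the first and those of the second list. -/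
def splitIdx (n n' : List Web) : Fin (n ++ n').length ≃ Fin n.length ⊕ Fin n'.length :=
  (finCongr List.length_append).trans finSumFinEquiv.symm

theorem get_splitIdx (n n' : List Web) (j : Fin (n ++ n').length) :
    (n ++ n').get j = Sum.elim n.get n'.get (splitIdx n n' j) := by
  obtain ⟨x, rfl⟩ := (splitIdx n n').symm.surjective j
  cases x <;> simp [splitIdx]

namespace Cob

/-- The disjoint union of two families of collars, over the concatenation of the lists. -/
def unionCollars {n n' : List Web} {M N : Type} (a : Fin n.length → Cyl → M)
    (b : Fin n'.length → Cyl → N) (j : Fin (n ++ n').length) (z : Cyl) : M ⊕ N :=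
  Sum.map (fun i => a i z) (fun i => b i z) (splitIdx n n' j)

theorem unionCollars_collar {n n' : List Web} {M N : Type} [TopologicalSpace M]
    [ChartedSpace ℂ M] [TopologicalSpace N] [ChartedSpace ℂ N] {a : Fin n.length → Cyl → M}
    {b : Fin n'.length → Cyl → N} (ha : ∀ j, IsCollar (n.get j) (a j))
    (hb : ∀ j, IsCollar (n'.get j) (b j)) (j : Fin (n ++ n').length) :
    IsCollar ((n ++ n').get j) (unionCollars a b j) := by
  rw [get_splitIdx]
  unfold unionCollars
  cases splitIdx n n' j with
  | inl i =>
    have h : IsOpenEmbedding ((Sum.inl : M → M ⊕ N) ∘ a i) :=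
      IsOpenEmbedding.inl.comp (ha i).1
    refine ⟨h, fun c hc => ?_⟩
    rcases ChartedSpace.mem_atlas_sum hc with ⟨c', hc', rfl⟩ | ⟨c', hc', rfl⟩
    · exact (ha i).comp_lift IsOpenEmbedding.inl h hc'
    · exact IsCollar.comp_lift_empty IsOpenEmbedding.inr h c' (by simp)
  | inr i =>
    have h : IsOpenEmbedding ((Sum.inr : N → M ⊕ N) ∘ b i) :=
      IsOpenEmbedding.inr.comp (hb i).1
    refine ⟨h, fun c hc => ?_⟩
    rcases ChartedSpace.mem_atlas_sum hc with ⟨c', hc', rfl⟩ | ⟨c', hc', rfl⟩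
    · exact IsCollar.comp_lift_empty IsOpenEmbedding.inl h c' (by simp)
    · exact (hb i).comp_lift IsOpenEmbedding.inr h hc'

theorem unionCollars_inj {n n' : List Web} {M N : Type} {a : Fin n.length → Cyl → M}
    {b : Fin n'.length → Cyl → N} (ha : ∀ i j z w, a i z = a j w → i = j ∧ z = w)
    (hb : ∀ i j z w, b i z = b j w → i = j ∧ z = w) (i j : Fin (n ++ n').length) (z w : Cyl)
    (h : unionCollars a b i z = unionCollars a b j w) : i = j ∧ z = w := by
  unfold unionCollars at h
  rcases hi : splitIdx n n' i with i' | i' <;> rcases hj : splitIdx n n' j with j' | j' <;>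
    simp only [hi, hj, Sum.map_inl, Sum.map_inr, Sum.inl.injEq, Sum.inr.injEq, reduceCtorEq] at h
  · obtain ⟨rfl, rfl⟩ := ha _ _ _ _ h
    exact ⟨(splitIdx n n').injective (hi.trans hj.symm), rfl⟩
  · obtain ⟨rfl, rfl⟩ := hb _ _ _ _ h
    exact ⟨(splitIdx n n').injective (hi.trans hj.symm), rfl⟩

theorem unionCollars_closed {n n' : List Web} {M N : Type} [TopologicalSpace M]
    [TopologicalSpace N] {a : Fin n.length → Cyl → M} {b : Fin n'.length → Cyl → N} {S : Set Cyl}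
    (ha : ∀ j, IsClosed (a j '' S)) (hb : ∀ j, IsClosed (b j '' S)) (j : Fin (n ++ n').length) :
    IsClosed (unionCollars a b j '' S) := by
  unfold unionCollars
  cases splitIdx n n' j with
  | inl i =>
    have := IsClosedEmbedding.inl (X := M) (Y := N) |>.isClosedMap _ (ha i)
    rwa [image_image] at this
  | inr i =>
    have := IsClosedEmbedding.inr (X := M) (Y := N) |>.isClosedMap _ (hb i)
    rwa [image_image] at this

/-- The free union of singular cobordisms. -/
def tensor {n m n' m' : List Web} (A : Cob n m) (B : Cob n' m') : Cob (n ++ n') (m ++ m') where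
  M := A.M ⊕ B.M
  groupoid := by
    refine ⟨fun {e e'} he he' => ?_⟩
    rcases ChartedSpace.mem_atlas_sum he with ⟨c, hc, rfl⟩ | ⟨c, hc, rfl⟩ <;>
      rcases ChartedSpace.mem_atlas_sum he' with ⟨c', hc', rfl⟩ | ⟨c', hc', rfl⟩
    · rw [OpenPartialHomeomorph.lift_openEmbedding_trans]
      exact singGroupoid.compatible hc hc'
    · refine mem_singGroupoid_of_empty fun z hz => ?_
      simp at hz
    · refine mem_singGroupoid_of_empty fun z hz => ?_
      simp at hz
    · rw [OpenPartialHomeomorph.lift_openEmbedding_trans]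
      exact singGroupoid.compatible hc hc'
  src := unionCollars A.src B.src
  tgt := unionCollars A.tgt B.tgt
  src_collar := unionCollars_collar A.src_collar B.src_collar
  tgt_collar := unionCollars_collar A.tgt_collar B.tgt_collar
  src_inj := unionCollars_inj A.src_inj B.src_inj
  tgt_inj := unionCollars_inj A.tgt_inj B.tgt_inj
  src_ne_tgt := by
    intro i j z w h
    unfold unionCollars at h
    rcases hi : splitIdx n n' i with i' | i' <;> rcases hj : splitIdx m m' j with j' | j' <;>
      simp only [hi, hj, Sum.map_inl, Sum.map_inr, Sum.inl.injEq, Sum.inr.injEq,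
        reduceCtorEq] at h
    · exact A.src_ne_tgt _ _ _ _ h
    · exact B.src_ne_tgt _ _ _ _ h
  src_closed := unionCollars_closed A.src_closed B.src_closed
  tgt_closed := unionCollars_closed A.tgt_closed B.tgt_closed
  compact := by
    have h := (A.compact.image (continuous_inl (Y := B.M))).union
      (B.compact.image (continuous_inr (X := A.M)))
    convert h using 1
    ext x
    have hs (n n' : List Web) {p : Fin (n ++ n').length → Prop} : (∀ j, p j) ↔
        (∀ i, p ((splitIdx n n').symm (.inl i))) ∧ (∀ i, p ((splitIdx n n').symm (.inr i))) := by
      rw [← (splitIdx n n').symm.surjective.forall.symm, Sum.forall]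
    simp only [mem_ofPred_eq, hs n n', hs m m', unionCollars, Equiv.apply_symm_apply]
    cases x <;> simp

/-! ### Composition -/

/-- The identification of the target collars of `A` with the source collars of `B`. -/
def glueSetoid {n m k : List Web} (A : Cob n m) (B : Cob m k) : Setoid (A.M ⊕ B.M) where
  r x y := x = y ∨ (∃ j z, x = .inl (A.tgt j z) ∧ y = .inr (B.src j z)) ∨
    (∃ j z, x = .inr (B.src j z) ∧ y = .inl (A.tgt j z))
  iseqv := by
    refine ⟨fun x => .inl rfl, ?_, ?_⟩
    · rintro x y (rfl | ⟨j, z, rfl, rfl⟩ | ⟨j, z, rfl, rfl⟩)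
      · exact .inl rfl
      · exact .inr (.inr ⟨j, z, rfl, rfl⟩)
      · exact .inr (.inl ⟨j, z, rfl, rfl⟩)
    · rintro x y w (rfl | ⟨j, z, rfl, rfl⟩ | ⟨j, z, rfl, rfl⟩) h
      · exact h
      · rcases h with rfl | ⟨j', z', h, -⟩ | ⟨j', z', h, rfl⟩
        · exact .inr (.inl ⟨j, z, rfl, rfl⟩)
        · simp at h
        · obtain ⟨rfl, rfl⟩ := B.src_inj _ _ _ _ (Sum.inr.inj h)
          exact .inl rfl
      · rcases h with rfl | ⟨j', z', h, rfl⟩ | ⟨j', z', h, -⟩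
        · exact .inr (.inr ⟨j, z, rfl, rfl⟩)
        · obtain ⟨rfl, rfl⟩ := A.tgt_inj _ _ _ _ (Sum.inl.inj h)
          exact .inl rfl
        · simp at h

/-- The surface obtained from `A` and `B` by gluing them along their common boundary components
(and collars). -/
def Glue {n m k : List Web} (A : Cob n m) (B : Cob m k) : Type := Quotient (glueSetoid A B)

section Glue

variable {n m k : List Web} (A : Cob n m) (B : Cob m k)

instance : TopologicalSpace (Glue A B) :=
  inferInstanceAs (TopologicalSpace (Quotient (glueSetoid A B)))

/-- The inclusion of the first surface. -/
def glueInl (x : A.M) : Glue A B := Quotient.mk (glueSetoid A B) (.inl x)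

/-- The inclusion of the second surface. -/
def glueInr (x : B.M) : Glue A B := Quotient.mk (glueSetoid A B) (.inr x)

theorem glueInl_inj {x y : A.M} (h : glueInl A B x = glueInl A B y) : x = y := by
  rcases Quotient.exact h with h | ⟨j, z, -, h⟩ | ⟨j, z, h, -⟩
  · exact Sum.inl.inj h
  · simp at h
  · simp at h

theorem glueInr_inj {x y : B.M} (h : glueInr A B x = glueInr A B y) : x = y := by
  rcases Quotient.exact h with h | ⟨j, z, h, -⟩ | ⟨j, z, -, h⟩
  · exact Sum.inr.inj h
  · simp at h
  · simp at h

theorem glueInl_eq_glueInr {x : A.M} {y : B.M} :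
    glueInl A B x = glueInr A B y ↔ ∃ j z, x = A.tgt j z ∧ y = B.src j z := by
  constructor
  · intro h
    rcases Quotient.exact h with h | ⟨j, z, h, h'⟩ | ⟨j, z, h, -⟩
    · simp at h
    · exact ⟨j, z, Sum.inl.inj h, Sum.inr.inj h'⟩
    · simp at h
  · rintro ⟨j, z, rfl, rfl⟩
    exact Quotient.sound (.inr (.inl ⟨j, z, rfl, rfl⟩))

theorem glue_cases (x : Glue A B) : (∃ a, glueInl A B a = x) ∨ ∃ b, glueInr A B b = x := by
  obtain ⟨y, rfl⟩ := Quotient.exists_rep x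
  cases y with
  | inl a => exact .inl ⟨a, rfl⟩
  | inr b => exact .inr ⟨b, rfl⟩

theorem glue_isOpen_iff {U : Set (Glue A B)} :
    IsOpen U ↔ IsOpen (glueInl A B ⁻¹' U) ∧ IsOpen (glueInr A B ⁻¹' U) :=
  isOpen_coinduced.trans isOpen_sum_iff

theorem glueInl_isOpenEmbedding : IsOpenEmbedding (glueInl A B) := by
  refine .of_continuous_injective_isOpenMap (continuous_quotient_mk'.comp continuous_inl)
    (fun _ _ => glueInl_inj A B) fun U hU => ?_
  refine (glue_isOpen_iff A B).2 ⟨?_, ?_⟩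
  · rwa [preimage_image_eq _ fun _ _ => glueInl_inj A B]
  · have : glueInr A B ⁻¹' (glueInl A B '' U) = ⋃ j, B.src j '' (A.tgt j ⁻¹' U) := by
      ext y
      simp only [mem_preimage, mem_image, mem_iUnion, glueInl_eq_glueInr]
      constructor
      · rintro ⟨x, hx, j, z, rfl, rfl⟩
        exact ⟨j, z, hx, rfl⟩
      · rintro ⟨j, z, hx, rfl⟩
        exact ⟨_, hx, j, z, rfl, rfl⟩
    rw [this]
    exact isOpen_iUnion fun j => (B.src_collar j).1.isOpenMap _
      (hU.preimage (A.tgt_collar j).1.continuous)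

theorem glueInr_isOpenEmbedding : IsOpenEmbedding (glueInr A B) := by
  refine .of_continuous_injective_isOpenMap (continuous_quotient_mk'.comp continuous_inr)
    (fun _ _ => glueInr_inj A B) fun U hU => ?_
  refine (glue_isOpen_iff A B).2 ⟨?_, ?_⟩
  · have : glueInl A B ⁻¹' (glueInr A B '' U) = ⋃ j, A.tgt j '' (B.src j ⁻¹' U) := by
      ext y
      simp only [mem_preimage, mem_image, mem_iUnion, eq_comm (b := glueInl A B y),
        glueInl_eq_glueInr]
      constructor
      · rintro ⟨x, hx, j, z, rfl, rfl⟩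
        exact ⟨j, z, hx, rfl⟩
      · rintro ⟨j, z, hx, rfl⟩
        exact ⟨_, hx, j, z, rfl, rfl⟩
    rw [this]
    exact isOpen_iUnion fun j => (A.tgt_collar j).1.isOpenMap _
      (hU.preimage (B.src_collar j).1.continuous)
  · rwa [preimage_image_eq _ fun _ _ => glueInr_inj A B]

/-- The charts of the glued surface are those of the two pieces. -/
instance : ChartedSpace ℂ (Glue A B) where
  atlas := ((fun e => e.lift_openEmbedding (glueInl_isOpenEmbedding A B)) '' atlas ℂ A.M) ∪
    ((fun e => e.lift_openEmbedding (glueInr_isOpenEmbedding A B)) '' atlas ℂ B.M)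
  chartAt x := by
    classical
    exact if h : ∃ a, glueInl A B a = x then
      (chartAt ℂ h.choose).lift_openEmbedding (glueInl_isOpenEmbedding A B)
    else
      (chartAt ℂ ((glue_cases A B x).resolve_left h).choose).lift_openEmbedding
        (glueInr_isOpenEmbedding A B)
  mem_chart_source x := by
    split_ifs with h
    · exact ⟨h.choose, mem_chart_source ℂ _, h.choose_spec⟩
    · exact ⟨_, mem_chart_source ℂ _, ((glue_cases A B x).resolve_left h).choose_spec⟩
  chart_mem_atlas x := by
    split_ifs with h
    · exact .inl ⟨_, chart_mem_atlas ℂ _, rfl⟩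
    · exact .inr ⟨_, chart_mem_atlas ℂ _, rfl⟩

theorem glue_cross {c : OpenPartialHomeomorph A.M ℂ} {c' : OpenPartialHomeomorph B.M ℂ}
    (hc : c ∈ atlas ℂ A.M) (hc' : c' ∈ atlas ℂ B.M) :
    (c.lift_openEmbedding (glueInl_isOpenEmbedding A B)).symm ≫ₕ
      c'.lift_openEmbedding (glueInr_isOpenEmbedding A B) ∈ singGroupoid := by
  refine singGroupoid.locality fun p hp => ?_
  simp only [OpenPartialHomeomorph.trans_source, mem_inter_iff, mem_preimage,
    OpenPartialHomeomorph.lift_openEmbedding_source, OpenPartialHomeomorph.symm_source,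
    OpenPartialHomeomorph.lift_openEmbedding_target,
    OpenPartialHomeomorph.lift_openEmbedding_symm, Function.comp] at hp
  obtain ⟨hp, y, hy, hyp⟩ := hp
  obtain ⟨j, z, hz, rfl⟩ := (glueInl_eq_glueInr A B).1 hyp.symm
  obtain ⟨h1, h1'⟩ := A.tgt_collar j
  obtain ⟨h2, h2'⟩ := B.src_collar j
  set E := (cylChart (m.get j)).symm ≫ₕ h1.toOpenPartialHomeomorph _ ≫ₕ c with hE
  set F := (cylChart (m.get j)).symm ≫ₕ h2.toOpenPartialHomeomorph _ ≫ₕ c' with hF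
  have hsrc : ∀ w : Cyl, w ∈ (cylChart (m.get j)).source := fun w => mem_univ w
  have hEs : ∀ q, q ∈ E.source ↔ q ∈ (cylChart (m.get j)).target ∧
      A.tgt j ((cylChart (m.get j)).symm q) ∈ c.source := by
    intro q; simp [hE]
  have hFs : ∀ q, q ∈ F.source ↔ q ∈ (cylChart (m.get j)).target ∧
      B.src j ((cylChart (m.get j)).symm q) ∈ c'.source := by
    intro q; simp [hF]
  have hEt : ∀ q, q ∈ E.target → ∃ w : Cyl, A.tgt j w ∈ c.source ∧ q = c (A.tgt j w) ∧
      E.symm q = cylChart (m.get j) w := by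
    intro q hq
    obtain ⟨h3, h4⟩ := (hEs _).1 (E.map_target hq)
    refine ⟨(cylChart (m.get j)).symm (E.symm q), h4, ?_, ?_⟩
    · conv_lhs => rw [← E.right_inv hq]
      simp [hE]
    · rw [(cylChart (m.get j)).right_inv h3]
  have hpE : p ∈ E.target := by
    have h5 : cylChart (m.get j) z ∈ E.source := by
      rw [hEs, (cylChart (m.get j)).left_inv (hsrc z)]
      exact ⟨(cylChart (m.get j)).map_source (hsrc z), hz ▸ c.map_target hp⟩
    have h6 := E.map_source h5
    have h7 : E (cylChart (m.get j) z) = p := by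
      simp only [hE, OpenPartialHomeomorph.coe_trans, Function.comp,
        (cylChart (m.get j)).left_inv (hsrc z), IsOpenEmbedding.toOpenPartialHomeomorph_apply]
      rw [← hz, c.right_inv hp]
    rwa [h7] at h6
  refine ⟨E.target, E.open_target, hpE, ?_⟩
  refine singGroupoid.mem_of_eqOnSource
    (singGroupoid.trans (singGroupoid.symm (h1' c hc)) (h2' c' hc')) ⟨?_, ?_⟩
  · change _ = (E.symm ≫ₕ F).source
    ext q
    simp only [OpenPartialHomeomorph.restr_source, E.open_target.interior_eq,
      OpenPartialHomeomorph.trans_source, mem_inter_iff, mem_preimage,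
      OpenPartialHomeomorph.lift_openEmbedding_source, OpenPartialHomeomorph.symm_source,
      OpenPartialHomeomorph.lift_openEmbedding_target,
      OpenPartialHomeomorph.lift_openEmbedding_symm, Function.comp]
    constructor
    · rintro ⟨⟨-, y, hy, hyq⟩, hq⟩
      refine ⟨hq, ?_⟩
      obtain ⟨w, hw, rfl, hw'⟩ := hEt q hq
      rw [c.left_inv hw] at hyq
      obtain ⟨i, v, hv, rfl⟩ := (glueInl_eq_glueInr A B).1 hyq.symm
      obtain ⟨rfl, rfl⟩ := A.tgt_inj _ _ _ _ hv
      rw [hw', hFs, (cylChart (m.get j)).left_inv (hsrc w)]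
      exact ⟨(cylChart (m.get j)).map_source (hsrc w), hy⟩
    · rintro ⟨hq, hq'⟩
      obtain ⟨w, hw, rfl, hw'⟩ := hEt q hq
      rw [hw', hFs, (cylChart (m.get j)).left_inv (hsrc w)] at hq'
      refine ⟨⟨c.map_source hw, _, hq'.2, ?_⟩, hq⟩
      rw [c.left_inv hw]
      exact ((glueInl_eq_glueInr A B).2 ⟨j, w, rfl, rfl⟩).symm
  · intro q hq
    change _ = F (E.symm q)
    rw [OpenPartialHomeomorph.restr_source, E.open_target.interior_eq] at hq
    obtain ⟨w, hw, rfl, hw'⟩ := hEt q hq.2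
    rw [hw']
    simp only [OpenPartialHomeomorph.restr_apply, OpenPartialHomeomorph.coe_trans,
      Function.comp, OpenPartialHomeomorph.lift_openEmbedding_symm, c.left_inv hw, hF,
      (cylChart (m.get j)).left_inv (hsrc w), IsOpenEmbedding.toOpenPartialHomeomorph_apply]
    rw [(glueInl_eq_glueInr A B).2 ⟨j, w, rfl, rfl⟩,
      OpenPartialHomeomorph.lift_openEmbedding_apply]

instance : HasGroupoid (Glue A B) singGroupoid where
  compatible := by
    rintro _ _ (⟨c, hc, rfl⟩ | ⟨c, hc, rfl⟩) (⟨c', hc', rfl⟩ | ⟨c', hc', rfl⟩)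
    · simp only [OpenPartialHomeomorph.lift_openEmbedding_trans]
      exact singGroupoid.compatible hc hc'
    · exact glue_cross A B hc hc'
    · exact singGroupoid.symm (glue_cross A B hc' hc)
    · simp only [OpenPartialHomeomorph.lift_openEmbedding_trans]
      exact singGroupoid.compatible hc hc'

theorem glue_separated (a : A.M) (b : B.M) (h : glueInl A B a ≠ glueInr A B b) :
    ∃ u v : Set (Glue A B), IsOpen u ∧ IsOpen v ∧ glueInl A B a ∈ u ∧ glueInr A B b ∈ v ∧
      Disjoint u v := by
  by_cases ha : ∃ j z, a = A.tgt j z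
  · obtain ⟨j, z, rfl⟩ := ha
    have h' : glueInl A B (A.tgt j z) = glueInr A B (B.src j z) :=
      (glueInl_eq_glueInr A B).2 ⟨j, z, rfl, rfl⟩
    rw [h'] at h ⊢
    obtain ⟨u, v, hu, hv, hau, hbv, huv⟩ := t2_separation fun hb => h (congrArg _ hb)
    refine ⟨_, _, (glueInr_isOpenEmbedding A B).isOpenMap _ hu,
      (glueInr_isOpenEmbedding A B).isOpenMap _ hv, mem_image_of_mem _ hau,
      mem_image_of_mem _ hbv, ?_⟩
    exact disjoint_image_of_injective (fun _ _ => glueInr_inj A B) huv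
  by_cases hb : ∃ j z, b = B.src j z
  · obtain ⟨j, z, rfl⟩ := hb
    have h' : glueInl A B (A.tgt j z) = glueInr A B (B.src j z) :=
      (glueInl_eq_glueInr A B).2 ⟨j, z, rfl, rfl⟩
    rw [← h'] at h ⊢
    obtain ⟨u, v, hu, hv, hau, hbv, huv⟩ := t2_separation fun hb => h (congrArg _ hb)
    refine ⟨_, _, (glueInl_isOpenEmbedding A B).isOpenMap _ hu,
      (glueInl_isOpenEmbedding A B).isOpenMap _ hv, mem_image_of_mem _ hau,
      mem_image_of_mem _ hbv, ?_⟩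
    exact disjoint_image_of_injective (fun _ _ => glueInl_inj A B) huv
  refine ⟨_, _, (glueInl_isOpenEmbedding A B).isOpenMap _
      (isClosed_iUnion_of_finite A.tgt_closed).isOpen_compl,
    (glueInr_isOpenEmbedding A B).isOpenMap _
      (isClosed_iUnion_of_finite B.src_closed).isOpen_compl,
    mem_image_of_mem _ ?_, mem_image_of_mem _ ?_, ?_⟩
  · simp only [mem_compl_iff, mem_iUnion, mem_image, not_exists, not_and]
    exact fun j z _ h => ha ⟨j, z, h.symm⟩
  · simp only [mem_compl_iff, mem_iUnion, mem_image, not_exists, not_and]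
    exact fun j z _ h => hb ⟨j, z, h.symm⟩
  · rw [Set.disjoint_left]
    rintro _ ⟨x, hx, rfl⟩ ⟨y, hy, hxy⟩
    obtain ⟨j, z, rfl, rfl⟩ := (glueInl_eq_glueInr A B).1 hxy.symm
    simp only [mem_compl_iff, mem_iUnion, mem_image, not_exists, not_and] at hx hy
    rcases le_total 1 ‖(z : ℂ)‖ with h1 | h1
    · exact hx j z h1 rfl
    · exact hy j z h1 rfl

instance : T2Space (Glue A B) where
  t2 := by
    intro x y hxy
    rcases glue_cases A B x with ⟨a, rfl⟩ | ⟨a, rfl⟩ <;>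
      rcases glue_cases A B y with ⟨b, rfl⟩ | ⟨b, rfl⟩
    · obtain ⟨u, v, hu, hv, hau, hbv, huv⟩ := t2_separation fun h => hxy (congrArg _ h)
      exact ⟨_, _, (glueInl_isOpenEmbedding A B).isOpenMap _ hu,
        (glueInl_isOpenEmbedding A B).isOpenMap _ hv, mem_image_of_mem _ hau,
        mem_image_of_mem _ hbv,
        disjoint_image_of_injective (fun _ _ => glueInl_inj A B) huv⟩
    · exact glue_separated A B a b hxy
    · obtain ⟨u, v, hu, hv, h1, h2, huv⟩ := glue_separated A B b a hxy.symm
      exact ⟨v, u, hv, hu, h2, h1, huv.symm⟩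
    · obtain ⟨u, v, hu, hv, hau, hbv, huv⟩ := t2_separation fun h => hxy (congrArg _ h)
      exact ⟨_, _, (glueInr_isOpenEmbedding A B).isOpenMap _ hu,
        (glueInr_isOpenEmbedding A B).isOpenMap _ hv, mem_image_of_mem _ hau,
        mem_image_of_mem _ hbv,
        disjoint_image_of_injective (fun _ _ => glueInr_inj A B) huv⟩

theorem glueInl_src_ne (j : Fin n.length) (z : Cyl) (y : B.M) :
    glueInl A B (A.src j z) ≠ glueInr A B y := by
  intro h
  obtain ⟨i, w, h, -⟩ := (glueInl_eq_glueInr A B).1 h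
  exact A.src_ne_tgt _ _ _ _ h

theorem glueInr_tgt_ne (j : Fin k.length) (z : Cyl) (x : A.M) :
    glueInr A B (B.tgt j z) ≠ glueInl A B x := by
  intro h
  obtain ⟨i, w, -, h⟩ := (glueInl_eq_glueInr A B).1 h.symm
  exact B.src_ne_tgt _ _ _ _ h.symm

/-- The composition of singular cobordisms, `A` being placed on top of `B`. -/
def comp : Cob n k where
  M := Glue A B
  src j := glueInl A B ∘ A.src j
  tgt j := glueInr A B ∘ B.tgt j
  src_collar j := by
    have h := (glueInl_isOpenEmbedding A B).comp (A.src_collar j).1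
    refine ⟨h, ?_⟩
    rintro _ (⟨c, hc, rfl⟩ | ⟨c, hc, rfl⟩)
    · exact (A.src_collar j).comp_lift _ h hc
    · exact IsCollar.comp_lift_empty _ h c (glueInl_src_ne A B j)
  tgt_collar j := by
    have h := (glueInr_isOpenEmbedding A B).comp (B.tgt_collar j).1
    refine ⟨h, ?_⟩
    rintro _ (⟨c, hc, rfl⟩ | ⟨c, hc, rfl⟩)
    · exact IsCollar.comp_lift_empty _ h c (glueInr_tgt_ne A B j)
    · exact (B.tgt_collar j).comp_lift _ h hc
  src_inj i j z w h := A.src_inj i j z w (glueInl_inj A B h)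
  tgt_inj i j z w h := B.tgt_inj i j z w (glueInr_inj A B h)
  src_ne_tgt i j z w := glueInl_src_ne A B i z (B.tgt j w)
  src_closed j := by
    rw [← isOpen_compl_iff, glue_isOpen_iff, preimage_compl, preimage_compl, isOpen_compl_iff,
      isOpen_compl_iff, image_comp, preimage_image_eq _ fun _ _ => glueInl_inj A B]
    refine ⟨A.src_closed j, ?_⟩
    convert isClosed_empty using 1
    refine eq_empty_of_forall_notMem ?_
    rintro y ⟨_, ⟨z, -, rfl⟩, h⟩
    exact glueInl_src_ne A B j z y h
  tgt_closed j := by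
    rw [← isOpen_compl_iff, glue_isOpen_iff, preimage_compl, preimage_compl, isOpen_compl_iff,
      isOpen_compl_iff, image_comp, preimage_image_eq _ fun _ _ => glueInr_inj A B]
    refine ⟨?_, B.tgt_closed j⟩
    convert isClosed_empty using 1
    refine eq_empty_of_forall_notMem ?_
    rintro y ⟨_, ⟨z, -, rfl⟩, h⟩
    exact glueInr_tgt_ne A B j z y h
  compact := by
    have h := (A.compact.image (glueInl_isOpenEmbedding A B).continuous).union
      (B.compact.image (glueInr_isOpenEmbedding A B).continuous)
    convert h using 1
    ext x
    simp only [Function.comp, mem_ofPred_eq, mem_union, mem_image]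
    constructor
    · rintro ⟨h1, h2⟩
      rcases glue_cases A B x with ⟨a, rfl⟩ | ⟨b, rfl⟩
      · by_cases ha : ∀ j z, A.tgt j z = a → ‖(z : ℂ)‖ ≤ 1
        · exact .inl ⟨a, ⟨fun j z h => h1 j z (congrArg _ h), ha⟩, rfl⟩
        · push Not at ha
          obtain ⟨j, z, rfl, hz⟩ := ha
          refine .inr ⟨B.src j z, ⟨?_, ?_⟩,
            ((glueInl_eq_glueInr A B).2 ⟨j, z, rfl, rfl⟩).symm⟩
          · intro i w hw
            obtain ⟨-, rfl⟩ := B.src_inj _ _ _ _ hw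
            exact hz.le
          · exact fun i w hw => absurd hw.symm (B.src_ne_tgt _ _ _ _)
      · by_cases hb : ∀ j z, B.src j z = b → 1 ≤ ‖(z : ℂ)‖
        · exact .inr ⟨b, ⟨hb, fun j z h => h2 j z (congrArg _ h)⟩, rfl⟩
        · push Not at hb
          obtain ⟨j, z, rfl, hz⟩ := hb
          refine .inl ⟨A.tgt j z, ⟨?_, ?_⟩, (glueInl_eq_glueInr A B).2 ⟨j, z, rfl, rfl⟩⟩
          · exact fun i w hw => absurd hw (A.src_ne_tgt _ _ _ _)
          · intro i w hw
            obtain ⟨-, rfl⟩ := A.tgt_inj _ _ _ _ hw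
            exact hz.le
    · rintro (⟨a, ⟨h1, h2⟩, rfl⟩ | ⟨b, ⟨h1, h2⟩, rfl⟩)
      · exact ⟨fun j z h => h1 j z (glueInl_inj A B h),
          fun j z h => absurd h (glueInr_tgt_ne A B j z a)⟩
      · exact ⟨fun j z h => absurd h (glueInl_src_ne A B j z b),
          fun j z h => h2 j z (glueInr_inj A B h)⟩

end Glue

/-! ### Permutations of the boundary components, reversal -/

/-- Renumber the target components along a bijection that respects their kinds. -/
def permTgt {n m m' : List Web} (A : Cob n m) (σ : Fin m'.length ≃ Fin m.length)
    (hσ : ∀ j, m'.get j = m.get (σ j)) : Cob n m' where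
  M := A.M
  src := A.src
  tgt j := A.tgt (σ j)
  src_collar := A.src_collar
  tgt_collar j := by rw [hσ]; exact A.tgt_collar (σ j)
  src_inj := A.src_inj
  tgt_inj i j z w h := ⟨σ.injective (A.tgt_inj _ _ _ _ h).1, (A.tgt_inj _ _ _ _ h).2⟩
  src_ne_tgt i j z w := A.src_ne_tgt i (σ j) z w
  src_closed := A.src_closed
  tgt_closed j := A.tgt_closed (σ j)
  compact := by
    refine (congrArg IsCompact (Set.ext fun x => ?_)).mp A.compact
    exact and_congr_right fun _ => σ.surjective.forall

end Cob

theorem hasFDerivAt_radial {φ : ℝ → ℝ} {z : ℂ} {φ' : ℝ} (h : HasDerivAt φ φ' (‖z‖ ^ 2)) :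
    HasFDerivAt (fun z : ℂ => φ (‖z‖ ^ 2) • z)
      (φ (‖z‖ ^ 2) • ContinuousLinearMap.id ℝ ℂ +
        (φ' • (2 • innerSL ℝ z)).smulRight z) z := by
  have h1 : HasFDerivAt (fun z : ℂ => ‖z‖ ^ 2) (2 • innerSL ℝ z) z :=
    (hasStrictFDerivAt_norm_sq z).hasFDerivAt
  exact (h.comp_hasFDerivAt z h1).smul (hasFDerivAt_id z)

theorem det_radial (a b : ℝ) (z : ℂ) :
    (a • ContinuousLinearMap.id ℝ ℂ + (b • (2 • innerSL ℝ z)).smulRight z).det =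
      a * (a + 2 * b * ‖z‖ ^ 2) := by
  rw [det_eq, Complex.sq_norm, Complex.normSq_apply]
  simp [Complex.inner]
  ring

/-- The Jacobian determinant of a radial map. -/
theorem det_fderiv_radial {φ : ℝ → ℝ} {z : ℂ} {φ' : ℝ} (h : HasDerivAt φ φ' (‖z‖ ^ 2)) :
    (fderiv ℝ (fun z : ℂ => φ (‖z‖ ^ 2) • z) z).det =
      φ (‖z‖ ^ 2) * (φ (‖z‖ ^ 2) + 2 * φ' * ‖z‖ ^ 2) := by
  rw [(hasFDerivAt_radial h).fderiv, det_radial]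

theorem contDiffOn_radial {φ : ℝ → ℝ} (h : ContDiffOn ℝ ∞ φ (Ioi 0)) :
    ContDiffOn ℝ ∞ (fun z : ℂ => φ (‖z‖ ^ 2) • z) {0}ᶜ := by
  refine ContDiffOn.smul (h.comp (contDiff_norm_sq ℝ).contDiffOn fun z hz => ?_) contDiffOn_id
  have : z ≠ 0 := hz
  have := norm_pos_iff.2 this
  exact pow_pos this 2

/-- Inversion of the direction of a cylinder: `(u, t) ↦ (u, -t)`. -/
def cylInv (z : Cyl) : Cyl :=
  ⟨(‖(z : ℂ)‖ ^ 2)⁻¹ • (z : ℂ), by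
    have : (z : ℂ) ≠ 0 := z.2
    simpa using this⟩

theorem norm_cylInv (z : Cyl) : ‖(cylInv z : ℂ)‖ = ‖(z : ℂ)‖⁻¹ := by
  have : ‖(z : ℂ)‖ ≠ 0 := norm_ne_zero_iff.2 z.2
  simp only [cylInv, norm_smul, norm_inv, norm_pow, norm_norm]
  field_simp

theorem cylInv_cylInv (z : Cyl) : cylInv (cylInv z) = z := by
  have h : ‖(z : ℂ)‖ ≠ 0 := norm_ne_zero_iff.2 z.2
  apply Subtype.ext
  change (‖(cylInv z : ℂ)‖ ^ 2)⁻¹ • ((‖(z : ℂ)‖ ^ 2)⁻¹ • (z : ℂ)) = z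
  rw [norm_cylInv, smul_smul]
  have : (‖(z : ℂ)‖⁻¹ ^ 2)⁻¹ * (‖(z : ℂ)‖ ^ 2)⁻¹ = 1 := by field_simp
  rw [this, one_smul]

theorem continuous_cylInv : Continuous cylInv := by
  have h1 : Continuous fun z : Cyl => (‖(z : ℂ)‖ ^ 2)⁻¹ := by
    refine Continuous.inv₀ (by fun_prop) fun z => ?_
    have : (z : ℂ) ≠ 0 := z.2
    simpa using this
  exact Continuous.subtype_mk (h1.smul continuous_subtype_val) _

/-- The inversion as a homeomorphism. -/
def cylInvHomeo : Cyl ≃ₜ Cyl where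
  toFun := cylInv
  invFun := cylInv
  left_inv := cylInv_cylInv
  right_inv := cylInv_cylInv
  continuous_toFun := continuous_cylInv
  continuous_invFun := continuous_cylInv

theorem inversion_signedSmooth (b : Web) :
    SignedSmoothOn b.weight (-b.weight) (fun z : ℂ => (‖z‖ ^ 2)⁻¹ • z) {0}ᶜ := by
  refine ⟨contDiffOn_radial (φ := fun s => s⁻¹) (contDiffOn_inv ℝ |>.mono fun x hx => hx.ne'),
    fun z hz => ?_⟩
  have hz0 : z ≠ 0 := hz
  have hn : 0 < ‖z‖ ^ 2 := pow_pos (norm_pos_iff.2 hz0) 2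
  have hd := det_fderiv_radial (hasDerivAt_inv hn.ne')
  have hd' : (fderiv ℝ (fun z : ℂ => (‖z‖ ^ 2)⁻¹ • z) z).det = -((‖z‖ ^ 2)⁻¹) ^ 2 := by
    rw [hd]; field_simp; ring
  rw [hd']
  have hi : 0 < (‖z‖ ^ 2)⁻¹ := inv_pos.2 hn
  refine ⟨by simpa using hz0, ?_, fun hw => ?_⟩
  · cases b
    · simp [Web.weight]
    · simp only [Web.weight, Pi.neg_apply, Complex.smul_im, smul_eq_mul, neg_eq_zero,
        mul_eq_zero, hi.ne', false_or]
  · cases b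
    · simp only [Web.weight, Pi.neg_apply]
      have := pow_pos hi 2
      linarith
    · simp only [Web.weight, Pi.neg_apply, Complex.smul_im, smul_eq_mul] at hw ⊢
      have h1 : 0 < z.im ^ 2 := by positivity
      have h2 : z.im * -((‖z‖ ^ 2)⁻¹ * z.im) * -((‖z‖ ^ 2)⁻¹) ^ 2 =
          z.im ^ 2 * ((‖z‖ ^ 2)⁻¹) ^ 3 := by ring
      rw [h2]
      positivity

/-- The reflection of the plane in the imaginary axis; it reverses the orientation of the local
model. -/
def reflect : ℂ ≃ₜ ℂ where
  toFun z := -(starRingEnd ℂ) z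
  invFun z := -(starRingEnd ℂ) z
  left_inv z := by simp
  right_inv z := by simp
  continuous_toFun := Complex.continuous_conj.neg
  continuous_invFun := Complex.continuous_conj.neg

theorem reflect_signedSmooth (s : Set ℂ) :
    SignedSmoothOn (-Complex.im) Complex.im reflect s := by
  have h : ∀ z, HasFDerivAt reflect (-(Complex.conjCLE : ℂ →L[ℝ] ℂ)) z := fun z =>
    (Complex.conjCLE : ℂ →L[ℝ] ℂ).hasFDerivAt.neg
  refine ⟨(Complex.conjCLE.contDiff.neg : ContDiff ℝ ∞ fun z => -Complex.conjCLE z).contDiffOn,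
    fun z _ => ?_⟩
  have hd : (fderiv ℝ reflect z).det = -1 := by
    rw [(h z).fderiv, det_eq]; simp
  have him : (reflect z).im = z.im := by simp [reflect]
  rw [hd, him]
  refine ⟨by norm_num, by simp, fun hw => ?_⟩
  simp only [Pi.neg_apply] at hw ⊢
  have : 0 < z.im ^ 2 := by
    have : z.im ≠ 0 := fun h => hw (by simp [h])
    positivity
  linarith

theorem SignedSmoothOn.of_comp {w w' w'' : ℂ → ℝ} {f g h : ℂ → ℂ} {s t u : Set ℂ}
    (hg : SignedSmoothOn w' w'' g t) (hf : SignedSmoothOn w w' f s) (hs : IsOpen s)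
    (ht : IsOpen t) (hu : IsOpen u) (h1 : ∀ z ∈ u, z ∈ s ∧ f z ∈ t)
    (h2 : ∀ z ∈ u, h z = g (f z)) : SignedSmoothOn w w'' h u :=
  ((hg.comp hf hs ht).mono fun z hz => h1 z hz).congr hu h2

/-- The inverse of the coordinate `flatten`. -/
theorem flatten_symm_signedSmooth (b : Web) :
    SignedSmoothOn Complex.im b.weight
      ((flatten_isOpenEmbedding b).toOpenPartialHomeomorph _).symm (range (flatten b)) := by
  have := SignedSmoothOn.symm (w := b.weight) (w' := Complex.im)
    ((flatten_isOpenEmbedding b).toOpenPartialHomeomorph _) ((flatten_signedSmooth b).mono (by simp))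
  simpa using this

theorem cylChart_apply (b : Web) (z : Cyl) : cylChart b z = flatten b z := rfl

theorem cylChart_symm_flatten (b : Web) (z : Cyl) : (cylChart b).symm (flatten b z) = z :=
  (cylChart b).left_inv (mem_univ z)

theorem mem_cylChart_target (b : Web) (q : ℂ) :
    q ∈ (cylChart b).target ↔ ∃ z : Cyl, flatten b z = q := by
  simp [cylChart]

theorem flatten_symm_flatten (b : Web) (z : ℂ) :
    ((flatten_isOpenEmbedding b).toOpenPartialHomeomorph _).symm (flatten b z) = z :=
  ((flatten_isOpenEmbedding b).toOpenPartialHomeomorph _).left_inv (mem_univ z)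

/-- The inversion in the coordinate of the cylinder. -/
theorem inv_coord_signedSmooth (b : Web) :
    SignedSmoothOn Complex.im (-Complex.im)
      (fun q => cylChart b (cylInv ((cylChart b).symm q))) (cylChart b).target := by
  have h1 : SignedSmoothOn Complex.im (-b.weight)
      (fun q => (cylInv ((cylChart b).symm q) : ℂ)) (cylChart b).target := by
    refine (inversion_signedSmooth b).of_comp (flatten_symm_signedSmooth b)
      (flatten_isOpenEmbedding b).isOpen_range isOpen_compl_singleton (cylChart b).open_target ?_ ?_
    · intro q hq
      obtain ⟨z, rfl⟩ := (mem_cylChart_target b q).1 hq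
      rw [flatten_symm_flatten]
      exact ⟨mem_range_self _, z.2⟩
    · intro q hq
      obtain ⟨z, rfl⟩ := (mem_cylChart_target b q).1 hq
      rw [flatten_symm_flatten, cylChart_symm_flatten]
      rfl
  exact (flatten_signedSmooth b).neg.of_comp h1 (cylChart b).open_target isOpen_univ
    (cylChart b).open_target (fun q hq => ⟨hq, mem_univ _⟩) fun q hq => rfl

theorem reflected_mem {e : OpenPartialHomeomorph ℂ ℂ} (he : e ∈ singGroupoid) :
    reflect.symm.toOpenPartialHomeomorph ≫ₕ e ≫ₕ reflect.toOpenPartialHomeomorph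
      ∈ singGroupoid := by
  rw [mem_singGroupoid] at he ⊢
  have h1 : SignedSmoothOn Complex.im (-Complex.im) reflect univ := by
    simpa using (reflect_signedSmooth univ).neg
  have h2 := he.neg.comp h1 isOpen_univ e.open_source
  refine (reflect_signedSmooth univ).of_comp h2 (isOpen_univ.inter
    (e.open_source.preimage reflect.continuous)) isOpen_univ
    (OpenPartialHomeomorph.open_source _) ?_ ?_
  · intro q hq
    simp only [OpenPartialHomeomorph.trans_source, mem_inter_iff, mem_preimage] at hq
    exact ⟨⟨mem_univ _, hq.2.1⟩, mem_univ _⟩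
  · intro q hq
    rfl

namespace Cob

section Reverse

variable {n m : List Web} (A : Cob n m)

/-- The surface of `A` with the opposite orientation. -/
def Opp : Type := A.M

instance : TopologicalSpace A.Opp := A.top

instance : T2Space A.Opp := A.t2

instance : ChartedSpace ℂ A.Opp where
  atlas := (fun c : OpenPartialHomeomorph A.M ℂ => c ≫ₕ reflect.toOpenPartialHomeomorph) ''
    atlas ℂ A.M
  chartAt x := chartAt (H := ℂ) (M := A.M) x ≫ₕ reflect.toOpenPartialHomeomorph
  mem_chart_source x := by
    have := mem_chart_source (H := ℂ) (M := A.M) x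
    exact ⟨this, mem_univ _⟩
  chart_mem_atlas x := ⟨_, chart_mem_atlas (H := ℂ) (M := A.M) x, rfl⟩

instance : HasGroupoid A.Opp singGroupoid where
  compatible := by
    rintro _ _ ⟨c, hc, rfl⟩ ⟨c', hc', rfl⟩
    have h := reflected_mem (singGroupoid.compatible hc hc')
    rw [OpenPartialHomeomorph.trans_assoc, ← OpenPartialHomeomorph.trans_assoc] at h
    exact h

theorem opp_collar {b : Web} {e : Cyl → A.M} (he : IsCollar b e) :
    IsCollar b (M := A.Opp) (e ∘ cylInv) := by
  obtain ⟨h, he⟩ := he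
  have h' : IsOpenEmbedding (e ∘ cylInv) := h.comp cylInvHomeo.isOpenEmbedding
  refine ⟨h', ?_⟩
  rintro _ ⟨c, hc, rfl⟩
  have h1 := mem_singGroupoid.1 (he c hc)
  rw [mem_singGroupoid]
  have h2 := h1.neg.comp (inv_coord_signedSmooth b) (cylChart b).open_target
    (OpenPartialHomeomorph.open_source _)
  refine (reflect_signedSmooth univ).of_comp h2 ?_ isOpen_univ
    (OpenPartialHomeomorph.open_source _) ?_ ?_
  · refine ContinuousOn.isOpen_inter_preimage (inv_coord_signedSmooth b).1.continuousOn
      (cylChart b).open_target (OpenPartialHomeomorph.open_source _)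
  · intro q hq
    refine ⟨⟨hq.1, ?_⟩, mem_univ _⟩
    have hq2 := hq.2
    simp only [OpenPartialHomeomorph.trans_source, mem_inter_iff, mem_preimage] at hq2 ⊢
    refine ⟨(cylChart b).map_source (mem_univ _), mem_univ _, ?_⟩
    rw [(cylChart b).left_inv (mem_univ _)]
    exact hq2.2.1
  · intro q hq
    change reflect (c (e (cylInv ((cylChart b).symm q)))) =
      reflect (c (e ((cylChart b).symm (cylChart b (cylInv ((cylChart b).symm q))))))
    rw [(cylChart b).left_inv (mem_univ _)]

theorem image_cylInv {X : Type} (e : Cyl → X) {S T : Set Cyl} (h : ∀ z, cylInv z ∈ T ↔ z ∈ S) :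
    (e ∘ cylInv) '' S = e '' T := by
  ext x
  constructor
  · rintro ⟨z, hz, rfl⟩
    exact ⟨_, (h z).2 hz, rfl⟩
  · rintro ⟨z, hz, rfl⟩
    exact ⟨cylInv z, (h _).1 (by rwa [cylInv_cylInv]), by simp [cylInv_cylInv]⟩

/-- The reversed cobordism: the same surface with the opposite orientation, read from bottom to
top. -/
def reverse : Cob m n where
  M := A.Opp
  src j := A.tgt j ∘ cylInv
  tgt j := A.src j ∘ cylInv
  src_collar j := A.opp_collar (A.tgt_collar j)
  tgt_collar j := A.opp_collar (A.src_collar j)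
  src_inj i j z w h := by
    obtain ⟨h1, h2⟩ := A.tgt_inj _ _ _ _ h
    exact ⟨h1, by rw [← cylInv_cylInv z, h2, cylInv_cylInv]⟩
  tgt_inj i j z w h := by
    obtain ⟨h1, h2⟩ := A.src_inj _ _ _ _ h
    exact ⟨h1, by rw [← cylInv_cylInv z, h2, cylInv_cylInv]⟩
  src_ne_tgt i j z w h := A.src_ne_tgt _ _ _ _ h.symm
  src_closed j := by
    have h := A.tgt_closed j
    rwa [← image_cylInv (A.tgt j) (S := {z | ‖(z : ℂ)‖ ≤ 1})] at h
    intro z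
    have : 0 < ‖(z : ℂ)‖ := norm_pos_iff.2 z.2
    simp only [mem_ofPred_eq, norm_cylInv]
    exact one_le_inv₀ this
  tgt_closed j := by
    have h := A.src_closed j
    rwa [← image_cylInv (A.src j) (S := {z | 1 ≤ ‖(z : ℂ)‖})] at h
    intro z
    have : 0 < ‖(z : ℂ)‖ := norm_pos_iff.2 z.2
    simp only [mem_ofPred_eq, norm_cylInv]
    exact inv_le_one₀ this
  compact := by
    refine (congrArg (IsCompact (X := A.M)) (Set.ext fun x => ?_)).mp A.compact
    have hs : Function.Surjective cylInv := cylInvHomeo.surjective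
    have h1 : ∀ z : Cyl, 1 ≤ ‖(cylInv z : ℂ)‖ ↔ ‖(z : ℂ)‖ ≤ 1 := fun z => by
      rw [norm_cylInv]; exact one_le_inv₀ (norm_pos_iff.2 z.2)
    have h2 : ∀ z : Cyl, ‖(cylInv z : ℂ)‖ ≤ 1 ↔ 1 ≤ ‖(z : ℂ)‖ := fun z => by
      rw [norm_cylInv]; exact inv_le_one₀ (norm_pos_iff.2 z.2)
    refine Iff.trans ?_ and_comm
    refine and_congr (forall_congr' fun j => ?_) (forall_congr' fun j => ?_)
    · rw [hs.forall (p := fun z => A.src j z = x → 1 ≤ ‖(z : ℂ)‖)]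
      simp only [h1]
      exact Iff.rfl
    · rw [hs.forall (p := fun z => A.tgt j z = x → ‖(z : ℂ)‖ ≤ 1)]
      simp only [h2]
      exact Iff.rfl

end Reverse

end Cob

/-! ### Discs with holes -/

/-- The plane minus finitely many points, with the piecewise orientation attached to `b`: for
the circle it has no singular points, for the bi-web its singular points form the real axis. -/
def Punctured (_b : Web) {k : ℕ} (p : Fin k → ℂ) : Type := ((range p)ᶜ : Set ℂ)

section Punctured

variable (b : Web) {k : ℕ} (p : Fin k → ℂ)

theorem isOpen_punctured : IsOpen ((range p)ᶜ : Set ℂ) := (finite_range p).isClosed.isOpen_compl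

instance : TopologicalSpace (Punctured b p) :=
  inferInstanceAs (TopologicalSpace ((range p)ᶜ : Set ℂ))

instance : T2Space (Punctured b p) := inferInstanceAs (T2Space ((range p)ᶜ : Set ℂ))

instance : Nonempty (Punctured b p) :=
  ((finite_range p).infinite_compl).nonempty.to_subtype

theorem punctured_isOpenEmbedding :
    IsOpenEmbedding (fun z : Punctured b p => flatten b z.1) :=
  isOpenEmbedding_coe_of_isOpen (isOpen_punctured p) b

instance : ChartedSpace ℂ (Punctured b p) :=
  (punctured_isOpenEmbedding b p).singletonChartedSpace

instance : HasGroupoid (Punctured b p) singGroupoid :=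
  (punctured_isOpenEmbedding b p).singleton_hasGroupoid _

variable {b p}

theorem isOpenMap_of_signedSmooth {w w' : ℂ → ℝ} {f : ℂ → ℂ} {s : Set ℂ} (hs : IsOpen s)
    (hf : SignedSmoothOn w w' f s) : ∀ t ⊆ s, IsOpen t → IsOpen (f '' t) := by
  intro t hts ht
  rw [isOpen_iff_mem_nhds]
  rintro _ ⟨z, hz, rfl⟩
  have hc := hf.1.contDiffAt (hs.mem_nhds (hts hz))
  have h1 := hc.hasStrictFDerivAt (n := ∞) (by simp)
  have h2 : HasStrictFDerivAt f (((fderiv ℝ f z).toContinuousLinearEquivOfDetNeZero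
      (hf.2 z (hts hz)).1 : ℂ ≃L[ℝ] ℂ) : ℂ →L[ℝ] ℂ) z := by simpa using h1
  rw [← h2.map_nhds_eq_of_equiv]
  exact Filter.image_mem_map (ht.mem_nhds hz)

theorem punctured_collar {b' : Web} {f : ℂ → ℂ} (hf : SignedSmoothOn b'.weight b.weight f {0}ᶜ)
    (hinj : InjOn f {0}ᶜ) (hmaps : MapsTo f {0}ᶜ (range p)ᶜ) :
    IsCollar b' (M := Punctured b p) (fun z : Cyl => ⟨f z, hmaps z.2⟩) := by
  have h : IsOpenEmbedding (Y := Punctured b p) (fun z : Cyl => ⟨f z, hmaps z.2⟩) := by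
    refine .of_continuous_injective_isOpenMap ?_ ?_ ?_
    · exact Continuous.subtype_mk (hf.1.continuousOn.comp_continuous continuous_subtype_val
        fun z => z.2) _
    · intro z w hzw
      exact Subtype.ext (hinj z.2 w.2 (congrArg Subtype.val hzw))
    · intro V hV
      obtain ⟨t, ht, rfl⟩ := hV
      refine ⟨f '' (t ∩ {0}ᶜ), isOpenMap_of_signedSmooth isOpen_compl_singleton hf _
        inter_subset_right (ht.inter isOpen_compl_singleton), ?_⟩
      ext x
      constructor
      · rintro ⟨z, ⟨hz, hz0⟩, hzx⟩
        exact ⟨⟨z, hz0⟩, hz, Subtype.ext hzx⟩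
      · rintro ⟨z, hz, rfl⟩
        exact ⟨z, ⟨hz, z.2⟩, rfl⟩
  refine ⟨h, fun c hc => ?_⟩
  obtain rfl : c = (punctured_isOpenEmbedding b p).toOpenPartialHomeomorph _ :=
    OpenPartialHomeomorph.singletonChartedSpace_mem_atlas_eq _
      (IsOpenEmbedding.toOpenPartialHomeomorph_source _ _) c hc
  rw [mem_singGroupoid]
  have h1 : SignedSmoothOn Complex.im b.weight
      (fun q => f ((cylChart b').symm q)) (cylChart b').target := by
    refine hf.of_comp (flatten_symm_signedSmooth b')
      (flatten_isOpenEmbedding b').isOpen_range isOpen_compl_singleton (cylChart b').open_target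
      ?_ ?_
    · intro q hq
      obtain ⟨z, rfl⟩ := (mem_cylChart_target b' q).1 hq
      rw [flatten_symm_flatten]
      exact ⟨mem_range_self _, z.2⟩
    · intro q hq
      obtain ⟨z, rfl⟩ := (mem_cylChart_target b' q).1 hq
      rw [flatten_symm_flatten, cylChart_symm_flatten]
  refine (flatten_signedSmooth b).of_comp h1 (cylChart b').open_target isOpen_univ
    (OpenPartialHomeomorph.open_source _) (fun q hq => ⟨hq.1, mem_univ _⟩) fun q hq => rfl

end Punctured

/-- The collar of a hole: it maps the punctured plane onto the punctured open unit disc around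
`p`, and the unit circle to the circle of radius `1 / √2` around `p`. -/
def holeMap (p z : ℂ) : ℂ := p + (√(1 + ‖z‖ ^ 2))⁻¹ • z

/-- The outer collar: it maps the punctured plane onto the complement of the closed disc of
radius `R` around the origin, and the unit circle to the circle of radius `√(1 + R²)`. -/
def outerMap (R : ℝ) (z : ℂ) : ℂ := √(1 + R ^ 2 / ‖z‖ ^ 2) • z

theorem norm_holeMap_sub (p z : ℂ) : ‖holeMap p z - p‖ ^ 2 = ‖z‖ ^ 2 / (1 + ‖z‖ ^ 2) := by
  have h : 0 ≤ 1 + ‖z‖ ^ 2 := by positivity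
  rw [holeMap, add_sub_cancel_left, norm_smul, mul_pow, norm_inv, inv_pow, Real.norm_eq_abs,
    sq_abs, Real.sq_sqrt h]
  field_simp

theorem norm_outerMap (R : ℝ) {z : ℂ} (hz : z ≠ 0) :
    ‖outerMap R z‖ ^ 2 = ‖z‖ ^ 2 + R ^ 2 := by
  have hn := norm_pos_iff.2 hz
  have h : 0 ≤ 1 + R ^ 2 / ‖z‖ ^ 2 := by positivity
  rw [outerMap, norm_smul, mul_pow, Real.norm_eq_abs, sq_abs, Real.sq_sqrt h]
  field_simp

theorem holeMap_inj (p : ℂ) : Function.Injective (holeMap p) := by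
  intro z w h
  have h1 := congrArg (fun x => ‖x - p‖ ^ 2) h
  simp only [norm_holeMap_sub] at h1
  have h2 : ‖z‖ ^ 2 = ‖w‖ ^ 2 := by
    field_simp at h1
    linarith
  simp only [holeMap, h2, add_right_inj] at h
  have : (√(1 + ‖w‖ ^ 2))⁻¹ ≠ 0 := by positivity
  exact smul_right_injective ℂ this h

theorem outerMap_inj (R : ℝ) : InjOn (outerMap R) {0}ᶜ := by
  intro z hz w hw h
  have h1 := congrArg (fun x => ‖x‖ ^ 2) h
  simp only [norm_outerMap R hz, norm_outerMap R hw] at h1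
  have h2 : ‖z‖ ^ 2 = ‖w‖ ^ 2 := by linarith
  simp only [outerMap, h2] at h
  have hn : 0 < ‖w‖ := norm_pos_iff.2 hw
  have : √(1 + R ^ 2 / ‖w‖ ^ 2) ≠ 0 := by positivity
  exact smul_right_injective ℂ this h

theorem holeMap_surj {p x : ℂ} (h0 : x ≠ p) (h1 : ‖x - p‖ < 1) :
    ∃ z : Cyl, holeMap p z = x := by
  have hn : 0 < ‖x - p‖ := norm_pos_iff.2 (sub_ne_zero.2 h0)
  have hs : 0 < 1 - ‖x - p‖ ^ 2 := by nlinarith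
  have hq := Real.sqrt_pos.2 hs
  refine ⟨⟨(√(1 - ‖x - p‖ ^ 2))⁻¹ • (x - p), ?_⟩, ?_⟩
  · rw [mem_compl_singleton_iff]
    exact smul_ne_zero (inv_ne_zero hq.ne') (sub_ne_zero.2 h0)
  · have h2 : ‖(√(1 - ‖x - p‖ ^ 2))⁻¹ • (x - p)‖ ^ 2 = ‖x - p‖ ^ 2 / (1 - ‖x - p‖ ^ 2) := by
      rw [norm_smul, mul_pow, norm_inv, inv_pow, Real.norm_eq_abs, sq_abs, Real.sq_sqrt hs.le]
      field_simp
    have h3 : 1 + ‖x - p‖ ^ 2 / (1 - ‖x - p‖ ^ 2) = (1 - ‖x - p‖ ^ 2)⁻¹ := by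
      field_simp; ring
    simp only [holeMap]
    rw [h2, h3, Real.sqrt_inv, inv_inv, smul_smul, mul_inv_cancel₀ hq.ne', one_smul]
    ring

theorem outerMap_surj {R : ℝ} (hR : 0 ≤ R) {x : ℂ} (h : R < ‖x‖) :
    ∃ z : Cyl, outerMap R z = x := by
  have hn : 0 < ‖x‖ := hR.trans_lt h
  have hx : x ≠ 0 := norm_pos_iff.1 hn
  have hs : 0 < 1 - R ^ 2 / ‖x‖ ^ 2 := by
    rw [sub_pos, div_lt_one (by positivity)]
    nlinarith
  have hq := Real.sqrt_pos.2 hs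
  refine ⟨⟨√(1 - R ^ 2 / ‖x‖ ^ 2) • x, ?_⟩, ?_⟩
  · rw [mem_compl_singleton_iff]
    exact smul_ne_zero hq.ne' hx
  · have h2 : ‖√(1 - R ^ 2 / ‖x‖ ^ 2) • x‖ ^ 2 = ‖x‖ ^ 2 - R ^ 2 := by
      rw [norm_smul, mul_pow, Real.norm_eq_abs, sq_abs, Real.sq_sqrt hs.le]
      field_simp
    have h4 : 0 < ‖x‖ ^ 2 - R ^ 2 := by nlinarith
    have h3 : 1 + R ^ 2 / (‖x‖ ^ 2 - R ^ 2) = (1 - R ^ 2 / ‖x‖ ^ 2)⁻¹ := by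
      have : 1 - R ^ 2 / ‖x‖ ^ 2 = (‖x‖ ^ 2 - R ^ 2) / ‖x‖ ^ 2 := by field_simp
      rw [this, inv_div]
      field_simp
      ring
    simp only [outerMap]
    rw [h2, h3, Real.sqrt_inv, smul_smul, inv_mul_cancel₀ hq.ne', one_smul]

theorem holeMap_signedSmooth {b b' : Web} {p : ℂ}
    (hw : ∀ z ≠ 0, (b.weight (holeMap p z) = 0 ↔ b'.weight z = 0) ∧
      (b'.weight z ≠ 0 → 0 < b'.weight z * b.weight (holeMap p z))) :
    SignedSmoothOn b'.weight b.weight (holeMap p) {0}ᶜ := by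
  have hφ : ∀ s : ℝ, 0 < s → ContDiffAt ℝ ∞ (fun s : ℝ => (√(1 + s))⁻¹) s := fun s hs =>
    ((contDiffAt_const.add contDiffAt_id).sqrt (by simp; positivity)).inv (by simp; positivity)
  refine ⟨contDiffOn_const.add (contDiffOn_radial (φ := fun s => (√(1 + s))⁻¹)
    fun s hs => (hφ s hs).contDiffWithinAt), fun z hz => ?_⟩
  have hn : 0 < ‖z‖ ^ 2 := pow_pos (norm_pos_iff.2 hz) 2
  set s := ‖z‖ ^ 2 with hs
  have hpos : 0 < √(1 + s) := Real.sqrt_pos.2 (by positivity)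
  have hd : HasDerivAt (fun s : ℝ => (√(1 + s))⁻¹) (-(1 / (2 * √(1 + s))) / √(1 + s) ^ 2) s :=
    (((hasDerivAt_id s).const_add 1).sqrt (by simp; positivity)).inv hpos.ne'
  have hdet : 0 < (fderiv ℝ (holeMap p) z).det := by
    have h1 : fderiv ℝ (holeMap p) z = fderiv ℝ (fun z : ℂ => (√(1 + ‖z‖ ^ 2))⁻¹ • z) z :=
      fderiv_const_add p
    rw [h1, det_fderiv_radial hd, ← hs]
    have h2 : √(1 + s) ^ 2 = 1 + s := Real.sq_sqrt (by positivity)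
    have h3 : (√(1 + s))⁻¹ + 2 * (-(1 / (2 * √(1 + s))) / √(1 + s) ^ 2) * s =
        (√(1 + s))⁻¹ * (1 + s)⁻¹ := by
      rw [h2]
      field_simp
      ring
    rw [h3]
    positivity
  exact ⟨hdet.ne', (hw z hz).1, fun h => mul_pos ((hw z hz).2 h) hdet⟩

theorem outerMap_signedSmooth (b : Web) (R : ℝ) :
    SignedSmoothOn b.weight b.weight (outerMap R) {0}ᶜ := by
  have hφ : ∀ s : ℝ, 0 < s → ContDiffAt ℝ ∞ (fun s : ℝ => √(1 + R ^ 2 / s)) s := fun s hs =>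
    (contDiffAt_const.add (contDiffAt_const.div contDiffAt_id hs.ne')).sqrt
      (by simp; positivity)
  refine ⟨contDiffOn_radial (φ := fun s => √(1 + R ^ 2 / s))
    fun s hs => (hφ s hs).contDiffWithinAt, fun z hz => ?_⟩
  have hn : 0 < ‖z‖ ^ 2 := pow_pos (norm_pos_iff.2 hz) 2
  set s := ‖z‖ ^ 2 with hs
  have hpos : 0 < √(1 + R ^ 2 / s) := Real.sqrt_pos.2 (by positivity)
  have hd : HasDerivAt (fun s : ℝ => √(1 + R ^ 2 / s))
      (R ^ 2 * -(s ^ 2)⁻¹ / (2 * √(1 + R ^ 2 / s))) s :=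
    (((hasDerivAt_inv hn.ne').const_mul (R ^ 2)).const_add 1).sqrt (by positivity)
  have hdet : (fderiv ℝ (outerMap R) z).det = 1 := by
    have h1 := det_fderiv_radial hd
    rw [← hs] at h1
    refine h1.trans ?_
    have h2 : √(1 + R ^ 2 / s) ^ 2 = 1 + R ^ 2 / s := Real.sq_sqrt (by positivity)
    have h3 : √(1 + R ^ 2 / s) * (√(1 + R ^ 2 / s) +
        2 * (R ^ 2 * -(s ^ 2)⁻¹ / (2 * √(1 + R ^ 2 / s))) * s) =
        √(1 + R ^ 2 / s) ^ 2 - R ^ 2 / s := by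
      field_simp
      ring
    rw [h3, h2]
    ring
  rw [hdet]
  refine ⟨one_ne_zero, ?_, fun hw => ?_⟩
  · cases b
    · simp [Web.weight]
    · simp only [Web.weight, outerMap, ← hs, Complex.smul_im, smul_eq_mul, mul_eq_zero, hpos.ne',
        false_or]
  · cases b
    · simp [Web.weight]
    · simp only [Web.weight, outerMap, ← hs, Complex.smul_im, smul_eq_mul] at hw ⊢
      have : 0 < z.im ^ 2 := by positivity
      nlinarith [mul_pos hpos this]

/-- The conditions on the centers `p j` of the holes of a disc: the open unit discs around
them are disjoint and contained in the disc of radius `R`. On a singular disc the holes whose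
boundary is a bi-web are centered on the singular line, and those whose boundary is a circle lie
in the facet of points with positive imaginary part; an ordinary disc has circles only. -/
structure IsDisc (b : Web) (n : List Web) (p : Fin n.length → ℂ) (R : ℝ) : Prop where
  nonneg : 0 ≤ R
  sep : ∀ i j, i ≠ j → 2 ≤ ‖p i - p j‖
  inside : ∀ j, ‖p j‖ + 1 ≤ R
  kind : ∀ j, match b, n.get j with
    | .circle, .circle => True
    | .circle, .biweb => False
    | .biweb, .circle => 1 ≤ (p j).im
    | .biweb, .biweb => (p j).im = 0

namespace Cob

section Disc

variable {b : Web} {n : List Web} {p : Fin n.length → ℂ} {R : ℝ}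

theorem holeMap_im (p z : ℂ) : (holeMap p z).im = p.im + (√(1 + ‖z‖ ^ 2))⁻¹ * z.im := by
  simp only [holeMap, Complex.add_im, Complex.smul_im, smul_eq_mul]

theorem norm_holeMap_lt (p z : ℂ) : ‖holeMap p z - p‖ < 1 := by
  have h := norm_holeMap_sub p z
  have h1 : ‖z‖ ^ 2 / (1 + ‖z‖ ^ 2) < 1 := by
    rw [div_lt_one (by positivity)]; linarith
  rw [← h] at h1
  exact (sq_lt_one_iff₀ (norm_nonneg _)).1 h1

theorem lt_norm_outerMap {z : ℂ} (hz : z ≠ 0) : R < ‖outerMap R z‖ := by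
  have h := norm_outerMap R hz
  have hn : 0 < ‖z‖ := norm_pos_iff.2 hz
  exact lt_of_pow_lt_pow_left₀ 2 (norm_nonneg _) (by rw [h]; nlinarith)

theorem disc_hole_smooth (h : IsDisc b n p R) (j : Fin n.length) :
    SignedSmoothOn (n.get j).weight b.weight (holeMap (p j)) {0}ᶜ := by
  refine holeMap_signedSmooth fun z _ => ?_
  have hk := h.kind j
  have hpos : 0 < (√(1 + ‖z‖ ^ 2))⁻¹ := by positivity
  revert hk
  generalize n.get j = b'
  intro hk
  cases b <;> cases b'
  · simp [Web.weight]
  · exact hk.elim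
  · have h1 := norm_holeMap_lt (p j) z
    have h2 := (Complex.abs_im_le_norm (holeMap (p j) z - p j)).trans_lt h1
    rw [Complex.sub_im, abs_lt] at h2
    have h3 : 1 ≤ (p j).im := hk
    have h4 : 0 < (holeMap (p j) z).im := by linarith
    simp only [Web.weight]
    exact ⟨by simp [h4.ne'], fun _ => by linarith⟩
  · have h3 : (p j).im = 0 := hk
    simp only [Web.weight, holeMap_im, h3, zero_add, mul_eq_zero, hpos.ne', false_or, true_and]
    intro hz
    have : 0 < z.im ^ 2 := by positivity
    nlinarith [mul_pos hpos this]

theorem disc_hole_maps (h : IsDisc b n p R) (j : Fin n.length) :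
    MapsTo (holeMap (p j)) {0}ᶜ (range p)ᶜ := by
  rintro z hz ⟨i, hi⟩
  have h1 := norm_holeMap_lt (p j) z
  rw [← hi] at h1
  by_cases hij : i = j
  · subst hij
    have h2 := norm_holeMap_sub (p i) z
    rw [← hi, sub_self, norm_zero] at h2
    have hn : 0 < ‖z‖ := norm_pos_iff.2 hz
    have : 0 < ‖z‖ ^ 2 / (1 + ‖z‖ ^ 2) := by positivity
    rw [← h2] at this
    norm_num at this
  · linarith [h.sep i j hij]

theorem disc_outer_maps (h : IsDisc b n p R) : MapsTo (outerMap R) {0}ᶜ (range p)ᶜ := by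
  rintro z hz ⟨i, hi⟩
  have h1 := lt_norm_outerMap (R := R) hz
  rw [← hi] at h1
  linarith [h.inside i]

/-- A disc with holes, as a cobordism from the boundaries of the holes to the outer boundary. -/
def disc (h : IsDisc b n p R) : Cob n [b] where
  M := Punctured b p
  src j z := ⟨holeMap (p j) z, disc_hole_maps h j z.2⟩
  tgt _ z := ⟨outerMap R z, disc_outer_maps h z.2⟩
  src_collar j := punctured_collar (disc_hole_smooth h j) (holeMap_inj _).injOn _
  tgt_collar j := by
    obtain rfl : j = 0 := Subsingleton.elim (α := Fin 1) _ _
    exact punctured_collar (outerMap_signedSmooth b R) (outerMap_inj R) _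
  src_inj i j z w hzw := by
    have h1 : holeMap (p i) z = holeMap (p j) w := congrArg Subtype.val hzw
    have hij : i = j := by
      by_contra hij
      have h2 := norm_holeMap_lt (p i) z
      have h3 := norm_holeMap_lt (p j) w
      have h4 := h.sep i j hij
      have h5 := norm_sub_le_norm_sub_add_norm_sub (p i) (holeMap (p i) z) (p j)
      rw [norm_sub_rev (p i) (holeMap _ _), h1] at h5
      rw [h1] at h2
      linarith
    subst hij
    exact ⟨rfl, Subtype.ext (holeMap_inj _ h1)⟩
  tgt_inj i j z w hzw :=
    ⟨Subsingleton.elim (α := Fin 1) _ _,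
      Subtype.ext (outerMap_inj R z.2 w.2 (congrArg Subtype.val hzw))⟩
  src_ne_tgt i j z w hzw := by
    have h1 : holeMap (p i) z = outerMap R w := congrArg Subtype.val hzw
    have h2 := norm_holeMap_lt (p i) z
    have h3 := lt_norm_outerMap (R := R) w.2
    have h4 := h.inside i
    rw [← h1] at h3
    have h5 := norm_le_norm_add_norm_sub' (holeMap (p i) z) (p i)
    linarith
  src_closed j := by
    have hc : IsClosed {x : ℂ | ‖x - p j‖ ^ 2 ≤ 1 / 2} :=
      isClosed_le (by fun_prop) (by fun_prop)
    refine (congrArg IsClosed (Set.ext fun x => ?_)).mp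
      (hc.preimage (continuous_subtype_val (p := fun x => x ∈ (range p)ᶜ)))
    have hk : ∀ z : ℂ, ‖holeMap (p j) z - p j‖ ^ 2 ≤ 1 / 2 ↔ ‖z‖ ≤ 1 := by
      intro z
      rw [norm_holeMap_sub, div_le_div_iff₀ (by positivity) (by norm_num),
        ← sq_le_one_iff₀ (norm_nonneg z)]
      constructor <;> intro h <;> linarith
    constructor
    · intro hx
      have hx' : ‖x.1 - p j‖ ^ 2 ≤ 1 / 2 := hx
      obtain ⟨z, hz⟩ := holeMap_surj (p := p j) (x := x.1) (fun h => x.2 ⟨j, h.symm⟩)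
        ((sq_lt_one_iff₀ (norm_nonneg _)).1 (by linarith))
      refine ⟨z, (hk z).1 (by rwa [hz]), Subtype.ext hz⟩
    · rintro ⟨z, hz, rfl⟩
      exact (hk z).2 hz
  tgt_closed j := by
    have hc : IsClosed {x : ℂ | 1 + R ^ 2 ≤ ‖x‖ ^ 2} :=
      isClosed_le (by fun_prop) (by fun_prop)
    refine (congrArg IsClosed (Set.ext fun x => ?_)).mp
      (hc.preimage (continuous_subtype_val (p := fun x => x ∈ (range p)ᶜ)))
    have hk : ∀ z : Cyl, 1 + R ^ 2 ≤ ‖outerMap R z‖ ^ 2 ↔ 1 ≤ ‖(z : ℂ)‖ := by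
      intro z
      rw [norm_outerMap R z.2, ← one_le_sq_iff₀ (norm_nonneg (z : ℂ))]
      constructor <;> intro h <;> linarith
    constructor
    · intro hx
      have hx' : 1 + R ^ 2 ≤ ‖x.1‖ ^ 2 := hx
      obtain ⟨z, hz⟩ := outerMap_surj h.nonneg (x := x.1)
        (lt_of_pow_lt_pow_left₀ 2 (norm_nonneg _) (by linarith))
      refine ⟨z, (hk z).1 (by rwa [hz]), Subtype.ext hz⟩
    · rintro ⟨z, hz, rfl⟩
      exact (hk z).2 hz
  compact := by
    have hc : IsCompact ({x : ℂ | ∀ j, 1 / 2 ≤ ‖x - p j‖ ^ 2} ∩ {x : ℂ | ‖x‖ ^ 2 ≤ 1 + R ^ 2}) := by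
      refine Metric.isCompact_of_isClosed_isBounded (IsClosed.inter ?_ ?_) ?_
      · simp only [ofPred_forall]
        exact isClosed_iInter fun j => isClosed_le (by fun_prop) (by fun_prop)
      · exact isClosed_le (by fun_prop) (by fun_prop)
      · refine (Metric.isBounded_closedBall (x := (0 : ℂ)) (r := 1 + R)).subset ?_
        rintro x ⟨-, hx⟩
        have hx' : ‖x‖ ^ 2 ≤ 1 + R ^ 2 := hx
        rw [mem_closedBall_zero_iff]
        have := h.nonneg
        exact le_of_sq_le_sq (by nlinarith) (by linarith)
    have hsub : ({x : ℂ | ∀ j, 1 / 2 ≤ ‖x - p j‖ ^ 2} ∩ {x : ℂ | ‖x‖ ^ 2 ≤ 1 + R ^ 2}) ⊆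
        range (Subtype.val : ((range p)ᶜ : Set ℂ) → ℂ) := by
      rintro x ⟨hx, -⟩
      rw [Subtype.range_val]
      rintro ⟨j, rfl⟩
      have := hx j
      norm_num at this
    refine (congrArg IsCompact (Set.ext fun x => ?_)).mp
      ((IsInducing.subtypeVal (t := (range p)ᶜ)).isCompact_preimage' hc hsub)
    have hk : ∀ j (z : ℂ), 1 / 2 ≤ ‖holeMap (p j) z - p j‖ ^ 2 ↔ 1 ≤ ‖z‖ := by
      intro j z
      rw [norm_holeMap_sub, div_le_div_iff₀ (by norm_num) (by positivity),
        ← one_le_sq_iff₀ (norm_nonneg z)]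
      constructor <;> intro h <;> linarith
    have hk' : ∀ z : Cyl, ‖outerMap R z‖ ^ 2 ≤ 1 + R ^ 2 ↔ ‖(z : ℂ)‖ ≤ 1 := by
      intro z
      rw [norm_outerMap R z.2, ← sq_le_one_iff₀ (norm_nonneg (z : ℂ))]
      constructor <;> intro h <;> linarith
    constructor
    · rintro ⟨h1, h2⟩
      have h1' : ∀ j, 1 / 2 ≤ ‖x.1 - p j‖ ^ 2 := h1
      have h2' : ‖x.1‖ ^ 2 ≤ 1 + R ^ 2 := h2
      refine ⟨?_, ?_⟩
      · rintro j z rfl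
        exact (hk j z).1 (h1' j)
      · rintro j z rfl
        exact (hk' z).1 h2'
    · rintro ⟨h1, h2⟩
      refine ⟨?_, ?_⟩
      · intro j
        by_contra hlt
        push Not at hlt
        obtain ⟨z, hz⟩ := holeMap_surj (p := p j) (x := x.1) (fun h => x.2 ⟨j, h.symm⟩)
          ((sq_lt_one_iff₀ (norm_nonneg _)).1 (by linarith))
        have := (hk j z).2 (h1 j z (Subtype.ext hz))
        rw [hz] at this
        linarith
      · change ‖x.1‖ ^ 2 ≤ 1 + R ^ 2
        by_contra hlt
        push Not at hlt
        obtain ⟨z, hz⟩ := outerMap_surj h.nonneg (x := x.1)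
          (lt_of_pow_lt_pow_left₀ 2 (norm_nonneg _) (by linarith))
        have := (hk' z).2 (h2 0 z (Subtype.ext hz))
        rw [hz] at this
        linarith

end Disc

theorem equivalent_equivalence (n m : List Web) : Equivalence (Equivalent (n := n) (m := m)) := by
  refine ⟨fun A => ?_, ?_, ?_⟩
  · exact ⟨Structomorph.refl A.M, 1, one_pos, fun _ _ _ => rfl, fun _ _ _ => rfl⟩
  · rintro A B ⟨Φ, δ, hδ, h1, h2⟩
    refine ⟨Φ.symm, δ, hδ, fun j z hz => ?_, fun j z hz => ?_⟩
    · rw [← h1 j z hz]; exact Φ.toHomeomorph.symm_apply_apply _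
    · rw [← h2 j z hz]; exact Φ.toHomeomorph.symm_apply_apply _
  · rintro A B C ⟨Φ, δ, hδ, h1, h2⟩ ⟨Ψ, ε, hε, h3, h4⟩
    refine ⟨Φ.trans Ψ, min δ ε, lt_min hδ hε, fun j z hz => ?_, fun j z hz => ?_⟩
    · rw [← h3 j z (hz.trans_le (by gcongr; exact min_le_right _ _)),
        ← h1 j z (hz.trans_le (by gcongr; exact min_le_left _ _))]
      rfl
    · rw [← h4 j z (lt_of_le_of_lt (by gcongr; exact min_le_right _ _) hz),
        ← h2 j z (lt_of_le_of_lt (by gcongr; exact min_le_left _ _) hz)]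
      rfl

/-! ### Generators -/

/-- The cylinder over `x`, which is the identity of the object `(x)`. -/
def cyl (x : Web) : Cob [x] [x] :=
  disc (b := x) (n := [x]) (p := fun _ => 0) (R := 1)
    { nonneg := zero_le_one
      sep := fun i j h => absurd (Subsingleton.elim (α := Fin 1) i j) h
      inside := by simp
      kind := fun j => by
        obtain rfl : j = 0 := Subsingleton.elim (α := Fin 1) _ _
        cases x <;> simp }

/-- The multiplications: the pair of pants for the circle, and for the bi-web the pair of pants
with three singular arcs that divide it into two hexagons. -/
def mult (x : Web) : Cob [x, x] [x] :=
  disc (b := x) (n := [x, x]) (p := ![-1, 1]) (R := 2)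
    { nonneg := zero_le_two
      sep := by
        change ∀ i j : Fin 2, _
        intro i j h
        fin_cases i <;> fin_cases j <;> simp at h ⊢ <;> norm_num
      inside := by
        change ∀ i : Fin 2, _
        intro i
        fin_cases i <;> simp <;> norm_num
      kind := by
        change ∀ i : Fin 2, _
        intro i
        fin_cases i <;> cases x <;> simp }

/-- The units: a disc for the circle, a disc with one singular arc for the bi-web. -/
def unit (x : Web) : Cob [] [x] :=
  disc (b := x) (n := []) (p := fun j => j.elim0) (R := 0)
    { nonneg := le_rfl
      sep := fun i => i.elim0
      inside := fun i => i.elim0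
      kind := fun i => i.elim0 }

/-- The comultiplications, the multiplications upside down. -/
def comult (x : Web) : Cob [x] [x, x] := (mult x).reverse

/-- The counits, the units upside down. -/
def counit (x : Web) : Cob [x] [] := (unit x).reverse

/-- The zipper: an annulus with a singular arc that has both ends on the bi-web and cuts off a
half disc. -/
def zipper : Cob [.circle] [.biweb] :=
  disc (b := .biweb) (n := [.circle]) (p := fun _ => Complex.I) (R := 2)
    { nonneg := zero_le_two
      sep := fun i j h => absurd (Subsingleton.elim (α := Fin 1) i j) h
      inside := by simp; norm_num
      kind := fun j => by
        obtain rfl : j = 0 := Subsingleton.elim (α := Fin 1) _ _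
        simp }

/-- The cozipper, the zipper upside down. -/
def cozipper : Cob [.biweb] [.circle] := zipper.reverse

/-- The braiding of two components: two cylinders with the target components exchanged. -/
def braid (x y : Web) : Cob [x, y] [y, x] :=
  (tensor (cyl x) (cyl y)).permTgt (Equiv.swap (0 : Fin 2) 1) (by
    change ∀ i : Fin 2, _
    intro i
    fin_cases i <;> rfl)

end Cob

/-! ### Frobenius algebra objects

The free union is strictly associative and unital on objects, so that the associativity and unit
isomorphisms between the objects below are identities. Morphisms are equivalence classes of
singular cobordisms, so that equality of morphisms is equivalence of representatives. In a
composition `A ⨾ B` the first factor is on top. -/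

infixl:65 " ⨾ " => Cob.comp
notation:70 a:70 " ⨿ₛ " b:71 => (Cob.tensor a b :)
infix:50 " ≅ₛ " => Cob.Equivalent

/-- `(x)` with multiplication `m`, unit `u`, comultiplication `d` and counit `e` is a Frobenius
algebra object. -/
structure IsFrobenius (x : Web) (m : Cob [x, x] [x]) (u : Cob [] [x]) (d : Cob [x] [x, x])
    (e : Cob [x] []) : Prop where
  assoc : (Cob.cyl x ⨿ₛ m) ⨾ m ≅ₛ (m ⨿ₛ Cob.cyl x) ⨾ m
  mul_unit : (Cob.cyl x ⨿ₛ u) ⨾ m ≅ₛ Cob.cyl x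
  unit_mul : (u ⨿ₛ Cob.cyl x) ⨾ m ≅ₛ Cob.cyl x
  coassoc : d ⨾ (Cob.cyl x ⨿ₛ d) ≅ₛ d ⨾ (d ⨿ₛ Cob.cyl x)
  comul_counit : d ⨾ (Cob.cyl x ⨿ₛ e) ≅ₛ Cob.cyl x
  counit_comul : d ⨾ (e ⨿ₛ Cob.cyl x) ≅ₛ Cob.cyl x
  frobenius_left : (Cob.cyl x ⨿ₛ d) ⨾ (m ⨿ₛ Cob.cyl x) ≅ₛ m ⨾ d
  frobenius_right : (d ⨿ₛ Cob.cyl x) ⨾ (Cob.cyl x ⨿ₛ m) ≅ₛ m ⨾ d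

/-- A commutative Frobenius algebra object. -/
structure IsCommutativeFrobenius (x : Web) (m : Cob [x, x] [x]) (u : Cob [] [x])
    (d : Cob [x] [x, x]) (e : Cob [x] []) : Prop extends IsFrobenius x m u d e where
  comm : Cob.braid x x ⨾ m ≅ₛ m

/-- A symmetric Frobenius algebra object. -/
structure IsSymmetricFrobenius (x : Web) (m : Cob [x, x] [x]) (u : Cob [] [x])
    (d : Cob [x] [x, x]) (e : Cob [x] []) : Prop extends IsFrobenius x m u d e where
  symm : m ⨾ e ≅ₛ Cob.braid x x ⨾ m ⨾ e

/-- `f` is a homomorphism from the algebra object `(x, m, u)` to the algebra object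
`(y, m', u')`. -/
structure IsAlgebraHom {x y : Web} (m : Cob [x, x] [x]) (u : Cob [] [x]) (m' : Cob [y, y] [y])
    (u' : Cob [] [y]) (f : Cob [x] [y]) : Prop where
  map_mul : m ⨾ f ≅ₛ (f ⨿ₛ f) ⨾ m'
  map_unit : u ⨾ f ≅ₛ u'

/-! ### Linear combinations and local relations -/

section Linear

variable (R : Type u) [CommRing R] (i : R)

/-- Formal linear combinations of singular cobordisms. -/
abbrev Chain (n m : List Web) : Type (max 1 u) := Cob n m →₀ R

/-- The bilinear extension of the composition. -/
def Chain.comp (n m k : List Web) : Chain R n m →ₗ[R] Chain R m k →ₗ[R] Chain R n k :=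
  Finsupp.linearCombination R fun A => Finsupp.lmapDomain R R fun B => A ⨾ B

/-- The bilinear extension of the free union. -/
def Chain.tensor (n m n' m' : List Web) :
    Chain R n m →ₗ[R] Chain R n' m' →ₗ[R] Chain R (n ++ n') (m ++ m') :=
  Finsupp.linearCombination R fun A => Finsupp.lmapDomain R R fun B => A ⨿ₛ B

/-- The linear combinations that become zero when equivalent cobordisms are identified and the
local relations `cozipper ⨾ zipper = -i • cyl` and `zipper ⨾ cozipper = -i • cyl` are imposed:
the smallest family of submodules that contains these relations and is stable under composition
and free union with arbitrary morphisms. -/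
inductive IsNull : ∀ {n m : List Web}, Chain R n m → Prop
  | zero {n m : List Web} : IsNull (0 : Chain R n m)
  | add {n m : List Web} {a b : Chain R n m} : IsNull a → IsNull b → IsNull (a + b)
  | smul {n m : List Web} (r : R) {a : Chain R n m} : IsNull a → IsNull (r • a)
  | equivalent {n m : List Web} {A B : Cob n m} : A ≅ₛ B →
      IsNull (Finsupp.single A 1 - Finsupp.single B 1)
  | local_biweb : IsNull (Finsupp.single (Cob.cozipper ⨾ Cob.zipper) 1 -
      (-i) • Finsupp.single (Cob.cyl .biweb) 1)
  | local_circle : IsNull (Finsupp.single (Cob.zipper ⨾ Cob.cozipper) 1 -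
      (-i) • Finsupp.single (Cob.cyl .circle) 1)
  | comp_left {n m k : List Web} {a : Chain R n m} (b : Chain R m k) : IsNull a →
      IsNull (Chain.comp R n m k a b)
  | comp_right {n m k : List Web} (a : Chain R n m) {b : Chain R m k} : IsNull b →
      IsNull (Chain.comp R n m k a b)
  | tensor_left {n m n' m' : List Web} {a : Chain R n m} (b : Chain R n' m') : IsNull a →
      IsNull (Chain.tensor R n m n' m' a b)
  | tensor_right {n m n' m' : List Web} (a : Chain R n m) {b : Chain R n' m'} : IsNull b →
      IsNull (Chain.tensor R n m n' m' a b)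

/-- The submodule of null linear combinations. -/
def nullSubmodule (n m : List Web) : Submodule R (Chain R n m) where
  carrier := {a | IsNull R i a}
  add_mem' := IsNull.add
  zero_mem' := IsNull.zero
  smul_mem' r _ := IsNull.smul r

/-- The morphisms of the linear category of singular cobordisms modulo the local relations. -/
abbrev Mor (n m : List Web) : Type (max 1 u) := Chain R n m ⧸ nullSubmodule R i n m

/-- The morphism represented by a singular cobordism. -/
def Mor.of {n m : List Web} (A : Cob n m) : Mor R i n m :=
  (nullSubmodule R i n m).mkQ (Finsupp.single A 1)

/-- The composition of morphisms; the first argument is on top. -/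
def Mor.comp (n m k : List Web) : Mor R i n m →ₗ[R] Mor R i m k →ₗ[R] Mor R i n k :=
  ((nullSubmodule R i m k).liftQ
    ((nullSubmodule R i n m).liftQ ((Chain.comp R n m k).compr₂ (nullSubmodule R i n k).mkQ)
      (fun a ha => LinearMap.ext fun b =>
        (Submodule.Quotient.mk_eq_zero _).2 (IsNull.comp_left b ha))).flip
    (fun b hb => LinearMap.ext fun x => by
      obtain ⟨a, rfl⟩ := Submodule.Quotient.mk_surjective _ x
      exact (Submodule.Quotient.mk_eq_zero _).2 (IsNull.comp_right a hb))).flip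

/-- The free union of morphisms. -/
def Mor.tensor (n m n' m' : List Web) :
    Mor R i n m →ₗ[R] Mor R i n' m' →ₗ[R] Mor R i (n ++ n') (m ++ m') :=
  ((nullSubmodule R i n' m').liftQ
    ((nullSubmodule R i n m).liftQ
      ((Chain.tensor R n m n' m').compr₂ (nullSubmodule R i (n ++ n') (m ++ m')).mkQ)
      (fun a ha => LinearMap.ext fun b =>
        (Submodule.Quotient.mk_eq_zero _).2 (IsNull.tensor_left b ha))).flip
    (fun b hb => LinearMap.ext fun x => by
      obtain ⟨a, rfl⟩ := Submodule.Quotient.mk_surjective _ x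
      exact (Submodule.Quotient.mk_eq_zero _).2 (IsNull.tensor_right a hb))).flip

theorem Mor.of_eq_of_equivalent {n m : List Web} {A B : Cob n m} (h : A ≅ₛ B) :
    Mor.of R i A = Mor.of R i B :=
  (Submodule.Quotient.eq _).2 (IsNull.equivalent h)

theorem Mor.of_comp {n m k : List Web} (A : Cob n m) (B : Cob m k) :
    Mor.of R i (A ⨾ B) = Mor.comp R i n m k (Mor.of R i A) (Mor.of R i B) := by
  have : Chain.comp R n m k (Finsupp.single A 1) (Finsupp.single B 1) =
      Finsupp.single (A ⨾ B) 1 := by simp [Chain.comp]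
  rw [Mor.of, ← this]
  rfl

theorem Mor.of_tensor {n m n' m' : List Web} (A : Cob n m) (B : Cob n' m') :
    Mor.of R i (A ⨿ₛ B) = Mor.tensor R i n m n' m' (Mor.of R i A) (Mor.of R i B) := by
  have : Chain.tensor R n m n' m' (Finsupp.single A 1) (Finsupp.single B 1) =
      Finsupp.single (A ⨿ₛ B) 1 := by simp [Chain.tensor]
  rw [Mor.of, ← this]
  rfl

end Linear

end SingCob

end

open SingCob

/-! Every cobordism that occurs in items 1 to 5, except for the free unions on the way, is a
connected surface of genus zero whose singular set, if there is one, can be laid out as the real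
axis of a plane. The proof makes this literal and turns each relation into a statement about a few
marked points.

A model (`IsModel`) identifies the surface of a cobordism, together with its outer collars, with a
piecewise oriented plane minus finitely many points. One end, the root, lies at infinity; every
other end, a leaf, surrounds a puncture. The collars need only be smooth, but at the puncture they
must have a nonzero complex derivative. Bi-web leaves sit on the real axis, circle leaves in the
upper half plane (or anywhere, if the plane is nonsingular).

The central fact is `IsModel.equivalent`: kind of plane, root and positions of the punctures
determine the cobordism up to equivalence. The obvious map between two surfaces with the same model
need not respect the collars, so these are first made linear (`IsModel.exists_normal`). The
straightening is an automorphism of the surface supported in its ends (`Cob.twist`), built from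
planar diffeomorphisms: a germ tangent to the identity is cut off to a small Lipschitz perturbation
of the identity (`exists_extension_tangent`), and the remaining complex factor is produced by a
radial twist (`spiral`), which gives `exists_planar_extension`. At a bi-web end this factor is a
positive real number, because the half planes are preserved.

Models of composites are made by gluing in the plane. The generators are discs with holes, so their
inclusion is a model (`isModel_disc`); turning a cobordism upside down reflects the model
(`IsModel.reverse`), and an inversion moves another end to infinity (`IsModel.reroot`). A linear
model can be shrunk and inserted at a leaf of another one, the bounding circles being matched by
powers of one small parameter (`IsNormalModel.core`, `IsCore.comp`). This covers a pair of trees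
glued to a tree with two leaves (`IsForest.comp_right`, `IsForest.comp_left`), two trees
(`IsModel.comp_right`, `IsModel.comp_cap`), four trees along a path (`IsModel.comp_path_left`,
`IsModel.comp_path_right`), and the pairing needed for duality (`IsModel.comp_pairing`).

It remains to compare punctures. They may be moved by affine maps and by compactly supported
horizontal shifts (`exists_shift`). Hence three leaves on the real line matter only through their
order, which settles associativity, coassociativity and the Frobenius relations; an annulus with
both ends of the kind of the plane is unique, which settles the unit and counit relations and
symmetry; two points of the nonsingular plane can be exchanged, which is commutativity; two circles
in the upper half plane at equal height matter only through their horizontal order, which gives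
multiplicativity of the zipper; and a circle in the upper half plane slides past a bi-web on the
real axis, which is centrality. Duality of the cozipper compares annuli with a single circle leaf,
which can be normalized to lie at `Complex.I`.

Item 6 is formal: in the quotient both composites of zipper and cozipper are `-i` times a cylinder,
and `i * -i = 1`. -/

noncomputable section

namespace SingCob

/-! ### Pointwise signed smoothness -/

/-- The pointwise form of `SignedSmoothOn`. -/
def SignedSmoothAt (w w' : ℂ → ℝ) (f : ℂ → ℂ) (z : ℂ) : Prop :=
  ContDiffAt ℝ ∞ f z ∧ (fderiv ℝ f z).det ≠ 0 ∧ (w' (f z) = 0 ↔ w z = 0) ∧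
    (w z ≠ 0 → 0 < w z * w' (f z) * (fderiv ℝ f z).det)

theorem SignedSmoothOn.at {w w' : ℂ → ℝ} {f : ℂ → ℂ} {s : Set ℂ} (h : SignedSmoothOn w w' f s)
    (hs : IsOpen s) {z : ℂ} (hz : z ∈ s) : SignedSmoothAt w w' f z :=
  ⟨h.1.contDiffAt (hs.mem_nhds hz), h.2 z hz⟩

theorem SignedSmoothOn.of_at {w w' : ℂ → ℝ} {f : ℂ → ℂ} {s : Set ℂ}
    (h : ∀ z ∈ s, SignedSmoothAt w w' f z) : SignedSmoothOn w w' f s :=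
  ⟨fun z hz => (h z hz).1.contDiffWithinAt, fun z hz => (h z hz).2⟩

theorem det_comp (L L' : ℂ →L[ℝ] ℂ) : (L.comp L').det = L.det * L'.det := by
  simp [ContinuousLinearMap.det, LinearMap.det_comp]

namespace SignedSmoothAt

variable {w w' w'' : ℂ → ℝ} {f g : ℂ → ℂ} {z : ℂ}

theorem differentiableAt (h : SignedSmoothAt w w' f z) : DifferentiableAt ℝ f z :=
  h.1.differentiableAt (by simp)

theorem continuousAt (h : SignedSmoothAt w w' f z) : ContinuousAt f z := h.1.continuousAt

theorem congr (h : SignedSmoothAt w w' f z) (hg : g =ᶠ[𝓝 z] f) : SignedSmoothAt w w' g z := by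
  refine ⟨h.1.congr_of_eventuallyEq hg, ?_⟩
  rw [hg.fderiv_eq, hg.eq_of_nhds]
  exact h.2

theorem id_at (w : ℂ → ℝ) (z : ℂ) : SignedSmoothAt w w id z :=
  (SignedSmoothOn.id_on w univ).at isOpen_univ (mem_univ z)

/-- Only the signs of the three numbers matter, so the claim is a finite check in `SignType`. -/
theorem sign_iff {a b d : ℝ} (hd : d ≠ 0) (h : b = 0 ↔ a = 0) :
    (a ≠ 0 → 0 < a * b * d) ↔ SignType.sign b = SignType.sign a * SignType.sign d := by
  have key : ∀ s t u : SignType, u ≠ 0 → (t = 0 ↔ s = 0) →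
      ((s ≠ 0 → s * t * u = 1) ↔ t = s * u) := by decide
  rw [← sign_eq_one_iff, sign_mul, sign_mul, ← sign_ne_zero (a := a)]
  exact key _ _ _ (sign_ne_zero.2 hd) (by simpa using h)

/-- The conditions on zeros and on orientation merge into one multiplicative identity of signs.
Composition and both cancellation rules then reduce to algebra in `SignType`. -/
theorem iff_sign : SignedSmoothAt w w' f z ↔ ContDiffAt ℝ ∞ f z ∧ (fderiv ℝ f z).det ≠ 0 ∧
    SignType.sign (w' (f z)) = SignType.sign (w z) * SignType.sign (fderiv ℝ f z).det := by
  refine and_congr_right fun _ => and_congr_right fun hd => ?_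
  constructor
  · rintro ⟨h1, h2⟩
    exact (sign_iff hd h1).1 h2
  · intro h
    have h1 : w' (f z) = 0 ↔ w z = 0 := by
      rw [← sign_eq_zero_iff, h, ← sign_eq_zero_iff (a := w z)]
      have : SignType.sign (fderiv ℝ f z).det ≠ 0 := by simpa using hd
      simp [hd]
    exact ⟨h1, (sign_iff hd h1).2 h⟩

theorem comp (hg : SignedSmoothAt w' w'' g (f z)) (hf : SignedSmoothAt w w' f z) :
    SignedSmoothAt w w'' (g ∘ f) z := by
  have hdet : (fderiv ℝ (g ∘ f) z).det = (fderiv ℝ g (f z)).det * (fderiv ℝ f z).det := by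
    rw [fderiv_comp z hg.differentiableAt hf.differentiableAt, det_comp]
  rw [iff_sign] at hg hf ⊢
  refine ⟨hg.1.comp z hf.1, by rw [hdet]; exact mul_ne_zero hg.2.1 hf.2.1, ?_⟩
  rw [hdet, sign_mul, Function.comp_apply, hg.2.2, hf.2.2, mul_assoc,
    mul_comm (SignType.sign (fderiv ℝ f z).det)]

/-- Signed smoothness of the inner factor of a composition. -/
theorem cancel_left (hg : SignedSmoothAt w' w'' g (f z)) (hgf : SignedSmoothAt w w'' (g ∘ f) z)
    (hf : ContDiffAt ℝ ∞ f z) : SignedSmoothAt w w' f z := by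
  have hdet : (fderiv ℝ (g ∘ f) z).det = (fderiv ℝ g (f z)).det * (fderiv ℝ f z).det := by
    rw [fderiv_comp z hg.differentiableAt (hf.differentiableAt (by simp)), det_comp]
  rw [iff_sign] at hg hgf ⊢
  obtain ⟨-, g2, g3⟩ := hg
  obtain ⟨-, k2, k3⟩ := hgf
  rw [hdet] at k2 k3
  refine ⟨hf, right_ne_zero_of_mul k2, ?_⟩
  rw [sign_mul, Function.comp_apply, g3] at k3
  have key : ∀ s t u v : SignType, v ≠ 0 → s * v = t * (v * u) → s = t * u := by decide
  exact key _ _ _ _ (sign_ne_zero.2 g2) k3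

/-- The derivative as a linear equivalence. -/
def equiv (h : SignedSmoothAt w w' f z) : ℂ ≃L[ℝ] ℂ :=
  (fderiv ℝ f z).toContinuousLinearEquivOfDetNeZero h.2.1

theorem hasFDerivAt_equiv (h : SignedSmoothAt w w' f z) :
    HasFDerivAt f (h.equiv : ℂ →L[ℝ] ℂ) z := by
  simpa [equiv] using h.differentiableAt.hasFDerivAt

theorem map_nhds_eq (h : SignedSmoothAt w w' f z) : Filter.map f (𝓝 z) = 𝓝 (f z) := by
  have h1 := h.1.hasStrictFDerivAt (n := ∞) (by simp)
  have h2 : HasStrictFDerivAt f (h.equiv : ℂ →L[ℝ] ℂ) z := by simpa [equiv] using h1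
  exact h2.map_nhds_eq_of_equiv

/-- Signed smoothness of the outer factor of a composition. -/
theorem cancel_right (hf : SignedSmoothAt w w' f z) (hgf : SignedSmoothAt w w'' (g ∘ f) z) :
    SignedSmoothAt w' w'' g (f z) := by
  -- The inverse function theorem gives a local inverse of `f`; near `f z` the map `g` is `g ∘ f`
  -- composed with it.
  set e := hf.1.toOpenPartialHomeomorph f hf.hasFDerivAt_equiv (n := ∞) (by simp) with he
  have hef : ∀ x, e x = f x := fun x => rfl
  have hz : z ∈ e.source := hf.1.mem_toOpenPartialHomeomorph_source hf.hasFDerivAt_equiv (by simp)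
  have hfz : f z ∈ e.target := e.map_source hz
  have hsz : e.symm (f z) = z := e.left_inv hz
  have hs : ContDiffAt ℝ ∞ e.symm (f z) := by
    refine e.contDiffAt_symm (f₀' := hf.equiv) hfz ?_ ?_
    · rw [hsz]; exact hf.hasFDerivAt_equiv
    · rw [hsz]; exact hf.1
  have hse : f ∘ e.symm =ᶠ[𝓝 (f z)] id := by
    filter_upwards [e.open_target.mem_nhds hfz] with y hy using e.right_inv hy
  have hi : SignedSmoothAt w' w e.symm (f z) := by
    refine cancel_left (w' := w) (w'' := w') (g := f) ?_ ?_ hs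
    · rw [hsz]; exact hf
    · exact (id_at w' (f z)).congr hse
  have h := SignedSmoothAt.comp (f := e.symm) (g := g ∘ f) (z := f z) (by rw [hsz]; exact hgf) hi
  refine h.congr ?_
  filter_upwards [hse] with y hy
  exact congrArg g hy.symm

end SignedSmoothAt

/-! ### Morphisms of piecewise oriented surfaces -/

theorem coord_eventuallyEq {M N : Type} [TopologicalSpace M] [TopologicalSpace N] {f : M → N}
    {x : M} (hf : ContinuousAt f x)
    {c d : OpenPartialHomeomorph M ℂ} {c' d' : OpenPartialHomeomorph N ℂ} (hx : x ∈ c.source)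
    (hd : x ∈ d.source) (hx' : f x ∈ c'.source) :
    d' ∘ f ∘ d.symm =ᶠ[𝓝 (d x)] (d' ∘ c'.symm) ∘ (c' ∘ f ∘ c.symm) ∘ (c ∘ d.symm) := by
  have h1 : Filter.Tendsto d.symm (𝓝 (d x)) (𝓝 x) := by
    simpa [d.left_inv hd] using (d.continuousAt_symm (d.map_source hd)).tendsto
  filter_upwards [h1.eventually (c.open_source.mem_nhds hx),
    h1.eventually (hf.eventually (c'.open_source.mem_nhds hx'))] with y hy hy'
  simp [c.left_inv hy, c'.left_inv hy']

section SingAt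

variable {M N K : Type} [TopologicalSpace M] [ChartedSpace ℂ M] [TopologicalSpace N]
  [ChartedSpace ℂ N] [TopologicalSpace K] [ChartedSpace ℂ K]

/-- `f` is, near `x`, an orientation preserving local diffeomorphism of piecewise oriented
surfaces. -/
def SingAt (f : M → N) (x : M) : Prop :=
  ContinuousAt f x ∧ SignedSmoothAt Complex.im Complex.im
    (chartAt ℂ (f x) ∘ f ∘ (chartAt ℂ x).symm) (chartAt ℂ x x)

theorem signedSmoothAt_transition [HasGroupoid M singGroupoid] {c c' : OpenPartialHomeomorph M ℂ}
    (hc : c ∈ atlas ℂ M) (hc' : c' ∈ atlas ℂ M) {x : M} (hx : x ∈ c.source)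
    (hx' : x ∈ c'.source) :
    SignedSmoothAt Complex.im Complex.im (c' ∘ c.symm) (c x) := by
  have h := mem_singGroupoid.1 (singGroupoid.compatible hc hc')
  refine h.at (OpenPartialHomeomorph.open_source _) ?_
  simp [hx, hx']

theorem signedSmoothAt_coord_change [HasGroupoid M singGroupoid] [HasGroupoid N singGroupoid]
    {f : M → N} {x : M} (hf : ContinuousAt f x)
    {c d : OpenPartialHomeomorph M ℂ} {c' d' : OpenPartialHomeomorph N ℂ}
    (hc : c ∈ atlas ℂ M) (hd : d ∈ atlas ℂ M) (hc' : c' ∈ atlas ℂ N) (hd' : d' ∈ atlas ℂ N)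
    (hx : x ∈ c.source) (hxd : x ∈ d.source) (hx' : f x ∈ c'.source) (hxd' : f x ∈ d'.source)
    (h : SignedSmoothAt Complex.im Complex.im (c' ∘ f ∘ c.symm) (c x)) :
    SignedSmoothAt Complex.im Complex.im (d' ∘ f ∘ d.symm) (d x) := by
  refine SignedSmoothAt.congr ?_ (coord_eventuallyEq hf hx hxd hx')
  have e1 : (c ∘ d.symm) (d x) = c x := by simp [d.left_inv hxd]
  have e2 : (c' ∘ f ∘ c.symm) (c x) = c' (f x) := by simp [c.left_inv hx]
  refine SignedSmoothAt.comp (w' := Complex.im) ?_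
    (SignedSmoothAt.comp (w' := Complex.im) ?_ (signedSmoothAt_transition hd hc hxd hx))
  · rw [Function.comp_apply (g := c ∘ d.symm), e1, e2]
    exact signedSmoothAt_transition hc' hd' hx' hxd'
  · rw [e1]; exact h

/-- Transition maps lie in the groupoid, so the preferred charts in the definition may be replaced
by any charts of the two atlases around the points. -/
theorem singAt_iff [HasGroupoid M singGroupoid] [HasGroupoid N singGroupoid] {f : M → N} {x : M}
    {c : OpenPartialHomeomorph M ℂ} {c' : OpenPartialHomeomorph N ℂ}
    (hc : c ∈ atlas ℂ M) (hc' : c' ∈ atlas ℂ N) (hx : x ∈ c.source) (hx' : f x ∈ c'.source) :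
    SingAt f x ↔ ContinuousAt f x ∧
      SignedSmoothAt Complex.im Complex.im (c' ∘ f ∘ c.symm) (c x) := by
  refine and_congr_right fun hf => ⟨fun h => ?_, fun h => ?_⟩
  · exact signedSmoothAt_coord_change hf (chart_mem_atlas ℂ x) hc (chart_mem_atlas ℂ _) hc'
      (mem_chart_source ℂ x) hx (mem_chart_source ℂ _) hx' h
  · exact signedSmoothAt_coord_change hf hc (chart_mem_atlas ℂ x) hc' (chart_mem_atlas ℂ _)
      hx (mem_chart_source ℂ x) hx' (mem_chart_source ℂ _) h

namespace SingAt

variable {f : M → N} {g : N → K} {x : M}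

theorem congr {f' : M → N} (h : SingAt f x) (hf : f' =ᶠ[𝓝 x] f) : SingAt f' x := by
  refine ⟨h.1.congr hf.symm, ?_⟩
  rw [hf.eq_of_nhds]
  refine h.2.congr ?_
  have h1 : Filter.Tendsto (chartAt ℂ x).symm (𝓝 (chartAt ℂ x x)) (𝓝 x) := by
    simpa using ((chartAt ℂ x).continuousAt_symm (mem_chart_target ℂ x)).tendsto
  filter_upwards [h1.eventually hf] with y hy
  simp [hy]

theorem coord_comp (hf : ContinuousAt f x) (g : N → K) :
    chartAt ℂ (g (f x)) ∘ (g ∘ f) ∘ (chartAt ℂ x).symm =ᶠ[𝓝 (chartAt ℂ x x)]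
      (chartAt ℂ (g (f x)) ∘ g ∘ (chartAt ℂ (f x)).symm) ∘
        (chartAt ℂ (f x) ∘ f ∘ (chartAt ℂ x).symm) := by
  have h1 : Filter.Tendsto (chartAt ℂ x).symm (𝓝 (chartAt ℂ x x)) (𝓝 x) := by
    simpa using ((chartAt ℂ x).continuousAt_symm (mem_chart_target ℂ x)).tendsto
  filter_upwards [h1.eventually (hf.eventually
    ((chartAt ℂ (f x)).open_source.mem_nhds (mem_chart_source ℂ (f x))))] with y hy
  simp [(chartAt ℂ (f x)).left_inv hy]

theorem comp (hg : SingAt g (f x)) (hf : SingAt f x) : SingAt (g ∘ f) x := by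
  refine ⟨hg.1.comp hf.1, SignedSmoothAt.congr ?_ (coord_comp hf.1 g)⟩
  refine SignedSmoothAt.comp ?_ hf.2
  have : (chartAt ℂ (f x) ∘ f ∘ (chartAt ℂ x).symm) (chartAt ℂ x x) = chartAt ℂ (f x) (f x) := by
    simp
  rw [this]
  exact hg.2

theorem id_at (x : M) : SingAt (id : M → M) x := by
  refine ⟨continuousAt_id, (SignedSmoothAt.id_at _ _).congr ?_⟩
  filter_upwards [(chartAt ℂ x).open_target.mem_nhds (mem_chart_target ℂ x)] with y hy
  simp [(chartAt ℂ x).right_inv hy]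

theorem map_nhds_eq (hf : SingAt f x) : Filter.map f (𝓝 x) = 𝓝 (f x) := by
  have h1 := hf.2.map_nhds_eq
  have h2 : (chartAt ℂ (f x) ∘ f ∘ (chartAt ℂ x).symm) (chartAt ℂ x x) =
      chartAt ℂ (f x) (f x) := by simp
  have h3 : Filter.map (chartAt ℂ (f x)).symm (𝓝 (chartAt ℂ (f x) (f x))) = 𝓝 (f x) := by
    simpa using (chartAt ℂ (f x)).symm.map_nhds_eq (x := chartAt ℂ (f x) (f x))
      (mem_chart_target ℂ _)
  have h4 : Filter.map (chartAt ℂ x).symm (𝓝 (chartAt ℂ x x)) = 𝓝 x := by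
    simpa using (chartAt ℂ x).symm.map_nhds_eq (x := chartAt ℂ x x) (mem_chart_target ℂ _)
  rw [h2, ← Filter.map_map, ← Filter.map_map, h4] at h1
  rw [← h3, ← h1, Filter.map_map]
  refine Filter.map_congr ?_
  filter_upwards [hf.1.eventually ((chartAt ℂ (f x)).open_source.mem_nhds
    (mem_chart_source ℂ (f x)))] with y hy
  exact ((chartAt ℂ (f x)).left_inv hy).symm

/-- A morphism is locally invertible, so a map out of its target may be tested after composing with
it. Maps out of glued surfaces, free unions and ends of cobordisms are all checked in this way. -/
theorem cancel_right (hf : SingAt f x) (hgf : SingAt (g ∘ f) x) : SingAt g (f x) := by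
  have hc : ContinuousAt g (f x) := by
    have := hgf.1
    unfold ContinuousAt at this ⊢
    rw [← hf.map_nhds_eq, Filter.tendsto_map'_iff]
    exact this
  refine ⟨hc, ?_⟩
  have h2 : (chartAt ℂ (f x) ∘ f ∘ (chartAt ℂ x).symm) (chartAt ℂ x x) =
      chartAt ℂ (f x) (f x) := by simp
  have h := SignedSmoothAt.cancel_right hf.2 (hgf.2.congr (coord_comp hf.1 g).symm)
  rwa [h2] at h

end SingAt

theorem isOpenMap_of_singAt {f : M → N} (hf : ∀ x, SingAt f x) : IsOpenMap f :=
  isOpenMap_iff_nhds_le.2 fun x => (hf x).map_nhds_eq.ge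

theorem continuous_of_singAt {f : M → N} (hf : ∀ x, SingAt f x) : Continuous f :=
  continuous_iff_continuousAt.2 fun x => (hf x).1

/-- A bijective morphism is an isomorphism. -/
def structomorphOfBijective [HasGroupoid M singGroupoid] [HasGroupoid N singGroupoid] (f : M → N)
    (hb : Function.Bijective f) (hf : ∀ x, SingAt f x) : Structomorph singGroupoid M N where
  toHomeomorph := (Equiv.ofBijective f hb).toHomeomorphOfContinuousOpen
    (continuous_of_singAt hf) (isOpenMap_of_singAt hf)
  mem_groupoid := by
    intro c c' hc hc'
    rw [mem_singGroupoid]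
    refine SignedSmoothOn.of_at fun z hz => ?_
    have h1 : z ∈ c.target := hz.1
    have h2 : f (c.symm z) ∈ c'.source := hz.2.2
    have h3 := ((singAt_iff hc hc' (c.map_target h1) h2).1 (hf _)).2
    rw [c.right_inv h1] at h3
    exact h3

end SingAt

end SingCob

namespace SingCob

/-! ### The piecewise oriented planes -/

/-- The plane, piecewise oriented by `b.weight`. -/
def Plane (_b : Web) : Type := ℂ

instance (b : Web) : TopologicalSpace (Plane b) := inferInstanceAs (TopologicalSpace ℂ)

instance (b : Web) : Nonempty (Plane b) := inferInstanceAs (Nonempty ℂ)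

theorem plane_isOpenEmbedding (b : Web) :
    IsOpenEmbedding (X := Plane b) (fun z : Plane b => flatten b z) :=
  flatten_isOpenEmbedding b

instance (b : Web) : ChartedSpace ℂ (Plane b) := (plane_isOpenEmbedding b).singletonChartedSpace

instance (b : Web) : HasGroupoid (Plane b) singGroupoid :=
  (plane_isOpenEmbedding b).singleton_hasGroupoid _

/-- The global chart of the plane. -/
def planeChart (b : Web) : OpenPartialHomeomorph (Plane b) ℂ :=
  (plane_isOpenEmbedding b).toOpenPartialHomeomorph _

theorem planeChart_mem (b : Web) : planeChart b ∈ atlas ℂ (Plane b) :=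
  chart_mem_atlas ℂ (Classical.arbitrary (Plane b))

theorem planeChart_source (b : Web) (z : Plane b) : z ∈ (planeChart b).source := mem_univ z

theorem planeChart_symm_signedSmoothAt (b : Web) (z : ℂ) :
    SignedSmoothAt Complex.im b.weight (planeChart b).symm (planeChart b z) :=
  (flatten_symm_signedSmooth b).at (flatten_isOpenEmbedding b).isOpen_range (mem_range_self z)

theorem planeChart_signedSmoothAt (b : Web) (z : ℂ) :
    SignedSmoothAt b.weight Complex.im (planeChart b) z :=
  (flatten_signedSmooth b).at isOpen_univ (mem_univ z)

section

variable {M N : Type} [TopologicalSpace M] [ChartedSpace ℂ M] [TopologicalSpace N]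
  [ChartedSpace ℂ N] [HasGroupoid M singGroupoid] [HasGroupoid N singGroupoid]

/-- The global chart of the plane transports `b.weight` to the weight of the local model, so it can
be cancelled and the target treated as `ℂ` with the weight `b.weight`. -/
theorem singAt_toPlane_iff {b : Web} {f : M → ℂ} {x : M} {c : OpenPartialHomeomorph M ℂ}
    (hc : c ∈ atlas ℂ M) (hx : x ∈ c.source) :
    SingAt (N := Plane b) f x ↔ ContinuousAt f x ∧
      SignedSmoothAt Complex.im b.weight (f ∘ c.symm) (c x) := by
  refine (singAt_iff (N := Plane b) hc (planeChart_mem b) hx (planeChart_source b _)).trans ?_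
  refine and_congr_right fun _ => ⟨fun h => ?_, fun h => ?_⟩
  · have h1 := SignedSmoothAt.comp (w'' := b.weight) (g := (planeChart b).symm)
      (f := planeChart b ∘ f ∘ c.symm) (z := c x) ?_ h
    · refine h1.congr (Filter.Eventually.of_forall fun y => ?_)
      exact ((planeChart b).left_inv (planeChart_source b _)).symm
    · exact planeChart_symm_signedSmoothAt b _
  · exact SignedSmoothAt.comp (planeChart_signedSmoothAt b _) h

theorem singAt_ofPlane_iff {b : Web} {e : ℂ → N} {z : ℂ} {c : OpenPartialHomeomorph N ℂ}
    (hc : c ∈ atlas ℂ N) (hx : e z ∈ c.source) :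
    SingAt (M := Plane b) e z ↔ ContinuousAt e z ∧
      SignedSmoothAt b.weight Complex.im (c ∘ e) z := by
  refine (singAt_iff (M := Plane b) (planeChart_mem b) hc (planeChart_source b _) hx).trans ?_
  refine and_congr_right fun _ => ⟨fun h => ?_, fun h => ?_⟩
  · have h1 := h.comp (planeChart_signedSmoothAt b z)
    refine h1.congr (Filter.Eventually.of_forall fun y => ?_)
    exact congrArg (fun y => c (e y)) ((planeChart b).left_inv (planeChart_source b y)).symm
  · have h2 : (planeChart b).symm (planeChart b z) = z :=
      (planeChart b).left_inv (planeChart_source b z)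
    refine SignedSmoothAt.comp (g := c ∘ e) (f := (planeChart b).symm) ?_
      (planeChart_symm_signedSmoothAt b z)
    rw [h2]
    exact h

end

theorem singAt_plane_iff {b b' : Web} {f : ℂ → ℂ} {z : ℂ} :
    SingAt (M := Plane b) (N := Plane b') f z ↔ SignedSmoothAt b.weight b'.weight f z := by
  have h2 : (planeChart b).symm (planeChart b z) = z :=
    (planeChart b).left_inv (planeChart_source b z)
  refine (singAt_toPlane_iff (M := Plane b) (planeChart_mem b) (planeChart_source b z)).trans ?_
  constructor
  · rintro ⟨-, h⟩
    have h1 := h.comp (planeChart_signedSmoothAt b z)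
    refine h1.congr (Filter.Eventually.of_forall fun y => ?_)
    exact congrArg f ((planeChart b).left_inv (planeChart_source b y)).symm
  · intro h
    refine ⟨h.continuousAt, ?_⟩
    refine SignedSmoothAt.comp (f := (planeChart b).symm) ?_ (planeChart_symm_signedSmoothAt b z)
    rw [h2]
    exact h

/-! ### Ends of a cobordism -/

/-- The extension of a collar by a junk value to the whole plane. -/
def extend {M : Type} (e : Cyl → M) (z : ℂ) : M :=
  if h : z ≠ 0 then e ⟨z, h⟩ else e ⟨1, one_ne_zero⟩

theorem extend_of_ne {M : Type} (e : Cyl → M) {z : ℂ} (h : z ≠ 0) : extend e z = e ⟨z, h⟩ :=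
  dif_pos h

theorem extend_coe {M : Type} (e : Cyl → M) (z : Cyl) : extend e z = e z :=
  extend_of_ne e z.2

theorem IsCollar.singAt {b : Web} {M : Type} [TopologicalSpace M] [ChartedSpace ℂ M]
    [HasGroupoid M singGroupoid] {e : Cyl → M} (he : IsCollar b e) {z : ℂ} (hz : z ≠ 0) :
    SingAt (M := Plane b) (extend e) z := by
  obtain ⟨h, he⟩ := he
  have hz' : extend e z = e ⟨z, hz⟩ := extend_of_ne e hz
  have hopen : IsOpenEmbedding (Subtype.val : Cyl → ℂ) :=
    isOpen_compl_singleton.isOpenEmbedding_subtypeVal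
  have hcont : ContinuousAt (extend e) z := by
    have h1 := hopen.continuousAt_iff (f := Subtype.val) (g := extend e) (x := ⟨z, hz⟩)
    refine h1.1 ?_
    have : extend e ∘ Subtype.val = e := funext fun z => extend_coe e z
    rw [this]
    exact h.continuous.continuousAt
  refine (singAt_ofPlane_iff (chart_mem_atlas ℂ (extend e z)) (mem_chart_source ℂ _)).2
    ⟨hcont, ?_⟩
  set c := chartAt ℂ (extend e z) with hc
  have h1 := mem_singGroupoid.1 (he c (chart_mem_atlas ℂ _))
  have hs : flatten b z ∈ ((cylChart b).symm ≫ₕ h.toOpenPartialHomeomorph e ≫ₕ c).source := by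
    have h2 : (cylChart b).symm (flatten b z) = ⟨z, hz⟩ := cylChart_symm_flatten b ⟨z, hz⟩
    refine ⟨(mem_cylChart_target b _).2 ⟨⟨z, hz⟩, rfl⟩, mem_univ _, ?_⟩
    have h3 : extend e z ∈ c.source := mem_chart_source ℂ _
    rw [hz', ← h2] at h3
    exact h3
  have h2 := SignedSmoothAt.comp (h1.at (OpenPartialHomeomorph.open_source _) hs)
    ((flatten_signedSmooth b).at isOpen_univ (mem_univ z))
  refine h2.congr ?_
  filter_upwards [isOpen_compl_singleton.mem_nhds hz] with y hy
  have h4 : (cylChart b).symm (flatten b y) = ⟨y, hy⟩ := cylChart_symm_flatten b ⟨y, hy⟩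
  simp only [Function.comp_apply, OpenPartialHomeomorph.coe_trans, h4,
    IsOpenEmbedding.toOpenPartialHomeomorph_apply]
  rw [extend_of_ne e hy]

/-- The real derivative is multiplication by `c`. Complex differentiability is needed at the one
point only, which is what germs at punctures offer. -/
theorem det_of_hasDerivAt {f : ℂ → ℂ} {c z : ℂ} (h : HasDerivAt f c z) :
    (fderiv ℝ f z).det = Complex.normSq c := by
  rw [(h.hasFDerivAt.restrictScalars ℝ).fderiv, det_eq]
  simp [Complex.normSq_apply]

/-- The map `z ↦ -1 / z` exchanges the two ends of a cylinder and preserves orientations. -/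
theorem negInv_signedSmoothAt (b : Web) {z : ℂ} (hz : z ≠ 0) :
    SignedSmoothAt b.weight b.weight (fun z => -z⁻¹) z := by
  have hd : HasDerivAt (fun z : ℂ => -z⁻¹) ((z ^ 2)⁻¹) z := by
    have := (hasDerivAt_inv hz).neg
    rwa [neg_neg] at this
  have hc : ContDiffAt ℝ ∞ (fun z : ℂ => -z⁻¹) z :=
    ((contDiffAt_inv ℂ hz).neg).restrict_scalars ℝ
  have hdet := det_of_hasDerivAt hd
  have hpos : 0 < Complex.normSq ((z ^ 2)⁻¹) :=
    Complex.normSq_pos.2 (inv_ne_zero (pow_ne_zero 2 hz))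
  refine ⟨hc, by rw [hdet]; exact hpos.ne', ?_⟩
  rw [hdet]
  have hn : 0 < Complex.normSq z := Complex.normSq_pos.2 hz
  cases b
  · simp only [Web.weight]
    simpa only [one_ne_zero, mul_one, one_mul, true_and, ne_eq, not_false_eq_true, forall_const]
  · have him : (-z⁻¹).im = z.im / Complex.normSq z := by
      simp [Complex.inv_im]
      ring
    simp only [Web.weight, him]
    refine ⟨by simp [hn.ne'], fun h => ?_⟩
    have : 0 < z.im ^ 2 := by positivity
    have h3 : z.im * (z.im / Complex.normSq z) = z.im ^ 2 / Complex.normSq z := by ring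
    rw [h3]
    positivity

/-- The index set of the ends of a cobordism. -/
abbrev EndIdx (n m : List Web) : Type := Fin n.length ⊕ Fin m.length

/-- The kinds of the ends. -/
def endKind (n m : List Web) : EndIdx n m → Web := Sum.elim n.get m.get

namespace Cob

variable {n m : List Web} (A : Cob n m)

/-- The ends of a cobordism; `endMap e z` leaves the surface for `z → 0`. -/
def endMap : EndIdx n m → ℂ → A.M
  | .inl j => extend (A.src j)
  | .inr j => fun z => extend (A.tgt j) (-z⁻¹)

theorem endMap_inl (j : Fin n.length) (z : Cyl) : A.endMap (.inl j) z = A.src j z :=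
  extend_coe _ z

theorem endMap_inr (j : Fin m.length) (z : Cyl) : A.endMap (.inr j) (-(z : ℂ)⁻¹) = A.tgt j z := by
  simp [endMap, extend_coe]

theorem endMap_inr_of_ne (j : Fin m.length) {z : ℂ} (hz : z ≠ 0) :
    A.endMap (.inr j) z = A.tgt j ⟨-z⁻¹, by simpa using hz⟩ :=
  extend_of_ne _ _

theorem endMap_inl_of_ne (j : Fin n.length) {z : ℂ} (hz : z ≠ 0) :
    A.endMap (.inl j) z = A.src j ⟨z, hz⟩ :=
  extend_of_ne _ _

theorem endMap_singAt (e : EndIdx n m) {z : ℂ} (hz : z ≠ 0) :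
    SingAt (M := Plane (endKind n m e)) (A.endMap e) z := by
  cases e with
  | inl j => exact (A.src_collar j).singAt hz
  | inr j =>
    exact SingAt.comp (M := Plane (m.get j)) (N := Plane (m.get j)) (f := fun z : ℂ => -z⁻¹)
      ((A.tgt_collar j).singAt (by simpa using hz))
      (singAt_plane_iff.2 (negInv_signedSmoothAt _ hz))

theorem endMap_inj {e e' : EndIdx n m} {z w : ℂ} (hz : z ≠ 0) (hw : w ≠ 0)
    (h : A.endMap e z = A.endMap e' w) : e = e' ∧ z = w := by
  cases e <;> cases e' <;>
    simp only [endMap_inl_of_ne _ _ hz, endMap_inr_of_ne _ _ hz, endMap_inl_of_ne _ _ hw,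
      endMap_inr_of_ne _ _ hw] at h
  · obtain ⟨rfl, h'⟩ := A.src_inj _ _ _ _ h
    exact ⟨rfl, congrArg Subtype.val h'⟩
  · exact absurd h (A.src_ne_tgt _ _ _ _)
  · exact absurd h.symm (A.src_ne_tgt _ _ _ _)
  · obtain ⟨rfl, h'⟩ := A.tgt_inj _ _ _ _ h
    exact ⟨rfl, inv_injective (neg_injective (congrArg Subtype.val h'))⟩

theorem endMap_continuousOn (e : EndIdx n m) : ContinuousOn (A.endMap e) {0}ᶜ :=
  fun _ hz => (A.endMap_singAt e hz).1.continuousWithinAt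

/-- For both source and target ends the coordinate is chosen so that the outer part of the collar is
the punctured unit disc; this merges the two closedness conditions in the definition of a cobordism.
-/
theorem endMap_closed_one (e : EndIdx n m) : IsClosed (A.endMap e '' {z | z ≠ 0 ∧ ‖z‖ ≤ 1}) := by
  cases e with
  | inl j =>
    convert A.src_closed j using 1
    ext x
    constructor
    · rintro ⟨z, ⟨hz, hz1⟩, rfl⟩
      exact ⟨⟨z, hz⟩, hz1, (A.endMap_inl_of_ne j hz).symm⟩
    · rintro ⟨z, hz, rfl⟩
      exact ⟨z, ⟨z.2, hz⟩, A.endMap_inl j z⟩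
  | inr j =>
    convert A.tgt_closed j using 1
    ext x
    constructor
    · rintro ⟨z, ⟨hz, hz1⟩, rfl⟩
      refine ⟨⟨-z⁻¹, by simpa using hz⟩, ?_, (A.endMap_inr_of_ne j hz).symm⟩
      simpa using (one_le_inv₀ (norm_pos_iff.2 hz)).2 hz1
    · rintro ⟨z, hz, rfl⟩
      have hz0 : (z : ℂ) ≠ 0 := z.2
      refine ⟨-(z : ℂ)⁻¹, ⟨by simpa using hz0, ?_⟩, A.endMap_inr j z⟩
      simpa using inv_le_one_of_one_le₀ hz

/-- Beyond the unit disc only the image of a compact annulus is added, and the surface is Hausdorff.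
-/
theorem endMap_closed (e : EndIdx n m) {r : ℝ} (hr : 1 ≤ r) :
    IsClosed (A.endMap e '' {z | z ≠ 0 ∧ ‖z‖ ≤ r}) := by
  have h1 : {z : ℂ | z ≠ 0 ∧ ‖z‖ ≤ r} =
      {z | z ≠ 0 ∧ ‖z‖ ≤ 1} ∪ (Metric.closedBall 0 r ∩ {z | 1 ≤ ‖z‖}) := by
    ext z
    simp only [mem_ofPred_eq, mem_union, mem_inter_iff, mem_closedBall_zero_iff]
    constructor
    · rintro ⟨h1, h2⟩
      rcases le_total ‖z‖ 1 with h | h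
      · exact .inl ⟨h1, h⟩
      · exact .inr ⟨h2, h⟩
    · rintro (⟨h1, h2⟩ | ⟨h1, h2⟩)
      · exact ⟨h1, h2.trans hr⟩
      · exact ⟨norm_pos_iff.1 (by linarith), h1⟩
  rw [h1, image_union]
  refine (A.endMap_closed_one e).union (IsCompact.isClosed ?_)
  refine ((isCompact_closedBall 0 r).inter_right
    (isClosed_le continuous_const continuous_norm)).image_of_continuousOn
    ((A.endMap_continuousOn e).mono fun z hz => ?_)
  have : 1 ≤ ‖z‖ := hz.2
  exact norm_pos_iff.1 (by linarith)

/-! ### Automorphisms supported in the ends -/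

section Twist

variable (T : EndIdx n m → ℂ ≃ ℂ)

open Classical in
/-- The self-map that acts on each end `e` by `T e` and fixes all other points. -/
def twist (x : A.M) : A.M :=
  if h : ∃ p : EndIdx n m × ℂ, p.2 ≠ 0 ∧ A.endMap p.1 p.2 = x then
    A.endMap h.choose.1 (T h.choose.1 h.choose.2) else x

theorem twist_endMap (e : EndIdx n m) {z : ℂ} (hz : z ≠ 0) :
    A.twist T (A.endMap e z) = A.endMap e (T e z) := by
  have h : ∃ p : EndIdx n m × ℂ, p.2 ≠ 0 ∧ A.endMap p.1 p.2 = A.endMap e z := ⟨(e, z), hz, rfl⟩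
  obtain ⟨h1, h2⟩ := A.endMap_inj h.choose_spec.1 hz h.choose_spec.2
  rw [twist, dif_pos h, h2, h1]

theorem twist_of_notMem {x : A.M} (hx : ∀ e z, z ≠ 0 → A.endMap e z ≠ x) : A.twist T x = x :=
  dif_neg fun ⟨_, h, h'⟩ => hx _ _ h h'

variable {T}

theorem twist_twist_symm (h0 : ∀ e, T e 0 = 0) (x : A.M) : A.twist T (A.twist (fun e => (T e).symm) x) = x := by
  by_cases h : ∃ e z, z ≠ 0 ∧ A.endMap e z = x
  · obtain ⟨e, z, hz, rfl⟩ := h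
    have h1 : (T e).symm z ≠ 0 := fun h => hz (by rw [← (T e).apply_symm_apply z, h, h0])
    rw [twist_endMap _ _ _ hz, twist_endMap _ _ _ h1, Equiv.apply_symm_apply]
  · push Not at h
    rw [twist_of_notMem _ (fun e => (T e).symm) h, twist_of_notMem _ _ h]

theorem twist_bijective (h0 : ∀ e, T e 0 = 0) : Function.Bijective (A.twist T) := by
  have h1 : ∀ e, (T e).symm 0 = 0 := fun e => (T e).symm_apply_eq.2 (h0 e).symm
  refine Function.bijective_iff_has_inverse.2 ⟨A.twist fun e => (T e).symm, fun x => ?_,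
    fun x => A.twist_twist_symm h0 x⟩
  exact A.twist_twist_symm (T := fun e => (T e).symm) h1 x

/-- On an end the twist is the planar map `T e`, read in the end coordinate. A point outside all
ends has a neighbourhood that misses the closed sets `‖z‖ ≤ r`, and there the twist is the identity.
-/
theorem twist_singAt (h0 : ∀ e, T e 0 = 0)
    (hT : ∀ e z, z ≠ 0 → SignedSmoothAt (endKind n m e).weight (endKind n m e).weight (T e) z)
    {r : ℝ} (hr : 1 ≤ r) (hid : ∀ e z, r ≤ ‖z‖ → T e z = z) (x : A.M) :
    SingAt (A.twist T) x := by
  by_cases h : ∃ e z, z ≠ 0 ∧ A.endMap e z = x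
  · obtain ⟨e, z, hz, rfl⟩ := h
    refine SingAt.cancel_right (M := Plane (endKind n m e)) (A.endMap_singAt e hz) ?_
    have h1 : T e z ≠ 0 := fun h => hz ((T e).injective (h.trans (h0 e).symm))
    have h2 := SingAt.comp (M := Plane (endKind n m e)) (N := Plane (endKind n m e))
      (f := T e) (A.endMap_singAt e h1) (singAt_plane_iff.2 (hT e z hz))
    refine h2.congr ?_
    have : ∀ᶠ y : ℂ in 𝓝 z, y ≠ 0 := isOpen_compl_singleton.mem_nhds hz
    filter_upwards [this] with y hy
    exact A.twist_endMap T e hy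
  · push Not at h
    have hc : IsClosed (⋃ e, A.endMap e '' {z | z ≠ 0 ∧ ‖z‖ ≤ r}) :=
      isClosed_iUnion_of_finite fun e => A.endMap_closed e hr
    refine (SingAt.id_at x).congr ?_
    have hx : x ∈ (⋃ e, A.endMap e '' {z | z ≠ 0 ∧ ‖z‖ ≤ r})ᶜ := by
      simp only [mem_compl_iff, mem_iUnion, mem_image, not_exists, not_and]
      exact fun e z hz => h e z hz.1
    filter_upwards [hc.isOpen_compl.mem_nhds hx] with y hy
    by_cases h' : ∃ e z, z ≠ 0 ∧ A.endMap e z = y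
    · obtain ⟨e, z, hz, rfl⟩ := h'
      rw [twist_endMap _ _ _ hz, hid]
      · rfl
      · by_contra hlt
        push Not at hlt
        exact hy (mem_iUnion.2 ⟨e, z, ⟨hz, hlt.le⟩, rfl⟩)
    · push Not at h'
      exact A.twist_of_notMem T h'

end Twist

end Cob

end SingCob

namespace SingCob

/-! ### Planar normalization near a puncture -/

theorem SignedSmoothAt.of_det_pos {w w' : ℂ → ℝ} {f : ℂ → ℂ} {z : ℂ} (hf : ContDiffAt ℝ ∞ f z)
    (hd : 0 < (fderiv ℝ f z).det) (hs : SignType.sign (w' (f z)) = SignType.sign (w z)) :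
    SignedSmoothAt w w' f z :=
  SignedSmoothAt.iff_sign.2 ⟨hf, hd.ne', by rw [hs, sign_pos hd, mul_one]⟩

theorem SignedSmoothAt.sign_eq {w w' : ℂ → ℝ} {f : ℂ → ℂ} {z : ℂ} (hf : SignedSmoothAt w w' f z)
    (hd : 0 < (fderiv ℝ f z).det) : SignType.sign (w' (f z)) = SignType.sign (w z) := by
  rw [(SignedSmoothAt.iff_sign.1 hf).2.2, sign_pos hd, mul_one]

theorem sign_mul_pos {a b : ℝ} (ha : 0 < a) : SignType.sign (a * b) = SignType.sign b := by
  rw [sign_mul, sign_pos ha, one_mul]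

/-- Two real numbers of the same sign have convex combinations of this sign. -/
theorem sign_convex {a b t : ℝ} (h : SignType.sign a = SignType.sign b) (h0 : 0 ≤ t)
    (h1 : t ≤ 1) : SignType.sign ((1 - t) * a + t * b) = SignType.sign b := by
  rcases lt_trichotomy b 0 with hb | hb | hb
  · have ha : a < 0 := by rwa [sign_neg hb, sign_eq_neg_one_iff] at h
    rw [sign_neg hb, sign_eq_neg_one_iff]
    rcases h0.eq_or_lt with rfl | h0
    · linarith
    · nlinarith [mul_neg_of_pos_of_neg h0 hb, mul_nonneg (sub_nonneg.2 h1) (neg_nonneg.2 ha.le)]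
  · have ha : a = 0 := by rwa [hb, sign_zero, sign_eq_zero_iff] at h
    simp [ha, hb]
  · have ha : 0 < a := by rwa [sign_pos hb, sign_eq_one_iff] at h
    rw [sign_pos hb, sign_eq_one_iff]
    rcases h0.eq_or_lt with rfl | h0
    · linarith
    · nlinarith [mul_pos h0 hb, mul_nonneg (sub_nonneg.2 h1) ha.le]

/-- The entries of `L` are at most `1 / 4` in absolute value, so the determinant is at least `(3 /
4) ^ 2 - (1 / 4) ^ 2`. -/
theorem det_id_add_pos {L : ℂ →L[ℝ] ℂ} (h : ‖L‖ ≤ 1 / 4) :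
    0 < (ContinuousLinearMap.id ℝ ℂ + L).det := by
  have h1 : ‖L 1‖ ≤ 1 / 4 := (L.le_of_opNorm_le h 1).trans (by simp)
  have h2 : ‖L Complex.I‖ ≤ 1 / 4 := (L.le_of_opNorm_le h Complex.I).trans (by simp)
  have a1 := abs_le.1 ((Complex.abs_re_le_norm _).trans h1)
  have a2 := abs_le.1 ((Complex.abs_im_le_norm _).trans h1)
  have a3 := abs_le.1 ((Complex.abs_re_le_norm _).trans h2)
  have a4 := abs_le.1 ((Complex.abs_im_le_norm _).trans h2)
  rw [det_eq]
  simp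
  nlinarith

/-- `h` is smooth near `0`, with value `p` and nonzero complex derivative `c` at `0`. -/
structure IsGerm (h : ℂ → ℂ) (p c : ℂ) : Prop where
  smooth : ∀ᶠ z in 𝓝 0, ContDiffAt ℝ ∞ h z
  zero : h 0 = p
  deriv : HasDerivAt h c 0
  ne : c ≠ 0

theorem IsGerm.contDiffAt {h : ℂ → ℂ} {p c : ℂ} (hh : IsGerm h p c) : ContDiffAt ℝ ∞ h 0 :=
  hh.smooth.self_of_nhds

theorem continuous_det : Continuous fun L : ℂ →L[ℝ] ℂ => L.det := by
  simp only [det_eq]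
  fun_prop

theorem IsGerm.det_pos {h : ℂ → ℂ} {p c : ℂ} (hh : IsGerm h p c) :
    ∀ᶠ z in 𝓝 0, 0 < (fderiv ℝ h z).det := by
  have h1 : ContinuousAt (fun z => (fderiv ℝ h z).det) 0 :=
    continuous_det.continuousAt.comp (hh.contDiffAt.continuousAt_fderiv (by simp))
  refine h1.eventually (lt_mem_nhds ?_)
  change 0 < (fderiv ℝ h 0).det
  rw [det_of_hasDerivAt hh.deriv]
  exact Complex.normSq_pos.2 hh.ne

/-- The derivative at the origin of a germ that preserves the two half planes is positive. -/
theorem IsGerm.pos_of_sign {g : ℂ → ℂ} {c : ℂ} (hg : IsGerm g 0 c)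
    (hs : ∀ᶠ z in 𝓝[≠] 0, SignType.sign (g z).im = SignType.sign z.im) : 0 < c.re ∧ c.im = 0 := by
  have hs' : ∀ᶠ z in 𝓝 0, SignType.sign (g z).im = SignType.sign z.im := by
    rw [eventually_nhdsWithin_iff] at hs
    filter_upwards [hs] with z hz
    by_cases h : z = 0
    · simp [h, hg.zero]
    · exact hz h
  -- The sign of `Im g` is known on the real and on the imaginary axis, so the imaginary part is
  -- differentiated along lines through the origin.
  have key : ∀ v : ℂ, HasDerivAt (fun t : ℝ => (g (t * v)).im) (c * v).im 0 := by
    intro v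
    have h1 : HasDerivAt (fun t : ℝ => (t : ℂ) * v) v 0 := by
      simpa using (Complex.ofRealCLM.hasDerivAt (x := (0 : ℝ))).mul_const v
    have h2 : HasDerivAt g c ((fun t : ℝ => (t : ℂ) * v) 0) := by simpa using hg.deriv
    have h3 := h2.comp_of_eq (0 : ℝ) h1 rfl
    exact Complex.imCLM.hasFDerivAt.comp_hasDerivAt (0 : ℝ) h3
  have hlim : ∀ v : ℂ, Filter.Tendsto (fun t : ℝ => (t : ℂ) * v) (𝓝 0) (𝓝 0) := by
    intro v
    have : Continuous fun t : ℝ => (t : ℂ) * v := by fun_prop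
    simpa using this.tendsto 0
  -- Along the real axis `Im g` vanishes identically, hence so does its derivative `Im c`.
  have him : c.im = 0 := by
    have h1 := key 1
    have h2 : (fun t : ℝ => (g (t * 1)).im) =ᶠ[𝓝 0] fun _ => 0 := by
      filter_upwards [(hlim 1).eventually hs'] with t ht
      simpa using ht
    have h3 := (h1.congr_of_eventuallyEq h2.symm).unique (hasDerivAt_const (0 : ℝ) (0 : ℝ))
    simpa using h3
  refine ⟨?_, him⟩
  have h1 := key Complex.I
  -- Along the positive imaginary axis `Im g` is positive, so its one-sided derivative `Re c` is
  -- nonnegative; it cannot be zero since `c ≠ 0`.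
  have h2 : 0 ≤ (c * Complex.I).im := by
    refine ge_of_tendsto h1.tendsto_slope_zero_right ?_
    have h4 := (hlim Complex.I).eventually hs'
    filter_upwards [h4.filter_mono nhdsWithin_le_nhds, self_mem_nhdsWithin] with t ht ht0
    have ht0' : 0 < t := ht0
    have h3 : 0 < (g (t * Complex.I)).im := by
      rw [← sign_eq_one_iff, ht]
      simpa [sign_eq_one_iff] using ht0'
    simp only [zero_add, Complex.ofReal_zero, zero_mul, hg.zero, Complex.zero_im, sub_zero,
      smul_eq_mul]
    positivity
  have h3 : 0 ≤ c.re := by simpa using h2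
  refine lt_of_le_of_ne h3 fun h => hg.ne (Complex.ext h.symm him)

/-- A germ that is tangent to the identity extends to a diffeomorphism of the plane. -/
theorem exists_extension_tangent {κ : Web} {k : ℂ → ℂ} (hk : IsGerm k 0 1)
    (hs : ∀ᶠ z in 𝓝 0, SignType.sign (κ.weight (k z)) = SignType.sign (κ.weight z)) :
    ∃ ρ > 0, ∃ S : ℂ ≃ ℂ, (∀ y, SignedSmoothAt κ.weight κ.weight S y) ∧
      (∀ y, ‖y‖ < ρ → S y = k y) ∧ ∀ y, 1 ≤ ‖y‖ → S y = y := by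
  let η : ContDiffBump (0 : ℂ) := ⟨1 / 2, 1, by norm_num, by norm_num⟩
  have hηc : ContDiff ℝ ∞ η := η.contDiff
  obtain ⟨C, hC⟩ : ∃ C, ∀ y, ‖fderiv ℝ η y‖ ≤ C :=
    (hηc.continuous_fderiv (by simp)).bounded_above_of_compact_support
      (η.hasCompactSupport.fderiv ℝ)
  have hC0 : 0 ≤ C := (norm_nonneg _).trans (hC 0)
  -- Chosen so that `δ + 2 * C * δ = 1 / 4`, the bound needed below for the derivative of the
  -- cut-off perturbation.
  set δ : ℝ := 1 / (4 * (1 + 2 * C)) with hδ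
  have hδ0 : 0 < δ := by positivity
  set u : ℂ → ℂ := fun y => k y - y with hu
  have hu0 : u 0 = 0 := by simp [hu, hk.zero]
  have hud : fderiv ℝ u 0 = 0 := by
    have h1 : HasDerivAt u (1 - 1) 0 := hk.deriv.sub (hasDerivAt_id 0)
    rw [(h1.hasFDerivAt.restrictScalars ℝ).fderiv]
    ext; simp
  have hus : ∀ᶠ y in 𝓝 0, ContDiffAt ℝ ∞ u y := by
    filter_upwards [hk.smooth] with y hy using hy.sub contDiffAt_id
  have hus' : ∀ᶠ y in 𝓝 0, ‖fderiv ℝ u y‖ < δ := by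
    have h1 := hus.self_of_nhds.continuousAt_fderiv (by simp)
    have h2 : ContinuousAt (fun y => ‖fderiv ℝ u y‖) 0 := h1.norm
    exact h2.eventually (gt_mem_nhds (by simpa [hud] using hδ0))
  obtain ⟨ρ₀, hρ₀, hall⟩ := Metric.eventually_nhds_iff_ball.1 ((hus.and hus').and hs)
  set ρ : ℝ := min (ρ₀ / 2) 1 with hρ
  have hρ0 : 0 < ρ := lt_min (by positivity) one_pos
  have hball : ∀ y : ℂ, ‖y‖ < 2 * ρ → y ∈ Metric.ball (0 : ℂ) ρ₀ := by
    intro y hy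
    rw [mem_ball_zero_iff]
    have := min_le_left (ρ₀ / 2) 1
    linarith
  have hub : ∀ y : ℂ, ‖y‖ < 2 * ρ → ‖u y‖ ≤ δ * ‖y‖ := by
    intro y hy
    have h1 := (convex_ball (0 : ℂ) ρ₀).norm_image_sub_le_of_norm_fderiv_le (f := u) (𝕜 := ℝ)
      (C := δ) (fun z hz => ((hall z hz).1.1).differentiableAt (by simp))
      (fun z hz => (hall z hz).1.2.le) (Metric.mem_ball_self hρ₀) (hball y hy)
    simpa [hu0] using h1
  set v : ℂ → ℂ := fun y => η (ρ⁻¹ • y) • u y with hv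
  have hscale : ∀ y : ℂ, HasFDerivAt (fun y : ℂ => η (ρ⁻¹ • y))
      ((fderiv ℝ η (ρ⁻¹ • y)).comp (ρ⁻¹ • ContinuousLinearMap.id ℝ ℂ)) y := fun y =>
    ((hηc.differentiable (by simp)) _).hasFDerivAt.comp y
      ((ContinuousLinearMap.id ℝ ℂ).hasFDerivAt.const_smul ρ⁻¹)
  have hvout : ∀ y : ℂ, ρ ≤ ‖y‖ → v y = 0 := by
    intro y hy
    have : η (ρ⁻¹ • y) = 0 := by
      refine η.zero_of_le_dist ?_
      rw [dist_zero_right, norm_smul, Real.norm_of_nonneg (by positivity)]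
      rw [inv_mul_eq_div, le_div_iff₀ hρ0]
      change 1 * ρ ≤ ‖y‖
      linarith
    simp only [hv, this, zero_smul]
  have hvin : ∀ y : ℂ, ‖y‖ < ρ / 2 → v y = u y := by
    intro y hy
    have : η (ρ⁻¹ • y) = 1 := by
      refine η.one_of_mem_closedBall ?_
      rw [mem_closedBall_zero_iff, norm_smul, Real.norm_of_nonneg (by positivity)]
      rw [inv_mul_eq_div, div_le_iff₀ hρ0]
      change ‖y‖ ≤ 1 / 2 * ρ
      linarith
    simp only [hv, this, one_smul]
  -- Rescaling the cutoff costs a factor `ρ⁻¹` in its derivative, but tangency gives `‖u y‖ ≤ δ * (2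
  -- * ρ)` on the relevant disc, so the bound does not depend on `ρ`.
  have hvd : ∀ y : ℂ, ContDiffAt ℝ ∞ v y ∧ ‖fderiv ℝ v y‖ ≤ 1 / 4 := by
    intro y
    rcases lt_or_ge ‖y‖ (2 * ρ) with hy | hy
    · have h1 := (hall y (hball y hy)).1
      refine ⟨(hηc.contDiffAt.comp y (contDiffAt_id.const_smul ρ⁻¹)).smul h1.1, ?_⟩
      have h2 := ((hscale y).smul (h1.1.differentiableAt (by simp)).hasFDerivAt).fderiv
      refine (congrArg norm h2).le.trans ?_
      refine (norm_add_le _ _).trans ?_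
      have h3 : ‖η (ρ⁻¹ • y) • fderiv ℝ u y‖ ≤ δ := by
        rw [norm_smul, Real.norm_of_nonneg η.nonneg]
        exact (mul_le_of_le_one_left (norm_nonneg _) η.le_one).trans h1.2.le
      have h4 : ‖((fderiv ℝ η (ρ⁻¹ • y)).comp
          (ρ⁻¹ • ContinuousLinearMap.id ℝ ℂ)).smulRight (u y)‖ ≤ 2 * C * δ := by
        rw [ContinuousLinearMap.norm_smulRight_apply]
        have h5 : ‖(fderiv ℝ η (ρ⁻¹ • y)).comp (ρ⁻¹ • ContinuousLinearMap.id ℝ ℂ)‖ ≤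
            C * ρ⁻¹ := by
          refine (ContinuousLinearMap.opNorm_comp_le _ _).trans ?_
          refine mul_le_mul (hC _) ?_ (norm_nonneg _) hC0
          rw [norm_smul, Real.norm_of_nonneg (by positivity)]
          exact mul_le_of_le_one_right (by positivity) ContinuousLinearMap.norm_id_le
        have h6 : ‖u y‖ ≤ δ * (2 * ρ) := (hub y hy).trans (by gcongr)
        calc _ ≤ C * ρ⁻¹ * (δ * (2 * ρ)) := mul_le_mul h5 h6 (norm_nonneg _) (by positivity)
          _ = 2 * C * δ := by field_simp
      calc _ ≤ δ + 2 * C * δ := add_le_add h3 h4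
        _ = 1 / 4 := by rw [hδ]; field_simp
    · have h1 : v =ᶠ[𝓝 y] fun _ => 0 := by
        have : ∀ᶠ x : ℂ in 𝓝 y, ρ < ‖x‖ :=
          continuous_norm.continuousAt.eventually (lt_mem_nhds (by linarith))
        filter_upwards [this] with x hx using hvout x hx.le
      refine ⟨contDiffAt_const.congr_of_eventuallyEq h1, ?_⟩
      rw [h1.fderiv_eq]
      simp
  have hlip : LipschitzWith (1 / 4) v := by
    refine lipschitzWith_of_nnnorm_fderiv_le (𝕜 := ℝ)
      (fun y => (hvd y).1.differentiableAt (by simp)) fun y => ?_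
    rw [← NNReal.coe_le_coe]
    simpa using (hvd y).2
  -- A perturbation of the identity with Lipschitz constant `1 / 4` is a homeomorphism of the whole
  -- plane.
  have happ : ApproximatesLinearOn (fun y => y + v y)
      ((ContinuousLinearEquiv.refl ℝ ℂ : ℂ ≃L[ℝ] ℂ) : ℂ →L[ℝ] ℂ) univ (1 / 4) := by
    intro x _ y _
    have h1 := hlip.dist_le_mul x y
    rw [dist_eq_norm, dist_eq_norm] at h1
    have h2 : x + v x - (y + v y) - ((ContinuousLinearEquiv.refl ℝ ℂ : ℂ ≃L[ℝ] ℂ) :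
        ℂ →L[ℝ] ℂ) (x - y) = v x - v y := by
      simp
      ring
    rw [h2]
    exact h1
  have hcc : (1 / 4 : NNReal) < ‖((ContinuousLinearEquiv.refl ℝ ℂ).symm : ℂ →L[ℝ] ℂ)‖₊⁻¹ := by
    have h1 : ‖((ContinuousLinearEquiv.refl ℝ ℂ).symm : ℂ →L[ℝ] ℂ)‖₊ = 1 := by
      rw [← NNReal.coe_inj, coe_nnnorm]
      exact ContinuousLinearMap.norm_id
    rw [h1, inv_one, ← NNReal.coe_lt_coe]
    norm_num
  let S := happ.toHomeomorph _ (.inr hcc)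
  have hS : ∀ y, S y = y + v y := fun y => rfl
  refine ⟨ρ / 2, by positivity, S.toEquiv, fun y => ?_, fun y hy => ?_, fun y hy => ?_⟩
  · have h1 : fderiv ℝ S y = ContinuousLinearMap.id ℝ ℂ + fderiv ℝ v y :=
      ((hasFDerivAt_id y).add ((hvd y).1.differentiableAt (by simp)).hasFDerivAt).fderiv
    refine SignedSmoothAt.of_det_pos (contDiffAt_id.add (hvd y).1) ?_ ?_
    · change 0 < (fderiv ℝ S y).det
      rw [h1]
      exact det_id_add_pos (hvd y).2
    · change SignType.sign (κ.weight (y + v y)) = _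
      rcases lt_or_ge ‖y‖ (2 * ρ) with hy | hy
      · cases κ with
        | circle => simp [Web.weight]
        | biweb =>
          have h2 := (hall y (hball y hy)).2
          simp only [Web.weight] at h2 ⊢
          -- The cut-off map interpolates between `k` and the identity; both have imaginary parts of
          -- the same sign, hence so does every convex combination.
          have h3 : (y + v y).im = (1 - (1 - η (ρ⁻¹ • y))) * (k y).im +
              (1 - η (ρ⁻¹ • y)) * y.im := by
            simp [hv, hu]
            ring
          rw [h3]
          exact sign_convex h2 (sub_nonneg.2 η.le_one) (by linarith [η.nonneg (x := ρ⁻¹ • y)])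
      · rw [hvout y (by linarith), add_zero]
  · change y + v y = k y
    rw [hvin y hy]
    simp [hu]
  · change y + v y = y
    rw [hvout y (le_trans (min_le_right _ _) hy), add_zero]

/-! ### Radial diffeomorphisms that rotate and contract a disc -/

theorem det_fderiv_complexRadial {φ : ℝ → ℂ} {z φ' : ℂ} (h : HasDerivAt φ φ' (‖z‖ ^ 2)) :
    (fderiv ℝ (fun z : ℂ => φ (‖z‖ ^ 2) * z) z).det = Complex.normSq (φ (‖z‖ ^ 2)) +
      2 * ((φ (‖z‖ ^ 2)).re * φ'.re + (φ (‖z‖ ^ 2)).im * φ'.im) * ‖z‖ ^ 2 := by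
  have h1 : HasFDerivAt (fun z : ℂ => ‖z‖ ^ 2) (2 • innerSL ℝ z) z :=
    (hasStrictFDerivAt_norm_sq z).hasFDerivAt
  have h2 : HasFDerivAt (fun z : ℂ => φ (‖z‖ ^ 2)) ((2 • innerSL ℝ z).smulRight φ') z := by
    refine (h.hasFDerivAt.comp z h1).congr_fderiv ?_
    ext
    simp
    ring
  have h3 : HasFDerivAt (fun z : ℂ => φ (‖z‖ ^ 2) * z) (φ (‖z‖ ^ 2) • ContinuousLinearMap.id ℝ ℂ +
      z • (2 • innerSL ℝ z).smulRight φ') z := h2.mul (hasFDerivAt_id z)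
  rw [h3.fderiv, det_eq, Complex.sq_norm, Complex.normSq_apply, Complex.normSq_apply]
  simp [Complex.inner]
  ring

/-- A cutoff function: one on `(-∞, 16]` and zero on `[25, ∞)`. -/
def cutoff (s : ℝ) : ℝ := 1 - Real.smoothTransition ((s - 16) / 9)

theorem cutoff_contDiff : ContDiff ℝ ∞ cutoff :=
  contDiff_const.sub (Real.smoothTransition.contDiff.comp
    ((contDiff_id.sub contDiff_const).div_const 9))

theorem cutoff_antitone : Antitone cutoff := fun a b h =>
  sub_le_sub_left (Real.smoothTransition.monotone (by gcongr)) 1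

theorem cutoff_of_le {s : ℝ} (h : s ≤ 16) : cutoff s = 1 := by
  rw [cutoff, Real.smoothTransition.zero_of_nonpos (by linarith), sub_zero]

theorem cutoff_of_ge {s : ℝ} (h : 25 ≤ s) : cutoff s = 0 := by
  rw [cutoff, Real.smoothTransition.one_of_one_le (by linarith), sub_self]

/-- A diffeomorphism of the plane that is multiplication with `exp l` for `‖z‖ ≤ 4` and the
identity for `5 ≤ ‖z‖`. -/
def spiral (l : ℂ) (z : ℂ) : ℂ := Complex.exp (l * cutoff (‖z‖ ^ 2)) * z

theorem norm_spiral (l z : ℂ) : ‖spiral l z‖ = Real.exp (l.re * cutoff (‖z‖ ^ 2)) * ‖z‖ := by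
  rw [spiral, norm_mul, Complex.norm_exp]
  simp

/-- The modulus of the image depends on the modulus `r` alone. Since `l.re ≤ 0` and the cutoff
decreases, the factor in front of `r` does not decrease, so the modulus is strictly increasing; on
each circle the map is a rotation and a scaling. -/
theorem spiral_bijective {l : ℂ} (hl : l.re ≤ 0) : Function.Bijective (spiral l) := by
  have hmono : StrictMonoOn (fun r : ℝ => Real.exp (l.re * cutoff (r ^ 2)) * r) (Ici 0) := by
    intro r hr t ht h
    have hr' : 0 ≤ r := hr
    have h1 : Real.exp (l.re * cutoff (r ^ 2)) ≤ Real.exp (l.re * cutoff (t ^ 2)) := by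
      refine Real.exp_le_exp.2 (mul_le_mul_of_nonpos_left (cutoff_antitone ?_) hl)
      gcongr
    calc Real.exp (l.re * cutoff (r ^ 2)) * r < Real.exp (l.re * cutoff (r ^ 2)) * t := by gcongr
      _ ≤ _ := mul_le_mul_of_nonneg_right h1 (hr'.trans h.le)
  constructor
  · intro z w h
    have h1 := congrArg norm h
    rw [norm_spiral, norm_spiral] at h1
    have h2 := hmono.injOn (norm_nonneg z) (norm_nonneg w) h1
    simp only [spiral, h2] at h
    exact mul_left_cancel₀ (Complex.exp_ne_zero _) h
  · intro y
    have hcont : Continuous fun r : ℝ => Real.exp (l.re * cutoff (r ^ 2)) * r := by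
      have := cutoff_contDiff.continuous
      fun_prop
    obtain ⟨r, hr, hr'⟩ : ‖y‖ ∈ (fun r : ℝ => Real.exp (l.re * cutoff (r ^ 2)) * r) ''
        Icc 0 (‖y‖ + 5) := by
      refine intermediate_value_Icc (by positivity) hcont.continuousOn ⟨by simp, ?_⟩
      have : cutoff ((‖y‖ + 5) ^ 2) = 0 := cutoff_of_ge (by nlinarith [norm_nonneg y])
      simp [this]
    refine ⟨Complex.exp (-(l * cutoff (r ^ 2))) * y, ?_⟩
    have h1 : ‖Complex.exp (-(l * cutoff (r ^ 2))) * y‖ = r := by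
      rw [norm_mul, Complex.norm_exp, ← hr', ← mul_assoc, ← Real.exp_add]
      simp
    rw [spiral, h1, ← mul_assoc, ← Complex.exp_add]
    simp

/-- With `φ` the exponential factor, the Jacobian is `|φ|²` times `1 + 2 (l.re * cutoff') ‖z‖²`, and
the product in parentheses is nonnegative because both factors are nonpositive. In the singular
plane `l` is real, so `φ` is a positive number and preserves the half planes. -/
theorem spiral_signedSmoothAt {κ : Web} {l : ℂ} (hl : l.re ≤ 0) (hκ : κ = .biweb → l.im = 0)
    (z : ℂ) : SignedSmoothAt κ.weight κ.weight (spiral l) z := by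
  have hc := (cutoff_contDiff.differentiable (by simp) (‖z‖ ^ 2)).hasDerivAt
  have h1 : HasDerivAt (fun s : ℝ => Complex.exp (l * cutoff s))
      (Complex.exp (l * cutoff (‖z‖ ^ 2)) * (l * (deriv cutoff (‖z‖ ^ 2) : ℝ))) (‖z‖ ^ 2) :=
    (hc.ofReal_comp.const_mul l).cexp
  have hd : deriv cutoff (‖z‖ ^ 2) ≤ 0 := cutoff_antitone.deriv_nonpos
  refine SignedSmoothAt.of_det_pos ?_ ?_ ?_
  · have h2 : ContDiff ℝ ∞ fun z : ℂ => Complex.exp (l * cutoff (‖z‖ ^ 2)) * z := by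
      have h3 : ContDiff ℝ ∞ fun z : ℂ => ((cutoff (‖z‖ ^ 2) : ℝ) : ℂ) :=
        Complex.ofRealCLM.contDiff.comp (cutoff_contDiff.comp (contDiff_norm_sq ℝ))
      exact ((contDiff_const.mul h3).cexp).mul contDiff_id
    exact h2.contDiffAt
  · have h2 := det_fderiv_complexRadial h1
    change 0 < (fderiv ℝ (fun z : ℂ => Complex.exp (l * cutoff (‖z‖ ^ 2)) * z) z).det
    rw [h2]
    set φ := Complex.exp (l * cutoff (‖z‖ ^ 2)) with hφ
    have hpos : 0 < Complex.normSq φ := Complex.normSq_pos.2 (Complex.exp_ne_zero _)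
    have h3 : Complex.normSq φ + 2 * (φ.re * (φ * (l * (deriv cutoff (‖z‖ ^ 2) : ℝ))).re +
        φ.im * (φ * (l * (deriv cutoff (‖z‖ ^ 2) : ℝ))).im) * ‖z‖ ^ 2 =
        Complex.normSq φ * (1 + 2 * (l.re * deriv cutoff (‖z‖ ^ 2)) * ‖z‖ ^ 2) := by
      rw [Complex.normSq_apply]
      simp
      ring
    rw [h3]
    have := mul_nonneg_of_nonpos_of_nonpos hl hd
    positivity
  · cases κ with
    | circle => simp [Web.weight]
    | biweb =>
      have h2 : l * cutoff (‖z‖ ^ 2) = ((l.re * cutoff (‖z‖ ^ 2) : ℝ) : ℂ) := by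
        apply Complex.ext <;> simp [hκ rfl]
      simp only [Web.weight, spiral]
      rw [h2, ← Complex.ofReal_exp, Complex.im_ofReal_mul]
      exact sign_mul_pos (Real.exp_pos _)

theorem spiral_of_le {l z : ℂ} (h : ‖z‖ ≤ 4) : spiral l z = Complex.exp l * z := by
  rw [spiral, cutoff_of_le (by nlinarith [norm_nonneg z])]
  simp

theorem spiral_of_ge {l z : ℂ} (h : 5 ≤ ‖z‖) : spiral l z = z := by
  rw [spiral, cutoff_of_ge (by nlinarith)]
  simp

/-- A germ, composed with a contraction, extends to a diffeomorphism of the plane with support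
in a fixed disc. -/
theorem exists_planar_extension {κ : Web} {g : ℂ → ℂ} {c : ℂ} (hg : IsGerm g 0 c)
    (hs : ∀ᶠ z in 𝓝[≠] 0, SignedSmoothAt κ.weight κ.weight g z) :
    ∃ ε > 0, ∀ r : ℝ, 0 < r → r < ε → ∃ T : ℂ ≃ ℂ, T 0 = 0 ∧
      (∀ z, z ≠ 0 → SignedSmoothAt κ.weight κ.weight T z) ∧
      (∀ z, ‖z‖ < 4 → T z = g (r * z)) ∧ ∀ z, 5 ≤ ‖z‖ → T z = z := by
  have hsgn : ∀ᶠ z in 𝓝[≠] 0, SignType.sign (κ.weight (g z)) = SignType.sign (κ.weight z) := by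
    filter_upwards [hs, hg.det_pos.filter_mono nhdsWithin_le_nhds] with z h1 h2
    exact h1.sign_eq h2
  have hc : κ = .biweb → 0 < c.re ∧ c.im = 0 := by
    rintro rfl
    exact hg.pos_of_sign hsgn
  have hlim : Filter.Tendsto (fun y => c⁻¹ * y) (𝓝 0) (𝓝 0) := by
    have : Continuous fun y => c⁻¹ * y := by fun_prop
    simpa using this.tendsto 0
  -- Dividing by the complex derivative makes the germ tangent to the identity. In the singular
  -- plane `c` is a positive real number, so this scaling respects the half planes.
  have hk : IsGerm (fun y => g (c⁻¹ * y)) 0 1 := by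
    refine ⟨?_, by simp [hg.zero], ?_, one_ne_zero⟩
    · filter_upwards [hlim.eventually hg.smooth] with y hy
      exact hy.comp y (contDiffAt_const.mul contDiffAt_id)
    · have h1 : HasDerivAt (fun y => c⁻¹ * y) c⁻¹ 0 := by
        simpa using (hasDerivAt_id (0 : ℂ)).const_mul c⁻¹
      have h2 : HasDerivAt g c (c⁻¹ * 0) := by simpa using hg.deriv
      have h3 := h2.comp (0 : ℂ) h1
      rwa [mul_inv_cancel₀ hg.ne] at h3
  have hks : ∀ᶠ y in 𝓝 0, SignType.sign (κ.weight (g (c⁻¹ * y))) =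
      SignType.sign (κ.weight y) := by
    have h1 := hlim.eventually (eventually_nhdsWithin_iff.1 hsgn)
    filter_upwards [h1] with y hy
    cases κ with
    | circle => simp [Web.weight]
    | biweb =>
      obtain ⟨hre, him⟩ := hc rfl
      by_cases h : y = 0
      · simp [h, hg.zero]
      · have h2 := hy (by simpa [hg.ne] using h)
        refine h2.trans ?_
        have h3 : c⁻¹ = ((c.re⁻¹ : ℝ) : ℂ) := by
          apply Complex.ext <;> simp [Complex.inv_re, Complex.inv_im, him, Complex.normSq_apply]
        simp only [Web.weight]
        rw [h3, Complex.im_ofReal_mul]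
        exact sign_mul_pos (inv_pos.2 hre)
  obtain ⟨ρ, hρ, S, hS, hS1, hS2⟩ := exists_extension_tangent hk hks
  have hcpos : 0 < ‖c‖ := norm_pos_iff.2 hg.ne
  -- The first bound lets multiplication by `r * c` carry the disc `‖z‖ < 4` into the disc where `S`
  -- equals the germ; the second makes the real part of `log (r * c)` nonpositive, as `spiral`
  -- requires.
  refine ⟨min (ρ / (4 * ‖c‖)) (1 / ‖c‖), by positivity, fun r hr hr' => ?_⟩
  have hr1 : r * (4 * ‖c‖) < ρ :=
    (lt_div_iff₀ (by positivity)).1 (hr'.trans_le (min_le_left _ _))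
  have hr2 : r * ‖c‖ < 1 := (lt_div_iff₀ hcpos).1 (hr'.trans_le (min_le_right _ _))
  have hrc : (r : ℂ) * c ≠ 0 := mul_ne_zero (by exact_mod_cast hr.ne') hg.ne
  set l := Complex.log (r * c) with hl
  have hexp : Complex.exp l = r * c := Complex.exp_log hrc
  have hlre : l.re ≤ 0 := by
    rw [hl, Complex.log_re, norm_mul, Complex.norm_real, Real.norm_of_nonneg hr.le]
    exact Real.log_nonpos (by positivity) hr2.le
  have hlim0 : κ = .biweb → l.im = 0 := by
    intro h
    obtain ⟨hre, him⟩ := hc h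
    have h3 : (r : ℂ) * c = ((r * c.re : ℝ) : ℂ) := by
      apply Complex.ext <;> simp [him]
    rw [hl, Complex.log_im, h3, Complex.arg_ofReal_of_nonneg (by positivity)]
  have hspiral := fun z => spiral_signedSmoothAt hlre hlim0 z
  -- On this disc the spiral multiplies by `r * c`, and the factor `c` cancels against the `c⁻¹`
  -- built into `S`.
  have hT : ∀ z, ‖z‖ < 4 → S (spiral l z) = g (r * z) := by
    intro z hz
    rw [spiral_of_le hz.le, hexp, hS1]
    · congr 1
      field_simp [hg.ne]
    · rw [norm_mul, norm_mul, Complex.norm_real, Real.norm_of_nonneg hr.le]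
      nlinarith [mul_pos hr hcpos]
  refine ⟨(Equiv.ofBijective _ (spiral_bijective hlre)).trans S, ?_, fun z _ => ?_,
    fun z hz => hT z hz, fun z hz => ?_⟩
  · change S (spiral l 0) = 0
    rw [hT 0 (by simp), mul_zero, hg.zero]
  · exact SignedSmoothAt.comp (f := spiral l) (hS (spiral l z)) (hspiral z)
  · change S (spiral l z) = z
    rw [spiral_of_ge hz, hS2 z (by linarith)]

end SingCob

namespace SingCob

/-! ### Planar models of cobordisms -/

/-- `φ` agrees near `0`, except perhaps at `0`, with a germ with value `p`. -/
def HasGerm (φ : ℂ → ℂ) (p : ℂ) : Prop :=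
  ∃ h c, IsGerm h p c ∧ ∀ᶠ z in 𝓝[≠] 0, φ z = h z

/-- The position `p` of a puncture with an end of kind `κ` in the plane of kind `b` is
compatible with the singular set. -/
def Compat : Web → Web → ℂ → Prop
  | .circle, .circle => fun _ => True
  | .circle, .biweb => fun p => 0 < p.im
  | .biweb, .circle => fun _ => False
  | .biweb, .biweb => fun p => p.im = 0

theorem hasDerivAt_affine (a p z : ℂ) : HasDerivAt (fun y => p + a * y) a z := by
  simpa using ((hasDerivAt_id z).const_mul a).const_add p

theorem contDiff_affine (a p : ℂ) : ContDiff ℝ ∞ fun y : ℂ => p + a * y :=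
  contDiff_const.add (contDiff_const.mul contDiff_id)

/-- Affine maps between the piecewise oriented planes. -/
theorem affine_signedSmoothAt {b b' : Web} {a p y : ℂ} (ha : a ≠ 0)
    (hs : SignType.sign (b'.weight (p + a * y)) = SignType.sign (b.weight y)) :
    SignedSmoothAt b.weight b'.weight (fun y => p + a * y) y := by
  refine SignedSmoothAt.of_det_pos (contDiff_affine a p).contDiffAt ?_ hs
  rw [det_of_hasDerivAt (hasDerivAt_affine a p y)]
  exact Complex.normSq_pos.2 ha

theorem isGerm_affine {a : ℂ} (p : ℂ) (ha : a ≠ 0) : IsGerm (fun y => p + a * y) p a :=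
  ⟨.of_forall fun _ => (contDiff_affine a p).contDiffAt, by simp, hasDerivAt_affine a p 0, ha⟩

/-- This holds only near the origin: a circle end at a point of the upper half plane must stay away
from the real axis. -/
theorem Compat.signedSmoothAt {κ b : Web} {p : ℂ} (h : Compat κ b p) :
    ∀ᶠ y in 𝓝 0, SignedSmoothAt κ.weight b.weight (fun y => p + y) y := by
  have key : ∀ᶠ y in 𝓝 0, SignType.sign (b.weight (p + 1 * y)) = SignType.sign (κ.weight y) := by
    cases κ <;> cases b
    · simp [Web.weight]
    · have h1 : ContinuousAt (fun y : ℂ => (p + 1 * y).im) 0 := by fun_prop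
      have h2 : 0 < p.im := h
      filter_upwards [h1.eventually (lt_mem_nhds (a := 0) (by simpa using h2))] with y hy
      simp only [Web.weight, sign_one]
      exact sign_pos hy
    · exact h.elim
    · have h2 : p.im = 0 := h
      exact .of_forall fun y => by simp [Web.weight, h2]
  filter_upwards [key] with y hy
  simpa using affine_signedSmoothAt one_ne_zero hy

theorem eventually_punctured {p : ℂ → Prop} (h : ∀ᶠ y in 𝓝[≠] (0 : ℂ), p y) :
    ∀ᶠ y in 𝓝[≠] (0 : ℂ), ∀ᶠ x in 𝓝 y, p x := by
  filter_upwards [eventually_eventually_nhdsWithin.2 h, self_mem_nhdsWithin] with y hy hy0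
  rwa [isOpen_compl_singleton.nhdsWithin_eq hy0] at hy

theorem HasGerm.continuousAt_ne {φ : ℂ → ℂ} {p : ℂ} (h : HasGerm φ p) :
    ∀ᶠ z in 𝓝[≠] 0, φ z ≠ p := by
  obtain ⟨h, c, hh, he⟩ := h
  filter_upwards [he, hh.deriv.eventually_ne (c := p) hh.ne] with z h1 h2
  rwa [h1]

/-- Germs have inverses. -/
theorem HasGerm.exists_inverse {w w' : ℂ → ℝ} {φ : ℂ → ℂ} {p : ℂ} (hφ : HasGerm φ p)
    (h1 : ∀ᶠ z in 𝓝[≠] 0, SignedSmoothAt w w' φ z)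
    (h2 : ∀ᶠ y in 𝓝 0, SignedSmoothAt w w' (fun y => p + y) y) :
    ∃ g c, IsGerm g 0 c ∧ (∀ᶠ y in 𝓝[≠] 0, SignedSmoothAt w w g y) ∧
      ∀ᶠ y in 𝓝[≠] 0, φ (g y) = p + y := by
  obtain ⟨h, c, hh, he⟩ := hφ
  have hd := hh.det_pos
  let L : ℂ ≃L[ℝ] ℂ := (fderiv ℝ h 0).toContinuousLinearEquivOfDetNeZero hd.self_of_nhds.ne'
  have hL : HasFDerivAt h (L : ℂ →L[ℝ] ℂ) 0 := by
    simpa [L] using (hh.contDiffAt.differentiableAt (by simp)).hasFDerivAt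
  let e := hh.contDiffAt.toOpenPartialHomeomorph h hL (n := ∞) (by simp)
  have h0 : (0 : ℂ) ∈ e.source :=
    hh.contDiffAt.mem_toOpenPartialHomeomorph_source hL (by simp)
  have hp : p ∈ e.target := by rw [← hh.zero]; exact e.map_source h0
  have hep : e.symm p = 0 := by rw [← hh.zero]; exact e.left_inv h0
  have hlim : Filter.Tendsto (fun y => p + y) (𝓝 0) (𝓝 p) := by
    have : Continuous fun y => p + y := by fun_prop
    simpa using this.tendsto 0
  have hglim : Filter.Tendsto (fun y => e.symm (p + y)) (𝓝 0) (𝓝 0) := by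
    have h3 := (e.continuousAt_symm hp).tendsto
    rw [hep] at h3
    exact h3.comp hlim
  have htarget := hlim.eventually (e.open_target.mem_nhds hp)
  have hgs : ∀ᶠ y in 𝓝 0, ContDiffAt ℝ ∞ (fun y => e.symm (p + y)) y := by
    filter_upwards [htarget, hglim.eventually hh.smooth, hglim.eventually hd] with y h3 h4 h5
    have h6 : ContDiffAt ℝ ∞ e.symm (p + y) :=
      e.contDiffAt_symm (f₀' := (fderiv ℝ h (e.symm (p + y))).toContinuousLinearEquivOfDetNeZero
        h5.ne') h3
        (by
          rw [ContinuousLinearMap.coe_toContinuousLinearEquivOfDetNeZero]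
          exact (h4.differentiableAt (by simp)).hasFDerivAt) h4
    exact h6.comp y (contDiffAt_const.add contDiffAt_id)
  have hgd : HasDerivAt (fun y => e.symm (p + y)) c⁻¹ 0 := by
    have h3 : HasDerivAt e.symm c⁻¹ (p + 0) := by
      rw [add_zero]
      refine e.hasDerivAt_symm hp hh.ne ?_
      rw [hep]
      exact hh.deriv
    have h4 := h3.comp (0 : ℂ) ((hasDerivAt_id (0 : ℂ)).const_add p)
    rwa [mul_one] at h4
  have hg : IsGerm (fun y => e.symm (p + y)) 0 c⁻¹ :=
    ⟨hgs, by simpa using hep, hgd, inv_ne_zero hh.ne⟩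
  have hne : ∀ᶠ y in 𝓝[≠] 0, e.symm (p + y) ≠ 0 := hgd.eventually_ne (inv_ne_zero hh.ne)
  have hgpunct : Filter.Tendsto (fun y => e.symm (p + y)) (𝓝[≠] 0) (𝓝[≠] 0) :=
    tendsto_nhdsWithin_iff.2 ⟨hglim.mono_left nhdsWithin_le_nhds, hne⟩
  have heq : ∀ᶠ y in 𝓝[≠] 0, φ (e.symm (p + y)) = p + y := by
    filter_upwards [hgpunct.eventually he, htarget.filter_mono nhdsWithin_le_nhds] with y h3 h4
    rw [h3]
    exact e.right_inv h4
  -- Near nonzero points `φ ∘ g` is a translation, which respects the weights; so does `φ`, hence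
  -- `g` does as well by cancellation.
  refine ⟨_, _, hg, ?_, heq⟩
  filter_upwards [hgpunct.eventually h1, eventually_punctured heq,
    h2.filter_mono nhdsWithin_le_nhds, hgs.filter_mono nhdsWithin_le_nhds] with y h3 h4 h5 h6
  exact SignedSmoothAt.cancel_left h3 (h5.congr h4) h6

theorem HasGerm.comp {φ : ℂ → ℂ} {p c : ℂ} (hφ : HasGerm φ p) {G : ℂ → ℂ}
    (hG : ∀ᶠ y in 𝓝 p, ContDiffAt ℝ ∞ G y) (hd : HasDerivAt G c p) (hc : c ≠ 0) :
    HasGerm (fun z => G (φ z)) (G p) := by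
  obtain ⟨h, d, hh, he⟩ := hφ
  have hlim : Filter.Tendsto h (𝓝 0) (𝓝 p) := by
    have := hh.contDiffAt.continuousAt.tendsto
    rwa [hh.zero] at this
  refine ⟨fun z => G (h z), c * d, ⟨?_, by rw [hh.zero], ?_, mul_ne_zero hc hh.ne⟩, ?_⟩
  · filter_upwards [hlim.eventually hG, hh.smooth] with z h1 h2 using h1.comp z h2
  · exact HasDerivAt.comp (0 : ℂ) (by rwa [hh.zero]) hh.deriv
  · filter_upwards [he] with z hz
    rw [hz]

theorem HasGerm.congr {φ ψ : ℂ → ℂ} {p : ℂ} (hφ : HasGerm φ p)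
    (h : ∀ᶠ z in 𝓝[≠] 0, ψ z = φ z) : HasGerm ψ p := by
  obtain ⟨g, c, hg, he⟩ := hφ
  refine ⟨g, c, hg, ?_⟩
  filter_upwards [he, h] with z h1 h2
  rw [h2, h1]

theorem hasGerm_affine {a : ℂ} (p : ℂ) (ha : a ≠ 0) : HasGerm (fun y => p + a * y) p :=
  ⟨_, _, isGerm_affine p ha, .of_forall fun _ => rfl⟩

/-- `f` identifies the surface of `A` with the plane of kind `b` without the points `P e`, where
`e` runs over the ends other than the root `o`. At an end `e ≠ o` the collar is conformal at the
puncture `P e`, and the root is at infinity. -/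
structure IsModel {n m : List Web} (A : Cob n m) (b : Web) (o : EndIdx n m) (P : EndIdx n m → ℂ)
    (f : A.M → ℂ) : Prop where
  sing : ∀ x, SingAt (N := Plane b) f x
  inj : Function.Injective f
  range : ∀ y, (∃ x, f x = y) ↔ ∀ e, e ≠ o → y ≠ P e
  leaf : ∀ e, e ≠ o → HasGerm (fun z => f (A.endMap e z)) (P e)
  compat : ∀ e, e ≠ o → Compat (endKind n m e) b (P e)
  root : HasGerm (fun z => -(f (A.endMap o z))⁻¹) 0
  rootKind : endKind n m o = b

/-- A model for which the collars are linear. -/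
structure IsNormalModel {n m : List Web} (A : Cob n m) (b : Web) (o : EndIdx n m)
    (P : EndIdx n m → ℂ) (r : EndIdx n m → ℝ) (f : A.M → ℂ) : Prop extends
    IsModel A b o P f where
  pos : ∀ e, 0 < r e
  linear_leaf : ∀ e, e ≠ o → ∀ z, z ≠ 0 → ‖z‖ < 4 → f (A.endMap e z) = P e + r e * z
  linear_root : ∀ z, z ≠ 0 → ‖z‖ < 4 → f (A.endMap o z) = -(r o * z)⁻¹

namespace IsModel

variable {n m : List Web} {A B : Cob n m} {b : Web} {o : EndIdx n m} {P : EndIdx n m → ℂ}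
  {f : A.M → ℂ}

theorem congr (hf : IsModel A b o P f) {P' : EndIdx n m → ℂ} (h : ∀ e, e ≠ o → P' e = P e) :
    IsModel A b o P' f where
  sing := hf.sing
  inj := hf.inj
  range y := (hf.range y).trans
    ⟨fun h' e he => by rw [h e he]; exact h' e he, fun h' e he => by rw [← h e he]; exact h' e he⟩
  leaf e he := by rw [h e he]; exact hf.leaf e he
  compat e he := by rw [h e he]; exact hf.compat e he
  root := hf.root
  rootKind := hf.rootKind

theorem endMap_signedSmoothAt (hf : IsModel A b o P f) (e : EndIdx n m) {z : ℂ} (hz : z ≠ 0) :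
    SignedSmoothAt (endKind n m e).weight b.weight (fun z => f (A.endMap e z)) z :=
  singAt_plane_iff.1 (SingAt.comp (M := Plane (endKind n m e)) (K := Plane b) (hf.sing _)
    (A.endMap_singAt e hz))

/-- The collars of a model can be straightened by automorphisms of the plane. -/
theorem exists_straightening (hf : IsModel A b o P f) (e : EndIdx n m) :
    ∃ ε > 0, ∀ r : ℝ, 0 < r → r < ε → ∃ T : ℂ ≃ ℂ, T 0 = 0 ∧
      (∀ z, z ≠ 0 → SignedSmoothAt (endKind n m e).weight (endKind n m e).weight T z) ∧
      (∀ z, 5 ≤ ‖z‖ → T z = z) ∧ (e ≠ o → ∀ z, z ≠ 0 → ‖z‖ < 4 →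
        f (A.endMap e (T z)) = P e + r * z) ∧
      (e = o → ∀ z, z ≠ 0 → ‖z‖ < 4 → f (A.endMap e (T z)) = -(r * z)⁻¹) := by
  -- Leaves and root are treated alike: `φ` is the collar seen in the plane, after the inversion `-1
  -- / y` in the case of the root. If `g` inverts `φ` up to translation, then a diffeomorphism `T`
  -- with `T z = g (r * z)` makes `φ ∘ T` linear.
  have main : ∀ φ : ℂ → ℂ, ∀ p : ℂ, HasGerm φ p →
      (∀ᶠ z in 𝓝[≠] 0, SignedSmoothAt (endKind n m e).weight b.weight φ z) →
      (∀ᶠ y in 𝓝 0, SignedSmoothAt (endKind n m e).weight b.weight (fun y => p + y) y) →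
      ∃ ε > 0, ∀ r : ℝ, 0 < r → r < ε → ∃ T : ℂ ≃ ℂ, T 0 = 0 ∧
      (∀ z, z ≠ 0 → SignedSmoothAt (endKind n m e).weight (endKind n m e).weight T z) ∧
      (∀ z, 5 ≤ ‖z‖ → T z = z) ∧ (∀ z, z ≠ 0 → ‖z‖ < 4 → φ (T z) = p + r * z) := by
    intro φ p hφ h1 h2
    obtain ⟨g, c, hg, hgs, heq⟩ := hφ.exists_inverse h1 h2
    obtain ⟨ε, hε, hT⟩ := exists_planar_extension hg hgs
    rw [eventually_nhdsWithin_iff, Metric.eventually_nhds_iff_ball] at heq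
    obtain ⟨δ, hδ, heq⟩ := heq
    refine ⟨min ε (δ / 4), lt_min hε (by positivity), fun r hr hr' => ?_⟩
    obtain ⟨T, hT0, hT1, hT2, hT3⟩ := hT r hr (hr'.trans_le (min_le_left _ _))
    refine ⟨T, hT0, hT1, hT3, fun z hz hz4 => ?_⟩
    have hr4 : r < δ / 4 := hr'.trans_le (min_le_right _ _)
    rw [hT2 z hz4, heq]
    · rw [mem_ball_zero_iff, norm_mul, Complex.norm_real, Real.norm_of_nonneg hr.le]
      nlinarith [norm_nonneg z]
    · exact mul_ne_zero (by exact_mod_cast hr.ne') hz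
  by_cases he : e = o
  · subst he
    have hne := hf.root.continuousAt_ne
    have hs : ∀ᶠ z in 𝓝[≠] 0, SignedSmoothAt (endKind n m e).weight b.weight
        (fun z => -(f (A.endMap e z))⁻¹) z := by
      filter_upwards [hne, self_mem_nhdsWithin] with z h1 h2
      have h3 : f (A.endMap e z) ≠ 0 := by simpa using h1
      exact SignedSmoothAt.comp (f := fun z => f (A.endMap e z)) (negInv_signedSmoothAt b h3)
        (hf.endMap_signedSmoothAt e h2)
    have hs' : ∀ᶠ y in 𝓝 0, SignedSmoothAt (endKind n m e).weight b.weight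
        (fun y => 0 + y) y := by
      refine .of_forall fun y => ?_
      rw [hf.rootKind]
      simp only [zero_add]
      exact SignedSmoothAt.id_at b.weight y
    obtain ⟨ε, hε, h⟩ := main (fun z => -(f (A.endMap e z))⁻¹) 0 hf.root hs hs'
    refine ⟨ε, hε, fun r hr hr' => ?_⟩
    obtain ⟨T, h1, h2, h3, h4⟩ := h r hr hr'
    refine ⟨T, h1, h2, h3, fun h => absurd rfl h, fun _ z hz hz4 => ?_⟩
    have h5 := h4 z hz hz4
    rw [zero_add] at h5
    rw [← h5]
    simp
  · have hs : ∀ᶠ z in 𝓝[≠] 0, SignedSmoothAt (endKind n m e).weight b.weight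
        (fun z => f (A.endMap e z)) z := by
      filter_upwards [self_mem_nhdsWithin] with z hz using hf.endMap_signedSmoothAt e hz
    obtain ⟨ε, hε, h⟩ := main (fun z => f (A.endMap e z)) (P e) (hf.leaf e he) hs
      (hf.compat e he).signedSmoothAt
    refine ⟨ε, hε, fun r hr hr' => ?_⟩
    obtain ⟨T, h1, h2, h3, h4⟩ := h r hr hr'
    exact ⟨T, h1, h2, h3, fun _ => h4, fun h => absurd h he⟩

/-- All ends are straightened by a single twist. Every sufficiently small family of radii can be
prescribed; this freedom allows two models to be given equal radii, and pieces to be glued with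
matching circles. -/
theorem exists_normal (hf : IsModel A b o P f) :
    ∃ ε > 0, ∀ r : EndIdx n m → ℝ, (∀ e, 0 < r e) → (∀ e, r e < ε) →
      ∃ f', IsNormalModel A b o P r f' := by
  choose ε hε hT using hf.exists_straightening
  obtain ⟨δ, hδ, hδ'⟩ : ∃ δ > 0, ∀ e, δ ≤ ε e := by
    refine ⟨Finset.univ.inf' ⟨o, Finset.mem_univ o⟩ ε, ?_, fun e =>
      Finset.inf'_le _ (Finset.mem_univ e)⟩
    exact (Finset.lt_inf'_iff _).2 fun e _ => hε e
  refine ⟨δ, hδ, fun r hr hr' => ?_⟩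
  choose T hT0 hT1 hT2 hT3 hT4 using fun e => hT e (r e) (hr e) ((hr' e).trans_le (hδ' e))
  have hbij := A.twist_bijective hT0
  have hs := A.twist_singAt hT0 hT1 (r := 5) (by norm_num) hT2
  have hleaf : ∀ e, e ≠ o → ∀ z, z ≠ 0 → ‖z‖ < 4 →
      f (A.twist T (A.endMap e z)) = P e + r e * z := by
    intro e he z hz hz4
    rw [A.twist_endMap T e hz, hT3 e he z hz hz4]
  have hroot : ∀ z, z ≠ 0 → ‖z‖ < 4 → f (A.twist T (A.endMap o z)) = -(r o * z)⁻¹ := by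
    intro z hz hz4
    rw [A.twist_endMap T o hz, hT4 o rfl z hz hz4]
  have hsmall : ∀ᶠ z : ℂ in 𝓝[≠] 0, z ≠ 0 ∧ ‖z‖ < 4 := by
    filter_upwards [self_mem_nhdsWithin,
      mem_nhdsWithin_of_mem_nhds (Metric.ball_mem_nhds (0 : ℂ) (by norm_num : (0 : ℝ) < 4))]
      with z h1 h2
    exact ⟨h1, by simpa using h2⟩
  refine ⟨f ∘ A.twist T, ?_⟩
  exact
    { sing := fun x => SingAt.comp (K := Plane b) (hf.sing _) (hs x)
      inj := hf.inj.comp hbij.1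
      range := fun y => by
        rw [← hf.range y]
        constructor
        · rintro ⟨x, hx⟩
          exact ⟨_, hx⟩
        · rintro ⟨x, hx⟩
          obtain ⟨x', rfl⟩ := hbij.2 x
          exact ⟨x', hx⟩
      leaf := fun e he => (hasGerm_affine (P e) (a := r e)
          (by exact_mod_cast (hr e).ne')).congr (by
        filter_upwards [hsmall] with z hz using hleaf e he z hz.1 hz.2)
      compat := hf.compat
      root := (hasGerm_affine 0 (a := r o) (by exact_mod_cast (hr o).ne')).congr (by
        filter_upwards [hsmall] with z hz
        simp [hroot z hz.1 hz.2])
      rootKind := hf.rootKind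
      pos := hr
      linear_leaf := hleaf
      linear_root := hroot }

/-- Two cobordisms with the same model are equivalent. -/
theorem equivalent (hf : IsModel A b o P f) {f' : B.M → ℂ} (hf' : IsModel B b o P f') :
    A.Equivalent B := by
  obtain ⟨ε, hε, h⟩ := hf.exists_normal
  obtain ⟨ε', hε', h'⟩ := hf'.exists_normal
  -- Both models are made linear with the same radius at every end.
  have hpos : 0 < min ε ε' / 2 := by positivity
  have hlt : min ε ε' / 2 < min ε ε' := by linarith
  obtain ⟨g, hg⟩ := h (fun _ => min ε ε' / 2) (fun _ => hpos)
    fun _ => hlt.trans_le (min_le_left _ _)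
  obtain ⟨g', hg'⟩ := h' (fun _ => min ε ε' / 2) (fun _ => hpos)
    fun _ => hlt.trans_le (min_le_right _ _)
  -- The two maps have the same image, the plane without the punctures, so the equivalence can be
  -- taken as `g` followed by the inverse of `g'`.
  have hex : ∀ x, ∃ y, g' y = g x := fun x => (hg'.range _).2 ((hg.range _).1 ⟨x, rfl⟩)
  have hex' : ∀ y, ∃ x, g x = g' y := fun y => (hg.range _).2 ((hg'.range _).1 ⟨y, rfl⟩)
  choose Φ hΦ using hex
  have hbij : Function.Bijective Φ := by
    refine ⟨fun x y h => hg.inj (by rw [← hΦ x, h, hΦ y]), fun y => ?_⟩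
    obtain ⟨x, hx⟩ := hex' y
    exact ⟨x, hg'.inj ((hΦ x).trans hx)⟩
  have hsing : ∀ x, SingAt Φ x := by
    intro x
    have : Nonempty B.M := ⟨Φ x⟩
    have hinv : SingAt (M := Plane b) (Function.invFun g') (g' (Φ x)) := by
      refine SingAt.cancel_right (N := Plane b) (hg'.sing (Φ x)) ?_
      refine (SingAt.id_at _).congr (.of_forall fun y => ?_)
      exact Function.leftInverse_invFun hg'.inj y
    rw [hΦ x] at hinv
    refine (SingAt.comp (N := Plane b) hinv (hg.sing x)).congr (.of_forall fun y => ?_)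
    change Φ y = Function.invFun g' (g y)
    rw [← hΦ y]
    exact (Function.leftInverse_invFun hg'.inj (Φ y)).symm
  -- On the ends both models are given by the same linear formula, so the equivalence carries collar
  -- to collar.
  have hend : ∀ e z, z ≠ 0 → ‖z‖ < 4 → Φ (A.endMap e z) = B.endMap e z := by
    intro e z hz hz4
    refine hg'.inj ((hΦ _).trans ?_)
    by_cases he : e = o
    · subst he
      rw [hg.linear_root z hz hz4, hg'.linear_root z hz hz4]
    · rw [hg.linear_leaf e he z hz hz4, hg'.linear_leaf e he z hz hz4]
  -- For sources `‖z‖ < 3 / 2`, and for targets `‖z‖ > 1 / 2` means that the end coordinate `-1 / z`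
  -- has norm below `2`; both are within the range `4` of the linear formula.
  refine ⟨structomorphOfBijective Φ hbij hsing, 1 / 2, by norm_num, fun j z hz => ?_,
    fun j z hz => ?_⟩
  · have := hend (.inl j) z z.2 (by linarith)
    rwa [A.endMap_inl, B.endMap_inl] at this
  · have hz0 : (z : ℂ) ≠ 0 := z.2
    have := hend (.inr j) (-(z : ℂ)⁻¹) (by simpa using hz0) (by
      rw [norm_neg, norm_inv]
      have h1 : (1 / 2 : ℝ) < ‖(z : ℂ)‖ := by linarith
      have h2 : ‖(z : ℂ)‖⁻¹ < (1 / 2 : ℝ)⁻¹ := inv_strictAnti₀ (by norm_num) h1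
      norm_num at h2 ⊢
      linarith)
    rwa [A.endMap_inr, B.endMap_inr] at this

end IsModel

end SingCob

/-! ### Operations on models: diffeomorphisms of the plane, change of root, reversal -/

namespace SingCob

namespace IsModel

variable {n m : List Web} {A B : Cob n m} {b : Web} {o : EndIdx n m} {P : EndIdx n m → ℂ}
  {f : A.M → ℂ}

/-- A nonzero complex derivative makes the Jacobian positive, so the sign of the weight at the
puncture is unchanged. -/
theorem compat_image {κ b : Web} {G : ℂ → ℂ} {p c : ℂ} (h : Compat κ b p)
    (hG : SignedSmoothAt b.weight b.weight G p) (hd : HasDerivAt G c p) (hc : c ≠ 0) :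
    Compat κ b (G p) := by
  have h1 : 0 < (fderiv ℝ G p).det := by
    rw [det_of_hasDerivAt hd]; exact Complex.normSq_pos.2 hc
  have h2 := hG.sign_eq h1
  cases κ <;> cases b
  · trivial
  · have h3 : 0 < p.im := h
    simp only [Web.weight, sign_pos h3, sign_eq_one_iff] at h2
    exact h2
  · exact h
  · have h3 : p.im = 0 := h
    simp only [Web.weight, h3, sign_zero, sign_eq_zero_iff] at h2
    exact h2

/-- Composition of a model with a diffeomorphism of the plane. -/
theorem post (hf : IsModel A b o P f) {G : ℂ → ℂ} (hb : Function.Bijective G)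
    (hs : ∀ y, SignedSmoothAt b.weight b.weight G y)
    (hd : ∀ e, e ≠ o → ∃ c, c ≠ 0 ∧ HasDerivAt G c (P e))
    (hr : HasGerm (fun y => -(G (-y⁻¹))⁻¹) 0) : IsModel A b o (G ∘ P) (G ∘ f) where
  sing x := SingAt.comp (N := Plane b) (K := Plane b) (singAt_plane_iff.2 (hs _)) (hf.sing x)
  inj := hb.1.comp hf.inj
  range y := by
    obtain ⟨y, rfl⟩ := hb.2 y
    simp only [Function.comp_apply, hb.1.eq_iff, hb.1.ne_iff]
    exact hf.range y
  leaf e he := by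
    obtain ⟨c, hc, hd⟩ := hd e he
    exact (hf.leaf e he).comp (.of_forall fun y => (hs y).1) hd hc
  compat e he := by
    obtain ⟨c, hc, hd⟩ := hd e he
    exact compat_image (hf.compat e he) (hs _) hd hc
  root := by
    -- `K` is `G` read in the coordinate `-1 / y` at infinity; the new root germ is the old one
    -- followed by `K`.
    obtain ⟨K, c, hK, hKe⟩ := hr
    obtain ⟨h, d, hh, he⟩ := hf.root
    have h1 : HasGerm (fun z => K (-(f (A.endMap o z))⁻¹)) (K 0) :=
      HasGerm.comp ⟨h, d, hh, he⟩ hK.smooth hK.deriv hK.ne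
    rw [hK.zero] at h1
    refine h1.congr ?_
    have hlim : Filter.Tendsto h (𝓝[≠] 0) (𝓝[≠] 0) := by
      refine tendsto_nhdsWithin_iff.2 ⟨?_, hh.deriv.eventually_ne hh.ne⟩
      have := hh.contDiffAt.continuousAt.tendsto
      rw [hh.zero] at this
      exact this.mono_left nhdsWithin_le_nhds
    filter_upwards [he, hlim.eventually hKe] with z h2 h3
    rw [h2, ← h3, ← h2]
    simp
  rootKind := hf.rootKind

/-- In the singular plane a positive factor and a real translation preserve the axis and both half
planes. In the coordinate at infinity the map becomes `y / (a - p * y)`, which is smooth at `0` with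
derivative `a⁻¹`. -/
theorem post_affine (hf : IsModel A b o P f) {a p : ℂ} (ha : a ≠ 0)
    (hb : b = .biweb → 0 < a.re ∧ a.im = 0 ∧ p.im = 0) :
    IsModel A b o (fun e => p + a * P e) (fun x => p + a * f x) := by
  refine hf.post (G := fun y => p + a * y) ?_ (fun y => affine_signedSmoothAt ha ?_)
    (fun e _ => ⟨a, ha, hasDerivAt_affine a p _⟩) ?_
  · refine ⟨fun y z h => mul_left_cancel₀ ha (add_left_cancel h), fun y => ⟨a⁻¹ * (y - p), ?_⟩⟩
    simp [ha]
  · cases b with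
    | circle => rfl
    | biweb =>
      obtain ⟨h1, h2, h3⟩ := hb rfl
      simp only [Web.weight, Complex.add_im, Complex.mul_im, h2, h3, zero_mul, add_zero, zero_add]
      exact sign_mul_pos h1
  · have hlim : ∀ᶠ y : ℂ in 𝓝 0, a - p * y ≠ 0 := by
      have h1 : ContinuousAt (fun y : ℂ => a - p * y) 0 := by fun_prop
      exact h1.eventually_ne (by simpa using ha)
    refine ⟨fun y => y * (a - p * y)⁻¹, a⁻¹, ⟨?_, by simp, ?_, inv_ne_zero ha⟩, ?_⟩
    · filter_upwards [hlim] with y hy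
      exact contDiffAt_id.mul ((contDiffAt_const.sub (contDiffAt_const.mul contDiffAt_id)).inv hy)
    · have h1 : HasDerivAt (fun y : ℂ => a - p * y) (-p) 0 := by
        simpa using ((hasDerivAt_id (0 : ℂ)).const_mul p).const_sub a
      have h2 := (hasDerivAt_id (0 : ℂ)).mul (h1.inv (by simpa using ha))
      refine h2.congr_deriv ?_
      simp
    · filter_upwards [self_mem_nhdsWithin, hlim.filter_mono nhdsWithin_le_nhds] with y h1 h2
      have h1' : y ≠ 0 := h1
      have h3 : p + a * -y⁻¹ = -((a - p * y) / y) := by field_simp; ring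
      rw [h3, inv_neg, neg_neg, inv_div, div_eq_mul_inv]

/-- `G` is only real-smooth, but it is a translation near each puncture and the identity near
infinity, so the complex derivatives required there are `1`. -/
theorem post_compactSupport (hf : IsModel A b o P f) {G : ℂ → ℂ} (hb : Function.Bijective G)
    (hs : ∀ y, SignedSmoothAt b.weight b.weight G y)
    (hd : ∀ e, e ≠ o → ∃ d, ∀ᶠ y in 𝓝 (P e), G y = y + d) {R : ℝ}
    (hR : ∀ y, R ≤ ‖y‖ → G y = y) : IsModel A b o (G ∘ P) (G ∘ f) := by
  refine hf.post hb hs (fun e he => ?_) ?_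
  · obtain ⟨d, hd⟩ := hd e he
    refine ⟨1, one_ne_zero, ?_⟩
    have h1 : HasDerivAt (fun y : ℂ => y + d) 1 (P e) := (hasDerivAt_id _).add_const d
    exact h1.congr_of_eventuallyEq hd
  · refine (hasGerm_affine 0 one_ne_zero).congr ?_
    have h1 : ∀ᶠ y : ℂ in 𝓝 0, ‖y‖ * (|R| + 1) < 1 := by
      have h1 : ContinuousAt (fun y : ℂ => ‖y‖ * (|R| + 1)) 0 := by fun_prop
      exact h1.eventually (gt_mem_nhds (by simp))
    filter_upwards [h1.filter_mono nhdsWithin_le_nhds, self_mem_nhdsWithin] with y hy hy0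
    have hy0' : 0 < ‖y‖ := norm_pos_iff.2 hy0
    rw [hR]
    · simp
    · rw [norm_neg, norm_inv, ← one_div, le_div_iff₀ hy0']
      nlinarith [le_abs_self R, abs_nonneg R]

/-- Another end of a model may serve as its root. -/
theorem reroot (hf : IsModel A b o P f) {o' : EndIdx n m} (ho : o' ≠ o)
    (hk : endKind n m o' = b) (hP : ∀ e, e ≠ o → e ≠ o' → P e ≠ P o') :
    IsModel A b o' (fun e => if e = o then 0 else -(P e - P o')⁻¹)
      (fun x => -(f x - P o')⁻¹) := by
  have hne : ∀ x, f x - P o' ≠ 0 := fun x => sub_ne_zero.2 ((hf.range _).1 ⟨x, rfl⟩ o' ho)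
  have himp : b = .biweb → (P o').im = 0 := by
    intro h
    have := hf.compat o' ho
    rwa [hk, h] at this
  have hs : ∀ y, y - P o' ≠ 0 → SignedSmoothAt b.weight b.weight (fun y => -(y - P o')⁻¹) y := by
    intro y hy
    have h1 : SignedSmoothAt b.weight b.weight (fun y => -P o' + 1 * y) y := by
      refine affine_signedSmoothAt one_ne_zero ?_
      cases b with
      | circle => rfl
      | biweb => simp [Web.weight, himp rfl]
    have h2 : SignedSmoothAt b.weight b.weight (fun y => y - P o') y :=
      h1.congr (.of_forall fun y => by ring)
    exact SignedSmoothAt.comp (f := fun y => y - P o') (negInv_signedSmoothAt b hy) h2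
  have hd : ∀ y, y - P o' ≠ 0 →
      HasDerivAt (fun y => -(y - P o')⁻¹) (((y - P o') ^ 2)⁻¹) y := by
    intro y hy
    have h1 := (((hasDerivAt_id y).sub_const (P o')).inv hy).neg
    refine h1.congr_deriv ?_
    rw [neg_div, neg_neg, one_div]
    rfl
  refine ⟨fun x => ?_, fun x y h => ?_, fun y => ?_, fun e he => ?_, fun e he => ?_, ?_, hk⟩
  · exact SingAt.comp (N := Plane b) (K := Plane b) (f := f)
      (singAt_plane_iff.2 (hs _ (hne x))) (hf.sing x)
  · exact hf.inj (sub_left_injective (inv_injective (neg_injective h)))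
  · constructor
    · rintro ⟨x, rfl⟩ e he
      by_cases heo : e = o
      · simpa [heo] using hne x
      · rw [if_neg heo]
        intro h
        have h1 := sub_left_injective (inv_injective (neg_injective h))
        exact (hf.range _).1 ⟨x, rfl⟩ e heo h1
    · intro h
      have hy : y ≠ 0 := by simpa using h o ho.symm
      obtain ⟨x, hx⟩ := (hf.range (P o' - y⁻¹)).2 (by
        intro e he h'
        by_cases heo : e = o'
        · rw [heo] at h'
          simp [hy] at h'
        · refine h e heo ?_
          rw [if_neg he, ← h']
          simp)
      refine ⟨x, ?_⟩
      rw [hx]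
      simp
  · by_cases heo : e = o
    · subst heo
      rw [if_pos rfl]
      -- The old root becomes a leaf at `0`: in terms of `y = -1 / f` the new map is `y / (1 + P o'
      -- * y)`, which has derivative `1` at the origin.
      have h1 : ∀ᶠ y : ℂ in 𝓝 0, 1 + P o' * y ≠ 0 := by
        have h1 : ContinuousAt (fun y : ℂ => 1 + P o' * y) 0 := by fun_prop
        exact h1.eventually_ne (by simp)
      have h2 : HasDerivAt (fun y : ℂ => y * (1 + P o' * y)⁻¹) 1 0 := by
        have h3 : HasDerivAt (fun y : ℂ => 1 + P o' * y) (P o') 0 := hasDerivAt_affine _ _ _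
        refine ((hasDerivAt_id (0 : ℂ)).mul (h3.inv (by simp))).congr_deriv ?_
        simp
      have h3 := hf.root.comp (G := fun y : ℂ => y * (1 + P o' * y)⁻¹) (by
        filter_upwards [h1] with y hy
        exact contDiffAt_id.mul ((contDiffAt_const.add
          (contDiffAt_const.mul contDiffAt_id)).inv hy)) h2 one_ne_zero
      simp only [zero_mul] at h3
      refine h3.congr ?_
      filter_upwards [hf.root.continuousAt_ne] with z hz
      have hz' : f (A.endMap e z) ≠ 0 := by simpa using hz
      have h4 := hne (A.endMap e z)
      have h5 : 1 + P o' * -(f (A.endMap e z))⁻¹ =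
          (f (A.endMap e z) - P o') / f (A.endMap e z) := by field_simp; ring
      rw [h5]
      field_simp
    · rw [if_neg heo]
      have h1 := sub_ne_zero.2 (hP e heo he)
      refine (hf.leaf e heo).comp (G := fun y => -(y - P o')⁻¹) ?_ (hd _ h1)
        (inv_ne_zero (pow_ne_zero 2 h1))
      have h2 : ContinuousAt (fun y : ℂ => y - P o') (P e) := by fun_prop
      filter_upwards [h2.eventually_ne h1] with y hy using (hs y hy).1
  · by_cases heo : e = o
    · rw [if_pos heo, heo, hf.rootKind]
      cases b
      · trivial
      · rfl
    · rw [if_neg heo]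
      have h1 := sub_ne_zero.2 (hP e heo he)
      exact compat_image (G := fun y => -(y - P o')⁻¹) (hf.compat e heo) (hs _ h1) (hd _ h1)
        (inv_ne_zero (pow_ne_zero 2 h1))
  · have h1 := (hf.leaf o' ho).comp (G := fun y => y - P o') (c := 1)
      (.of_forall fun y => contDiffAt_id.sub contDiffAt_const)
      ((hasDerivAt_id _).sub_const _) one_ne_zero
    rw [sub_self] at h1
    refine h1.congr (.of_forall fun z => ?_)
    simp

/-! ### Reversal -/

/-- Reversal composes a collar with the inversion in the unit circle, and the exchange of source and
target composes the end coordinate with `-1 / z`. Together they form the reflection in the imaginary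
axis. -/
theorem endMap_reverse (A : Cob n m) (e : EndIdx m n) {z : ℂ} (hz : z ≠ 0) :
    A.reverse.endMap e z = A.endMap e.swap (-(starRingEnd ℂ) z) := by
  have hz' : -(starRingEnd ℂ) z ≠ 0 := by simpa using hz
  have hinv : ∀ w : ℂ, w ≠ 0 → (‖w‖ ^ 2)⁻¹ • w = ((starRingEnd ℂ) w)⁻¹ := by
    intro w hw
    rw [Complex.inv_def, Complex.conj_conj, Complex.normSq_conj, Complex.sq_norm, mul_comm]
    simp
  cases e with
  | inl j =>
    rw [Cob.endMap_inl_of_ne _ _ hz, Sum.swap_inl, Cob.endMap_inr_of_ne _ _ hz']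
    change A.tgt j (cylInv ⟨z, hz⟩) = _
    congr 1
    apply Subtype.ext
    simp only [cylInv, hinv z hz, inv_neg, neg_neg]
  | inr j =>
    rw [Cob.endMap_inr_of_ne _ _ hz, Sum.swap_inr, Cob.endMap_inl_of_ne _ _ hz']
    change A.src j (cylInv ⟨-z⁻¹, _⟩) = _
    congr 1
    apply Subtype.ext
    have hz2 : -z⁻¹ ≠ 0 := by simpa using hz
    simp only [cylInv, hinv _ hz2, map_neg, map_inv₀, inv_neg, inv_inv]

theorem signedSmoothAt_neg {w w' : ℂ → ℝ} {f : ℂ → ℂ} {z : ℂ} (h : SignedSmoothAt w w' f z) :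
    SignedSmoothAt (-w) (-w') f z := by
  simpa [SignedSmoothAt] using h

theorem reflect_signedSmoothAt (b : Web) (z : ℂ) :
    SignedSmoothAt (-b.weight) b.weight (fun z => -(starRingEnd ℂ) z) z := by
  have h1 := (reflect_signedSmooth univ).at isOpen_univ (mem_univ z)
  cases b with
  | biweb => exact h1
  | circle =>
    have hd : (fderiv ℝ (fun z : ℂ => -(starRingEnd ℂ) z) z).det = -1 := by
      have h : HasFDerivAt (fun z : ℂ => -(starRingEnd ℂ) z) (-(Complex.conjCLE : ℂ →L[ℝ] ℂ)) z :=
        (Complex.conjCLE : ℂ →L[ℝ] ℂ).hasFDerivAt.neg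
      rw [h.fderiv, det_eq]; simp
    refine ⟨h1.1, ?_⟩
    rw [hd]
    norm_num [Web.weight]

/-- The reversed cobordism has the reflected model. -/
theorem reverse (hf : IsModel A b o P f) : IsModel A.reverse b o.swap
    (fun e => -(starRingEnd ℂ) (P e.swap)) (fun x => -(starRingEnd ℂ) (f x)) := by
  have hinj : Function.Injective fun z : ℂ => -(starRingEnd ℂ) z := reflect.injective
  have hkind : ∀ e : EndIdx m n, endKind m n e = endKind n m e.swap := by
    rintro (j | j) <;> rfl
  have hsw : ∀ e : EndIdx m n, e ≠ o.swap → e.swap ≠ o := by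
    intro e he h
    exact he (by rw [← h, Sum.swap_swap])
  have hconj : ∀ z : ℂ, ContDiffAt ℝ ∞ (fun z : ℂ => -(starRingEnd ℂ) z) z := fun z =>
    (Complex.conjCLE.contDiff.neg : ContDiff ℝ ∞ fun z => -Complex.conjCLE z).contDiffAt
  have hgerm : ∀ {φ : ℂ → ℂ} {p : ℂ}, HasGerm φ p →
      HasGerm (fun z => -(starRingEnd ℂ) (φ (-(starRingEnd ℂ) z))) (-(starRingEnd ℂ) p) := by
    rintro φ p ⟨h, c, hh, he⟩
    have hlim : Filter.Tendsto (fun z : ℂ => -(starRingEnd ℂ) z) (𝓝 0) (𝓝 0) := by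
      simpa using (hconj 0).continuousAt.tendsto
    have hlim' : Filter.Tendsto (fun z : ℂ => -(starRingEnd ℂ) z) (𝓝[≠] 0) (𝓝[≠] 0) := by
      refine tendsto_nhdsWithin_iff.2 ⟨hlim.mono_left nhdsWithin_le_nhds, ?_⟩
      filter_upwards [self_mem_nhdsWithin] with z hz
      simpa using hz
    refine ⟨fun z => -(starRingEnd ℂ) (h (-(starRingEnd ℂ) z)), (starRingEnd ℂ) c,
      ⟨?_, by simp [hh.zero], ?_, by simpa using hh.ne⟩, ?_⟩
    · filter_upwards [hlim.eventually hh.smooth] with z hz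
      exact (hconj _).comp z (hz.comp z (hconj z))
    · have h1 : HasDerivAt (fun z : ℂ => -h (-z)) c 0 := by
        have h2 : HasDerivAt h c (-(0 : ℂ)) := by simpa using hh.deriv
        exact (h2.comp (0 : ℂ) (hasDerivAt_neg (0 : ℂ))).neg.congr_deriv (by ring)
      have h3 := h1.conj_conj
      simp only [map_zero] at h3
      refine h3.congr_of_eventuallyEq (.of_forall fun z => ?_)
      simp
    · filter_upwards [hlim'.eventually he] with z hz
      rw [hz]
  have hsmall : ∀ᶠ z : ℂ in 𝓝[≠] 0, z ≠ 0 := self_mem_nhdsWithin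
  refine ⟨fun x => ?_, hinj.comp hf.inj, fun y => ?_, fun e he => ?_, fun e he => ?_, ?_, ?_⟩
  · let c := chartAt (H := ℂ) (M := A.M) x
    have hc : c ∈ atlas ℂ A.M := chart_mem_atlas ℂ _
    have hx : x ∈ c.source := mem_chart_source (H := ℂ) (M := A.M) x
    have h1 := (singAt_toPlane_iff hc hx).1 (hf.sing x)
    have hc' : c ≫ₕ reflect.toOpenPartialHomeomorph ∈ atlas ℂ A.Opp := ⟨c, hc, rfl⟩
    refine (singAt_toPlane_iff (M := A.Opp) hc' ⟨hx, mem_univ _⟩).2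
      ⟨(hconj _).continuousAt.comp (f := f) h1.1, ?_⟩
    -- The chart of the reversed surface and the model are both reflected, so the orientation is
    -- reversed twice.
    have h2 : SignedSmoothAt Complex.im (-Complex.im) reflect.symm (reflect (c x)) := by
      have := signedSmoothAt_neg ((reflect_signedSmooth univ).at isOpen_univ
        (mem_univ (reflect (c x))))
      rwa [neg_neg] at this
    have h3 : SignedSmoothAt (-Complex.im) (-b.weight) (f ∘ c.symm)
        (reflect.symm (reflect (c x))) := by
      rw [reflect.symm_apply_apply]
      exact signedSmoothAt_neg h1.2
    exact SignedSmoothAt.comp (f := (f ∘ c.symm) ∘ reflect.symm)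
      (g := fun z => -(starRingEnd ℂ) z) (reflect_signedSmoothAt b _) (h3.comp h2)
  · have h1 : (∃ x, -(starRingEnd ℂ) (f x) = y) ↔ ∃ x, f x = -(starRingEnd ℂ) y := by
      refine exists_congr fun x => ⟨fun h => by rw [← h]; simp, fun h => by rw [h]; simp⟩
    refine h1.trans ((hf.range _).trans ⟨fun h e he h' => ?_, fun h e he h' => ?_⟩)
    · exact h e.swap (hsw e he) (by rw [h']; simp)
    · refine h e.swap (fun h2 => he (by rw [← e.swap_swap, h2, Sum.swap_swap])) ?_
      rw [Sum.swap_swap, ← h']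
      simp
  · refine (hgerm (hf.leaf e.swap (hsw e he))).congr ?_
    filter_upwards [hsmall] with z hz
    rw [endMap_reverse A e hz]
  · rw [hkind e]
    have := hf.compat e.swap (hsw e he)
    revert this
    generalize endKind n m e.swap = κ
    cases κ <;> cases b <;> simp [Compat]
  · have := hgerm hf.root
    simp only [map_zero, neg_zero] at this
    refine this.congr ?_
    filter_upwards [hsmall] with z hz
    rw [endMap_reverse A o.swap hz, Sum.swap_swap]
    simp
  · rw [hkind, Sum.swap_swap, hf.rootKind]

end IsModel

/-! ### Discs -/

/-- The difference quotient at the origin is `φ` itself. Thus radial collars, which are not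
holomorphic, still have a complex derivative at the puncture. -/
theorem hasDerivAt_continuous_mul {φ : ℂ → ℂ} (h : ContinuousAt φ 0) :
    HasDerivAt (fun z => φ z * z) (φ 0) 0 := by
  rw [hasDerivAt_iff_tendsto_slope_zero]
  refine (h.tendsto.mono_left nhdsWithin_le_nhds).congr' ?_
  filter_upwards [self_mem_nhdsWithin] with z hz
  have hz' : z ≠ 0 := hz
  simp only [zero_add, mul_zero, sub_zero, smul_eq_mul]
  field_simp

/-- The surface is by definition the plane without the centers of the holes, and the inclusion is
the model. Each hole collar is a translate of `z` times a smooth function of `‖z‖ ^ 2` that is `1`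
at the origin. The outer collar has the same form at infinity, with the factor `1 / √(1 + R ^ 2 *
‖z‖ ^ 2)`. -/
theorem isModel_disc {b : Web} {n : List Web} {p : Fin n.length → ℂ} {R : ℝ}
    (h : IsDisc b n p R) : IsModel (Cob.disc h) b (.inr 0) (Sum.elim p fun _ => 0)
      (fun x => x.1) := by
  have hroot : ∀ e : EndIdx n [b], e ≠ .inr 0 → ∃ j, e = .inl j := by
    rintro (j | j) he
    · exact ⟨j, rfl⟩
    · exact absurd (congrArg Sum.inr (Subsingleton.elim (α := Fin 1) j 0)) he
  refine ⟨fun x => ?_, Subtype.val_injective, fun y => ?_, fun e he => ?_, fun e he => ?_, ?_, rfl⟩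
  · let c : OpenPartialHomeomorph (Punctured b p) ℂ :=
      (punctured_isOpenEmbedding b p).toOpenPartialHomeomorph _
    have hc : c ∈ atlas ℂ (Punctured b p) := chart_mem_atlas ℂ x
    refine (singAt_toPlane_iff (M := Punctured b p) hc (mem_univ _)).2
      ⟨continuous_subtype_val.continuousAt, ?_⟩
    refine (planeChart_symm_signedSmoothAt b x.1).congr ?_
    have hx : c x ∈ c.target := c.map_source (mem_univ _)
    filter_upwards [c.open_target.mem_nhds hx] with y hy
    obtain ⟨w, rfl⟩ : ∃ w : Punctured b p, flatten b w.1 = y := by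
      simpa [c] using hy
    have h1 : c.symm (flatten b w.1) = w := c.left_inv (mem_univ w)
    have h2 : (planeChart b).symm (flatten b w.1) = w.1 :=
      (planeChart b).left_inv (planeChart_source b w.1)
    exact (congrArg Subtype.val h1).trans h2.symm
  · constructor
    · rintro ⟨x, rfl⟩ e he
      obtain ⟨j, rfl⟩ := hroot e he
      exact fun h => x.2 ⟨j, h.symm⟩
    · intro hy
      refine ⟨⟨y, ?_⟩, rfl⟩
      rintro ⟨j, rfl⟩
      exact hy (.inl j) (by simp) rfl
  · obtain ⟨j, rfl⟩ := hroot e he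
    have hs : ContDiff ℝ ∞ fun z : ℂ => (((√(1 + ‖z‖ ^ 2))⁻¹ : ℝ) : ℂ) := by
      refine Complex.ofRealCLM.contDiff.comp (ContDiff.inv (ContDiff.sqrt
        (contDiff_const.add (contDiff_norm_sq ℝ)) fun z => ?_) fun z => ?_) <;> positivity
    refine ⟨fun z => p j + ((√(1 + ‖z‖ ^ 2))⁻¹ : ℝ) * z, 1, ⟨.of_forall fun z =>
      (contDiff_const.add (hs.mul contDiff_id)).contDiffAt, by simp, ?_, one_ne_zero⟩, ?_⟩
    · have h1 := (hasDerivAt_continuous_mul (hs.continuous.continuousAt (x := 0))).const_add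
        (p j)
      simpa using h1
    · filter_upwards [self_mem_nhdsWithin] with z hz
      rw [Cob.endMap_inl_of_ne _ _ hz]
      change holeMap (p j) z = _
      rw [holeMap, Complex.real_smul]
  · obtain ⟨j, rfl⟩ := hroot e he
    have hk := h.kind j
    change Compat (n.get j) b (p j)
    revert hk
    generalize n.get j = κ
    cases κ <;> cases b <;> simp only [Compat]
    · simp
    · exact fun h => lt_of_lt_of_le one_pos h
    · exact id
    · exact id
  · have hs : ContDiff ℝ ∞ fun z : ℂ => (((√(1 + R ^ 2 * ‖z‖ ^ 2))⁻¹ : ℝ) : ℂ) := by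
      refine Complex.ofRealCLM.contDiff.comp (ContDiff.inv (ContDiff.sqrt
        (contDiff_const.add (contDiff_const.mul (contDiff_norm_sq ℝ))) fun z => ?_) fun z => ?_)
        <;> positivity
    refine ⟨fun z => 0 + ((√(1 + R ^ 2 * ‖z‖ ^ 2))⁻¹ : ℝ) * z, 1, ⟨.of_forall fun z =>
      (contDiff_const.add (hs.mul contDiff_id)).contDiffAt, by simp, ?_, one_ne_zero⟩, ?_⟩
    · have h1 := (hasDerivAt_continuous_mul (hs.continuous.continuousAt (x := 0))).const_add
        (0 : ℂ)
      simpa using h1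
    · filter_upwards [self_mem_nhdsWithin] with z hz
      rw [Cob.endMap_inr_of_ne _ _ hz]
      change -(outerMap R (-z⁻¹))⁻¹ = _
      rw [outerMap, Complex.real_smul, norm_neg, norm_inv, inv_pow, div_inv_eq_mul]
      simp [mul_comm]

end SingCob

namespace SingCob

/-! ### Horizontal shifts -/

/-- The derivative is continuous and vanishes outside `[0, 1]`. -/
theorem exists_deriv_smoothTransition_bound : ∃ C : ℝ, 0 < C ∧
    ∀ x, deriv Real.smoothTransition x ≤ C := by
  have hc : Continuous (deriv Real.smoothTransition) :=
    (Real.smoothTransition.contDiff (n := 1)).continuous_deriv le_rfl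
  obtain ⟨C, hC⟩ := (isCompact_Icc (a := (0 : ℝ)) (b := 1)).bddAbove_image hc.continuousOn
  refine ⟨max C 1, by positivity, fun x => ?_⟩
  by_cases hx : x ∈ Icc (0 : ℝ) 1
  · exact (hC (mem_image_of_mem _ hx)).trans (le_max_left _ _)
  · have h0 : deriv Real.smoothTransition x = 0 := by
      rcases lt_or_ge x 0 with h | h
      · have : Real.smoothTransition =ᶠ[𝓝 x] fun _ => 0 := by
          filter_upwards [gt_mem_nhds h] with y hy using Real.smoothTransition.zero_of_nonpos hy.le
        rw [this.deriv_eq, deriv_const]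
      · have h1 : 1 < x := by
          by_contra h'
          exact hx ⟨h, not_lt.1 h'⟩
        have : Real.smoothTransition =ᶠ[𝓝 x] fun _ => 1 := by
          filter_upwards [lt_mem_nhds h1] with y hy using Real.smoothTransition.one_of_one_le hy.le
        rw [this.deriv_eq, deriv_const]
    rw [h0]
    positivity

/-- A bump of height `d` whose decreasing part is flat. -/
theorem exists_flat_bump {t₀ t : ℝ} (ht : t₀ < t) {d : ℝ} (hd : 0 ≤ d) :
    ∃ u : ℝ → ℝ, ContDiff ℝ ∞ u ∧ (∀ x, -1 < deriv u x) ∧ (∀ x ≤ t₀, u x = 0) ∧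
      (∀ᶠ x in 𝓝 t, u x = d) ∧ ∃ X, ∀ x ≥ X, u x = 0 := by
  obtain ⟨C, hC, hCb⟩ := exists_deriv_smoothTransition_bound
  -- `L` is the length of the descent from height `d`. As `d * C < L`, the slope stays above `-1`.
  obtain ⟨L, hL, hdL⟩ : ∃ L : ℝ, 0 < L ∧ d * C < L := ⟨d * C + 1, by positivity, by linarith⟩
  -- The ascent starts at `t₀` and ends at the midpoint of `t₀` and `t`, and the descent starts at
  -- `t + 1`, so the bump equals `d` around `t`.
  let k : ℝ := 2 / (t - t₀)
  have hk : 0 < k := div_pos two_pos (sub_pos.2 ht)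
  have hχ : ContDiff ℝ ∞ Real.smoothTransition := Real.smoothTransition.contDiff
  have hχd : Differentiable ℝ Real.smoothTransition := hχ.differentiable (by simp)
  have hderiv : ∀ x, HasDerivAt (fun x => d * Real.smoothTransition (k * (x - t₀)) -
      d * Real.smoothTransition (L⁻¹ * (x - (t + 1))))
      (d * (deriv Real.smoothTransition (k * (x - t₀)) * k) -
        d * (deriv Real.smoothTransition (L⁻¹ * (x - (t + 1))) * L⁻¹)) x := by
    intro x
    have h1 : ∀ a c : ℝ, HasDerivAt (fun x => a * (x - c)) a x := fun a c => by
      simpa using ((hasDerivAt_id x).sub_const c).const_mul a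
    exact (((hχd _).hasDerivAt.comp x (h1 k t₀)).const_mul d).sub
      (((hχd _).hasDerivAt.comp x (h1 L⁻¹ (t + 1))).const_mul d)
  refine ⟨fun x => d * Real.smoothTransition (k * (x - t₀)) -
    d * Real.smoothTransition (L⁻¹ * (x - (t + 1))), ?_, fun x => ?_, fun x hx => ?_, ?_,
    max t (t + 1 + L), fun x hx => ?_⟩
  · exact (contDiff_const.mul (hχ.comp (contDiff_const.mul (contDiff_id.sub contDiff_const)))).sub
      (contDiff_const.mul (hχ.comp (contDiff_const.mul (contDiff_id.sub contDiff_const))))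
  · rw [(hderiv x).deriv]
    have h1 : 0 ≤ deriv Real.smoothTransition (k * (x - t₀)) :=
      Real.smoothTransition.monotone.deriv_nonneg
    have h2 : d * (deriv Real.smoothTransition (L⁻¹ * (x - (t + 1))) * L⁻¹) < 1 := by
      calc _ ≤ d * (C * L⁻¹) := by gcongr; exact hCb _
        _ = d * C / L := by ring
        _ < 1 := (div_lt_one hL).2 hdL
    have h3 : 0 ≤ d * (deriv Real.smoothTransition (k * (x - t₀)) * k) := by positivity
    linarith
  · have h1 : k * (x - t₀) ≤ 0 := mul_nonpos_of_nonneg_of_nonpos hk.le (by linarith)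
    have h2 : L⁻¹ * (x - (t + 1)) ≤ 0 :=
      mul_nonpos_of_nonneg_of_nonpos (by positivity) (by linarith)
    simp [Real.smoothTransition.zero_of_nonpos h1, Real.smoothTransition.zero_of_nonpos h2]
  · filter_upwards [lt_mem_nhds (show (t + t₀) / 2 < t by linarith),
      gt_mem_nhds (show t < t + 1 by linarith)] with x h3 h4
    have h1 : 1 ≤ k * (x - t₀) := by
      change 1 ≤ 2 / (t - t₀) * (x - t₀)
      rw [div_mul_eq_mul_div, le_div_iff₀ (sub_pos.2 ht)]
      linarith
    have h2 : L⁻¹ * (x - (t + 1)) ≤ 0 :=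
      mul_nonpos_of_nonneg_of_nonpos (by positivity) (by linarith)
    simp [Real.smoothTransition.one_of_one_le h1, Real.smoothTransition.zero_of_nonpos h2]
  · have hx1 := (le_max_left _ _).trans hx
    have hx2 := (le_max_right _ _).trans hx
    have h1 : 1 ≤ k * (x - t₀) := by
      change 1 ≤ 2 / (t - t₀) * (x - t₀)
      rw [div_mul_eq_mul_div, le_div_iff₀ (sub_pos.2 ht)]
      linarith
    have h2 : 1 ≤ L⁻¹ * (x - (t + 1)) := by
      rw [inv_mul_eq_div, le_div_iff₀ hL]
      linarith
    simp [Real.smoothTransition.one_of_one_le h1, Real.smoothTransition.one_of_one_le h2]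

/-- A plateau around `y₀`. -/
theorem exists_plateau (y₀ : ℝ) : ∃ φ : ℝ → ℝ, ContDiff ℝ ∞ φ ∧ (∀ y, 0 ≤ φ y) ∧ (∀ y, φ y ≤ 1) ∧
    (∀ᶠ y in 𝓝 y₀, φ y = 1) ∧ ∀ y, 1 / 2 ≤ |y - y₀| → φ y = 0 := by
  -- The argument exceeds `1` near `y₀` and is nonpositive once `|y - y₀| ≥ 1 / 2`.
  refine ⟨fun y => Real.smoothTransition (2 - 8 * (y - y₀) ^ 2), ?_, fun y =>
    Real.smoothTransition.nonneg _, fun y => Real.smoothTransition.le_one _, ?_, fun y hy => ?_⟩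
  · exact Real.smoothTransition.contDiff.comp (contDiff_const.sub (contDiff_const.mul
      ((contDiff_id.sub contDiff_const).pow 2)))
  · have h1 : ContinuousAt (fun y : ℝ => 8 * (y - y₀) ^ 2) y₀ := by fun_prop
    filter_upwards [h1.eventually (gt_mem_nhds (show 8 * (y₀ - y₀) ^ 2 < 1 by simp))] with y hy
    exact Real.smoothTransition.one_of_one_le (by linarith)
  · refine Real.smoothTransition.zero_of_nonpos ?_
    have : (1 / 2 : ℝ) ^ 2 ≤ |y - y₀| ^ 2 := by gcongr
    rw [sq_abs] at this
    linarith

/-- A diffeomorphism of the plane with compact support that moves `t + i y₀` to the right and fixes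
the points on the left of `t₀`, as well as those far from the height `y₀`. -/
theorem exists_shift {t₀ t : ℝ} (ht : t₀ < t) {d : ℝ} (hd : 0 ≤ d) (y₀ : ℝ) :
    ∃ G : ℂ → ℂ, Function.Bijective G ∧
      (∀ (b : Web) y, SignedSmoothAt b.weight b.weight G y) ∧ (∀ y, y.re ≤ t₀ → G y = y) ∧
      (∀ y, 1 / 2 ≤ |y.im - y₀| → G y = y) ∧
      (∀ᶠ y in 𝓝 (t + y₀ * Complex.I : ℂ), G y = y + d) ∧ ∃ R : ℝ, ∀ y, R ≤ ‖y‖ → G y = y := by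
  obtain ⟨u, hu, hud, hu0, hut, X, huX⟩ := exists_flat_bump ht hd
  obtain ⟨φ, hφ, hφ0, hφ1, hφy, hφz⟩ := exists_plateau y₀
  have hG : ContDiff ℝ ∞ fun y : ℂ => y + ((φ y.im * u y.re : ℝ) : ℂ) :=
    contDiff_id.add (Complex.ofRealCLM.contDiff.comp
      ((hφ.comp Complex.imCLM.contDiff).mul (hu.comp Complex.reCLM.contDiff)))
  -- This is the slope on the horizontal line at height `s`, and also the Jacobian of the shift,
  -- because heights are unchanged. It is positive since `0 ≤ φ ≤ 1` and `u' > -1`; so every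
  -- horizontal line is mapped bijectively to itself.
  have hpos : ∀ s x, 0 < 1 + φ s * deriv u x := by
    intro s x
    rcases (hφ0 s).eq_or_lt with h | h
    · simp [← h]
    · nlinarith [mul_pos h (neg_lt_iff_pos_add.1 (hud x)), hφ1 s]
  have hmono : ∀ s, StrictMono fun x => x + φ s * u x := by
    intro s
    refine strictMono_of_deriv_pos fun x => ?_
    have h1 : HasDerivAt (fun x => x + φ s * u x) (1 + φ s * deriv u x) x :=
      (hasDerivAt_id x).add (((hu.differentiable (by simp)) x).hasDerivAt.const_mul _)
    rw [h1.deriv]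
    exact hpos s x
  have hsurj : ∀ s, Function.Surjective fun x => x + φ s * u x := by
    intro s
    refine (continuous_id.add (continuous_const.mul hu.continuous)).surjective ?_ ?_
    · refine Filter.tendsto_id.congr' ?_
      filter_upwards [Filter.eventually_ge_atTop X] with x hx
      simp [huX x hx]
    · refine Filter.tendsto_id.congr' ?_
      filter_upwards [Filter.eventually_le_atBot t₀] with x hx
      simp [hu0 x hx]
  refine ⟨fun y : ℂ => y + ((φ y.im * u y.re : ℝ) : ℂ), ⟨fun y z h => ?_, fun y => ?_⟩,
    fun b y => SignedSmoothAt.of_det_pos hG.contDiffAt ?_ ?_, fun y hy => ?_, fun y hy => ?_,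
    ?_, |y₀| + 1 + |X| + |t₀|, fun y hy => ?_⟩
  · have h1 := congrArg Complex.im h
    have h2 := congrArg Complex.re h
    simp only [Complex.add_im, Complex.ofReal_im, add_zero, Complex.add_re,
      Complex.ofReal_re] at h1 h2
    rw [h1] at h2
    exact Complex.ext ((hmono _).injective h2) h1
  · obtain ⟨x, hx⟩ := hsurj y.im y.re
    refine ⟨⟨x, y.im⟩, Complex.ext ?_ ?_⟩
    · simpa using hx
    · simp
  · have h1 : HasFDerivAt (fun y : ℂ => y + ((φ y.im * u y.re : ℝ) : ℂ))
        (ContinuousLinearMap.id ℝ ℂ + Complex.ofRealCLM.comp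
          (φ y.im • (deriv u y.re • Complex.reCLM) +
            u y.re • (deriv φ y.im • Complex.imCLM))) y := by
      have h2 : HasFDerivAt (fun y : ℂ => u y.re) (deriv u y.re • Complex.reCLM) y :=
        ((hu.differentiable (by simp)) y.re).hasDerivAt.comp_hasFDerivAt y
          Complex.reCLM.hasFDerivAt
      have h3 : HasFDerivAt (fun y : ℂ => φ y.im) (deriv φ y.im • Complex.imCLM) y :=
        ((hφ.differentiable (by simp)) y.im).hasDerivAt.comp_hasFDerivAt y
          Complex.imCLM.hasFDerivAt
      exact (hasFDerivAt_id y).add (Complex.ofRealCLM.hasFDerivAt.comp y (h3.mul h2))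
    rw [h1.fderiv, det_eq]
    simp
    exact hpos y.im y.re
  · cases b <;> simp [Web.weight]
  · simp [hu0 _ hy]
  · simp [hφz _ hy]
  · have h1 : ContinuousAt Complex.re (t + y₀ * Complex.I : ℂ) := Complex.continuous_re.continuousAt
    have h2 : ContinuousAt Complex.im (t + y₀ * Complex.I : ℂ) := Complex.continuous_im.continuousAt
    have h3 : (t + y₀ * Complex.I : ℂ).re = t := by simp
    have h4 : (t + y₀ * Complex.I : ℂ).im = y₀ := by simp
    rw [ContinuousAt, h3] at h1
    rw [ContinuousAt, h4] at h2
    filter_upwards [h1.eventually hut, h2.eventually hφy] with y h5 h6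
    simp [h5, h6]
  · by_cases h1 : 1 / 2 ≤ |y.im - y₀|
    · simp [hφz _ h1]
    · have h2 : |y.im| < |y₀| + 1 := by
        have := abs_add_le (y.im - y₀) y₀
        rw [sub_add_cancel] at this
        linarith
      have h3 := Complex.norm_le_abs_re_add_abs_im y
      have h4 : |X| + |t₀| < |y.re| := by linarith
      rcases le_total y.re t₀ with h5 | h5
      · simp [hu0 _ h5]
      · have h6 : X ≤ y.re := by
          rcases abs_cases y.re with ⟨h7, -⟩ | ⟨h7, h8⟩
          · linarith [le_abs_self X, abs_nonneg t₀]
          · linarith [neg_abs_le t₀, abs_nonneg X]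
        simp [huX _ h6]

end SingCob

namespace SingCob

/-! ### Open embeddings of surfaces -/

/-- With respect to a chart and its lift along `ι`, the map `ι` is the identity. -/
theorem singAt_of_lift {M N : Type} [TopologicalSpace M] [ChartedSpace ℂ M]
    [HasGroupoid M singGroupoid] [TopologicalSpace N] [ChartedSpace ℂ N]
    [HasGroupoid N singGroupoid] {ι : M → N} (hι : IsOpenEmbedding ι) {x : M}
    (h : (chartAt ℂ x).lift_openEmbedding hι ∈ atlas ℂ N) : SingAt ι x := by
  refine (singAt_iff (chart_mem_atlas ℂ x) h (mem_chart_source ℂ x)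
    ⟨x, mem_chart_source ℂ x, rfl⟩).2 ⟨hι.continuous.continuousAt,
      (SignedSmoothAt.id_at _ _).congr ?_⟩
  filter_upwards [(chartAt ℂ x).open_target.mem_nhds (mem_chart_target ℂ x)] with y hy
  refine ((chartAt ℂ x).lift_openEmbedding_apply hι).trans ?_
  exact (chartAt ℂ x).right_inv hy

namespace Cob

theorem glueInl_singAt {n m k : List Web} (A : Cob n m) (B : Cob m k) (x : A.M) :
    SingAt (N := (A.comp B).M) (glueInl A B) x := by
  have h : IsOpenEmbedding (Y := (A.comp B).M) (glueInl A B) := glueInl_isOpenEmbedding A B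
  exact singAt_of_lift h (Or.inl ⟨_, chart_mem_atlas ℂ x, rfl⟩)

theorem glueInr_singAt {n m k : List Web} (A : Cob n m) (B : Cob m k) (x : B.M) :
    SingAt (N := (A.comp B).M) (glueInr A B) x := by
  have h : IsOpenEmbedding (Y := (A.comp B).M) (glueInr A B) := glueInr_isOpenEmbedding A B
  exact singAt_of_lift h (Or.inr ⟨_, chart_mem_atlas ℂ x, rfl⟩)

theorem sumInl_singAt {n m n' m' : List Web} (A : Cob n m) (B : Cob n' m') (x : A.M) :
    SingAt (N := (A.tensor B).M) Sum.inl x := by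
  have h : IsOpenEmbedding (Y := (A.tensor B).M) Sum.inl := IsOpenEmbedding.inl
  refine singAt_of_lift h ?_
  have h1 := chart_mem_atlas ℂ (Sum.inl x : A.M ⊕ B.M)
  rwa [ChartedSpace.sum_chartAt_inl] at h1

theorem sumInr_singAt {n m n' m' : List Web} (A : Cob n m) (B : Cob n' m') (x : B.M) :
    SingAt (N := (A.tensor B).M) Sum.inr x := by
  have h : IsOpenEmbedding (Y := (A.tensor B).M) Sum.inr := IsOpenEmbedding.inr
  refine singAt_of_lift h ?_
  have h1 := chart_mem_atlas ℂ (Sum.inr x : A.M ⊕ B.M)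
  rwa [ChartedSpace.sum_chartAt_inr] at h1

/-- For `r < 1` the set is cut out of the closed outer part by the complement of the image of `r <
‖z‖`, which is open because ends are local diffeomorphisms. -/
theorem endMap_closed_of_pos {n m : List Web} (A : Cob n m) (e : EndIdx n m) {r : ℝ}
    (hr : 0 < r) : IsClosed (A.endMap e '' {z | z ≠ 0 ∧ ‖z‖ ≤ r}) := by
  rcases le_total 1 r with h1 | h1
  · exact A.endMap_closed e h1
  have ho : IsOpen (A.endMap e '' {z | r < ‖z‖}) := by
    rw [isOpen_iff_mem_nhds]
    rintro _ ⟨z, hz, rfl⟩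
    have hz0 : z ≠ 0 := norm_pos_iff.1 (hr.trans hz)
    rw [← (A.endMap_singAt e hz0).map_nhds_eq]
    exact Filter.image_mem_map ((isOpen_lt continuous_const continuous_norm).mem_nhds hz)
  convert (A.endMap_closed_one e).inter ho.isClosed_compl using 1
  ext x
  constructor
  · rintro ⟨z, ⟨hz, hz1⟩, rfl⟩
    refine ⟨⟨z, ⟨hz, hz1.trans h1⟩, rfl⟩, ?_⟩
    rintro ⟨w, hw, h⟩
    have hw' : r < ‖w‖ := hw
    obtain ⟨-, rfl⟩ := A.endMap_inj (norm_pos_iff.1 (hr.trans hw')) hz h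
    linarith
  · rintro ⟨⟨z, ⟨hz, -⟩, rfl⟩, h⟩
    refine ⟨z, ⟨hz, ?_⟩, rfl⟩
    by_contra h'
    exact h ⟨z, not_le.1 h', rfl⟩

theorem comp_endMap_inl {n m k : List Web} (A : Cob n m) (B : Cob m k) (j : Fin n.length) {z : ℂ}
    (hz : z ≠ 0) : (A.comp B).endMap (.inl j) z = glueInl A B (A.endMap (.inl j) z) := by
  rw [endMap_inl_of_ne _ _ hz, endMap_inl_of_ne _ _ hz]
  rfl

theorem comp_endMap_inr {n m k : List Web} (A : Cob n m) (B : Cob m k) (j : Fin k.length) {z : ℂ}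
    (hz : z ≠ 0) : (A.comp B).endMap (.inr j) z = glueInr A B (B.endMap (.inr j) z) := by
  rw [endMap_inr_of_ne _ _ hz, endMap_inr_of_ne _ _ hz]
  rfl

theorem glueInl_eq_glueInr_iff {n m k : List Web} (A : Cob n m) (B : Cob m k) {x : A.M} {y : B.M} :
    glueInl A B x = glueInr A B y ↔
      ∃ j z, z ≠ 0 ∧ x = A.endMap (.inr j) z ∧ y = B.endMap (.inl j) (-z⁻¹) := by
  rw [glueInl_eq_glueInr]
  constructor
  · rintro ⟨j, z, rfl, rfl⟩
    have hz : (z : ℂ) ≠ 0 := z.2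
    refine ⟨j, -(z : ℂ)⁻¹, by simpa using hz, (A.endMap_inr j z).symm, ?_⟩
    rw [inv_neg, inv_inv, neg_neg, endMap_inl]
  · rintro ⟨j, z, hz, rfl, rfl⟩
    exact ⟨j, ⟨-z⁻¹, by simpa using hz⟩, endMap_inr_of_ne _ _ hz, endMap_inl_of_ne _ _ _⟩

/-- The identification `z ↦ -1 / z` exchanges the inside and the outside of the unit circle. A point
that lies beyond the seam in one piece therefore has a representative on the near side of the seam
in the other. -/
theorem glue_core_cases {n m k : List Web} (A : Cob n m) (B : Cob m k) (x : (A.comp B).M) :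
      (∃ a, (∀ j z, z ≠ 0 → A.endMap (.inr j) z = a → 1 ≤ ‖z‖) ∧ glueInl A B a = x) ∨
      ∃ a, (∀ j z, z ≠ 0 → B.endMap (.inl j) z = a → 1 ≤ ‖z‖) ∧ glueInr A B a = x := by
  rcases glue_cases A B x with ⟨a, rfl⟩ | ⟨a, rfl⟩
  · by_cases h : ∀ j z, z ≠ 0 → A.endMap (.inr j) z = a → 1 ≤ ‖z‖
    · exact .inl ⟨a, h, rfl⟩
    · push Not at h
      obtain ⟨j, z, hz, rfl, hz1⟩ := h
      refine .inr ⟨B.endMap (.inl j) (-z⁻¹), fun i w hw h => ?_,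
        ((glueInl_eq_glueInr_iff A B).2 ⟨j, z, hz, rfl, rfl⟩).symm⟩
      obtain ⟨-, rfl⟩ := B.endMap_inj hw (by simpa using hz) h
      rw [norm_neg, norm_inv]
      exact (one_le_inv₀ (norm_pos_iff.2 hz)).2 hz1.le
  · by_cases h : ∀ j z, z ≠ 0 → B.endMap (.inl j) z = a → 1 ≤ ‖z‖
    · exact .inr ⟨a, h, rfl⟩
    · push Not at h
      obtain ⟨j, z, hz, rfl, hz1⟩ := h
      refine .inl ⟨A.endMap (.inr j) (-z⁻¹), fun i w hw h => ?_,
        (glueInl_eq_glueInr_iff A B).2 ⟨j, -z⁻¹, by simpa using hz, rfl, by simp⟩⟩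
      obtain ⟨-, rfl⟩ := A.endMap_inj hw (by simpa using hz) h
      rw [norm_neg, norm_inv]
      exact (one_le_inv₀ (norm_pos_iff.2 hz)).2 hz1.le

end Cob

/-! ### Planar cores -/

/-- `f` maps the part of the surface of `A` that remains when the ends in `J` are cut along their
unit circles bijectively to a region `R` in the plane of kind `b`, and is a morphism on a
neighbourhood of this part. The collars become the maps `σ e`. -/
structure IsCore {n m : List Web} (A : Cob n m) (b : Web) (J : EndIdx n m → Prop) (f : A.M → ℂ)
    (R : Set ℂ) (σ : EndIdx n m → ℂ → ℂ) : Prop where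
  sing : ∀ x, (∀ e z, J e → z ≠ 0 → A.endMap e z = x → 1 / 4 < ‖z‖) → SingAt (N := Plane b) f x
  bij : BijOn f {x | ∀ e z, J e → z ≠ 0 → A.endMap e z = x → 1 ≤ ‖z‖} R
  seam : ∀ e z, z ≠ 0 → ‖z‖ < 4 → f (A.endMap e z) = σ e z

namespace IsCore

open Cob

variable {n m k : List Web} {b : Web}

section Comp

variable {A : Cob n m} {B : Cob m k} {JA : EndIdx n m → Prop} {JB : EndIdx m k → Prop}
  {f : A.M → ℂ} {g : B.M → ℂ} {RA RB : Set ℂ} {σA : EndIdx n m → ℂ → ℂ} {σB : EndIdx m k → ℂ → ℂ}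

/-- A map on a glued surface. -/
theorem exists_glue (hs : ∀ j z, z ≠ 0 → 1 / 4 < ‖z‖ → ‖z‖ < 4 →
      f (A.endMap (.inr j) z) = g (B.endMap (.inl j) (-z⁻¹))) :
    ∃ F : (A.comp B).M → ℂ,
      (∀ a, (∀ j z, z ≠ 0 → A.endMap (.inr j) z = a → 1 / 4 < ‖z‖) → F (glueInl A B a) = f a) ∧
      (∀ a, (∀ j z, z ≠ 0 → B.endMap (.inl j) z = a → 1 / 4 < ‖z‖) → F (glueInr A B a) = g a) := by
  classical
  -- The two maps are only trusted away from the tips `‖z‖ ≤ 1 / 4` of the glued ends. The condition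
  -- is stable under passage to the other piece exactly on the annulus `1 / 4 < ‖z‖ < 4`, which `z ↦
  -- -1 / z` preserves; there the maps agree, so the value is well defined.
  have hF : ∀ x : (A.comp B).M, ∃ y,
      (∀ a, (∀ j z, z ≠ 0 → A.endMap (.inr j) z = a → 1 / 4 < ‖z‖) → glueInl A B a = x →
        y = f a) ∧
      (∀ a, (∀ j z, z ≠ 0 → B.endMap (.inl j) z = a → 1 / 4 < ‖z‖) → glueInr A B a = x →
        y = g a) := by
    intro x
    have hcross : ∀ a a', glueInl A B a = glueInr A B a' →
        (∀ j z, z ≠ 0 → A.endMap (.inr j) z = a → 1 / 4 < ‖z‖) →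
        (∀ j z, z ≠ 0 → B.endMap (.inl j) z = a' → 1 / 4 < ‖z‖) → f a = g a' := by
      intro a a' h h1 h2
      obtain ⟨j, z, hz, rfl, rfl⟩ := (glueInl_eq_glueInr_iff A B).1 h
      have h3 := h1 j z hz rfl
      have h4 := h2 j (-z⁻¹) (by simpa using hz) rfl
      rw [norm_neg, norm_inv, one_div, inv_lt_inv₀ (by norm_num) (norm_pos_iff.2 hz)] at h4
      exact hs j z hz h3 h4
    rcases glue_core_cases A B x with ⟨a, ha, rfl⟩ | ⟨a, ha, rfl⟩
    · refine ⟨f a, fun a' _ h => by rw [glueInl_inj A B h], fun a' h1 h => ?_⟩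
      exact hcross a a' h.symm (fun j z hz h => by linarith [ha j z hz h]) h1
    · refine ⟨g a, fun a' h1 h => ?_, fun a' _ h => by rw [glueInr_inj A B h]⟩
      exact (hcross a' a h h1 fun j z hz h => by linarith [ha j z hz h]).symm
  choose F hF1 hF2 using hF
  exact ⟨F, fun a ha => hF1 _ a ha rfl, fun a ha => hF2 _ a ha rfl⟩

/-- Cores are glued along common circles. -/
theorem comp (hA : IsCore A b JA f RA σA) (hB : IsCore B b JB g RB σB) (hJA : ∀ j, JA (.inr j))
    (hJB : ∀ j, JB (.inl j))
    (hσ : ∀ j z, z ≠ 0 → σA (.inr j) z = σB (.inl j) (-z⁻¹))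
    (hR : ∀ y ∈ RA, y ∈ RB → ∃ j z, ‖z‖ = 1 ∧ y = σA (.inr j) z) :
    ∃ F, IsCore (A.comp B) b (Sum.elim (fun j => JA (.inl j)) (fun j => JB (.inr j))) F (RA ∪ RB)
      (Sum.elim (fun j => σA (.inl j)) (fun j => σB (.inr j))) := by
  obtain ⟨F, hF1, hF2⟩ := exists_glue (A := A) (B := B) (f := f) (g := g) (by
    intro j z hz h1 h2
    rw [hA.seam _ z hz h2, hB.seam _ _ (by simpa using hz), hσ j z hz]
    rw [norm_neg, norm_inv, ← inv_inv (4 : ℝ), inv_lt_inv₀ (norm_pos_iff.2 hz) (by norm_num),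
      ← one_div]
    exact h1)
  have hin1 : ∀ j (z : ℂ), z ≠ 0 → F (glueInl A B (A.endMap (.inl j) z)) =
      f (A.endMap (.inl j) z) := fun j z hz => hF1 _ fun i w hw h => by
    cases (A.endMap_inj hw hz h).1
  have hin2 : ∀ j (z : ℂ), z ≠ 0 → F (glueInr A B (B.endMap (.inr j) z)) =
      g (B.endMap (.inr j) z) := fun j z hz => hF2 _ fun i w hw h => by
    cases (B.endMap_inj hw hz h).1
  have hclA : IsClosed (⋃ j, A.endMap (.inr j) '' {z | z ≠ 0 ∧ ‖z‖ ≤ 1 / 4}) :=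
    isClosed_iUnion_of_finite fun j => A.endMap_closed_of_pos _ (by norm_num)
  have hclB : IsClosed (⋃ j, B.endMap (.inl j) '' {z | z ≠ 0 ∧ ‖z‖ ≤ 1 / 4}) :=
    isClosed_iUnion_of_finite fun j => B.endMap_closed_of_pos _ (by norm_num)
  -- The removed tips form a closed set, so `F` agrees with `f` on a whole neighbourhood, also of
  -- points on the seam.
  have hs1 : ∀ a, (∀ j z, z ≠ 0 → A.endMap (.inr j) z = a → 1 / 4 < ‖z‖) →
      SingAt (N := Plane b) f a → SingAt (N := Plane b) F (glueInl A B a) := by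
    intro a ha h
    refine SingAt.cancel_right (N := (A.comp B).M) (K := Plane b) (glueInl_singAt A B a)
      (h.congr ?_)
    have hmem : a ∈ (⋃ j, A.endMap (.inr j) '' {z | z ≠ 0 ∧ ‖z‖ ≤ 1 / 4})ᶜ := by
      simp only [mem_compl_iff, mem_iUnion, not_exists]
      rintro j ⟨z, ⟨hz, hz1⟩, hza⟩
      exact absurd (ha j z hz hza) (not_lt.2 hz1)
    filter_upwards [hclA.isOpen_compl.mem_nhds hmem] with a' ha'
    refine hF1 a' fun j z hz hza => ?_
    by_contra h'
    exact ha' (mem_iUnion.2 ⟨j, z, ⟨hz, not_lt.1 h'⟩, hza⟩)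
  have hs2 : ∀ a, (∀ j z, z ≠ 0 → B.endMap (.inl j) z = a → 1 / 4 < ‖z‖) →
      SingAt (N := Plane b) g a → SingAt (N := Plane b) F (glueInr A B a) := by
    intro a ha h
    refine SingAt.cancel_right (N := (A.comp B).M) (K := Plane b) (glueInr_singAt A B a)
      (h.congr ?_)
    have hmem : a ∈ (⋃ j, B.endMap (.inl j) '' {z | z ≠ 0 ∧ ‖z‖ ≤ 1 / 4})ᶜ := by
      simp only [mem_compl_iff, mem_iUnion, not_exists]
      rintro j ⟨z, ⟨hz, hz1⟩, hza⟩
      exact absurd (ha j z hz hza) (not_lt.2 hz1)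
    filter_upwards [hclB.isOpen_compl.mem_nhds hmem] with a' ha'
    refine hF2 a' fun j z hz hza => ?_
    by_contra h'
    exact ha' (mem_iUnion.2 ⟨j, z, ⟨hz, not_lt.1 h'⟩, hza⟩)
  have hAc : ∀ a, (∀ j z, z ≠ 0 → A.endMap (.inr j) z = a → 1 ≤ ‖z‖) →
      (∀ e z, Sum.elim (fun j => JA (.inl j)) (fun j => JB (.inr j)) e → z ≠ 0 →
        (A.comp B).endMap e z = glueInl A B a → 1 ≤ ‖z‖) →
      ∀ e z, JA e → z ≠ 0 → A.endMap e z = a → 1 ≤ ‖z‖ := by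
    rintro a h1 h2 (j | j) z hj hz h
    · exact h2 (.inl j) z hj hz (by rw [comp_endMap_inl A B j hz, h])
    · exact h1 j z hz h
  have hBc : ∀ a, (∀ j z, z ≠ 0 → B.endMap (.inl j) z = a → 1 ≤ ‖z‖) →
      (∀ e z, Sum.elim (fun j => JA (.inl j)) (fun j => JB (.inr j)) e → z ≠ 0 →
        (A.comp B).endMap e z = glueInr A B a → 1 ≤ ‖z‖) →
      ∀ e z, JB e → z ≠ 0 → B.endMap e z = a → 1 ≤ ‖z‖ := by
    rintro a h1 h2 (j | j) z hj hz h
    · exact h1 j z hz h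
    · exact h2 (.inr j) z hj hz (by rw [comp_endMap_inr A B j hz, h])
  have hF1' : ∀ a, (∀ j z, z ≠ 0 → A.endMap (.inr j) z = a → 1 ≤ ‖z‖) →
      F (glueInl A B a) = f a := fun a h => hF1 a fun j z hz hza => by linarith [h j z hz hza]
  have hF2' : ∀ a, (∀ j z, z ≠ 0 → B.endMap (.inl j) z = a → 1 ≤ ‖z‖) →
      F (glueInr A B a) = g a := fun a h => hF2 a fun j z hz hza => by linarith [h j z hz hza]
  -- Injectivity across the pieces: by `hR` a common value lies on a seam circle, and injectivity of
  -- `f` and `g` on the cores then places both points on the collars, where they are identified.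
  have hcross : ∀ a a', (∀ e z, JA e → z ≠ 0 → A.endMap e z = a → 1 ≤ ‖z‖) →
      (∀ e z, JB e → z ≠ 0 → B.endMap e z = a' → 1 ≤ ‖z‖) → f a = g a' →
      glueInl A B a = glueInr A B a' := by
    intro a a' h1 h2 h
    obtain ⟨j, z, hz1, hz⟩ := hR (f a) (hA.bij.mapsTo h1) (h ▸ hB.bij.mapsTo h2)
    have hz0 : z ≠ 0 := norm_pos_iff.1 (by rw [hz1]; exact one_pos)
    have hz0' : -z⁻¹ ≠ 0 := by simpa using hz0
    have hz1' : ‖-z⁻¹‖ = 1 := by simp [hz1]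
    refine (glueInl_eq_glueInr_iff A B).2 ⟨j, z, hz0, hA.bij.injOn h1 ?_ ?_,
      hB.bij.injOn h2 ?_ ?_⟩
    · intro e w _ hw h'
      rw [(A.endMap_inj hw hz0 h').2, hz1]
    · rw [hz, hA.seam _ z hz0 (by rw [hz1]; norm_num)]
    · intro e w _ hw h'
      rw [(B.endMap_inj hw hz0' h').2, hz1']
    · rw [← h, hz, hB.seam _ _ hz0' (by rw [hz1']; norm_num), hσ j z hz0]
  refine ⟨F, fun x hx => ?_, ⟨fun x hx => ?_, fun x hx y hy h => ?_, ?_⟩, ?_⟩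
  · rcases glue_core_cases A B x with ⟨a, ha, rfl⟩ | ⟨a, ha, rfl⟩
    · have h4 : ∀ j z, z ≠ 0 → A.endMap (.inr j) z = a → 1 / 4 < ‖z‖ :=
        fun j z hz hza => by linarith [ha j z hz hza]
      refine hs1 a h4 (hA.sing a ?_)
      rintro (j | j) z hj hz h
      · exact hx (.inl j) z hj hz (by rw [comp_endMap_inl A B j hz, h])
      · exact h4 j z hz h
    · have h4 : ∀ j z, z ≠ 0 → B.endMap (.inl j) z = a → 1 / 4 < ‖z‖ :=
        fun j z hz hza => by linarith [ha j z hz hza]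
      refine hs2 a h4 (hB.sing a ?_)
      rintro (j | j) z hj hz h
      · exact h4 j z hz h
      · exact hx (.inr j) z hj hz (by rw [comp_endMap_inr A B j hz, h])
  · rcases glue_core_cases A B x with ⟨a, ha, rfl⟩ | ⟨a, ha, rfl⟩
    · rw [hF1' a ha]
      exact .inl (hA.bij.mapsTo (hAc a ha hx))
    · rw [hF2' a ha]
      exact .inr (hB.bij.mapsTo (hBc a ha hx))
  · rcases glue_core_cases A B x with ⟨a, ha, rfl⟩ | ⟨a, ha, rfl⟩ <;>
      rcases glue_core_cases A B y with ⟨a', ha', rfl⟩ | ⟨a', ha', rfl⟩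
    · rw [hF1' a ha, hF1' a' ha'] at h
      rw [hA.bij.injOn (hAc a ha hx) (hAc a' ha' hy) h]
    · rw [hF1' a ha, hF2' a' ha'] at h
      exact hcross a a' (hAc a ha hx) (hBc a' ha' hy) h
    · rw [hF2' a ha, hF1' a' ha'] at h
      exact (hcross a' a (hAc a' ha' hy) (hBc a ha hx) h.symm).symm
    · rw [hF2' a ha, hF2' a' ha'] at h
      rw [hB.bij.injOn (hBc a ha hx) (hBc a' ha' hy) h]
  · rintro y (hy | hy)
    · obtain ⟨a, ha, rfl⟩ := hA.bij.surjOn hy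
      refine ⟨glueInl A B a, ?_, hF1' a fun j z hz h => ha _ z (hJA j) hz h⟩
      rintro (j | j) z hj hz h
      · rw [comp_endMap_inl A B j hz] at h
        exact ha _ z hj hz (glueInl_inj A B h)
      · rw [comp_endMap_inr A B j hz] at h
        obtain ⟨i, w, hw, -, h'⟩ := (glueInl_eq_glueInr_iff A B).1 h.symm
        cases (B.endMap_inj hz (by simpa using hw) h').1
    · obtain ⟨a, ha, rfl⟩ := hB.bij.surjOn hy
      refine ⟨glueInr A B a, ?_, hF2' a fun j z hz h => ha _ z (hJB j) hz h⟩
      rintro (j | j) z hj hz h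
      · rw [comp_endMap_inl A B j hz] at h
        obtain ⟨i, w, hw, h', -⟩ := (glueInl_eq_glueInr_iff A B).1 h
        cases (A.endMap_inj hz hw h').1
      · rw [comp_endMap_inr A B j hz] at h
        exact ha _ z hj hz (glueInr_inj A B h)
  · rintro (j | j) z hz hz4
    · rw [comp_endMap_inl A B j hz, hin1 j z hz]
      exact hA.seam _ z hz hz4
    · rw [comp_endMap_inr A B j hz, hin2 j z hz]
      exact hB.seam _ z hz hz4

end Comp

/-! ### Free unions and permutations -/

/-- The ends of a free union. -/
def endSplit (n m n' m' : List Web) : EndIdx (n ++ n') (m ++ m') → EndIdx n m ⊕ EndIdx n' m'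
  | .inl j => Sum.map .inl .inl (splitIdx n n' j)
  | .inr j => Sum.map .inr .inr (splitIdx m m' j)

theorem tensor_endMap {n' m' : List Web} (A : Cob n m) (B : Cob n' m')
    (e : EndIdx (n ++ n') (m ++ m')) {z : ℂ} (hz : z ≠ 0) :
    (A.tensor B).endMap e z =
      Sum.map (A.endMap · z) (B.endMap · z) (endSplit n m n' m' e) := by
  cases e with
  | inl j =>
    rw [endMap_inl_of_ne _ _ hz]
    change Sum.map _ _ (splitIdx n n' j) = Sum.map _ _ (Sum.map _ _ (splitIdx n n' j))
    rcases splitIdx n n' j with i | i <;>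
      simp only [Sum.map_inl, Sum.map_inr, endMap_inl_of_ne _ _ hz]
  | inr j =>
    rw [endMap_inr_of_ne _ _ hz]
    change Sum.map _ _ (splitIdx m m' j) = Sum.map _ _ (Sum.map _ _ (splitIdx m m' j))
    rcases splitIdx m m' j with i | i <;>
      simp only [Sum.map_inl, Sum.map_inr, endMap_inr_of_ne _ _ hz]

theorem endSplit_surjective (n m n' m' : List Web) :
    Function.Surjective (endSplit n m n' m') := by
  rintro ((j | j) | (j | j))
  · exact ⟨.inl ((splitIdx n n').symm (.inl j)), by simp [endSplit]⟩
  · exact ⟨.inr ((splitIdx m m').symm (.inl j)), by simp [endSplit]⟩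
  · exact ⟨.inl ((splitIdx n n').symm (.inr j)), by simp [endSplit]⟩
  · exact ⟨.inr ((splitIdx m m').symm (.inr j)), by simp [endSplit]⟩

/-- Two whole punctured planes would overlap; after cutting their roots, the pieces can be placed in
disjoint regions, and then the union of the two maps is still injective. -/
theorem tensor {n' m' : List Web} {A : Cob n m} {B : Cob n' m'} {JA : EndIdx n m → Prop}
    {JB : EndIdx n' m' → Prop} {f : A.M → ℂ} {g : B.M → ℂ} {RA RB : Set ℂ}
    {σA : EndIdx n m → ℂ → ℂ} {σB : EndIdx n' m' → ℂ → ℂ}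
    (hA : IsCore A b JA f RA σA) (hB : IsCore B b JB g RB σB) (hR : Disjoint RA RB) :
    IsCore (A.tensor B) b (fun e => Sum.elim JA JB (endSplit n m n' m' e)) (Sum.elim f g)
      (RA ∪ RB) (fun e => Sum.elim σA σB (endSplit n m n' m' e)) := by
  have hend1 : ∀ a (r : ℂ → Prop), (∀ e z, Sum.elim JA JB (endSplit n m n' m' e) → z ≠ 0 →
      (A.tensor B).endMap e z = Sum.inl a → r z) ↔
      ∀ e z, JA e → z ≠ 0 → A.endMap e z = a → r z := by
    intro a r
    constructor
    · intro h e z he hz hza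
      obtain ⟨e', he'⟩ := endSplit_surjective n m n' m' (.inl e)
      refine h e' z (by rwa [he']) hz ?_
      rw [tensor_endMap A B e' hz, he', Sum.map_inl, hza]
    · intro h e z he hz hza
      rw [tensor_endMap A B e hz] at hza
      rcases hs : endSplit n m n' m' e with e' | e'
      · rw [hs] at he hza
        exact h e' z he hz (Sum.inl.inj hza)
      · rw [hs] at hza
        cases hza
  have hend2 : ∀ a (r : ℂ → Prop), (∀ e z, Sum.elim JA JB (endSplit n m n' m' e) → z ≠ 0 →
      (A.tensor B).endMap e z = Sum.inr a → r z) ↔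
      ∀ e z, JB e → z ≠ 0 → B.endMap e z = a → r z := by
    intro a r
    constructor
    · intro h e z he hz hza
      obtain ⟨e', he'⟩ := endSplit_surjective n m n' m' (.inr e)
      refine h e' z (by rwa [he']) hz ?_
      rw [tensor_endMap A B e' hz, he', Sum.map_inr, hza]
    · intro h e z he hz hza
      rw [tensor_endMap A B e hz] at hza
      rcases hs : endSplit n m n' m' e with e' | e'
      · rw [hs] at hza
        cases hza
      · rw [hs] at he hza
        exact h e' z he hz (Sum.inr.inj hza)
  refine ⟨?_, ⟨?_, ?_, ?_⟩, fun e z hz hz4 => ?_⟩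
  · rintro (a | a) ha
    · exact SingAt.cancel_right (N := (A.tensor B).M) (K := Plane b) (sumInl_singAt A B a)
        (hA.sing a ((hend1 a _).1 ha))
    · exact SingAt.cancel_right (N := (A.tensor B).M) (K := Plane b) (sumInr_singAt A B a)
        (hB.sing a ((hend2 a _).1 ha))
  · rintro (a | a) ha
    · exact .inl (hA.bij.mapsTo ((hend1 a _).1 ha))
    · exact .inr (hB.bij.mapsTo ((hend2 a _).1 ha))
  · rintro (a | a) ha (a' | a') ha' h
    · exact congrArg _ (hA.bij.injOn ((hend1 a _).1 ha) ((hend1 a' _).1 ha') h)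
    · have h1 := hA.bij.mapsTo ((hend1 a _).1 ha)
      have h2 := hB.bij.mapsTo ((hend2 a' _).1 ha')
      have h3 : f a = g a' := h
      exact (disjoint_left.1 hR h1 (h3 ▸ h2)).elim
    · have h1 := hA.bij.mapsTo ((hend1 a' _).1 ha')
      have h2 := hB.bij.mapsTo ((hend2 a _).1 ha)
      have h3 : g a = f a' := h
      exact (disjoint_left.1 hR h1 (h3 ▸ h2)).elim
    · exact congrArg _ (hB.bij.injOn ((hend2 a _).1 ha) ((hend2 a' _).1 ha') h)
  · rintro y (hy | hy)
    · obtain ⟨a, ha, rfl⟩ := hA.bij.surjOn hy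
      exact ⟨.inl a, (hend1 a _).2 ha, rfl⟩
    · obtain ⟨a, ha, rfl⟩ := hB.bij.surjOn hy
      exact ⟨.inr a, (hend2 a _).2 ha, rfl⟩
  · rw [tensor_endMap A B e hz]
    rcases endSplit n m n' m' e with e' | e'
    · exact hA.seam e' z hz hz4
    · exact hB.seam e' z hz hz4

theorem permTgt {m' : List Web} {A : Cob n m} {J : EndIdx n m → Prop} {f : A.M → ℂ} {R : Set ℂ}
    {σ : EndIdx n m → ℂ → ℂ} (h : IsCore A b J f R σ) (π : Fin m'.length ≃ Fin m.length)
    (hπ : ∀ j, m'.get j = m.get (π j)) :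
    IsCore (A.permTgt π hπ) b (fun e => J (Sum.map id π e)) f R
      (fun e => σ (Sum.map id π e)) := by
  have hend : ∀ e (z : ℂ), z ≠ 0 →
      (A.permTgt π hπ).endMap e z = A.endMap (Sum.map id π e) z := by
    rintro (j | j) z hz
    · rfl
    · rfl
  have hex : ∀ x (r : ℂ → Prop), (∀ e z, J (Sum.map id π e) → z ≠ 0 →
      (A.permTgt π hπ).endMap e z = x → r z) ↔ ∀ e z, J e → z ≠ 0 → A.endMap e z = x → r z := by
    intro x r
    constructor
    · rintro h (j | j) z hj hz hx
      · exact h (.inl j) z hj hz hx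
      · refine h (.inr (π.symm j)) z (by simpa using hj) hz ?_
        refine (hend _ z hz).trans ((congrArg (A.endMap · z) ?_).trans hx)
        simp
    · intro h e z he hz hx
      exact h _ z he hz ((hend e z hz).symm.trans hx)
  refine ⟨fun x hx => h.sing x ((hex x _).1 hx), ?_, fun e z hz hz4 => ?_⟩
  · have : {x : (A.permTgt π hπ).M | ∀ e z, J (Sum.map id π e) → z ≠ 0 →
        (A.permTgt π hπ).endMap e z = x → 1 ≤ ‖z‖} =
        {x : A.M | ∀ e z, J e → z ≠ 0 → A.endMap e z = x → 1 ≤ ‖z‖} := ext fun x => hex x _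
    exact this ▸ h.bij
  · rw [hend e z hz]
    exact h.seam _ z hz hz4

end IsCore

end SingCob

namespace SingCob

/-! ### Placing normal models -/

/-- The part of the plane that is left over when the root end, if it is in `J`, is cut along the
circle of radius `ρ` around `Q`, and the leaf ends in `J` along circles of radius `ρ'`. -/
def region {ι : Type} (J : ι → Prop) (o : ι) (P : ι → ℂ) (Q : ℂ) (s ρ ρ' : ℝ) : Set ℂ :=
  {y | (J o → ‖y - Q‖ ≤ ρ) ∧ ∀ e, e ≠ o → (J e → ρ' ≤ ‖y - (Q + s * P e)‖) ∧
    (¬ J e → y ≠ Q + s * P e)}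

open Classical in
/-- The parametrizations of the circles that bound a region. -/
def seam {ι : Type} (o : ι) (P : ι → ℂ) (Q : ℂ) (s ρ ρ' : ℝ) (e : ι) (z : ℂ) : ℂ :=
  if e = o then Q - ρ * z⁻¹ else Q + s * P e + ρ' * z

theorem seam_root {ι : Type} (o : ι) (P : ι → ℂ) (Q : ℂ) (s ρ ρ' : ℝ) (z : ℂ) :
    seam o P Q s ρ ρ' o z = Q - ρ * z⁻¹ := if_pos rfl

theorem seam_leaf {ι : Type} {o e : ι} (h : e ≠ o) (P : ι → ℂ) (Q : ℂ) (s ρ ρ' : ℝ) (z : ℂ) :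
    seam o P Q s ρ ρ' e z = Q + s * P e + ρ' * z := if_neg h

/-- The disc of radius `ρ` around `Q` in the plane of kind `b`, or this plane itself if `¬ j`, is
of kind `κ`. -/
def Placed (κ b : Web) (j : Prop) (Q : ℂ) (ρ : ℝ) : Prop :=
  (κ = b ∧ (b = .biweb → Q.im = 0)) ∨ (κ = .circle ∧ b = .biweb ∧ j ∧ 4 * ρ ≤ Q.im)

/-- The model is placed by `y ↦ Q + s * y`. The root collar `-1 / (ℓ * z)` then bounds a disc of
radius `ρ = s / ℓ`, and a leaf collar becomes a circle of radius `ρ' = s * ℓ`. A piece of circle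
kind may be put into the singular plane as long as it stays in the upper half plane; the part with
root coordinate `1 / 4 < ‖z‖` has radius `4 * ρ`, which explains this constant in `Placed`. -/
theorem IsNormalModel.core {n m : List Web} {A : Cob n m} {κ b : Web} {o : EndIdx n m}
    {P : EndIdx n m → ℂ} {ℓ : ℝ} {f : A.M → ℂ} (h : IsNormalModel A κ o P (fun _ => ℓ) f)
    (J : EndIdx n m → Prop) {Q : ℂ} {s ρ ρ' : ℝ} (hs : 0 < s) (hρ : s = ρ * ℓ) (hρ' : ρ' = s * ℓ)
    (hQ : Placed κ b (J o) Q ρ) :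
    IsCore A b J (fun x => Q + s * f x) (region J o P Q s ρ ρ') (seam o P Q s ρ ρ') := by
  have hℓ : 0 < ℓ := h.pos o
  have hρ0 : 0 < ρ := by
    by_contra h'
    nlinarith
  have hℓ' : (ℓ : ℂ) ≠ 0 := by exact_mod_cast hℓ.ne'
  have hs' : (s : ℂ) ≠ 0 := by exact_mod_cast hs.ne'
  have hρs : (s : ℂ) = ρ * ℓ := by exact_mod_cast hρ
  have hρs' : (ρ' : ℂ) = s * ℓ := by exact_mod_cast hρ'
  have hnorm : ∀ y : ℂ, ‖(s : ℂ) * y‖ = s * ‖y‖ := fun y => by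
    rw [norm_mul, Complex.norm_real, Real.norm_of_nonneg hs.le]
  -- Points whose image is at distance at least `ρ` from `Q` belong to the root collar, with a
  -- parameter of norm `ρ / (s * ‖f x‖)`.
  have hroot : ∀ (t : ℝ) x, 1 ≤ t → t * ρ ≤ s * ‖f x‖ → ∃ z, z ≠ 0 ∧ A.endMap o z = x ∧
      ‖z‖ = ρ / (s * ‖f x‖) := by
    intro t x ht hx
    have hfx : 0 < ‖f x‖ := by
      by_contra h'
      nlinarith
    have hfx' : f x ≠ 0 := norm_pos_iff.1 hfx
    have hz : -(ℓ * f x)⁻¹ ≠ 0 := neg_ne_zero.2 (inv_ne_zero (mul_ne_zero hℓ' hfx'))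
    have hzn : ‖-(ℓ * f x)⁻¹‖ = ρ / (s * ‖f x‖) := by
      rw [norm_neg, norm_inv, norm_mul, Complex.norm_real, Real.norm_of_nonneg hℓ.le, hρ]
      field_simp
    refine ⟨-(ℓ * f x)⁻¹, hz, h.inj ?_, hzn⟩
    rw [h.linear_root _ hz]
    · field_simp
    · rw [hzn, div_lt_iff₀ (by positivity)]
      nlinarith
  refine ⟨fun x hx => ?_, ⟨fun x hx => ⟨fun ho => ?_, fun e he => ⟨fun hJ => ?_, fun hJ => ?_⟩⟩,
    fun x _ y _ hxy => ?_, fun y hy => ?_⟩, fun e z hz hz4 => ?_⟩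
  · refine SingAt.comp (N := Plane κ) (K := Plane b) (f := f) ((singAt_plane_iff
      (f := fun y => Q + s * y)).2 (affine_signedSmoothAt hs' ?_)) (h.sing x)
    rcases hQ with ⟨rfl, h1⟩ | ⟨rfl, rfl, h1, h2⟩
    · cases κ with
      | circle => rfl
      | biweb =>
        have := sign_mul_pos (b := (f x).im) hs
        simpa [Web.weight, h1 rfl] using this
    · have h3 : s * ‖f x‖ < 4 * ρ := by
        by_contra h'
        obtain ⟨z, hz, hzx, hzn⟩ := hroot 4 x (by norm_num) (not_lt.1 h')
        have h4 := hx o z h1 hz hzx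
        rw [hzn, lt_div_iff₀ (by linarith)] at h4
        linarith
      have h4 : |(s * f x : ℂ).im| < 4 * ρ := by
        refine (Complex.abs_im_le_norm _).trans_lt ?_
        rwa [hnorm]
      simp only [Web.weight, sign_one]
      refine sign_pos ?_
      rw [Complex.add_im]
      linarith [(abs_lt.1 h4).1]
  · simp only [add_sub_cancel_left, hnorm]
    by_contra h'
    obtain ⟨z, hz, hzx, hzn⟩ := hroot 1 x le_rfl (by linarith)
    have h4 := hx o z ho hz hzx
    rw [hzn, le_div_iff₀ (by linarith)] at h4
    linarith
  · by_contra h'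
    have h1 : Q + s * f x - (Q + s * P e) = s * (f x - P e) := by ring
    rw [h1, hnorm, hρ', not_le] at h'
    have h2 : ‖f x - P e‖ < ℓ := lt_of_mul_lt_mul_left h' hs.le
    have h3 : f x ≠ P e := (h.range _).1 ⟨x, rfl⟩ e he
    have hz : (ℓ : ℂ)⁻¹ * (f x - P e) ≠ 0 := mul_ne_zero (inv_ne_zero hℓ') (sub_ne_zero.2 h3)
    have hzn : ‖(ℓ : ℂ)⁻¹ * (f x - P e)‖ < 1 := by
      rw [norm_mul, norm_inv, Complex.norm_real, Real.norm_of_nonneg hℓ.le, inv_mul_lt_iff₀ hℓ,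
        mul_one]
      exact h2
    have h4 := hx e _ hJ hz (h.inj (by
      rw [h.linear_leaf e he _ hz (by linarith), mul_inv_cancel_left₀ hℓ', add_sub_cancel]))
    linarith
  · intro h'
    exact (h.range _).1 ⟨x, rfl⟩ e he (mul_left_cancel₀ hs' (add_left_cancel h'))
  · exact h.inj (mul_left_cancel₀ hs' (add_left_cancel hxy))
  · have hsub : ∀ e, y - (Q + s * P e) = s * ((s : ℂ)⁻¹ * (y - Q) - P e) := by
      intro e
      field_simp
      ring
    obtain ⟨x, hx⟩ := (h.range ((s : ℂ)⁻¹ * (y - Q))).2 (by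
      intro e he h'
      have h1 : y - (Q + s * P e) = 0 := by rw [hsub, h', sub_self, mul_zero]
      by_cases hJ : J e
      · have := (hy.2 e he).1 hJ
        rw [h1, norm_zero, hρ'] at this
        nlinarith
      · exact (hy.2 e he).2 hJ (sub_eq_zero.1 h1))
    have hxy : Q + s * f x = y := by
      rw [hx, mul_inv_cancel_left₀ hs', add_sub_cancel]
    refine ⟨x, fun e z hJ hz hzx => ?_, hxy⟩
    by_contra h'
    rw [not_le] at h'
    by_cases he : e = o
    · subst he
      have h1 := hy.1 hJ
      have h2 : y - Q = -(ρ * z⁻¹) := by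
        rw [← hxy, ← hzx, h.linear_root z hz (by linarith), hρs]
        field_simp
        ring
      rw [h2, norm_neg, norm_mul, Complex.norm_real, Real.norm_of_nonneg hρ0.le, norm_inv] at h1
      have h3 : 1 < ‖z‖⁻¹ := (one_lt_inv₀ (norm_pos_iff.2 hz)).2 h'
      nlinarith
    · have h1 := (hy.2 e he).1 hJ
      have h2 : y - (Q + s * P e) = s * (ℓ * z) := by
        rw [← hxy, ← hzx, h.linear_leaf e he z hz (by linarith)]
        ring
      rw [h2, hnorm, norm_mul, Complex.norm_real, Real.norm_of_nonneg hℓ.le, hρ'] at h1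
      nlinarith [mul_pos hs hℓ]
  · by_cases he : e = o
    · subst he
      rw [seam_root, h.linear_root z hz hz4, hρs]
      field_simp
      ring
    · rw [seam_leaf he, h.linear_leaf e he z hz hz4, hρs']
      ring

/-- Stated with a filter, so that the finitely many smallness conditions on the common parameter `ℓ`
of several pieces can be combined. -/
theorem IsModel.eventually_normal {n m : List Web} {A : Cob n m} {b : Web} {o : EndIdx n m}
    {P : EndIdx n m → ℂ} {f : A.M → ℂ} (h : IsModel A b o P f) :
    ∀ᶠ ℓ : ℝ in 𝓝[>] 0, ∃ f', IsNormalModel A b o P (fun _ => ℓ) f' := by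
  obtain ⟨ε, hε, h1⟩ := h.exists_normal
  filter_upwards [self_mem_nhdsWithin, mem_nhdsWithin_of_mem_nhds (gt_mem_nhds hε)] with ℓ h2 h3
  exact h1 _ (fun _ => h2) fun _ => h3

theorem eventually_mul_lt (c : ℝ) {d : ℝ} (hd : 0 < d) : ∀ᶠ ℓ : ℝ in 𝓝[>] 0, ℓ * c < d := by
  have h : ContinuousAt (fun ℓ : ℝ => ℓ * c) 0 := by fun_prop
  exact (h.eventually (gt_mem_nhds (by simpa using hd))).filter_mono nhdsWithin_le_nhds

theorem eventually_placed {κ b : Web} {Q : ℂ} (h : Compat κ b Q) {j : Prop} (hj : j) :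
    ∀ᶠ ℓ : ℝ in 𝓝[>] 0, Placed κ b j Q ℓ := by
  cases κ <;> cases b
  · exact .of_forall fun _ => .inl ⟨rfl, by simp⟩
  · have h' : 0 < Q.im := h
    filter_upwards [eventually_mul_lt 4 h'] with ℓ hℓ
    exact .inr ⟨rfl, rfl, hj, by linarith⟩
  · exact h.elim
  · exact .of_forall fun _ => .inl ⟨rfl, fun _ => h⟩

theorem placed_zero (b : Web) (j : Prop) (ρ : ℝ) : Placed b b j 0 ρ := .inl ⟨rfl, by simp⟩

/-! ### Models from cores -/

/-- It suffices to compare signs at `1`. A bi-web end in the nonsingular plane is excluded by the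
point `-Complex.I`, where the weight of the bi-web is negative. -/
theorem compat_of_signedSmoothAt {κ b : Web} {p : ℂ} {r : ℝ} (hr : 0 < r)
    (h : ∀ z : ℂ, z ≠ 0 → ‖z‖ < 4 →
      SignedSmoothAt κ.weight b.weight (fun z => p + (r : ℂ) * z) z) : Compat κ b p := by
  have hs : ∀ z : ℂ, z ≠ 0 → ‖z‖ < 4 →
      SignType.sign (b.weight (p + (r : ℂ) * z)) = SignType.sign (κ.weight z) := by
    intro z hz hz4
    refine (h z hz hz4).sign_eq ?_
    rw [det_of_hasDerivAt (hasDerivAt_affine r p z)]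
    exact Complex.normSq_pos.2 (by exact_mod_cast hr.ne')
  cases κ <;> cases b
  · trivial
  · have h1 := hs 1 one_ne_zero (by norm_num)
    simp only [Web.weight, sign_one, sign_eq_one_iff] at h1
    change 0 < p.im
    simpa using h1
  · have h1 := hs (-Complex.I) (by simp) (by norm_num)
    simp [Web.weight] at h1
  · have h1 := hs 1 one_ne_zero (by norm_num)
    change p.im = 0
    simpa [Web.weight] using h1

/-- If no end is cut, the core is the whole surface, and collars given by linear formulas have the
required germs. Compatibility of the leaves need not be assumed: it follows because `f` preserves
orientations. -/
theorem IsCore.isModel {n m : List Web} {A : Cob n m} {b : Web} {J : EndIdx n m → Prop}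
    {f : A.M → ℂ} {R : Set ℂ} {σ : EndIdx n m → ℂ → ℂ} (h : IsCore A b J f R σ)
    (hJ : ∀ e, ¬ J e) {o : EndIdx n m} (ho : endKind n m o = b) {P : EndIdx n m → ℂ}
    (hR : ∀ y, y ∈ R ↔ ∀ e, e ≠ o → y ≠ P e)
    (hleaf : ∀ e, e ≠ o → ∃ r : ℝ, 0 < r ∧ ∀ z, σ e z = P e + r * z)
    (hroot : ∃ r : ℝ, 0 < r ∧ ∀ z, σ o z = -(r * z)⁻¹) : IsModel A b o P f := by
  have hsing : ∀ x, SingAt (N := Plane b) f x := fun x => h.sing x fun e _ he => (hJ e he).elim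
  have hcore : ∀ x : A.M, x ∈ {x | ∀ e z, J e → z ≠ 0 → A.endMap e z = x → 1 ≤ ‖z‖} :=
    fun x e _ he => (hJ e he).elim
  have hsmall : ∀ᶠ z : ℂ in 𝓝[≠] 0, z ≠ 0 ∧ ‖z‖ < 4 := by
    filter_upwards [self_mem_nhdsWithin,
      mem_nhdsWithin_of_mem_nhds (Metric.ball_mem_nhds (0 : ℂ) (by norm_num : (0 : ℝ) < 4))]
      with z h1 h2
    exact ⟨h1, by simpa using h2⟩
  refine ⟨hsing, fun x y hxy => h.bij.injOn (hcore x) (hcore y) hxy, fun y => ?_, fun e he => ?_,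
    fun e he => ?_, ?_, ho⟩
  · rw [← hR]
    constructor
    · rintro ⟨x, rfl⟩
      exact h.bij.mapsTo (hcore x)
    · intro hy
      obtain ⟨x, -, hx⟩ := h.bij.surjOn hy
      exact ⟨x, hx⟩
  · obtain ⟨r, hr, hσ⟩ := hleaf e he
    refine (hasGerm_affine (P e) (a := r) (by exact_mod_cast hr.ne')).congr ?_
    filter_upwards [hsmall] with z hz
    rw [h.seam e z hz.1 hz.2, hσ]
  · obtain ⟨r, hr, hσ⟩ := hleaf e he
    refine compat_of_signedSmoothAt hr fun z hz hz4 => ?_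
    have h1 : SignedSmoothAt (endKind n m e).weight b.weight (fun z => f (A.endMap e z)) z :=
      singAt_plane_iff.1 (SingAt.comp (M := Plane (endKind n m e)) (K := Plane b) (hsing _)
        (A.endMap_singAt e hz))
    refine h1.congr ?_
    filter_upwards [isOpen_ne.mem_nhds hz,
      (isOpen_lt continuous_norm continuous_const).mem_nhds hz4] with w hw hw4
    rw [h.seam e w hw hw4, hσ]
  · obtain ⟨r, hr, hσ⟩ := hroot
    refine (hasGerm_affine 0 (a := r) (by exact_mod_cast hr.ne')).congr ?_
    filter_upwards [hsmall] with z hz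
    rw [h.seam o z hz.1 hz.2, hσ]
    simp

end SingCob

/-! ### Pairs of trees and their gluing to a tree -/

namespace SingCob

open Cob

variable {n m n' m' k : List Web} {b : Web}

theorem IsCore.congr {A : Cob n m} {J J' : EndIdx n m → Prop} {f : A.M → ℂ} {R R' : Set ℂ}
    {σ : EndIdx n m → ℂ → ℂ} (h : IsCore A b J f R σ) (hJ : ∀ e, J' e ↔ J e)
    (hR : ∀ y, y ∈ R' ↔ y ∈ R) : IsCore A b J' f R' σ := by
  obtain rfl : J' = J := funext fun e => propext (hJ e)
  obtain rfl : R' = R := Set.ext hR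
  exact h

theorem Placed.mono {κ : Web} {j j' : Prop} {Q : ℂ} {ρ : ℝ} (h : Placed κ b j Q ρ) (hj : j') :
    Placed κ b j' Q ρ :=
  h.imp id fun h => ⟨h.1, h.2.1, hj, h.2.2.2⟩

theorem IsCore.endSplit_injective (n m n' m' : List Web) :
    Function.Injective (endSplit n m n' m') := by
  have hcross : ∀ (x : Fin n.length ⊕ Fin n'.length) (y : Fin m.length ⊕ Fin m'.length),
      (Sum.map .inl .inl x : EndIdx n m ⊕ EndIdx n' m') ≠ Sum.map .inr .inr y := by
    rintro (x | x) (y | y) <;> simp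
  rintro (j | j) (j' | j') h
  · exact congrArg _ ((splitIdx n n').injective
      (Sum.map_injective.2 ⟨Sum.inl_injective, Sum.inl_injective⟩ h))
  · exact (hcross _ _ h).elim
  · exact (hcross _ _ h.symm).elim
  · exact congrArg _ ((splitIdx m m').injective
      (Sum.map_injective.2 ⟨Sum.inr_injective, Sum.inr_injective⟩ h))

theorem mem_region_root {ι : Type} {o : ι} {P : ι → ℂ} {Q y : ℂ} {s ρ ρ' : ℝ} :
    y ∈ region (fun e => e = o) o P Q s ρ ρ' ↔
      ‖y - Q‖ ≤ ρ ∧ ∀ e, e ≠ o → y ≠ Q + s * P e := by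
  refine and_congr (by simp) (forall_congr' fun e => imp_congr_right fun he => ?_)
  simp [he]

/-! ### Forests with two trees -/

/-- The components of `A` can be placed in two small discs, such that the ends `ro i` become their
boundaries. -/
def IsForest (A : Cob n m) (b : Web) (ro : Fin 2 → EndIdx n m) (w : EndIdx n m → Fin 2)
    (p : EndIdx n m → ℂ) : Prop :=
  ∀ᶠ ℓ : ℝ in 𝓝[>] 0, ∀ Q : Fin 2 → ℂ, (∀ i, Placed (endKind n m (ro i)) b True (Q i) ℓ) →
    2 * ℓ < ‖Q 0 - Q 1‖ → ∃ f σ, IsCore A b (fun e => ∃ i, e = ro i) f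
      {y | ∃ i, ‖y - Q i‖ ≤ ℓ ∧ ∀ e, (∀ i, e ≠ ro i) → w e = i →
        y ≠ Q i + (ℓ ^ 2 : ℝ) * p e} σ ∧
      (∀ i z, σ (ro i) z = Q i - ℓ * z⁻¹) ∧
      ∀ e, (∀ i, e ≠ ro i) → ∀ z, σ e z = Q (w e) + (ℓ ^ 2 : ℝ) * p e + (ℓ ^ 3 : ℝ) * z

/-- Each tree is made linear with radius `ℓ` and scaled by `ℓ ^ 2`, so its root circle has radius
`ℓ` and its leaf circles have radius `ℓ ^ 3`. The distance between the centers keeps the two discs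
disjoint. -/
theorem IsModel.forest {A : Cob n m} {B : Cob n' m'} {κ κ' : Web} {o : EndIdx n m}
    {o' : EndIdx n' m'} {P : EndIdx n m → ℂ} {P' : EndIdx n' m' → ℂ} {f : A.M → ℂ} {g : B.M → ℂ}
    (hf : IsModel A κ o P f) (hg : IsModel B κ' o' P' g)
    {ro : Fin 2 → EndIdx (n ++ n') (m ++ m')}
    (h0 : IsCore.endSplit n m n' m' (ro 0) = .inl o)
    (h1 : IsCore.endSplit n m n' m' (ro 1) = .inr o') :
    IsForest (A.tensor B) b ro
      (fun e => Sum.elim (fun _ => 0) (fun _ => 1) (IsCore.endSplit n m n' m' e))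
      (fun e => Sum.elim P P' (IsCore.endSplit n m n' m' e)) := by
  have hk : ∀ e, endKind (n ++ n') (m ++ m') e = Sum.elim (endKind n m) (endKind n' m')
      (IsCore.endSplit n m n' m' e) := by
    rintro (j | j)
    · refine (get_splitIdx n n' j).trans ?_
      simp only [IsCore.endSplit]
      rcases splitIdx n n' j with i | i <;> rfl
    · refine (get_splitIdx m m' j).trans ?_
      simp only [IsCore.endSplit]
      rcases splitIdx m m' j with i | i <;> rfl
  have hro0 : ∀ e, e = ro 0 ↔ IsCore.endSplit n m n' m' e = .inl o := fun e => by
    rw [← h0, (IsCore.endSplit_injective n m n' m').eq_iff]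
  have hro1 : ∀ e, e = ro 1 ↔ IsCore.endSplit n m n' m' e = .inr o' := fun e => by
    rw [← h1, (IsCore.endSplit_injective n m n' m').eq_iff]
  filter_upwards [hf.eventually_normal, hg.eventually_normal, self_mem_nhdsWithin]
    with ℓ ⟨f', hf'⟩ ⟨g', hg'⟩ hℓ Q hQ hsep
  have hℓ0 : 0 < ℓ := hℓ
  have q0 := hQ 0
  have q1 := hQ 1
  rw [hk, h0, Sum.elim_inl, hf.rootKind] at q0
  rw [hk, h1, Sum.elim_inr, hg.rootKind] at q1
  have c0 := hf'.core (b := b) (fun e => e = o) (Q := Q 0) (s := ℓ ^ 2) (ρ := ℓ) (ρ' := ℓ ^ 3)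
    (by positivity) (by ring) (by ring) (q0.mono rfl)
  have c1 := hg'.core (b := b) (fun e => e = o') (Q := Q 1) (s := ℓ ^ 2) (ρ := ℓ) (ρ' := ℓ ^ 3)
    (by positivity) (by ring) (by ring) (q1.mono rfl)
  have hd : Disjoint (region (fun e => e = o) o P (Q 0) (ℓ ^ 2) ℓ (ℓ ^ 3))
      (region (fun e => e = o') o' P' (Q 1) (ℓ ^ 2) ℓ (ℓ ^ 3)) := by
    refine disjoint_left.2 fun y hy hy' => ?_
    have h2 := hy.1 rfl
    have h3 := hy'.1 rfl
    have h4 : ‖Q 0 - Q 1‖ ≤ ‖y - Q 0‖ + ‖y - Q 1‖ := by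
      rw [norm_sub_rev y (Q 0)]
      exact norm_sub_le_norm_sub_add_norm_sub _ _ _
    linarith
  refine ⟨_, _, (c0.tensor c1 hd).congr (fun e => ?_) (fun y => ?_), fun i z => ?_,
    fun e he z => ?_⟩
  · rw [Fin.exists_fin_two, hro0, hro1]
    rcases IsCore.endSplit n m n' m' e with e' | e' <;> simp
  · have key : ∀ i (y : ℂ), (∀ e, (∀ i, e ≠ ro i) →
        Sum.elim (fun _ => (0 : Fin 2)) (fun _ => 1) (IsCore.endSplit n m n' m' e) = i →
        y ≠ Q i + (ℓ ^ 2 : ℝ) * Sum.elim P P' (IsCore.endSplit n m n' m' e)) ↔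
        ∀ e : EndIdx n m ⊕ EndIdx n' m', e ≠ .inl o → e ≠ .inr o' →
          Sum.elim (fun _ => (0 : Fin 2)) (fun _ => 1) e = i →
          y ≠ Q i + (ℓ ^ 2 : ℝ) * Sum.elim P P' e := by
      intro i y
      rw [(IsCore.endSplit_surjective n m n' m').forall]
      refine forall_congr' fun e => ?_
      rw [Fin.forall_fin_two, ne_eq, ne_eq, hro0, hro1, and_imp]
    rw [mem_union, mem_region_root, mem_region_root]
    simp only [mem_ofPred_eq, key, Fin.exists_fin_two]
    refine or_congr (and_congr_right fun _ => ⟨fun h e he => ?_, ?_⟩)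
      (and_congr_right fun _ => ⟨fun h e he => ?_, ?_⟩)
    · exact h (.inl e) (by simpa using he) (by simp) rfl
    · rintro h (e | e) he he' hi
      · exact h e (by simpa using he)
      · simp at hi
    · exact h (.inr e) (by simp) (by simpa using he) rfl
    · rintro h (e | e) he he' hi
      · simp at hi
      · exact h e (by simpa using he')
  · have : i = 0 ∨ i = 1 := by fin_cases i <;> simp
    rcases this with rfl | rfl
    · simp only [h0, Sum.elim_inl, seam_root]
    · simp only [h1, Sum.elim_inr, seam_root]
  · have e0 := (hro0 e).not.1 (he 0)
    have e1 := (hro1 e).not.1 (he 1)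
    revert e0 e1
    rcases IsCore.endSplit n m n' m' e with e' | e'
    · intro e0 _
      simp only [Sum.elim_inl]
      rw [seam_leaf fun h => e0 (by rw [h])]
    · intro _ e1
      simp only [Sum.elim_inr]
      rw [seam_leaf fun h => e1 (by rw [h])]

/-- A renumbering may exchange the two roots. The forest condition holds for all centers, so it can
be applied to the centers permuted by `τ`. -/
theorem IsForest.permTgt {A : Cob n m} {ro : Fin 2 → EndIdx n m} {w : EndIdx n m → Fin 2}
    {p : EndIdx n m → ℂ} (h : IsForest A b ro w p) (π : Fin m'.length ≃ Fin m.length)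
    (hπ : ∀ j, m'.get j = m.get (π j)) {ro' : Fin 2 → EndIdx n m'} (τ : Equiv.Perm (Fin 2))
    (hro : ∀ i, Sum.map id π (ro' i) = ro (τ i)) :
    IsForest (A.permTgt π hπ) b ro' (fun e => τ.symm (w (Sum.map id π e)))
      (fun e => p (Sum.map id π e)) := by
  have hinj : Function.Injective (Sum.map id π : EndIdx n m' → EndIdx n m) :=
    Sum.map_injective.2 ⟨Function.injective_id, π.injective⟩
  have hsurj : Function.Surjective (Sum.map id π : EndIdx n m' → EndIdx n m) :=
    Sum.map_surjective.2 ⟨Function.surjective_id, π.surjective⟩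
  have hroe : ∀ e i, e = ro' i ↔ Sum.map id π e = ro (τ i) := fun e i => by
    rw [← hro, hinj.eq_iff]
  have hk : ∀ i, endKind n m (ro (τ i)) = endKind n m' (ro' i) := by
    intro i
    rw [← hro]
    rcases ro' i with j | j
    · rfl
    · exact (hπ j).symm
  filter_upwards [h] with ℓ h Q hQ hsep
  obtain ⟨f, σ, hc, h1, h2⟩ := h (fun i => Q (τ.symm i)) (fun i => by
      have := hQ (τ.symm i)
      rwa [← hk, τ.apply_symm_apply] at this) (by
    have hτ : ∀ τ : Equiv.Perm (Fin 2), τ = 1 ∨ τ = Equiv.swap 0 1 := by decide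
    rcases hτ τ with rfl | rfl
    · exact hsep
    · rw [norm_sub_rev]
      exact hsep)
  refine ⟨f, _, (hc.permTgt π hπ).congr (fun e => ?_) (fun y => ?_), fun i z => ?_,
    fun e he z => ?_⟩
  · simp only [hroe]
    exact (τ.surjective.exists (p := fun i => Sum.map id π e = ro i)).symm
  · simp only [mem_ofPred_eq]
    conv_rhs => rw [τ.surjective.exists]
    refine exists_congr fun i => ?_
    rw [hsurj.forall, τ.symm_apply_apply]
    refine and_congr_right fun _ => forall_congr' fun e => ?_
    rw [τ.surjective.forall (p := fun i => Sum.map id π e ≠ ro i)]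
    simp only [ne_eq, hroe, Equiv.symm_apply_eq]
  · rw [hro, h1, τ.symm_apply_apply]
  · refine h2 _ (fun i => ?_) z
    obtain ⟨i, rfl⟩ := τ.surjective i
    exact (hroe e i).not.1 (he i)

end SingCob

namespace SingCob

open Cob

variable {n m n' m' k : List Web} {b : Web}

/-! ### Gluing a forest to a tree -/

/-- Supplies the parameter of a seam point that `IsCore.comp` asks for. -/
theorem exists_unit_of_norm_eq {y q : ℂ} {ℓ : ℝ} (hℓ : 0 < ℓ) (h : ‖y - q‖ = ℓ) :
    ∃ z : ℂ, ‖z‖ = 1 ∧ y = q - ℓ * z⁻¹ := by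
  have h0 : y - q ≠ 0 := norm_pos_iff.1 (by rw [h]; exact hℓ)
  have hℓ' : (ℓ : ℂ) ≠ 0 := by exact_mod_cast hℓ.ne'
  refine ⟨-(ℓ * (y - q)⁻¹), ?_, ?_⟩
  · rw [norm_neg, norm_mul, norm_inv, h, Complex.norm_real, Real.norm_of_nonneg hℓ.le,
      mul_inv_cancel₀ hℓ.ne']
  · field_simp
    ring

/-- The closed discs and the closure of their complement cover the plane. Since `ℓ * ‖p e‖ < 1`,
every leaf lies strictly inside its own disc, hence in neither the other disc nor the complement. -/
theorem forest_union {ι : Type} {Q : Fin 2 → ℂ} {ℓ : ℝ} {L : ι → Prop} {w : ι → Fin 2}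
    {p : ι → ℂ} (hℓ : 0 < ℓ) (hsep : 2 * ℓ < ‖Q 0 - Q 1‖) (hp : ∀ e, ℓ * ‖p e‖ < 1) (y : ℂ) :
    ((∃ i, ‖y - Q i‖ ≤ ℓ ∧ ∀ e, L e → w e = i → y ≠ Q i + (ℓ ^ 2 : ℝ) * p e) ∨
      ∀ i, ℓ ≤ ‖y - Q i‖) ↔ ∀ e, L e → y ≠ Q (w e) + (ℓ ^ 2 : ℝ) * p e := by
  have hsmall : ∀ e, y = Q (w e) + (ℓ ^ 2 : ℝ) * p e → ‖y - Q (w e)‖ < ℓ := by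
    intro e h
    rw [h, add_sub_cancel_left, norm_mul, Complex.norm_real, Real.norm_of_nonneg (by positivity)]
    nlinarith [hp e]
  have hsep' : ∀ i j, i ≠ j → 2 * ℓ < ‖Q i - Q j‖ := by
    intro i j hij
    have : (i = 0 ∧ j = 1) ∨ (i = 1 ∧ j = 0) := by revert i j; decide
    rcases this with ⟨rfl, rfl⟩ | ⟨rfl, rfl⟩
    · exact hsep
    · rwa [norm_sub_rev]
  constructor
  · rintro (⟨i, h1, h2⟩ | h) e he h'
    · by_cases hi : w e = i
      · subst hi
        exact h2 e he rfl h'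
      · have h3 := hsmall e h'
        have h4 := norm_sub_le_norm_sub_add_norm_sub (Q (w e)) y (Q i)
        rw [norm_sub_rev (Q (w e)) y] at h4
        linarith [hsep' _ _ hi]
    · linarith [hsmall e h', h (w e)]
  · intro h
    by_cases h1 : ∃ i, ‖y - Q i‖ ≤ ℓ
    · obtain ⟨i, hi⟩ := h1
      exact .inl ⟨i, hi, fun e he hw => by subst hw; exact h e he⟩
    · push Not at h1
      exact .inr fun i => (h1 i).le

/-- The tree `D` is placed at scale `1` with its root uncut, so its leaf circles have radius `ℓ`,
the radius of the roots of the forest. The forest is inserted at the leaves of `D`, whose separation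
is where `hne` enters. -/
theorem IsForest.comp_right {x y : Web} {A : Cob n [x, y]} {w : EndIdx n [x, y] → Fin 2}
    {p : EndIdx n [x, y] → ℂ} (hA : IsForest A b (fun i => .inr i) w p) {D : Cob [x, y] [b]}
    {P : EndIdx [x, y] [b] → ℂ} {g : D.M → ℂ} (hD : IsModel D b (.inr 0) P g)
    (hne : P (.inl 0) ≠ P (.inl 1)) :
    ∀ᶠ ℓ : ℝ in 𝓝[>] 0, ∃ f, IsModel (A.comp D) b (.inr 0)
      (Sum.elim (fun j => P (.inl (w (.inl j))) + (ℓ ^ 2 : ℝ) * p (.inl j)) fun _ => 0) f := by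
  have hcompat : ∀ i : Fin 2, ∀ᶠ ℓ : ℝ in 𝓝[>] 0, Placed (endKind n [x, y] (.inr i)) b True
      (P (.inl i)) ℓ := fun i => eventually_placed (hD.compat (.inl i) (by simp)) trivial
  filter_upwards [hA, hD.eventually_normal, self_mem_nhdsWithin,
    eventually_mul_lt 2 (norm_pos_iff.2 (sub_ne_zero.2 hne)),
    Filter.eventually_all.2 hcompat,
    Filter.eventually_all.2 fun e => eventually_mul_lt ‖p e‖ one_pos]
    with ℓ hA ⟨g', hg'⟩ hℓ hsep hQ hp
  have hℓ0 : 0 < ℓ := hℓ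
  obtain ⟨f, σ, hc, hσ1, hσ2⟩ := hA (fun i => P (.inl i)) hQ (by linarith)
  have cD := hg'.core (b := b) (fun e => e ≠ .inr 0) (Q := 0) (s := 1) (ρ := ℓ⁻¹) (ρ' := ℓ)
    one_pos (by field_simp) (by ring) (placed_zero b _ _)
  have hreg : ∀ z, z ∈ region (fun e => e ≠ .inr 0) (.inr 0) P 0 1 ℓ⁻¹ ℓ ↔
      ∀ i : Fin 2, ℓ ≤ ‖z - P (.inl i)‖ := by
    intro z
    constructor
    · intro hz i
      simpa using (hz.2 (.inl i) (by simp)).1 (by simp)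
    · intro hz
      refine ⟨fun h => (h rfl).elim, ?_⟩
      rintro (i | i) hi
      · refine ⟨fun _ => by simpa using hz i, fun h => (h hi).elim⟩
      · exact (hi (congrArg _ (Subsingleton.elim (α := Fin 1) i 0))).elim
  obtain ⟨F, hF⟩ := hc.comp cD (fun j => ⟨j, rfl⟩) (fun j => by simp)
    (fun j z _ => by
      rw [seam_leaf (by simp)]
      refine (hσ1 j z).trans ?_
      simp
      ring)
    (by
      rintro y ⟨i, h1, -⟩ h2
      obtain ⟨z, hz, hy⟩ := exists_unit_of_norm_eq hℓ0 (le_antisymm h1 ((hreg y).1 h2 i))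
      exact ⟨i, z, hz, hy.trans (hσ1 i z).symm⟩)
  have hleaf : ∀ (e : EndIdx n [x, y]), (∀ i : Fin 2, e ≠ .inr i) ↔ ∃ j, e = .inl j := by
    rintro (j | j)
    · simp
    · simp
  refine ⟨F, hF.isModel ?_ rfl (fun y => ?_) ?_ ?_⟩
  · rintro (j | j)
    · simp
    · exact fun h => h (congrArg _ (Subsingleton.elim (α := Fin 1) j 0))
  · rw [mem_union, hreg]
    refine (forest_union hℓ0 (by linarith) hp y).trans ?_
    constructor
    · rintro h (j | j) hj
      · exact h (.inl j) fun i => by simp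
      · exact (hj (congrArg _ (Subsingleton.elim (α := Fin 1) j 0))).elim
    · intro h e he
      obtain ⟨j, rfl⟩ := (hleaf e).1 he
      exact h (.inl j) (by simp)
  · rintro (j | j) hj
    · exact ⟨ℓ ^ 3, by positivity, hσ2 (.inl j) fun i => by simp⟩
    · exact (hj (congrArg _ (Subsingleton.elim (α := Fin 1) j 0))).elim
  · refine ⟨ℓ, hℓ0, fun z => ?_⟩
    refine (seam_root _ _ _ _ _ _ z).trans ?_
    simp [mul_comm]

/-- The upside-down situation: the roots of the forest are now its sources, and they are inserted at
the targets of `D`. -/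
theorem IsForest.comp_left {x y : Web} {A : Cob [x, y] k} {w : EndIdx [x, y] k → Fin 2}
    {p : EndIdx [x, y] k → ℂ} (hA : IsForest A b (fun i => .inl i) w p) {D : Cob [b] [x, y]}
    {P : EndIdx [b] [x, y] → ℂ} {g : D.M → ℂ} (hD : IsModel D b (.inl 0) P g)
    (hne : P (.inr 0) ≠ P (.inr 1)) :
    ∀ᶠ ℓ : ℝ in 𝓝[>] 0, ∃ f, IsModel (D.comp A) b (.inl 0)
      (Sum.elim (fun _ => 0) fun j => P (.inr (w (.inr j))) + (ℓ ^ 2 : ℝ) * p (.inr j)) f := by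
  have hcompat : ∀ i : Fin 2, ∀ᶠ ℓ : ℝ in 𝓝[>] 0, Placed (endKind [x, y] k (.inl i)) b True
      (P (.inr i)) ℓ := fun i => eventually_placed (hD.compat (.inr i) (by simp)) trivial
  filter_upwards [hA, hD.eventually_normal, self_mem_nhdsWithin,
    eventually_mul_lt 2 (norm_pos_iff.2 (sub_ne_zero.2 hne)),
    Filter.eventually_all.2 hcompat,
    Filter.eventually_all.2 fun e => eventually_mul_lt ‖p e‖ one_pos]
    with ℓ hA ⟨g', hg'⟩ hℓ hsep hQ hp
  have hℓ0 : 0 < ℓ := hℓ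
  obtain ⟨f, σ, hc, hσ1, hσ2⟩ := hA (fun i => P (.inr i)) hQ (by linarith)
  have cD := hg'.core (b := b) (fun e => e ≠ .inl 0) (Q := 0) (s := 1) (ρ := ℓ⁻¹) (ρ' := ℓ)
    one_pos (by field_simp) (by ring) (placed_zero b _ _)
  have hreg : ∀ z, z ∈ region (fun e => e ≠ .inl 0) (.inl 0) P 0 1 ℓ⁻¹ ℓ ↔
      ∀ i : Fin 2, ℓ ≤ ‖z - P (.inr i)‖ := by
    intro z
    constructor
    · intro hz i
      simpa using (hz.2 (.inr i) (by simp)).1 (by simp)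
    · intro hz
      refine ⟨fun h => (h rfl).elim, ?_⟩
      rintro (i | i) hi
      · exact (hi (congrArg _ (Subsingleton.elim (α := Fin 1) i 0))).elim
      · refine ⟨fun _ => by simpa using hz i, fun h => (h hi).elim⟩
  have hleafD : ∀ (i : Fin 2) z, seam (.inl 0) P 0 1 ℓ⁻¹ ℓ (.inr i) z = P (.inr i) + ℓ * z := by
    intro i z
    rw [seam_leaf (by simp)]
    simp
  obtain ⟨F, hF⟩ := cD.comp hc (fun j => by simp) (fun j => ⟨j, rfl⟩)
    (fun j z _ => by
      refine (hleafD j z).trans ((hσ1 j _).trans ?_).symm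
      simp)
    (by
      rintro y h2 ⟨i, h1, -⟩
      obtain ⟨z, hz, hy⟩ := exists_unit_of_norm_eq hℓ0 (le_antisymm h1 ((hreg y).1 h2 i))
      refine ⟨i, -z⁻¹, by simpa using hz, hy.trans ((hleafD i _).trans ?_).symm⟩
      ring)
  have hleaf : ∀ (e : EndIdx [x, y] k), (∀ i : Fin 2, e ≠ .inl i) ↔ ∃ j, e = .inr j := by
    rintro (j | j)
    · simp
    · simp
  refine ⟨F, hF.isModel ?_ rfl (fun y => ?_) ?_ ?_⟩
  · rintro (j | j)
    · exact fun h => h (congrArg _ (Subsingleton.elim (α := Fin 1) j 0))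
    · simp
  · rw [union_comm, mem_union, hreg]
    refine (forest_union hℓ0 (by linarith) hp y).trans ?_
    constructor
    · rintro h (j | j) hj
      · exact (hj (congrArg _ (Subsingleton.elim (α := Fin 1) j 0))).elim
      · exact h (.inr j) fun i => by simp
    · intro h e he
      obtain ⟨j, rfl⟩ := (hleaf e).1 he
      exact h (.inr j) (by simp)
  · rintro (j | j) hj
    · exact (hj (congrArg _ (Subsingleton.elim (α := Fin 1) j 0))).elim
    · exact ⟨ℓ ^ 3, by positivity, hσ2 (.inr j) fun i => by simp⟩
  · refine ⟨ℓ, hℓ0, fun z => ?_⟩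
    refine (seam_root _ _ _ _ _ _ z).trans ?_
    simp [mul_comm]

end SingCob

namespace SingCob

open Cob

variable {n m n' m' k : List Web} {b : Web}

/-! ### Associativity of the composition -/

namespace Cob

section Lift

variable (A : Cob n m) (B : Cob m k) {X : Type}

/-- Functions on a glued surface. -/
def glueLift (f : A.M → X) (g : B.M → X) (h : ∀ j z, f (A.tgt j z) = g (B.src j z)) :
    Glue A B → X :=
  Quotient.lift (Sum.elim f g) (by
    rintro x y (rfl | ⟨j, z, rfl, rfl⟩ | ⟨j, z, rfl, rfl⟩)
    · rfl
    · exact h j z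
    · exact (h j z).symm)

theorem glue_tgt_eq_src (j : Fin m.length) (z : Cyl) :
    glueInl A B (A.tgt j z) = glueInr A B (B.src j z) :=
  (glueInl_eq_glueInr A B).2 ⟨j, z, rfl, rfl⟩

end Lift

/-- Both sides are the same three surfaces with the same identifications. The rebracketing maps
restrict to inclusions on each piece, hence are morphisms, and they fix the collars on the nose. -/
theorem comp_assoc {l : List Web} (A : Cob n m) (B : Cob m k) (C : Cob k l) :
    ((A.comp B).comp C).Equivalent (A.comp (B.comp C)) := by
  let Φ : ((A.comp B).comp C).M → (A.comp (B.comp C)).M :=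
    glueLift (A.comp B) C
      (glueLift A B (glueInl A (B.comp C)) (fun y => glueInr A (B.comp C) (glueInl B C y))
        fun j z => glue_tgt_eq_src A (B.comp C) j z)
      (fun y => glueInr A (B.comp C) (glueInr B C y))
      fun j z => congrArg (glueInr A (B.comp C)) (glue_tgt_eq_src B C j z)
  let Ψ : (A.comp (B.comp C)).M → ((A.comp B).comp C).M :=
    glueLift A (B.comp C) (fun y => glueInl (A.comp B) C (glueInl A B y))
      (glueLift B C (fun y => glueInl (A.comp B) C (glueInr A B y)) (glueInr (A.comp B) C)
        fun j z => glue_tgt_eq_src (A.comp B) C j z)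
      fun j z => congrArg (glueInl (A.comp B) C) (glue_tgt_eq_src A B j z)
  have h1 : ∀ x, Ψ (Φ x) = x := by
    intro x
    rcases glue_cases (A.comp B) C x with ⟨x, rfl⟩ | ⟨x, rfl⟩
    · rcases glue_cases A B x with ⟨x, rfl⟩ | ⟨x, rfl⟩ <;> rfl
    · rfl
  have h2 : ∀ x, Φ (Ψ x) = x := by
    intro x
    rcases glue_cases A (B.comp C) x with ⟨x, rfl⟩ | ⟨x, rfl⟩
    · rfl
    · rcases glue_cases B C x with ⟨x, rfl⟩ | ⟨x, rfl⟩ <;> rfl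
  have hs : ∀ x, SingAt Φ x := by
    intro x
    rcases glue_cases (A.comp B) C x with ⟨x, rfl⟩ | ⟨x, rfl⟩
    · refine SingAt.cancel_right (N := ((A.comp B).comp C).M) (glueInl_singAt (A.comp B) C x) ?_
      rcases glue_cases A B x with ⟨x, rfl⟩ | ⟨x, rfl⟩
      · exact SingAt.cancel_right (N := (A.comp B).M) (glueInl_singAt A B x)
          (glueInl_singAt A (B.comp C) x)
      · exact SingAt.cancel_right (N := (A.comp B).M) (glueInr_singAt A B x)
          (SingAt.comp (N := (B.comp C).M) (K := (A.comp (B.comp C)).M)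
            (glueInr_singAt A (B.comp C) _) (glueInl_singAt B C x))
    · exact SingAt.cancel_right (N := ((A.comp B).comp C).M) (glueInr_singAt (A.comp B) C x)
        (SingAt.comp (N := (B.comp C).M) (K := (A.comp (B.comp C)).M)
          (glueInr_singAt A (B.comp C) _) (glueInr_singAt B C x))
  exact ⟨structomorphOfBijective Φ ⟨Function.LeftInverse.injective h1,
    Function.RightInverse.surjective h2⟩ hs, 1, one_pos, fun _ _ _ => rfl, fun _ _ _ => rfl⟩

end Cob

/-! ### Gluing two trees -/

/-- Gluing the root of a tree to a leaf of another one below. -/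
theorem IsModel.comp_right {x : Web} {A : Cob n [x]} {P : EndIdx n [x] → ℂ} {f : A.M → ℂ}
    (hA : IsModel A x (.inr 0) P f) {D : Cob [x] k} {j₀ : Fin k.length} {P' : EndIdx [x] k → ℂ}
    {g : D.M → ℂ} (hD : IsModel D b (.inr j₀) P' g)
    (hne : ∀ j, j ≠ j₀ → P' (.inr j) ≠ P' (.inl 0)) :
    ∀ᶠ ℓ : ℝ in 𝓝[>] 0, ∃ f, IsModel (A.comp D) b (.inr j₀)
      (Sum.elim (fun j => P' (.inl 0) + (ℓ ^ 2 : ℝ) * P (.inl j)) fun j => P' (.inr j)) f := by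
  have hcompat : ∀ᶠ ℓ : ℝ in 𝓝[>] 0, Placed x b (Sum.inr 0 = (Sum.inr 0 : EndIdx n [x]))
      (P' (.inl 0)) ℓ := eventually_placed (hD.compat (.inl 0) (by simp)) rfl
  have hsep : ∀ j : Fin k.length, ∀ᶠ ℓ : ℝ in 𝓝[>] 0, j ≠ j₀ →
      ℓ * 1 < ‖P' (.inr j) - P' (.inl 0)‖ := by
    intro j
    by_cases hj : j = j₀
    · exact .of_forall fun _ h => (h hj).elim
    · exact (eventually_mul_lt 1 (norm_pos_iff.2 (sub_ne_zero.2 (hne j hj)))).mono fun _ h _ => h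
  filter_upwards [hA.eventually_normal, hD.eventually_normal, self_mem_nhdsWithin, hcompat,
    Filter.eventually_all.2 hsep, Filter.eventually_all.2 fun e => eventually_mul_lt ‖P e‖ one_pos]
    with ℓ ⟨f', hf'⟩ ⟨g', hg'⟩ hℓ hQ hsep hp
  have hℓ0 : 0 < ℓ := hℓ
  -- `A` is inserted at the leaf of `D`: its root circle of radius `ℓ` must match the leaf circle of
  -- `D`, which is kept at scale `1`.
  have cA := hf'.core (b := b) (fun e => e = .inr 0) (Q := P' (.inl 0)) (s := ℓ ^ 2) (ρ := ℓ)
    (ρ' := ℓ ^ 3) (by positivity) (by ring) (by ring) hQ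
  have cD := hg'.core (b := b) (fun e => e = .inl 0) (Q := 0) (s := 1) (ρ := ℓ⁻¹) (ρ' := ℓ)
    one_pos (by field_simp) (by ring) (placed_zero b _ _)
  have hone : ∀ i : Fin [x].length, i = 0 := fun i => Subsingleton.elim (α := Fin 1) i 0
  have hregD : ∀ y, y ∈ region (fun e => e = .inl 0) (.inr j₀) P' 0 1 ℓ⁻¹ ℓ ↔
      ℓ ≤ ‖y - P' (.inl 0)‖ ∧ ∀ j, j ≠ j₀ → y ≠ P' (.inr j) := by
    intro y
    constructor
    · intro hy
      refine ⟨by simpa using (hy.2 (.inl 0) (by simp)).1 rfl, fun j hj => ?_⟩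
      simpa using (hy.2 (.inr j) (by simpa using hj)).2 (by simp)
    · rintro ⟨h1, h2⟩
      refine ⟨fun h => by simp at h, ?_⟩
      rintro (i | j) hi
      · obtain rfl := hone i
        exact ⟨fun _ => by simpa using h1, fun h => (h rfl).elim⟩
      · exact ⟨fun h => by simp at h, fun _ => by simpa using h2 j (by simpa using hi)⟩
  have hsA : ∀ z, seam (.inr 0) P (P' (.inl 0)) (ℓ ^ 2) ℓ (ℓ ^ 3) (.inr 0) z =
      P' (.inl 0) - ℓ * z⁻¹ := fun z => seam_root _ _ _ _ _ _ z
  obtain ⟨F, hF⟩ := cA.comp cD (fun j => by rw [hone j]) (fun j => by rw [hone j])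
    (fun j z _ => by
      obtain rfl := hone j
      rw [hsA, seam_leaf (by simp)]
      simp
      ring)
    (by
      intro y h1 h2
      obtain ⟨z, hz, hy⟩ := exists_unit_of_norm_eq hℓ0
        (le_antisymm (mem_region_root.1 h1).1 ((hregD y).1 h2).1)
      exact ⟨0, z, hz, hy.trans (hsA z).symm⟩)
  refine ⟨F, hF.isModel (o := .inr j₀) ?_ hD.rootKind (fun y => ?_) ?_ ?_⟩
  · rintro (j | j) <;> simp
  · rw [mem_union, hregD, mem_region_root]
    constructor
    · rintro (⟨h1, h2⟩ | ⟨h1, h2⟩) (j | j) hj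
      · exact h2 _ (by simp)
      · rintro rfl
        have := hsep j (by simpa using hj)
        simp only [Sum.elim_inr] at h1
        linarith
      · rintro rfl
        simp only [Sum.elim_inl, add_sub_cancel_left, norm_mul, Complex.norm_real] at h1
        rw [Real.norm_of_nonneg (by positivity)] at h1
        nlinarith [hp (.inl j)]
      · exact h2 j (by simpa using hj)
    · intro h
      rcases le_total ‖y - P' (.inl 0)‖ ℓ with h1 | h1
      · refine .inl ⟨h1, ?_⟩
        rintro (j | j) hj
        · exact h (.inl j) (by simp)
        · exact (hj (congrArg _ (hone j))).elim
      · exact .inr ⟨h1, fun j hj => h (.inr j) (by simpa using hj)⟩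
  · rintro (j | j) hj
    · exact ⟨ℓ ^ 3, by positivity, fun z => seam_leaf (by simp) _ _ _ _ _ z⟩
    · refine ⟨ℓ, hℓ0, fun z => ?_⟩
      refine (seam_leaf (by simpa using hj) _ _ _ _ _ z).trans ?_
      simp
  · refine ⟨ℓ, hℓ0, fun z => ?_⟩
    refine (seam_root _ _ _ _ _ _ z).trans ?_
    simp [mul_comm]

/-- Filling a leaf by a disc. -/
theorem IsModel.comp_cap {x : Web} {A : Cob n [x]} {j₀ : Fin n.length} {P : EndIdx n [x] → ℂ}
    {f : A.M → ℂ} (hA : IsModel A b (.inl j₀) P f) {D : Cob [x] []} {P' : EndIdx [x] [] → ℂ}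
    {g : D.M → ℂ} (hD : IsModel D x (.inl 0) P' g)
    (hne : ∀ j, j ≠ j₀ → P (.inl j) ≠ P (.inr 0)) :
    ∃ f, IsModel (A.comp D) b (.inl j₀) (Sum.elim (fun j => P (.inl j)) fun _ => 0) f := by
  have hcompat : ∀ᶠ ℓ : ℝ in 𝓝[>] 0, Placed x b (Sum.inl 0 = (Sum.inl 0 : EndIdx [x] []))
      (P (.inr 0)) ℓ := eventually_placed (hA.compat (.inr 0) (by simp)) rfl
  have hsep : ∀ j : Fin n.length, ∀ᶠ ℓ : ℝ in 𝓝[>] 0, j ≠ j₀ →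
      ℓ * 1 < ‖P (.inl j) - P (.inr 0)‖ := by
    intro j
    by_cases hj : j = j₀
    · exact .of_forall fun _ h => (h hj).elim
    · exact (eventually_mul_lt 1 (norm_pos_iff.2 (sub_ne_zero.2 (hne j hj)))).mono fun _ h _ => h
  have hpos : ∀ᶠ ℓ : ℝ in 𝓝[>] 0, ℓ ∈ Ioi 0 := self_mem_nhdsWithin
  obtain ⟨ℓ, ⟨f', hf'⟩, ⟨g', hg'⟩, hℓ, hQ, hsep⟩ := (hA.eventually_normal.and
    (hD.eventually_normal.and (hpos.and (hcompat.and (Filter.eventually_all.2 hsep))))).exists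
  have hℓ0 : 0 < ℓ := hℓ
  -- Here the upper piece keeps scale `1`, and the cap below, rooted at its source, fills the leaf
  -- circle of radius `ℓ`.
  have cD := hg'.core (b := b) (fun e => e = .inl 0) (Q := P (.inr 0)) (s := ℓ ^ 2) (ρ := ℓ)
    (ρ' := ℓ ^ 3) (by positivity) (by ring) (by ring) hQ
  have cA := hf'.core (b := b) (fun e => e = .inr 0) (Q := 0) (s := 1) (ρ := ℓ⁻¹) (ρ' := ℓ)
    one_pos (by field_simp) (by ring) (placed_zero b _ _)
  have hone : ∀ i : Fin [x].length, i = 0 := fun i => Subsingleton.elim (α := Fin 1) i 0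
  have hregA : ∀ y, y ∈ region (fun e => e = .inr 0) (.inl j₀) P 0 1 ℓ⁻¹ ℓ ↔
      ℓ ≤ ‖y - P (.inr 0)‖ ∧ ∀ j, j ≠ j₀ → y ≠ P (.inl j) := by
    intro y
    constructor
    · intro hy
      refine ⟨by simpa using (hy.2 (.inr 0) (by simp)).1 rfl, fun j hj => ?_⟩
      simpa using (hy.2 (.inl j) (by simpa using hj)).2 (by simp)
    · rintro ⟨h1, h2⟩
      refine ⟨fun h => by simp at h, ?_⟩
      rintro (j | i) hi
      · exact ⟨fun h => by simp at h, fun _ => by simpa using h2 j (by simpa using hi)⟩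
      · obtain rfl := hone i
        exact ⟨fun _ => by simpa using h1, fun h => (h rfl).elim⟩
  have hsA : ∀ z, seam (.inl j₀) P 0 1 ℓ⁻¹ ℓ (.inr 0) z = P (.inr 0) + ℓ * z := by
    intro z
    rw [seam_leaf (by simp)]
    simp
  obtain ⟨F, hF⟩ := cA.comp cD (fun j => by rw [hone j]) (fun j => by rw [hone j])
    (fun j z _ => by
      obtain rfl := hone j
      rw [seam_root, hsA]
      simp)
    (by
      intro y h1 h2
      obtain ⟨z, hz, hy⟩ := exists_unit_of_norm_eq hℓ0
        (le_antisymm (mem_region_root.1 h2).1 ((hregA y).1 h1).1)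
      refine ⟨0, -z⁻¹, by simpa using hz, hy.trans ((hsA _).trans ?_).symm⟩
      ring)
  refine ⟨F, hF.isModel (o := .inl j₀) ?_ hA.rootKind (fun y => ?_) ?_ ?_⟩
  · rintro (j | j)
    · simp
    · exact j.elim0
  · rw [mem_union, hregA, mem_region_root]
    constructor
    · rintro (⟨h1, h2⟩ | ⟨h1, h2⟩) (j | j) hj
      · exact h2 j (by simpa using hj)
      · exact j.elim0
      · rintro rfl
        have := hsep j (by simpa using hj)
        simp only [Sum.elim_inl] at h1
        linarith
      · exact j.elim0
    · intro h
      rcases le_total ‖y - P (.inr 0)‖ ℓ with h1 | h1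
      · refine .inr ⟨h1, ?_⟩
        rintro (j | j) hj
        · exact (hj (congrArg _ (hone j))).elim
        · exact j.elim0
      · exact .inl ⟨h1, fun j hj => h (.inl j) (by simpa using hj)⟩
  · rintro (j | j) hj
    · refine ⟨ℓ, hℓ0, fun z => ?_⟩
      refine (seam_leaf (by simpa using hj) _ _ _ _ _ z).trans ?_
      simp
    · exact j.elim0
  · refine ⟨ℓ, hℓ0, fun z => ?_⟩
    refine (seam_root _ _ _ _ _ _ z).trans ?_
    simp [mul_comm]

end SingCob

namespace SingCob

open Cob

variable {b : Web}

/-! ### Gluing four trees along a path -/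

/-- The planar regions of four trees that are glued along a path. -/
theorem path_regions {p₀ p₁ c u v q : ℂ} {ℓ : ℝ} (hℓ : 0 < ℓ) (hℓ1 : ℓ * 1 < 1)
    (hsep : ℓ * 2 < ‖p₀ - p₁‖) (hc : ℓ * ‖c‖ < 1) (hu : ℓ * ‖u‖ < 1)
    (hv : ℓ * (‖v‖ + 1) < 1) (hq : ℓ * ‖q‖ < 1) (huv : ℓ * 1 < ‖u - v‖) {C D M E : Set ℂ}
    (hC : ∀ y, y ∈ C ↔ ‖y - p₀‖ ≤ ℓ ∧ y ≠ p₀ + (ℓ ^ 2 : ℝ) * c)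
    (hD : ∀ y, y ∈ D ↔ ‖y - p₁‖ ≤ ℓ ∧ y ≠ p₁ + (ℓ ^ 2 : ℝ) * u ∧
      ℓ ^ 3 ≤ ‖y - (p₁ + (ℓ ^ 2 : ℝ) * v)‖)
    (hM : ∀ y, y ∈ M ↔ ℓ ≤ ‖y - p₀‖ ∧ ℓ ≤ ‖y - p₁‖)
    (hE : ∀ y, y ∈ E ↔ ‖y - (p₁ + (ℓ ^ 2 : ℝ) * v)‖ ≤ ℓ ^ 3 ∧
      y ≠ p₁ + (ℓ ^ 2 : ℝ) * v + (ℓ ^ 4 : ℝ) * q) :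
    Disjoint C D ∧ Disjoint M E ∧ Disjoint C E ∧ (∀ y ∈ C, y ∈ M → ‖y - p₀‖ = ℓ) ∧
      (∀ y ∈ D, y ∈ M → ‖y - p₁‖ = ℓ) ∧
      (∀ y ∈ D, y ∈ E → ‖y - (p₁ + (ℓ ^ 2 : ℝ) * v)‖ = ℓ ^ 3) ∧
      ∀ y, (y ∈ C ∨ y ∈ D ∨ y ∈ M ∨ y ∈ E) ↔ y ≠ p₀ + (ℓ ^ 2 : ℝ) * c ∧
        y ≠ p₁ + (ℓ ^ 2 : ℝ) * u ∧ y ≠ p₁ + (ℓ ^ 2 : ℝ) * v + (ℓ ^ 4 : ℝ) * q := by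
  have hsq : 0 < ℓ ^ 2 := by positivity
  have hscale : ∀ (k : ℕ) (w : ℂ), ‖((ℓ ^ k : ℝ) : ℂ) * w‖ = ℓ ^ k * ‖w‖ := by
    intro k w
    rw [norm_mul, Complex.norm_real, Real.norm_of_nonneg (by positivity)]
  have hsmall : ∀ w : ℂ, ℓ * ‖w‖ < 1 → ‖((ℓ ^ 2 : ℝ) : ℂ) * w‖ < ℓ := by
    intro w hw
    rw [hscale]
    nlinarith
  -- The innermost disc is contained in the disc around `p₁`, because `ℓ ^ 2 * ‖v‖ + ℓ ^ 3 ≤ ℓ ^ 2 *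
  -- (‖v‖ + 1) < ℓ`.
  have hin : ∀ y, ‖y - (p₁ + (ℓ ^ 2 : ℝ) * v)‖ ≤ ℓ ^ 3 → ‖y - p₁‖ < ℓ := by
    intro y hy
    have h1 : ‖y - p₁‖ ≤ ‖y - (p₁ + (ℓ ^ 2 : ℝ) * v)‖ + ‖((ℓ ^ 2 : ℝ) : ℂ) * v‖ := by
      have : y - p₁ = (y - (p₁ + (ℓ ^ 2 : ℝ) * v)) + (ℓ ^ 2 : ℝ) * v := by ring
      rw [this]
      exact norm_add_le _ _
    rw [hscale] at h1
    have h2 : ℓ ^ 3 ≤ ℓ ^ 2 := by nlinarith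
    nlinarith
  have hfar : ∀ y, ‖y - p₀‖ ≤ ℓ → ‖y - p₁‖ ≤ ℓ → False := by
    intro y h0 h1
    have := norm_sub_le_norm_sub_add_norm_sub p₀ y p₁
    rw [norm_sub_rev p₀ y] at this
    linarith
  have hq' : ‖((ℓ ^ 4 : ℝ) : ℂ) * q‖ < ℓ ^ 3 := by
    rw [hscale]
    have : 0 < ℓ ^ 3 := by positivity
    nlinarith
  refine ⟨disjoint_left.2 fun y h1 h2 => ?_, disjoint_left.2 fun y h1 h2 => ?_,
    disjoint_left.2 fun y h1 h2 => ?_, fun y h1 h2 => ?_, fun y h1 h2 => ?_, fun y h1 h2 => ?_,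
    fun y => ⟨?_, fun ⟨h1, h2, h3⟩ => ?_⟩⟩
  · exact hfar y ((hC y).1 h1).1 ((hD y).1 h2).1
  · linarith [hin y ((hE y).1 h2).1, ((hM y).1 h1).2]
  · exact hfar y ((hC y).1 h1).1 (hin y ((hE y).1 h2).1).le
  · exact le_antisymm ((hC y).1 h1).1 ((hM y).1 h2).1
  · exact le_antisymm ((hD y).1 h1).1 ((hM y).1 h2).2
  · exact le_antisymm ((hE y).1 h2).1 ((hD y).1 h1).2.2
  · have e0 : y = p₀ + (ℓ ^ 2 : ℝ) * c → ‖y - p₀‖ < ℓ := by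
      rintro rfl
      rw [add_sub_cancel_left]
      exact hsmall c hc
    have e1 : y = p₁ + (ℓ ^ 2 : ℝ) * u → ‖y - p₁‖ < ℓ ∧
        ℓ ^ 3 < ‖y - (p₁ + (ℓ ^ 2 : ℝ) * v)‖ := by
      rintro rfl
      constructor
      · rw [add_sub_cancel_left]
        exact hsmall u hu
      · have : p₁ + (ℓ ^ 2 : ℝ) * u - (p₁ + (ℓ ^ 2 : ℝ) * v) = (ℓ ^ 2 : ℝ) * (u - v) := by ring
        rw [this, hscale]
        nlinarith
    have e2 : y = p₁ + (ℓ ^ 2 : ℝ) * v + (ℓ ^ 4 : ℝ) * q →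
        ‖y - (p₁ + (ℓ ^ 2 : ℝ) * v)‖ < ℓ ^ 3 := by
      rintro rfl
      rw [add_sub_cancel_left]
      exact hq'
    rintro (h | h | h | h)
    · have h' := (hC y).1 h
      exact ⟨h'.2, fun h => hfar y h'.1 (e1 h).1.le, fun h => hfar y h'.1 (hin y (e2 h).le).le⟩
    · have h' := (hD y).1 h
      exact ⟨fun h => hfar y (e0 h).le h'.1, h'.2.1, fun h => by linarith [e2 h, h'.2.2]⟩
    · have h' := (hM y).1 h
      exact ⟨fun h => by linarith [e0 h, h'.1], fun h => by linarith [(e1 h).1, h'.2],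
        fun h => by linarith [hin y (e2 h).le, h'.2]⟩
    · have h' := (hE y).1 h
      exact ⟨fun h => hfar y (e0 h).le (hin y h'.1).le, fun h => by linarith [(e1 h).2, h'.1], h'.2⟩
  · rw [hC, hD, hM, hE]
    by_cases a0 : ‖y - p₀‖ ≤ ℓ
    · exact .inl ⟨a0, h1⟩
    by_cases a1 : ‖y - p₁‖ ≤ ℓ
    · by_cases a2 : ‖y - (p₁ + (ℓ ^ 2 : ℝ) * v)‖ ≤ ℓ ^ 3
      · exact .inr (.inr (.inr ⟨a2, h3⟩))
      · exact .inr (.inl ⟨a1, h2, (not_le.1 a2).le⟩)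
    · exact .inr (.inr (.inl ⟨(not_le.1 a0).le, (not_le.1 a1).le⟩))

theorem forall_fin_three {p : Fin 3 → Prop} (h0 : p 0) (h1 : p 1) (h2 : p 2) : ∀ i, p i :=
  Fin.forall_fin_succ.2 ⟨h0, Fin.forall_fin_two.2 ⟨h1, h2⟩⟩

/-- Three circles are glued, and the pieces form the path `X`, `Z`, `Y`, `W`; therefore the result
is again planar. Take `Z` as the outermost piece: `X` and `Y` are inserted at its two leaves, and
`W` at a leaf of `Y`. For this `Y` has to be rooted at its first target and `W` at its source. -/
theorem IsModel.comp_path_left {X : Cob [b] [b]} {Y : Cob [b] [b, b]} {Z : Cob [b, b] [b]}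
    {W : Cob [b] [b]} {PX PY PZ PW : _ → ℂ} {fX : X.M → ℂ} {fY : Y.M → ℂ} {fZ : Z.M → ℂ}
    {fW : W.M → ℂ} (hX : IsModel X b (.inr 0) PX fX) (hY : IsModel Y b (.inr 0) PY fY)
    (hZ : IsModel Z b (.inr 0) PZ fZ) (hW : IsModel W b (.inl 0) PW fW)
    (hneY : PY (.inl 0) ≠ PY (.inr 1)) (hneZ : PZ (.inl 0) ≠ PZ (.inl 1)) :
    ∀ᶠ ℓ : ℝ in 𝓝[>] 0, ∃ f, IsModel (n := [b, b]) (m := [b, b])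
      ((X.tensor Y).comp (Z.tensor W)) b (.inr 0)
      (Sum.elim ![PZ (.inl 0) + (ℓ ^ 2 : ℝ) * PX (.inl 0), PZ (.inl 1) + (ℓ ^ 2 : ℝ) * PY (.inl 0)]
        ![0, PZ (.inl 1) + (ℓ ^ 2 : ℝ) * PY (.inr 1) + (ℓ ^ 4 : ℝ) * PW (.inr 0)]) f := by
  filter_upwards [hX.eventually_normal, hY.eventually_normal, hZ.eventually_normal,
    hW.eventually_normal, self_mem_nhdsWithin, eventually_mul_lt 1 one_pos,
    eventually_mul_lt 2 (norm_pos_iff.2 (sub_ne_zero.2 hneZ)),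
    eventually_mul_lt ‖PX (.inl 0)‖ one_pos, eventually_mul_lt ‖PY (.inl 0)‖ one_pos,
    eventually_mul_lt (‖PY (.inr 1)‖ + 1) one_pos, eventually_mul_lt ‖PW (.inr 0)‖ one_pos,
    eventually_mul_lt 1 (norm_pos_iff.2 (sub_ne_zero.2 hneY))]
    with ℓ ⟨gX, nX⟩ ⟨gY, nY⟩ ⟨gZ, nZ⟩ ⟨gW, nW⟩ hℓ s1 s2 s3 s4 s5 s6 s7
  have hℓ0 : 0 < ℓ := hℓ
  have hZim : ∀ i : Fin 2, b = .biweb → (PZ (.inl i)).im = 0 := by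
    rintro i rfl
    have := hZ.compat (.inl i) (by simp)
    fin_cases i <;> exact this
  have hYim : b = .biweb → (PY (.inr 1)).im = 0 := by
    rintro rfl
    exact hY.compat (.inr 1) (by simp)
  have cX := nX.core (b := b) (fun e => e = .inr 0) (Q := PZ (.inl 0)) (s := ℓ ^ 2) (ρ := ℓ)
    (ρ' := ℓ ^ 3) (by positivity) (by ring) (by ring) (.inl ⟨rfl, hZim 0⟩)
  have cY := nY.core (b := b) (fun e => e ≠ .inl 0) (Q := PZ (.inl 1)) (s := ℓ ^ 2) (ρ := ℓ)
    (ρ' := ℓ ^ 3) (by positivity) (by ring) (by ring) (.inl ⟨rfl, hZim 1⟩)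
  have cZ := nZ.core (b := b) (fun e => e ≠ .inr 0) (Q := 0) (s := 1) (ρ := ℓ⁻¹)
    (ρ' := ℓ) one_pos (by field_simp) (by ring) (placed_zero b _ _)
  -- `W` is nested one level deeper. The scale `ℓ ^ 4` gives its root circle the radius `ℓ ^ 3` of
  -- the leaf circles of `Y`.
  have cW := nW.core (b := b) (fun e => e = .inl 0)
    (Q := PZ (.inl 1) + (ℓ ^ 2 : ℝ) * PY (.inr 1)) (s := ℓ ^ 4) (ρ := ℓ ^ 3)
    (ρ' := ℓ ^ 5) (by positivity) (by ring) (by ring) (.inl ⟨rfl, fun h => by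
      rw [Complex.add_im, Complex.im_ofReal_mul, hZim 1 h, hYim h]; simp⟩)
  have hone : ∀ i : Fin 1, i = 0 := fun i => Subsingleton.elim i 0
  have hC : ∀ y, y ∈ region (fun e => e = .inr 0) (.inr 0) PX (PZ (.inl 0)) (ℓ ^ 2) ℓ (ℓ ^ 3) ↔
      ‖y - PZ (.inl 0)‖ ≤ ℓ ∧ y ≠ PZ (.inl 0) + (ℓ ^ 2 : ℝ) * PX (.inl 0) := by
    refine fun y => mem_region_root.trans (and_congr_right fun _ => ⟨fun h => h (.inl 0) (by simp),
      fun h => ?_⟩)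
    rintro (i | i) hi
    · rwa [hone i]
    · exact (hi (congrArg _ (hone i))).elim
  have hE : ∀ y, y ∈ region (fun e => e = .inl 0) (.inl 0) PW
      (PZ (.inl 1) + (ℓ ^ 2 : ℝ) * PY (.inr 1)) (ℓ ^ 4) (ℓ ^ 3) (ℓ ^ 5) ↔
      ‖y - (PZ (.inl 1) + (ℓ ^ 2 : ℝ) * PY (.inr 1))‖ ≤ ℓ ^ 3 ∧
        y ≠ PZ (.inl 1) + (ℓ ^ 2 : ℝ) * PY (.inr 1) + (ℓ ^ 4 : ℝ) * PW (.inr 0) := by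
    refine fun y => mem_region_root.trans (and_congr_right fun _ => ⟨fun h => h (.inr 0) (by simp),
      fun h => ?_⟩)
    rintro (i | i) hi
    · exact (hi (congrArg _ (hone i))).elim
    · rwa [hone i]
  have hM : ∀ y, y ∈ region (fun e => e ≠ .inr 0) (.inr 0) PZ 0 1 ℓ⁻¹ ℓ ↔
      ℓ ≤ ‖y - PZ (.inl 0)‖ ∧ ℓ ≤ ‖y - PZ (.inl 1)‖ := by
    intro y
    constructor
    · intro hy
      exact ⟨by simpa using (hy.2 (.inl 0) (by simp)).1 (by simp),
        by simpa using (hy.2 (.inl 1) (by simp)).1 (by simp)⟩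
    · rintro ⟨h1, h2⟩
      refine ⟨fun h => (h rfl).elim, ?_⟩
      rintro (i | i) hi
      · refine ⟨fun _ => ?_, fun h => (h hi).elim⟩
        revert i
        exact Fin.forall_fin_two.2 ⟨fun _ => by simpa using h1, fun _ => by simpa using h2⟩
      · exact (hi (congrArg _ (hone i))).elim
  have hD : ∀ y, y ∈ region (fun e => e ≠ .inl 0) (.inr 0) PY (PZ (.inl 1)) (ℓ ^ 2) ℓ (ℓ ^ 3) ↔
      ‖y - PZ (.inl 1)‖ ≤ ℓ ∧ y ≠ PZ (.inl 1) + (ℓ ^ 2 : ℝ) * PY (.inl 0) ∧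
        ℓ ^ 3 ≤ ‖y - (PZ (.inl 1) + (ℓ ^ 2 : ℝ) * PY (.inr 1))‖ := by
    intro y
    constructor
    · intro hy
      exact ⟨hy.1 (by simp), (hy.2 (.inl 0) (by simp)).2 (by simp),
        (hy.2 (.inr 1) (by simp)).1 (by simp)⟩
    · rintro ⟨h1, h2, h3⟩
      refine ⟨fun _ => h1, ?_⟩
      rintro (i | i) hi
      · rw [hone i]
        exact ⟨fun h => (h rfl).elim, fun _ => h2⟩
      · revert i
        exact Fin.forall_fin_two.2 ⟨fun h => (h rfl).elim, fun _ => ⟨fun _ => h3,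
          fun h => (h (by simp)).elim⟩⟩
  obtain ⟨dCD, dME, dCE, eCM, eDM, eDE, hunion⟩ :=
    path_regions hℓ0 s1 s2 s3 s4 s5 s6 s7 hC hD hM hE
  have g0 : ∀ z, seam (.inr 0) PX (PZ (.inl 0)) (ℓ ^ 2) ℓ (ℓ ^ 3) (.inr 0) z =
      PZ (.inl 0) - ℓ * z⁻¹ := seam_root _ _ _ _ _ _
  have g1 : ∀ z, seam (.inr 0) PY (PZ (.inl 1)) (ℓ ^ 2) ℓ (ℓ ^ 3) (.inr 0) z =
      PZ (.inl 1) - ℓ * z⁻¹ := seam_root _ _ _ _ _ _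
  have g2 : ∀ z, seam (.inr 0) PY (PZ (.inl 1)) (ℓ ^ 2) ℓ (ℓ ^ 3) (.inr 1) z =
      PZ (.inl 1) + (ℓ ^ 2 : ℝ) * PY (.inr 1) + (ℓ ^ 3 : ℝ) * z :=
    seam_leaf (by simp) _ _ _ _ _
  have k0 : ∀ z, seam (.inr 0) PZ 0 1 ℓ⁻¹ ℓ (.inl 0) z = PZ (.inl 0) + ℓ * z := fun z =>
    (seam_leaf (by simp) _ _ _ _ _ z).trans (by simp)
  have k1 : ∀ z, seam (.inr 0) PZ 0 1 ℓ⁻¹ ℓ (.inl 1) z = PZ (.inl 1) + ℓ * z := fun z =>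
    (seam_leaf (by simp) _ _ _ _ _ z).trans (by simp)
  have k2 : ∀ z, seam (.inl 0) PW (PZ (.inl 1) + (ℓ ^ 2 : ℝ) * PY (.inr 1)) (ℓ ^ 4) (ℓ ^ 3)
      (ℓ ^ 5) (.inl 0) z = PZ (.inl 1) + (ℓ ^ 2 : ℝ) * PY (.inr 1) - (ℓ ^ 3 : ℝ) * z⁻¹ :=
    seam_root _ _ _ _ _ _
  obtain ⟨F, hF⟩ := (cX.tensor cY dCD).comp (cZ.tensor cW dME)
    (forall_fin_three rfl Sum.inr_ne_inl Sum.inr_ne_inl)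
    (forall_fin_three Sum.inl_ne_inr Sum.inl_ne_inr rfl)
    (forall_fin_three (fun z _ => (g0 z).trans ((k0 _).trans (by ring)).symm)
      (fun z _ => (g1 z).trans ((k1 _).trans (by ring)).symm)
      (fun z _ => (g2 z).trans ((k2 _).trans (by simp)).symm))
    (by
      rintro y (h1 | h1) (h2 | h2)
      · obtain ⟨z, hz, hy⟩ := exists_unit_of_norm_eq hℓ0 (eCM y h1 h2)
        exact ⟨(0 : Fin 3), z, hz, hy.trans (g0 z).symm⟩
      · exact (disjoint_left.1 dCE h1 h2).elim
      · obtain ⟨z, hz, hy⟩ := exists_unit_of_norm_eq hℓ0 (eDM y h1 h2)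
        exact ⟨(1 : Fin 3), z, hz, hy.trans (g1 z).symm⟩
      · obtain ⟨z, hz, hy⟩ := exists_unit_of_norm_eq (by positivity) (eDE y h1 h2)
        refine ⟨(2 : Fin 3), -z⁻¹, by simpa using hz, hy.trans ((g2 _).trans ?_).symm⟩
        ring)
  refine ⟨F, IsCore.isModel (n := [b, b]) (m := [b, b]) hF ?_ rfl (fun y => ?_) ?_ ?_⟩
  · rintro (j | j)
    · revert j
      exact Fin.forall_fin_two.2 ⟨Sum.inl_ne_inr, fun h => h rfl⟩
    · revert j
      exact Fin.forall_fin_two.2 ⟨fun h => h rfl, Sum.inr_ne_inl⟩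
  · refine Iff.trans ?_ ((hunion y).trans ?_)
    · simp only [mem_union]
      tauto
    · constructor
      · rintro ⟨h1, h2, h3⟩ (j | j) hj
        · revert j
          exact Fin.forall_fin_two.2 ⟨fun _ => h1, fun _ => h2⟩
        · revert j
          exact Fin.forall_fin_two.2 ⟨fun h => (h rfl).elim, fun _ => h3⟩
      · intro h
        exact ⟨h (.inl 0) (by simp), h (.inl 1) (by simp), h (.inr 1) (by simp)⟩
  · rintro (j | j) hj
    · revert j
      exact Fin.forall_fin_two.2
        ⟨fun _ => ⟨ℓ ^ 3, by positivity, seam_leaf (Sum.inl_ne_inr (a := 0)) _ _ _ _ _⟩,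
          fun _ => ⟨ℓ ^ 3, by positivity, seam_leaf (Sum.inl_ne_inr (a := 0)) _ _ _ _ _⟩⟩
    · revert j
      exact Fin.forall_fin_two.2 ⟨fun h => (h rfl).elim,
        fun _ => ⟨ℓ ^ 5, by positivity, seam_leaf (Sum.inr_ne_inl (b := 0)) _ _ _ _ _⟩⟩
  · refine ⟨ℓ, hℓ0, fun z => ?_⟩
    refine (seam_root _ _ _ _ _ _ z).trans ?_
    simp [mul_comm]

end SingCob

namespace SingCob

open Cob

variable {b : Web}

/-- The mirror image of `IsModel.comp_path_left`: `Y` is now inserted at the first leaf of `Z`, is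
rooted at its second target, and carries `W` at its first. -/
theorem IsModel.comp_path_right {X : Cob [b] [b]} {Y : Cob [b] [b, b]} {Z : Cob [b, b] [b]}
    {W : Cob [b] [b]} {PX PY PZ PW : _ → ℂ} {fX : X.M → ℂ} {fY : Y.M → ℂ} {fZ : Z.M → ℂ}
    {fW : W.M → ℂ} (hX : IsModel X b (.inr 0) PX fX) (hY : IsModel Y b (.inr 1) PY fY)
    (hZ : IsModel Z b (.inr 0) PZ fZ) (hW : IsModel W b (.inl 0) PW fW)
    (hneY : PY (.inl 0) ≠ PY (.inr 0)) (hneZ : PZ (.inl 1) ≠ PZ (.inl 0)) :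
    ∀ᶠ ℓ : ℝ in 𝓝[>] 0, ∃ f, IsModel (n := [b, b]) (m := [b, b])
      ((Y.tensor X).comp (W.tensor Z)) b (.inr 1)
      (Sum.elim ![PZ (.inl 0) + (ℓ ^ 2 : ℝ) * PY (.inl 0), PZ (.inl 1) + (ℓ ^ 2 : ℝ) * PX (.inl 0)]
        ![PZ (.inl 0) + (ℓ ^ 2 : ℝ) * PY (.inr 0) + (ℓ ^ 4 : ℝ) * PW (.inr 0), 0]) f := by
  filter_upwards [hX.eventually_normal, hY.eventually_normal, hZ.eventually_normal,
    hW.eventually_normal, self_mem_nhdsWithin, eventually_mul_lt 1 one_pos,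
    eventually_mul_lt 2 (norm_pos_iff.2 (sub_ne_zero.2 hneZ)),
    eventually_mul_lt ‖PX (.inl 0)‖ one_pos, eventually_mul_lt ‖PY (.inl 0)‖ one_pos,
    eventually_mul_lt (‖PY (.inr 0)‖ + 1) one_pos, eventually_mul_lt ‖PW (.inr 0)‖ one_pos,
    eventually_mul_lt 1 (norm_pos_iff.2 (sub_ne_zero.2 hneY))]
    with ℓ ⟨gX, nX⟩ ⟨gY, nY⟩ ⟨gZ, nZ⟩ ⟨gW, nW⟩ hℓ s1 s2 s3 s4 s5 s6 s7
  have hℓ0 : 0 < ℓ := hℓ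
  have hZim : ∀ i : Fin 2, b = .biweb → (PZ (.inl i)).im = 0 := by
    rintro i rfl
    have := hZ.compat (.inl i) (by simp)
    fin_cases i <;> exact this
  have hYim : b = .biweb → (PY (.inr 0)).im = 0 := by
    rintro rfl
    exact hY.compat (.inr 0) (by simp)
  have cX := nX.core (b := b) (fun e => e = .inr 0) (Q := PZ (.inl 1)) (s := ℓ ^ 2) (ρ := ℓ)
    (ρ' := ℓ ^ 3) (by positivity) (by ring) (by ring) (.inl ⟨rfl, hZim 1⟩)
  have cY := nY.core (b := b) (fun e => e ≠ .inl 0) (Q := PZ (.inl 0)) (s := ℓ ^ 2) (ρ := ℓ)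
    (ρ' := ℓ ^ 3) (by positivity) (by ring) (by ring) (.inl ⟨rfl, hZim 0⟩)
  have cZ := nZ.core (b := b) (fun e => e ≠ .inr 0) (Q := 0) (s := 1) (ρ := ℓ⁻¹)
    (ρ' := ℓ) one_pos (by field_simp) (by ring) (placed_zero b _ _)
  have cW := nW.core (b := b) (fun e => e = .inl 0)
    (Q := PZ (.inl 0) + (ℓ ^ 2 : ℝ) * PY (.inr 0)) (s := ℓ ^ 4) (ρ := ℓ ^ 3)
    (ρ' := ℓ ^ 5) (by positivity) (by ring) (by ring) (.inl ⟨rfl, fun h => by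
      rw [Complex.add_im, Complex.im_ofReal_mul, hZim 0 h, hYim h]; simp⟩)
  have hone : ∀ i : Fin 1, i = 0 := fun i => Subsingleton.elim i 0
  have hC : ∀ y, y ∈ region (fun e => e = .inr 0) (.inr 0) PX (PZ (.inl 1)) (ℓ ^ 2) ℓ (ℓ ^ 3) ↔
      ‖y - PZ (.inl 1)‖ ≤ ℓ ∧ y ≠ PZ (.inl 1) + (ℓ ^ 2 : ℝ) * PX (.inl 0) := by
    refine fun y => mem_region_root.trans (and_congr_right fun _ => ⟨fun h => h (.inl 0) (by simp),
      fun h => ?_⟩)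
    rintro (i | i) hi
    · rwa [hone i]
    · exact (hi (congrArg _ (hone i))).elim
  have hE : ∀ y, y ∈ region (fun e => e = .inl 0) (.inl 0) PW
      (PZ (.inl 0) + (ℓ ^ 2 : ℝ) * PY (.inr 0)) (ℓ ^ 4) (ℓ ^ 3) (ℓ ^ 5) ↔
      ‖y - (PZ (.inl 0) + (ℓ ^ 2 : ℝ) * PY (.inr 0))‖ ≤ ℓ ^ 3 ∧
        y ≠ PZ (.inl 0) + (ℓ ^ 2 : ℝ) * PY (.inr 0) + (ℓ ^ 4 : ℝ) * PW (.inr 0) := by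
    refine fun y => mem_region_root.trans (and_congr_right fun _ => ⟨fun h => h (.inr 0) (by simp),
      fun h => ?_⟩)
    rintro (i | i) hi
    · exact (hi (congrArg _ (hone i))).elim
    · rwa [hone i]
  have hM : ∀ y, y ∈ region (fun e => e ≠ .inr 0) (.inr 0) PZ 0 1 ℓ⁻¹ ℓ ↔
      ℓ ≤ ‖y - PZ (.inl 1)‖ ∧ ℓ ≤ ‖y - PZ (.inl 0)‖ := by
    intro y
    constructor
    · intro hy
      exact ⟨by simpa using (hy.2 (.inl 1) (by simp)).1 (by simp),
        by simpa using (hy.2 (.inl 0) (by simp)).1 (by simp)⟩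
    · rintro ⟨h1, h2⟩
      refine ⟨fun h => (h rfl).elim, ?_⟩
      rintro (i | i) hi
      · refine ⟨fun _ => ?_, fun h => (h hi).elim⟩
        revert i
        exact Fin.forall_fin_two.2 ⟨fun _ => by simpa using h2, fun _ => by simpa using h1⟩
      · exact (hi (congrArg _ (hone i))).elim
  have hD : ∀ y, y ∈ region (fun e => e ≠ .inl 0) (.inr 1) PY (PZ (.inl 0)) (ℓ ^ 2) ℓ (ℓ ^ 3) ↔
      ‖y - PZ (.inl 0)‖ ≤ ℓ ∧ y ≠ PZ (.inl 0) + (ℓ ^ 2 : ℝ) * PY (.inl 0) ∧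
        ℓ ^ 3 ≤ ‖y - (PZ (.inl 0) + (ℓ ^ 2 : ℝ) * PY (.inr 0))‖ := by
    intro y
    constructor
    · intro hy
      exact ⟨hy.1 (by simp), (hy.2 (.inl 0) (by simp)).2 (by simp),
        (hy.2 (.inr 0) (by simp)).1 (by simp)⟩
    · rintro ⟨h1, h2, h3⟩
      refine ⟨fun _ => h1, ?_⟩
      rintro (i | i) hi
      · rw [hone i]
        exact ⟨fun h => (h rfl).elim, fun _ => h2⟩
      · revert i
        exact Fin.forall_fin_two.2 ⟨fun _ => ⟨fun _ => h3,
          fun h => (h (by simp)).elim⟩, fun h => (h rfl).elim⟩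
  obtain ⟨dCD, dME, dCE, eCM, eDM, eDE, hunion⟩ :=
    path_regions hℓ0 s1 s2 s3 s4 s5 s6 s7 hC hD hM hE
  have g0 : ∀ z, seam (.inr 0) PX (PZ (.inl 1)) (ℓ ^ 2) ℓ (ℓ ^ 3) (.inr 0) z =
      PZ (.inl 1) - ℓ * z⁻¹ := seam_root _ _ _ _ _ _
  have g1 : ∀ z, seam (.inr 1) PY (PZ (.inl 0)) (ℓ ^ 2) ℓ (ℓ ^ 3) (.inr 1) z =
      PZ (.inl 0) - ℓ * z⁻¹ := seam_root _ _ _ _ _ _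
  have g2 : ∀ z, seam (.inr 1) PY (PZ (.inl 0)) (ℓ ^ 2) ℓ (ℓ ^ 3) (.inr 0) z =
      PZ (.inl 0) + (ℓ ^ 2 : ℝ) * PY (.inr 0) + (ℓ ^ 3 : ℝ) * z :=
    seam_leaf (by simp) _ _ _ _ _
  have k0 : ∀ z, seam (.inr 0) PZ 0 1 ℓ⁻¹ ℓ (.inl 1) z = PZ (.inl 1) + ℓ * z := fun z =>
    (seam_leaf (by simp) _ _ _ _ _ z).trans (by simp)
  have k1 : ∀ z, seam (.inr 0) PZ 0 1 ℓ⁻¹ ℓ (.inl 0) z = PZ (.inl 0) + ℓ * z := fun z =>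
    (seam_leaf (by simp) _ _ _ _ _ z).trans (by simp)
  have k2 : ∀ z, seam (.inl 0) PW (PZ (.inl 0) + (ℓ ^ 2 : ℝ) * PY (.inr 0)) (ℓ ^ 4) (ℓ ^ 3)
      (ℓ ^ 5) (.inl 0) z = PZ (.inl 0) + (ℓ ^ 2 : ℝ) * PY (.inr 0) - (ℓ ^ 3 : ℝ) * z⁻¹ :=
    seam_root _ _ _ _ _ _
  obtain ⟨F, hF⟩ := (cY.tensor cX dCD.symm).comp (cW.tensor cZ dME.symm)
    (forall_fin_three Sum.inr_ne_inl Sum.inr_ne_inl rfl)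
    (forall_fin_three rfl Sum.inl_ne_inr Sum.inl_ne_inr)
    (forall_fin_three (fun z _ => (g2 z).trans ((k2 _).trans (by simp)).symm)
      (fun z _ => (g1 z).trans ((k1 _).trans (by ring)).symm)
      (fun z _ => (g0 z).trans ((k0 _).trans (by ring)).symm))
    (by
      rintro y (h1 | h1) (h2 | h2)
      · obtain ⟨z, hz, hy⟩ := exists_unit_of_norm_eq (by positivity) (eDE y h1 h2)
        refine ⟨(0 : Fin 3), -z⁻¹, by simpa using hz, hy.trans ((g2 _).trans ?_).symm⟩
        ring
      · obtain ⟨z, hz, hy⟩ := exists_unit_of_norm_eq hℓ0 (eDM y h1 h2)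
        exact ⟨(1 : Fin 3), z, hz, hy.trans (g1 z).symm⟩
      · exact (disjoint_left.1 dCE h1 h2).elim
      · obtain ⟨z, hz, hy⟩ := exists_unit_of_norm_eq hℓ0 (eCM y h1 h2)
        exact ⟨(2 : Fin 3), z, hz, hy.trans (g0 z).symm⟩)
  refine ⟨F, IsCore.isModel (n := [b, b]) (m := [b, b]) hF ?_ rfl (fun y => ?_) ?_ ?_⟩
  · rintro (j | j)
    · revert j
      exact Fin.forall_fin_two.2 ⟨fun h => h rfl, Sum.inl_ne_inr⟩
    · revert j
      exact Fin.forall_fin_two.2 ⟨Sum.inr_ne_inl, fun h => h rfl⟩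
  · refine Iff.trans ?_ ((hunion y).trans ?_)
    · simp only [mem_union]
      tauto
    · constructor
      · rintro ⟨h1, h2, h3⟩ (j | j) hj
        · revert j
          exact Fin.forall_fin_two.2 ⟨fun _ => h2, fun _ => h1⟩
        · revert j
          exact Fin.forall_fin_two.2 ⟨fun _ => h3, fun h => (h rfl).elim⟩
      · intro h
        exact ⟨h (.inl 1) (by simp), h (.inl 0) (by simp), h (.inr 0) (by simp)⟩
  · rintro (j | j) hj
    · revert j
      exact Fin.forall_fin_two.2
        ⟨fun _ => ⟨ℓ ^ 3, by positivity, seam_leaf (Sum.inl_ne_inr (a := 0)) _ _ _ _ _⟩,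
          fun _ => ⟨ℓ ^ 3, by positivity, seam_leaf (Sum.inl_ne_inr (a := 0)) _ _ _ _ _⟩⟩
    · revert j
      exact Fin.forall_fin_two.2 ⟨
        fun _ => ⟨ℓ ^ 5, by positivity, seam_leaf (Sum.inr_ne_inl (b := 0)) _ _ _ _ _⟩,
        fun h => (h rfl).elim⟩
  · refine ⟨ℓ, hℓ0, fun z => ?_⟩
    refine (seam_root _ _ _ _ _ _ z).trans ?_
    simp [mul_comm]

end SingCob

/-! ### The pairing of a circle with a bi-web through the cozipper -/

namespace SingCob

open Cob

/-- Gluing an annulus and a tree to a pairing of circles. -/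
theorem IsModel.comp_pairing {X : Cob [.circle] [.circle]} {Y : Cob [.biweb] [.circle]}
    {D : Cob [.circle, .circle] []} {PX PY PD : _ → ℂ} {fX : X.M → ℂ} {fY : Y.M → ℂ}
    {fD : D.M → ℂ} (hX : IsModel X .circle (.inr 0) PX fX) (hY : IsModel Y .biweb (.inl 0) PY fY)
    (hD : IsModel D .circle (.inl 1) PD fD) :
    ∃ p f, IsModel (n := [.circle, .biweb]) (m := []) ((X.tensor Y).comp D) .biweb (.inl 1)
      (Sum.elim ![p, 0] Fin.elim0) f := by
  have hv : 0 < (PY (.inr 0)).im := hY.compat (.inr 0) (by simp)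
  have hpos : ∀ᶠ ℓ : ℝ in 𝓝[>] 0, ℓ ∈ Ioi 0 := self_mem_nhdsWithin
  obtain ⟨ℓ, ⟨gX, nX⟩, ⟨gY, nY⟩, ⟨gD, nD⟩, hℓ, s1, s2, s3, s4⟩ := (hX.eventually_normal.and
    (hY.eventually_normal.and (hD.eventually_normal.and (hpos.and
      ((eventually_mul_lt 1 one_pos).and ((eventually_mul_lt ‖PX (.inl 0)‖ one_pos).and
      ((eventually_mul_lt (‖PD (.inl 0)‖ + 1) one_pos).and (eventually_mul_lt 5 hv)))))))).exists
  have hℓ0 : 0 < ℓ := hℓ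
  have hscale : ∀ (k : ℕ) (w : ℂ), ‖((ℓ ^ k : ℝ) : ℂ) * w‖ = ℓ ^ k * ‖w‖ := by
    intro k w
    rw [norm_mul, Complex.norm_real, Real.norm_of_nonneg (by positivity)]
  have hsmall : ℓ ^ 2 * ‖PD (.inl 0)‖ + ℓ ^ 3 < ℓ := by
    have h2 : ℓ ^ 3 ≤ ℓ ^ 2 := by nlinarith [sq_nonneg ℓ]
    nlinarith
  -- The cozipper `Y`, rooted at its bi-web, provides the singular plane; the pairing `D` fills its
  -- circle leaf in the upper half plane, and `X` fills the leaf of `D`. The leaf of `Y` has height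
  -- above `5 * ℓ` and the offset inside `D` is below `ℓ`, so the height left is at least `4 * ℓ ≥ 4
  -- * ℓ ^ 3`.
  have cX := nX.core (b := .biweb) (fun e => e = .inr 0)
    (Q := PY (.inr 0) + (ℓ ^ 2 : ℝ) * PD (.inl 0)) (s := ℓ ^ 4) (ρ := ℓ ^ 3) (ρ' := ℓ ^ 5)
    (by positivity) (by ring) (by ring) (.inr ⟨rfl, rfl, rfl, by
      have h1 := (abs_le.1 (Complex.abs_im_le_norm ((ℓ ^ 2 : ℝ) * PD (.inl 0)))).1
      rw [hscale] at h1
      have h2 : ℓ ^ 3 ≤ ℓ := by nlinarith [mul_nonneg (sq_nonneg ℓ) (norm_nonneg (PD (.inl 0)))]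
      rw [Complex.add_im]
      nlinarith [sq_nonneg ℓ]⟩)
  have cY := nY.core (b := .biweb) (fun e => e = .inr 0) (Q := 0) (s := 1) (ρ := ℓ⁻¹)
    (ρ' := ℓ) one_pos (by field_simp) (by ring) (placed_zero _ _ _)
  have cD := nD.core (b := .biweb) (fun _ => True) (Q := PY (.inr 0)) (s := ℓ ^ 2) (ρ := ℓ)
    (ρ' := ℓ ^ 3) (by positivity) (by ring) (by ring) (.inr ⟨rfl, rfl, trivial, by linarith⟩)
  have hone : ∀ i : Fin 1, i = 0 := fun i => Subsingleton.elim i 0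
  have hRX : ∀ y, y ∈ region (fun e => e = .inr 0) (.inr 0) PX
      (PY (.inr 0) + (ℓ ^ 2 : ℝ) * PD (.inl 0)) (ℓ ^ 4) (ℓ ^ 3) (ℓ ^ 5) ↔
      ‖y - (PY (.inr 0) + (ℓ ^ 2 : ℝ) * PD (.inl 0))‖ ≤ ℓ ^ 3 ∧
        y ≠ PY (.inr 0) + (ℓ ^ 2 : ℝ) * PD (.inl 0) + (ℓ ^ 4 : ℝ) * PX (.inl 0) := by
    refine fun y => mem_region_root.trans (and_congr_right fun _ => ⟨fun h => h (.inl 0) (by simp),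
      fun h => ?_⟩)
    rintro (i | i) hi
    · rwa [hone i]
    · exact (hi (congrArg _ (hone i))).elim
  have hRY : ∀ y, y ∈ region (fun e => e = .inr 0) (.inl 0) PY 0 1 ℓ⁻¹ ℓ ↔
      ℓ ≤ ‖y - PY (.inr 0)‖ := by
    intro y
    constructor
    · intro hy
      simpa using (hy.2 (.inr 0) (by simp)).1 rfl
    · intro h1
      refine ⟨fun h => by simp at h, ?_⟩
      rintro (i | i) hi
      · exact (hi (congrArg _ (hone i))).elim
      · rw [hone i]
        exact ⟨fun _ => by simpa using h1, fun h => (h rfl).elim⟩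
  have hRD : ∀ y, y ∈ region (fun _ => True) (.inl 1) PD (PY (.inr 0)) (ℓ ^ 2) ℓ (ℓ ^ 3) ↔
      ‖y - PY (.inr 0)‖ ≤ ℓ ∧ ℓ ^ 3 ≤ ‖y - (PY (.inr 0) + (ℓ ^ 2 : ℝ) * PD (.inl 0))‖ := by
    intro y
    constructor
    · intro hy
      exact ⟨hy.1 trivial, (hy.2 (.inl 0) (by simp)).1 trivial⟩
    · rintro ⟨h1, h2⟩
      refine ⟨fun _ => h1, ?_⟩
      rintro (i | i) hi
      · revert i
        exact Fin.forall_fin_two.2 ⟨fun _ => ⟨fun _ => h2, fun h => (h trivial).elim⟩,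
          fun h => (h rfl).elim⟩
      · exact i.elim0
  have hin : ∀ y, ‖y - (PY (.inr 0) + (ℓ ^ 2 : ℝ) * PD (.inl 0))‖ ≤ ℓ ^ 3 →
      ‖y - PY (.inr 0)‖ < ℓ := by
    intro y hy
    have h1 : ‖y - PY (.inr 0)‖ ≤ ‖y - (PY (.inr 0) + (ℓ ^ 2 : ℝ) * PD (.inl 0))‖ +
        ‖((ℓ ^ 2 : ℝ) : ℂ) * PD (.inl 0)‖ := by
      have : y - PY (.inr 0) = (y - (PY (.inr 0) + (ℓ ^ 2 : ℝ) * PD (.inl 0))) +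
        (ℓ ^ 2 : ℝ) * PD (.inl 0) := by ring
      rw [this]
      exact norm_add_le _ _
    rw [hscale] at h1
    linarith
  have hdis : Disjoint (region (fun e => e = .inr 0) (.inr 0) PX
      (PY (.inr 0) + (ℓ ^ 2 : ℝ) * PD (.inl 0)) (ℓ ^ 4) (ℓ ^ 3) (ℓ ^ 5))
      (region (fun e => e = .inr 0) (.inl 0) PY 0 1 ℓ⁻¹ ℓ) :=
    disjoint_left.2 fun y h1 h2 => by
      linarith [hin y ((hRX y).1 h1).1, (hRY y).1 h2]
  have g0 : ∀ z, seam (.inr 0) PX (PY (.inr 0) + (ℓ ^ 2 : ℝ) * PD (.inl 0)) (ℓ ^ 4) (ℓ ^ 3)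
      (ℓ ^ 5) (.inr 0) z = PY (.inr 0) + (ℓ ^ 2 : ℝ) * PD (.inl 0) - (ℓ ^ 3 : ℝ) * z⁻¹ :=
    seam_root _ _ _ _ _ _
  have g1 : ∀ z, seam (.inl 0) PY 0 1 ℓ⁻¹ ℓ (.inr 0) z = PY (.inr 0) + ℓ * z := fun z =>
    (seam_leaf (by simp) _ _ _ _ _ z).trans (by simp)
  have k0 : ∀ z, seam (.inl 1) PD (PY (.inr 0)) (ℓ ^ 2) ℓ (ℓ ^ 3) (.inl 0) z =
      PY (.inr 0) + (ℓ ^ 2 : ℝ) * PD (.inl 0) + (ℓ ^ 3 : ℝ) * z :=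
    seam_leaf (by simp) _ _ _ _ _
  have k1 : ∀ z, seam (.inl 1) PD (PY (.inr 0)) (ℓ ^ 2) ℓ (ℓ ^ 3) (.inl 1) z =
      PY (.inr 0) - ℓ * z⁻¹ := seam_root _ _ _ _ _ _
  obtain ⟨F, hF⟩ := (cX.tensor cY hdis).comp cD
    (Fin.forall_fin_two.2 ⟨rfl, rfl⟩) (fun _ => trivial)
    (Fin.forall_fin_two.2 ⟨fun z _ => (g0 z).trans ((k0 _).trans (by ring)).symm,
      fun z _ => (g1 z).trans ((k1 _).trans (by simp)).symm⟩)
    (by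
      rintro y (h1 | h1) h2
      · obtain ⟨z, hz, hy⟩ := exists_unit_of_norm_eq (by positivity)
          (le_antisymm ((hRX y).1 h1).1 ((hRD y).1 h2).2)
        exact ⟨(0 : Fin 2), z, hz, hy.trans (g0 z).symm⟩
      · obtain ⟨z, hz, hy⟩ := exists_unit_of_norm_eq hℓ0
          (le_antisymm ((hRD y).1 h2).1 ((hRY y).1 h1))
        refine ⟨(1 : Fin 2), -z⁻¹, by simpa using hz, hy.trans ((g1 _).trans ?_).symm⟩
        ring)
  refine ⟨PY (.inr 0) + (ℓ ^ 2 : ℝ) * PD (.inl 0) + (ℓ ^ 4 : ℝ) * PX (.inl 0), F,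
    IsCore.isModel (n := [.circle, .biweb]) (m := []) hF ?_ rfl (fun y => ?_) ?_ ?_⟩
  · rintro (j | j)
    · revert j
      exact Fin.forall_fin_two.2 ⟨Sum.inl_ne_inr, Sum.inl_ne_inr⟩
    · exact j.elim0
  · have h4 : ‖((ℓ ^ 4 : ℝ) : ℂ) * PX (.inl 0)‖ < ℓ ^ 3 := by
      rw [hscale]
      have : 0 < ℓ ^ 3 := by positivity
      nlinarith
    have h5 : y = PY (.inr 0) + (ℓ ^ 2 : ℝ) * PD (.inl 0) + (ℓ ^ 4 : ℝ) * PX (.inl 0) →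
        ‖y - (PY (.inr 0) + (ℓ ^ 2 : ℝ) * PD (.inl 0))‖ < ℓ ^ 3 := by
      rintro rfl
      rwa [add_sub_cancel_left]
    refine Iff.trans (b := y ≠ PY (.inr 0) + (ℓ ^ 2 : ℝ) * PD (.inl 0) +
      (ℓ ^ 4 : ℝ) * PX (.inl 0)) ⟨?_, fun h => ?_⟩ ⟨fun h => ?_, fun h => h (.inl 0) (by simp)⟩
    · rintro ((h | h) | h) h'
      · exact ((hRX y).1 h).2 h'
      · linarith [hin y (h5 h').le, (hRY y).1 h]
      · linarith [h5 h', ((hRD y).1 h).2]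
    · rcases le_total ‖y - (PY (.inr 0) + (ℓ ^ 2 : ℝ) * PD (.inl 0))‖ (ℓ ^ 3) with h1 | h1
      · exact .inl (.inl ((hRX y).2 ⟨h1, h⟩))
      rcases le_total ‖y - PY (.inr 0)‖ ℓ with h2 | h2
      · exact .inr ((hRD y).2 ⟨h2, h1⟩)
      · exact .inl (.inr ((hRY y).2 h2))
    · rintro (j | j) hj
      · revert j
        exact Fin.forall_fin_two.2 ⟨fun _ => h, fun h => (h rfl).elim⟩
      · exact j.elim0
  · rintro (j | j) hj
    · revert j
      exact Fin.forall_fin_two.2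
        ⟨fun _ => ⟨ℓ ^ 5, by positivity, seam_leaf (Sum.inl_ne_inr (a := 0)) _ _ _ _ _⟩,
        fun h => (h rfl).elim⟩
    · exact j.elim0
  · refine ⟨ℓ, hℓ0, fun z => ?_⟩
    refine (seam_root _ _ _ _ _ _ z).trans ?_
    simp [mul_comm]

end SingCob

namespace SingCob

open Cob

/-! ### Normal forms of models -/

namespace IsModel

variable {n m : List Web} {A B : Cob n m} {b : Web} {o : EndIdx n m} {P Q : EndIdx n m → ℂ}
  {f : A.M → ℂ}

/-- The rightmost puncture of a horizontal strip can be moved to the right. -/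
theorem shift (hf : IsModel A b o P f) {e₀ : EndIdx n m} {t₀ t y₀ T : ℝ} (ht : t₀ < t)
    (hT : t ≤ T) (h₀ : P e₀ = t + y₀ * Complex.I) (hQ₀ : Q e₀ = T + y₀ * Complex.I)
    (h : ∀ e, e ≠ o → e ≠ e₀ → Q e = P e ∧ ((P e).re < t₀ ∨ 1 / 2 < |(P e).im - y₀|)) :
    ∃ f, IsModel A b o Q f := by
  obtain ⟨G, hG, hs, hre, him, ht', R, hR⟩ := exists_shift ht (sub_nonneg.2 hT) y₀
  have hfix : ∀ e, e ≠ o → e ≠ e₀ → ∀ᶠ y in 𝓝 (P e), G y = y := by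
    intro e he he₀
    rcases (h e he he₀).2 with h1 | h1
    · filter_upwards [Complex.continuous_re.continuousAt.eventually (gt_mem_nhds h1)] with y hy
      exact hre y hy.le
    · have hc : ContinuousAt (fun y : ℂ => |y.im - y₀|) (P e) := by fun_prop
      filter_upwards [hc.eventually (lt_mem_nhds h1)] with y hy
      exact him y hy.le
  refine ⟨_, (hf.post_compactSupport hG (hs b) (fun e he => ?_) hR).congr fun e he => ?_⟩
  · by_cases he₀ : e = e₀
    · subst he₀
      exact ⟨_, by rw [h₀]; exact ht'⟩
    · exact ⟨0, by simpa using hfix e he he₀⟩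
  · by_cases he₀ : e = e₀
    · subst he₀
      rw [Function.comp_apply, h₀, ht'.self_of_nhds, hQ₀]
      push_cast
      ring
    · rw [Function.comp_apply, (hfix e he he₀).self_of_nhds, (h e he he₀).1]

/-- An affine map sends the first two points to `0` and `1`. The third one then lies at some `t >
1`, and being rightmost it can be shifted to any `T ≥ t` without disturbing the others. -/
theorem exists_three (hf : IsModel A b o P f) {e₁ e₂ e₃ : EndIdx n m}
    (he : ∀ e, e ≠ o → e = e₁ ∨ e = e₂ ∨ e = e₃) {x₁ x₂ x₃ : ℝ} (h₁ : P e₁ = x₁) (h₂ : P e₂ = x₂)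
    (h₃ : P e₃ = x₃) (h₁₂ : x₁ < x₂) (h₂₃ : x₂ < x₃) :
    ∃ t : ℝ, ∀ T : ℝ, t ≤ T → ∀ Q : EndIdx n m → ℂ, Q e₁ = 0 → Q e₂ = 1 → Q e₃ = T →
      ∃ f, IsModel A b o Q f := by
  have hpos : 0 < (x₂ - x₁)⁻¹ := inv_pos.2 (sub_pos.2 h₁₂)
  have hx : ((x₂ - x₁ : ℝ) : ℂ) ≠ 0 := by exact_mod_cast (sub_pos.2 h₁₂).ne'
  have hg := hf.post_affine (a := ((x₂ - x₁)⁻¹ : ℝ)) (p := ((-(x₂ - x₁)⁻¹ * x₁ : ℝ) : ℂ))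
    (by exact_mod_cast hpos.ne') (fun _ => ⟨hpos, Complex.ofReal_im _, Complex.ofReal_im _⟩)
  have ht : 1 < (x₂ - x₁)⁻¹ * (x₃ - x₁) := by
    rw [inv_mul_eq_div, one_lt_div (sub_pos.2 h₁₂)]
    linarith
  have k₁ : ((-(x₂ - x₁)⁻¹ * x₁ : ℝ) : ℂ) + ((x₂ - x₁)⁻¹ : ℝ) * P e₁ = 0 := by
    rw [h₁]
    push_cast
    ring
  have k₂ : ((-(x₂ - x₁)⁻¹ * x₁ : ℝ) : ℂ) + ((x₂ - x₁)⁻¹ : ℝ) * P e₂ = 1 := by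
    rw [h₂, ← Complex.ofReal_mul, ← Complex.ofReal_add, ← Complex.ofReal_one, Complex.ofReal_inj]
    have := (sub_pos.2 h₁₂).ne'
    field_simp
    ring
  refine ⟨(x₂ - x₁)⁻¹ * (x₃ - x₁), fun T hT Q q₁ q₂ q₃ =>
    hg.shift (e₀ := e₃) (t₀ := (1 + (x₂ - x₁)⁻¹ * (x₃ - x₁)) / 2) (y₀ := 0) (by linarith) hT ?_
      (by simpa using q₃) fun e h hne => ?_⟩
  · rw [h₃]
    push_cast
    ring
  · rcases he e h with rfl | rfl | rfl
    · rw [k₁, q₁]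
      exact ⟨rfl, .inl (by simp; linarith)⟩
    · rw [k₂, q₂]
      exact ⟨rfl, .inl (by simp; linarith)⟩
    · exact absurd rfl hne

/-- Trees with three leaves on the real line are determined by the order of their leaves. -/
theorem equivalent_of_three (hf : IsModel A b o P f) {f' : B.M → ℂ} (hf' : IsModel B b o Q f')
    (e₁ e₂ e₃ : EndIdx n m) (he : ∀ e, e ≠ o → e = e₁ ∨ e = e₂ ∨ e = e₃) (he₁₂ : e₁ ≠ e₂)
    (he₁₃ : e₁ ≠ e₃) (he₂₃ : e₂ ≠ e₃) {x₁ x₂ x₃ : ℝ} (h₁ : P e₁ = x₁)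
    (h₂ : P e₂ = x₂) (h₃ : P e₃ = x₃) (h₁₂ : x₁ < x₂) (h₂₃ : x₂ < x₃) {y₁ y₂ y₃ : ℝ}
    (k₁ : Q e₁ = y₁) (k₂ : Q e₂ = y₂) (k₃ : Q e₃ = y₃) (k₁₂ : y₁ < y₂) (k₂₃ : y₂ < y₃) :
    A.Equivalent B := by
  obtain ⟨t, ht⟩ := hf.exists_three he h₁ h₂ h₃ h₁₂ h₂₃
  obtain ⟨t', ht'⟩ := hf'.exists_three he k₁ k₂ k₃ k₁₂ k₂₃
  -- Shifts go to the right only, so the common normal form uses the larger of the two thresholds.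
  let S : EndIdx n m → ℂ := fun e => if e = e₁ then 0 else if e = e₂ then 1 else (max t t' : ℝ)
  have s₁ : S e₁ = 0 := if_pos rfl
  have s₂ : S e₂ = 1 := by simp [S, he₁₂.symm]
  have s₃ : S e₃ = (max t t' : ℝ) := by simp [S, he₁₃.symm, he₂₃.symm]
  obtain ⟨g, hg⟩ := ht _ (le_max_left t t') S s₁ s₂ s₃
  obtain ⟨g', hg'⟩ := ht' _ (le_max_right t t') S s₁ s₂ s₃
  exact hg.equivalent hg'

/-- Annuli with conformally equivalent models are equivalent. -/
theorem equivalent_of_one (hf : IsModel A b o P f) {f' : B.M → ℂ} (hf' : IsModel B b o Q f')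
    {e₁ : EndIdx n m} (he : ∀ e, e ≠ o → e = e₁) (hk : endKind n m e₁ = b) :
    A.Equivalent B := by
  by_cases h₁ : e₁ = o
  -- In this case there are no leaves, and the positions carry no information.
  · exact (hf.congr (P' := Q) fun e h => absurd ((he e h).trans h₁) h).equivalent hf'
  · refine ((hf.post_affine (a := 1) (p := Q e₁ - P e₁) one_ne_zero ?_).congr
      (P' := Q) fun e h => ?_).equivalent hf'
    · rintro rfl
      have c₁ := hf.compat e₁ h₁
      have c₂ := hf'.compat e₁ h₁
      rw [hk] at c₁ c₂
      have c₁' : (P e₁).im = 0 := c₁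
      have c₂' : (Q e₁).im = 0 := c₂
      simp [c₁', c₂']
    · obtain rfl := he e h
      ring

/-- A circle in the upper half plane can be moved to `I`. -/
theorem exists_one_circle {P : EndIdx n m → ℂ} {f : A.M → ℂ} (hf : IsModel A .biweb o P f)
    {e₁ : EndIdx n m} (h₁ : e₁ ≠ o) (hk : endKind n m e₁ = .circle)
    (he : ∀ e, e ≠ o → e = e₁) : ∃ f, IsModel A .biweb o (fun _ => Complex.I) f := by
  have hc := hf.compat e₁ h₁
  rw [hk] at hc
  have hpos : 0 < (P e₁).im := hc
  refine ⟨_, (hf.post_affine (a := ((P e₁).im⁻¹ : ℝ)) (p := ((-(P e₁).im⁻¹ * (P e₁).re : ℝ) : ℂ))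
    (by exact_mod_cast (inv_pos.2 hpos).ne')
    (fun _ => ⟨by simpa using hpos, by simp, by simp⟩)).congr fun e h => ?_⟩
  obtain rfl := he e h
  apply Complex.ext
  · simp
  · simp [hpos.ne']

/-- Two pairs of circles at the same height in the upper half plane are equivalent. -/
theorem equivalent_of_two {P Q : EndIdx n m → ℂ} {f : A.M → ℂ} {f' : B.M → ℂ}
    (hf : IsModel A .biweb o P f) (hf' : IsModel B .biweb o Q f') {e₁ e₂ : EndIdx n m}
    (he : ∀ e, e ≠ o → e = e₁ ∨ e = e₂) (he₁₂ : e₁ ≠ e₂)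
    (h₁ : 0 < (P e₁).im) (h₂ : (P e₂).im = (P e₁).im) (h₁₂ : (P e₁).re < (P e₂).re)
    (k₁ : 0 < (Q e₁).im) (k₂ : (Q e₂).im = (Q e₁).im) (k₁₂ : (Q e₁).re < (Q e₂).re) :
    A.Equivalent B := by
  have key : ∀ {C : Cob n m} {P : EndIdx n m → ℂ} {f : C.M → ℂ}, IsModel C .biweb o P f →
      0 < (P e₁).im → (P e₂).im = (P e₁).im → (P e₁).re < (P e₂).re → ∃ t : ℝ, ∀ T : ℝ, t ≤ T →
      ∀ S : EndIdx n m → ℂ, S e₁ = Complex.I → S e₂ = T + Complex.I →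
        ∃ f, IsModel C .biweb o S f := by
    intro C P f hf h₁ h₂ h₁₂
    have hpos : 0 < (P e₁).im⁻¹ := inv_pos.2 h₁
    have hg := hf.post_affine (a := ((P e₁).im⁻¹ : ℝ))
      (p := ((-(P e₁).im⁻¹ * (P e₁).re : ℝ) : ℂ)) (by exact_mod_cast hpos.ne')
      (fun _ => ⟨by simpa using h₁, by simp, by simp⟩)
    have ht : 0 < (P e₁).im⁻¹ * ((P e₂).re - (P e₁).re) := mul_pos hpos (sub_pos.2 h₁₂)
    have q₁ : ((-(P e₁).im⁻¹ * (P e₁).re : ℝ) : ℂ) + ((P e₁).im⁻¹ : ℝ) * P e₁ = Complex.I := by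
      apply Complex.ext
      · simp
      · simp [h₁.ne']
    refine ⟨(P e₁).im⁻¹ * ((P e₂).re - (P e₁).re), fun T hT S s₁ s₂ =>
      hg.shift (e₀ := e₂) (t₀ := (P e₁).im⁻¹ * ((P e₂).re - (P e₁).re) / 2) (y₀ := 1)
        (by linarith) hT ?_ (by simpa using s₂) fun e h h' => ?_⟩
    · apply Complex.ext
      · simp
        ring
      · simp [h₂, h₁.ne']
    · rcases he e h with rfl | rfl
      · rw [q₁, s₁]
        exact ⟨rfl, .inl (by simp only [Complex.I_re]; linarith)⟩
      · exact absurd rfl h'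
  obtain ⟨t, ht⟩ := key hf h₁ h₂ h₁₂
  obtain ⟨t', ht'⟩ := key hf' k₁ k₂ k₁₂
  let S : EndIdx n m → ℂ := fun e => if e = e₁ then Complex.I else (max t t' : ℝ) + Complex.I
  have s₁ : S e₁ = Complex.I := if_pos rfl
  have s₂ : S e₂ = (max t t' : ℝ) + Complex.I := if_neg he₁₂.symm
  obtain ⟨g, hg⟩ := ht _ (le_max_left t t') S s₁ s₂
  obtain ⟨g', hg'⟩ := ht' _ (le_max_right t t') S s₁ s₂
  exact hg.equivalent hg'

/-- A circle in the upper half plane can be moved past a bi-web on the real line. -/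
theorem equivalent_of_central {P Q : EndIdx n m → ℂ} {f : A.M → ℂ} {f' : B.M → ℂ}
    (hf : IsModel A .biweb o P f) (hf' : IsModel B .biweb o Q f') {e₁ e₂ : EndIdx n m}
    (he : ∀ e, e ≠ o → e = e₁ ∨ e = e₂) (he₁₂ : e₁ ≠ e₂)
    (h₁ : (P e₁).im = 0) (h₂ : 0 < (P e₂).im) (k₁ : (Q e₁).im = 0) (k₂ : 0 < (Q e₂).im) :
    A.Equivalent B := by
  have key : ∀ {C : Cob n m} {P : EndIdx n m → ℂ} {f : C.M → ℂ}, IsModel C .biweb o P f →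
      (P e₁).im = 0 → 0 < (P e₂).im → ∃ t : ℝ, ∀ T : ℝ, t ≤ T →
      ∀ S : EndIdx n m → ℂ, S e₁ = 0 → S e₂ = T + Complex.I → ∃ f, IsModel C .biweb o S f := by
    intro C P f hf h₁ h₂
    have hpos : 0 < (P e₂).im⁻¹ := inv_pos.2 h₂
    have hg := hf.post_affine (a := ((P e₂).im⁻¹ : ℝ))
      (p := ((-(P e₂).im⁻¹ * (P e₁).re : ℝ) : ℂ)) (by exact_mod_cast hpos.ne')
      (fun _ => ⟨by simpa using h₂, by simp, by simp⟩)
    have q₁ : ((-(P e₂).im⁻¹ * (P e₁).re : ℝ) : ℂ) + ((P e₂).im⁻¹ : ℝ) * P e₁ = 0 := by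
      apply Complex.ext
      · simp
      · simp [h₁]
    -- The circle is moved within a strip of half-width `1 / 2` around height `1`. The bi-web on the
    -- real axis lies outside the strip and is not disturbed, whichever of the two is further to the
    -- right; so any starting point `t - 1` of the shift will do.
    refine ⟨(P e₂).im⁻¹ * ((P e₂).re - (P e₁).re), fun T hT S s₁ s₂ =>
      hg.shift (e₀ := e₂) (y₀ := 1) (sub_one_lt _) hT ?_ (by simpa using s₂) fun e h h' => ?_⟩
    · apply Complex.ext
      · simp
        ring
      · simp [h₂.ne']
    · rcases he e h with rfl | rfl
      · rw [q₁, s₁]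
        exact ⟨rfl, .inr (by norm_num)⟩
      · exact absurd rfl h'
  obtain ⟨t, ht⟩ := key hf h₁ h₂
  obtain ⟨t', ht'⟩ := key hf' k₁ k₂
  let S : EndIdx n m → ℂ := fun e => if e = e₁ then 0 else (max t t' : ℝ) + Complex.I
  have s₁ : S e₁ = 0 := if_pos rfl
  have s₂ : S e₂ = (max t t' : ℝ) + Complex.I := if_neg he₁₂.symm
  obtain ⟨g, hg⟩ := ht _ (le_max_left t t') S s₁ s₂
  obtain ⟨g', hg'⟩ := ht' _ (le_max_right t t') S s₁ s₂
  exact hg.equivalent hg'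

/-- Any two pairs of circles in the plane are equivalent. -/
theorem equivalent_of_two_circles {P Q : EndIdx n m → ℂ} {f : A.M → ℂ} {f' : B.M → ℂ}
    (hf : IsModel A .circle o P f) (hf' : IsModel B .circle o Q f') {e₁ e₂ : EndIdx n m}
    (he : ∀ e, e ≠ o → e = e₁ ∨ e = e₂) (h : P e₁ ≠ P e₂) (k : Q e₁ ≠ Q e₂) :
    A.Equivalent B := by
  have hP : P e₂ - P e₁ ≠ 0 := sub_ne_zero.2 h.symm
  -- Without a singular axis the factor may be any nonzero complex number, so a single affine map
  -- carries one pair of points to the other.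
  refine ((hf.post_affine (a := (Q e₂ - Q e₁) / (P e₂ - P e₁))
    (p := Q e₁ - (Q e₂ - Q e₁) / (P e₂ - P e₁) * P e₁)
    (div_ne_zero (sub_ne_zero.2 k.symm) hP) nofun).congr (P' := Q) fun e h' => ?_).equivalent hf'
  rcases he e h' with rfl | rfl
  · ring
  · field_simp
    ring

end IsModel

end SingCob

namespace SingCob

open Cob

/-! ### Models of the generators -/

theorem isModel_cyl (x : Web) : ∃ f, IsModel (cyl x) x (.inr 0) (fun _ => 0) f :=
  ⟨_, (isModel_disc _).congr fun e _ => by rcases e with j | j <;> rfl⟩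

theorem isModel_mult (x : Web) :
    ∃ f, IsModel (mult x) x (.inr 0) (Sum.elim ![-1, 1] fun _ => 0) f :=
  ⟨_, isModel_disc _⟩

theorem isModel_unit (x : Web) : ∃ f, IsModel (unit x) x (.inr 0) (fun _ => 0) f :=
  ⟨_, (isModel_disc _).congr fun e _ => by rcases e with j | j; exacts [j.elim0, rfl]⟩

theorem isModel_zipper : ∃ f, IsModel zipper .biweb (.inr 0) (fun _ => Complex.I) f :=
  ⟨_, (isModel_disc _).congr (by
    rintro (j | j) h
    · rfl
    · exact absurd (congrArg Sum.inr (Subsingleton.elim (α := Fin 1) j 0)) h)⟩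

theorem isModel_cyl_inl (x : Web) : ∃ f, IsModel (cyl x) x (.inl 0) (fun _ => 0) f := by
  obtain ⟨f, hf⟩ := isModel_cyl x
  refine ⟨_, (hf.reroot (o' := .inl 0) Sum.inl_ne_inr rfl ?_).congr ?_⟩
  · rintro (j | j) h h'
    · exact absurd (congrArg Sum.inl (Subsingleton.elim (α := Fin 1) j 0)) h'
    · exact absurd (congrArg Sum.inr (Subsingleton.elim (α := Fin 1) j 0)) h
  · simp

theorem isModel_counit (x : Web) : ∃ f, IsModel (counit x) x (.inl 0) (fun _ => 0) f := by
  obtain ⟨f, hf⟩ := isModel_unit x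
  exact ⟨_, hf.reverse.congr fun e _ => by simp⟩

theorem isModel_cozipper : ∃ f, IsModel cozipper .biweb (.inl 0) (fun _ => Complex.I) f := by
  obtain ⟨f, hf⟩ := isModel_zipper
  exact ⟨_, hf.reverse.congr fun e _ => by simp⟩

/-- The reflection in the imaginary axis exchanges `-1` and `1`, so the targets appear from right to
left. -/
theorem isModel_comult (x : Web) :
    ∃ f, IsModel (comult x) x (.inl 0) (Sum.elim (fun _ => 0) ![1, -1]) f := by
  obtain ⟨f, hf⟩ := isModel_mult x
  refine ⟨_, hf.reverse.congr ?_⟩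
  rintro (j | j) _
  · simp
  · revert j
    exact Fin.forall_fin_two.2 ⟨by simp, by simp⟩

/-- The inversion sends the target at `1` to infinity, the old root to `0`, and the other target
from `-1` to `-(-1 - 1)⁻¹ = 1 / 2`. -/
theorem isModel_comult_inr_zero (x : Web) : ∃ f, IsModel (comult x) x (.inr (0 : Fin 2))
    (Sum.elim (fun _ => 0) ![0, 1 / 2]) f := by
  obtain ⟨f, hf⟩ := isModel_comult x
  refine ⟨_, (hf.reroot (o' := .inr (0 : Fin 2)) Sum.inr_ne_inl rfl ?_).congr ?_⟩
  · rintro (j | j) h h'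
    · exact absurd (congrArg Sum.inl (Subsingleton.elim (α := Fin 1) j 0)) h
    · revert j
      exact Fin.forall_fin_two.2 ⟨fun _ h => (h rfl).elim, fun _ _ => by norm_num⟩
  · rintro (j | j) h
    · exact (if_pos (congrArg Sum.inl (Subsingleton.elim (α := Fin 1) j 0))).symm
    · revert j
      exact Fin.forall_fin_two.2 ⟨fun h => (h rfl).elim, fun _ => by
        refine Eq.trans ?_ (if_neg Sum.inr_ne_inl).symm
        norm_num⟩

/-- Now the target at `-1` goes to infinity, and the one at `1` goes to `-(1 + 1)⁻¹ = -1 / 2`. -/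
theorem isModel_comult_inr_one (x : Web) : ∃ f, IsModel (comult x) x (.inr (1 : Fin 2))
    (Sum.elim (fun _ => 0) ![-1 / 2, 0]) f := by
  obtain ⟨f, hf⟩ := isModel_comult x
  refine ⟨_, (hf.reroot (o' := .inr (1 : Fin 2)) Sum.inr_ne_inl rfl ?_).congr ?_⟩
  · rintro (j | j) h h'
    · exact absurd (congrArg Sum.inl (Subsingleton.elim (α := Fin 1) j 0)) h
    · revert j
      exact Fin.forall_fin_two.2 ⟨fun _ _ => by norm_num, fun _ h => (h rfl).elim⟩
  · rintro (j | j) h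
    · exact (if_pos (congrArg Sum.inl (Subsingleton.elim (α := Fin 1) j 0))).symm
    · revert j
      exact Fin.forall_fin_two.2 ⟨fun _ => by
        refine Eq.trans ?_ (if_neg Sum.inr_ne_inl).symm
        norm_num, fun h => (h rfl).elim⟩

/-! ### Products with the generators -/

variable {n n' : List Web} {b : Web}

/-- The inserted trees are scaled by `ℓ ^ 2`; the bound `1 / 2` keeps the order of the resulting
punctures evident. -/
theorem eventually_sq_lt : ∀ᶠ ℓ : ℝ in 𝓝[>] 0, 0 < ℓ ^ 2 ∧ ℓ ^ 2 < 1 / 2 := by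
  filter_upwards [self_mem_nhdsWithin, eventually_mul_lt 2 one_pos] with ℓ h1 h2
  have h1' : 0 < ℓ := h1
  exact ⟨by positivity, by nlinarith⟩

/-- A pair of trees glued to a multiplication. -/
theorem IsModel.tensor_comp_mult {X : Cob n [b]} {Y : Cob n' [b]} {PX : EndIdx n [b] → ℂ}
    {PY : EndIdx n' [b] → ℂ} {fX : X.M → ℂ} {fY : Y.M → ℂ}
    (hX : IsModel X b (.inr 0) PX fX) (hY : IsModel Y b (.inr 0) PY fY) :
    ∃ r : ℝ, 0 < r ∧ r < 1 / 2 ∧ ∃ f, IsModel ((X.tensor Y).comp (mult b)) b (.inr 0)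
      (Sum.elim (fun j => Sum.elim (fun j => -1 + r * PX (.inl j))
        (fun j => 1 + r * PY (.inl j)) (splitIdx n n' j)) fun _ => 0) f := by
  obtain ⟨g, hg⟩ := isModel_mult b
  have hF : IsForest (X.tensor Y) b (fun i => .inr i) _ _ := hX.forest hY rfl rfl
  have h := hF.comp_right hg (by norm_num)
  obtain ⟨ℓ, ⟨h1, h2⟩, f, hf⟩ := (eventually_sq_lt.and h).exists
  refine ⟨ℓ ^ 2, h1, h2, f, hf.congr ?_⟩
  rintro (j | j) _
  · simp only [Sum.elim_inl, IsCore.endSplit]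
    rcases splitIdx n n' j with i | i <;> rfl
  · rfl

/-- A comultiplication glued to a pair of trees. -/
theorem IsModel.comult_comp_tensor {X : Cob [b] n} {Y : Cob [b] n'} {PX : EndIdx [b] n → ℂ}
    {PY : EndIdx [b] n' → ℂ} {fX : X.M → ℂ} {fY : Y.M → ℂ}
    (hX : IsModel X b (.inl 0) PX fX) (hY : IsModel Y b (.inl 0) PY fY) :
    ∃ r : ℝ, 0 < r ∧ r < 1 / 2 ∧ ∃ f, IsModel ((comult b).comp (X.tensor Y)) b (.inl 0)
      (Sum.elim (fun _ => 0) fun j => Sum.elim (fun j => 1 + r * PX (.inr j))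
        (fun j => -1 + r * PY (.inr j)) (splitIdx n n' j)) f := by
  obtain ⟨g, hg⟩ := isModel_comult b
  have hF : IsForest (X.tensor Y) b (fun i => .inl i) _ _ := hX.forest hY rfl rfl
  have h := hF.comp_left hg (by norm_num)
  obtain ⟨ℓ, ⟨h1, h2⟩, f, hf⟩ := (eventually_sq_lt.and h).exists
  refine ⟨ℓ ^ 2, h1, h2, f, hf.congr ?_⟩
  rintro (j | j) _
  · rfl
  · simp only [Sum.elim_inr, IsCore.endSplit]
    rcases splitIdx n n' j with i | i <;> rfl

/-- The opposite of the multiplication. -/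
theorem isModel_braid_mult (x : Web) :
    ∃ f, IsModel ((braid x x).comp (mult x)) x (.inr 0) (Sum.elim ![1, -1] fun _ => 0) f := by
  obtain ⟨g, hg⟩ := isModel_mult x
  obtain ⟨c, hc⟩ := isModel_cyl x
  have hT : IsForest ((cyl x).tensor (cyl x)) x (fun i => .inr i) _ _ := hc.forest hc rfl rfl
  -- The braiding is a pair of cylinders whose targets, which are the roots, are exchanged; hence
  -- both the renumbering and the permutation of the discs are the transposition.
  have hF : IsForest (n := [x, x]) (m := [x, x]) (braid x x) x (fun i => .inr i) _ _ :=
    hT.permTgt (m' := [x, x]) (Equiv.swap (0 : Fin 2) 1) (Fin.forall_fin_two.2 ⟨rfl, rfl⟩)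
      (Equiv.swap (0 : Fin 2) 1) (Fin.forall_fin_two.2 ⟨rfl, rfl⟩)
  obtain ⟨ℓ, f, hf⟩ := (hF.comp_right hg (by norm_num)).exists
  refine ⟨f, hf.congr ?_⟩
  rintro (j | j) _
  · revert j
    refine Fin.forall_fin_two.2 ⟨fun _ => ?_, fun _ => ?_⟩
    · change (1 : ℂ) = 1 + _ * 0
      ring
    · change (-1 : ℂ) = -1 + _ * 0
      ring
  · rfl

end SingCob

namespace SingCob

open Cob

/-! ### The relations -/

theorem EndIdx.eq_inl_of_ne {n : List Web} {x : Web} {e : EndIdx n [x]} (h : e ≠ .inr 0) :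
    ∃ j, e = .inl j := by
  rcases e with j | j
  · exact ⟨j, rfl⟩
  · exact absurd (congrArg Sum.inr (Subsingleton.elim (α := Fin 1) j 0)) h

theorem EndIdx.eq_inr_of_ne {n : List Web} {x : Web} {e : EndIdx [x] n} (h : e ≠ .inl 0) :
    ∃ j, e = .inr j := by
  rcases e with j | j
  · exact absurd (congrArg Sum.inl (Subsingleton.elim (α := Fin 1) j 0)) h
  · exact ⟨j, rfl⟩

section Frobenius

variable (x : Web)

/-- The inputs lie at `-1`, `1 - r`, `1 + r` on one side and at `-1 - s`, `-1 + s`, `1` on the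
other: the same order on the line. -/
theorem mult_assoc : ((cyl x).tensor (mult x)).comp (mult x) |>.Equivalent
    (((mult x).tensor (cyl x)).comp (mult x)) := by
  obtain ⟨fc, hc⟩ := isModel_cyl x
  obtain ⟨fm, hm⟩ := isModel_mult x
  obtain ⟨r, hr, hr', f, hf⟩ := hc.tensor_comp_mult hm
  obtain ⟨s, hs, hs', f', hf'⟩ := hm.tensor_comp_mult hc
  refine IsModel.equivalent_of_three (n := [x, x, x]) (m := [x]) hf hf'
    (.inl (0 : Fin 3)) (.inl (1 : Fin 3)) (.inl (2 : Fin 3)) ?_ (by simp) (by simp) (by simp)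
    (x₁ := -1) (x₂ := 1 - r) (x₃ := 1 + r) (y₁ := -1 - s) (y₂ := -1 + s) (y₃ := 1)
    ?_ ?_ ?_ (by linarith) (by linarith) ?_ ?_ ?_ (by linarith) (by linarith)
  · intro e h
    obtain ⟨j, rfl⟩ := EndIdx.eq_inl_of_ne h
    revert j
    exact forall_fin_three (fun _ => .inl rfl) (fun _ => .inr (.inl rfl))
      (fun _ => .inr (.inr rfl))
  · change -1 + (r : ℂ) * 0 = _
    push_cast; ring
  · change 1 + (r : ℂ) * (-1) = _
    push_cast; ring
  · change 1 + (r : ℂ) * 1 = _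
    push_cast; ring
  · change -1 + (s : ℂ) * (-1) = _
    push_cast; ring
  · change -1 + (s : ℂ) * 1 = _
    push_cast; ring
  · change 1 + (s : ℂ) * 0 = _
    push_cast; ring

/-- As for associativity, but on both sides the targets are ordered from right to left. -/
theorem comult_coassoc : (comult x).comp ((cyl x).tensor (comult x)) |>.Equivalent
    ((comult x).comp ((comult x).tensor (cyl x))) := by
  obtain ⟨fc, hc⟩ := isModel_cyl_inl x
  obtain ⟨fd, hd⟩ := isModel_comult x
  obtain ⟨r, hr, hr', f, hf⟩ := hc.comult_comp_tensor hd
  obtain ⟨s, hs, hs', f', hf'⟩ := hd.comult_comp_tensor hc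
  refine IsModel.equivalent_of_three (n := [x]) (m := [x, x, x]) hf hf'
    (.inr (2 : Fin 3)) (.inr (1 : Fin 3)) (.inr (0 : Fin 3)) ?_ (by simp) (by simp) (by simp)
    (x₁ := -1 - r) (x₂ := -1 + r) (x₃ := 1) (y₁ := -1) (y₂ := 1 - s) (y₃ := 1 + s)
    ?_ ?_ ?_ (by linarith) (by linarith) ?_ ?_ ?_ (by linarith) (by linarith)
  · intro e h
    obtain ⟨j, rfl⟩ := EndIdx.eq_inr_of_ne h
    revert j
    exact forall_fin_three (fun _ => .inr (.inr rfl)) (fun _ => .inr (.inl rfl))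
      (fun _ => .inl rfl)
  · change -1 + (r : ℂ) * (-1) = _
    push_cast; ring
  · change -1 + (r : ℂ) * 1 = _
    push_cast; ring
  · change 1 + (r : ℂ) * 0 = _
    push_cast; ring
  · change -1 + (s : ℂ) * 0 = _
    push_cast; ring
  · change 1 + (s : ℂ) * (-1) = _
    push_cast; ring
  · change 1 + (s : ℂ) * 1 = _
    push_cast; ring

/-- With the first target at infinity, both sides carry, from left to right, the two inputs and the
second target. -/
theorem mult_comult_left : ((cyl x).tensor (comult x)).comp ((mult x).tensor (cyl x)) |>.Equivalent
    ((mult x).comp (comult x)) := by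
  obtain ⟨fc, hc⟩ := isModel_cyl x
  obtain ⟨fc', hc'⟩ := isModel_cyl_inl x
  obtain ⟨fm, hm⟩ := isModel_mult x
  obtain ⟨fd, hd⟩ := isModel_comult_inr_zero x
  have hne : ∀ j : Fin 2, j ≠ 0 → (![0, 1 / 2] : Fin 2 → ℂ) j ≠ 0 :=
    Fin.forall_fin_two.2 ⟨fun h => (h rfl).elim, fun _ => by norm_num⟩
  obtain ⟨ℓ, ⟨hℓ, -⟩, f, hf⟩ :=
    (eventually_sq_lt.and (hc.comp_path_left hd hm hc' (by norm_num) (by norm_num))).exists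
  obtain ⟨s, ⟨hs, hs'⟩, f', hf'⟩ := (eventually_sq_lt.and (hm.comp_right hd hne)).exists
  refine IsModel.equivalent_of_three (n := [x, x]) (m := [x, x]) hf hf'
    (.inl (0 : Fin 2)) (.inl (1 : Fin 2)) (.inr (1 : Fin 2)) ?_ (by simp) (by simp) (by simp)
    (x₁ := -1) (x₂ := 1) (x₃ := 1 + ℓ ^ 2 / 2) (y₁ := -s ^ 2) (y₂ := s ^ 2) (y₃ := 1 / 2)
    ?_ ?_ ?_ (by linarith) (by linarith) ?_ ?_ ?_ (by linarith) (by linarith)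
  · rintro (j | j)
    · revert j
      exact Fin.forall_fin_two.2 ⟨fun _ => .inl rfl, fun _ => .inr (.inl rfl)⟩
    · revert j
      exact Fin.forall_fin_two.2 ⟨fun h => (h rfl).elim, fun _ => .inr (.inr rfl)⟩
  · change -1 + ((ℓ ^ 2 : ℝ) : ℂ) * 0 = _
    push_cast; ring
  · change 1 + ((ℓ ^ 2 : ℝ) : ℂ) * 0 = _
    push_cast; ring
  · change 1 + ((ℓ ^ 2 : ℝ) : ℂ) * (1 / 2) + ((ℓ ^ 4 : ℝ) : ℂ) * 0 = _
    push_cast; ring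
  · change 0 + ((s ^ 2 : ℝ) : ℂ) * (-1) = _
    push_cast; ring
  · change 0 + ((s ^ 2 : ℝ) : ℂ) * 1 = _
    push_cast; ring
  · change (1 / 2 : ℂ) = _
    push_cast; ring

/-- With the second target at infinity, both sides carry, from left to right, the first target and
the two inputs. -/
theorem mult_comult_right :
    ((comult x).tensor (cyl x)).comp ((cyl x).tensor (mult x)) |>.Equivalent
      ((mult x).comp (comult x)) := by
  obtain ⟨fc, hc⟩ := isModel_cyl x
  obtain ⟨fc', hc'⟩ := isModel_cyl_inl x
  obtain ⟨fm, hm⟩ := isModel_mult x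
  obtain ⟨fd, hd⟩ := isModel_comult_inr_one x
  have hne : ∀ j : Fin 2, j ≠ 1 → (![-1 / 2, 0] : Fin 2 → ℂ) j ≠ 0 :=
    Fin.forall_fin_two.2 ⟨fun _ => by norm_num, fun h => (h rfl).elim⟩
  obtain ⟨ℓ, ⟨hℓ, -⟩, f, hf⟩ :=
    (eventually_sq_lt.and (hc.comp_path_right hd hm hc' (by norm_num) (by norm_num))).exists
  obtain ⟨s, ⟨hs, hs'⟩, f', hf'⟩ := (eventually_sq_lt.and (hm.comp_right hd hne)).exists
  refine IsModel.equivalent_of_three (n := [x, x]) (m := [x, x]) hf hf'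
    (.inr (0 : Fin 2)) (.inl (0 : Fin 2)) (.inl (1 : Fin 2)) ?_ (by simp) (by simp) (by simp)
    (x₁ := -1 - ℓ ^ 2 / 2) (x₂ := -1) (x₃ := 1) (y₁ := -1 / 2) (y₂ := -s ^ 2) (y₃ := s ^ 2)
    ?_ ?_ ?_ (by linarith) (by linarith) ?_ ?_ ?_ (by linarith) (by linarith)
  · rintro (j | j)
    · revert j
      exact Fin.forall_fin_two.2 ⟨fun _ => .inr (.inl rfl), fun _ => .inr (.inr rfl)⟩
    · revert j
      exact Fin.forall_fin_two.2 ⟨fun _ => .inl rfl, fun h => (h rfl).elim⟩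
  · change -1 + ((ℓ ^ 2 : ℝ) : ℂ) * (-1 / 2) + ((ℓ ^ 4 : ℝ) : ℂ) * 0 = _
    push_cast; ring
  · change -1 + ((ℓ ^ 2 : ℝ) : ℂ) * 0 = _
    push_cast; ring
  · change 1 + ((ℓ ^ 2 : ℝ) : ℂ) * 0 = _
    push_cast; ring
  · change (-1 / 2 : ℂ) = _
    push_cast; ring
  · change 0 + ((s ^ 2 : ℝ) : ℂ) * (-1) = _
    push_cast; ring
  · change 0 + ((s ^ 2 : ℝ) : ℂ) * 1 = _
    push_cast; ring

/-- The unit and counit relations need no positions: filling one leaf leaves an annulus whose only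
leaf has the kind of the plane, and this is a cylinder. -/
theorem isFrobenius : IsFrobenius x (mult x) (unit x) (comult x) (counit x) := by
  obtain ⟨fc, hc⟩ := isModel_cyl x
  obtain ⟨fc', hc'⟩ := isModel_cyl_inl x
  obtain ⟨fu, hu⟩ := isModel_unit x
  obtain ⟨fe, he⟩ := isModel_counit x
  have hl : ∀ e : EndIdx [x] [x], e ≠ .inr 0 → e = .inl (0 : Fin 1) := fun e h => by
    obtain ⟨j, rfl⟩ := EndIdx.eq_inl_of_ne h
    exact congrArg Sum.inl (Subsingleton.elim (α := Fin 1) j 0)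
  have hr : ∀ e : EndIdx [x] [x], e ≠ .inl 0 → e = .inr (0 : Fin 1) := fun e h => by
    obtain ⟨j, rfl⟩ := EndIdx.eq_inr_of_ne h
    exact congrArg Sum.inr (Subsingleton.elim (α := Fin 1) j 0)
  refine ⟨mult_assoc x, ?_, ?_, comult_coassoc x, ?_, ?_, mult_comult_left x,
    mult_comult_right x⟩
  · obtain ⟨r, -, -, f, hf⟩ := hc.tensor_comp_mult hu
    exact IsModel.equivalent_of_one (n := [x]) (m := [x]) hf hc hl rfl
  · obtain ⟨r, -, -, f, hf⟩ := hu.tensor_comp_mult hc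
    exact IsModel.equivalent_of_one (n := [x]) (m := [x]) hf hc hl rfl
  · obtain ⟨r, -, -, f, hf⟩ := hc'.comult_comp_tensor he
    exact IsModel.equivalent_of_one (n := [x]) (m := [x]) hf hc' hr rfl
  · obtain ⟨r, -, -, f, hf⟩ := he.comult_comp_tensor hc'
    exact IsModel.equivalent_of_one (n := [x]) (m := [x]) hf hc' hr rfl

end Frobenius

/-- The inputs are two distinct points of a nonsingular plane, and a half turn exchanges them. For
the bi-web the order on the axis obstructs this. -/
theorem braid_mult_circle : ((braid .circle .circle).comp (mult .circle)).Equivalent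
    (mult .circle) := by
  obtain ⟨fm, hm⟩ := isModel_mult .circle
  obtain ⟨f, hf⟩ := isModel_braid_mult .circle
  refine hf.equivalent_of_two_circles hm (e₁ := .inl (0 : Fin 2)) (e₂ := .inl (1 : Fin 2)) ?_
    (by norm_num) (by norm_num)
  intro e h
  obtain ⟨j, rfl⟩ := EndIdx.eq_inl_of_ne h
  revert j
  exact Fin.forall_fin_two.2 ⟨fun _ => .inl rfl, fun _ => .inr rfl⟩

/-- Capping off a tree with two inputs. -/
theorem IsModel.comp_counit {b x : Web} {D : Cob [x, b] [b]} {P : EndIdx [x, b] [b] → ℂ}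
    {g : D.M → ℂ} (hD : IsModel D b (.inr 0) P g) (hne : P (.inl 0) ≠ P (.inl 1)) :
    ∃ P f, IsModel (D.comp (counit b)) b (.inl (1 : Fin 2)) P f := by
  obtain ⟨fe, he⟩ := isModel_counit b
  have hr := hD.reroot (o' := .inl (1 : Fin 2)) Sum.inl_ne_inr rfl (by
    intro e h
    obtain ⟨j, rfl⟩ := EndIdx.eq_inl_of_ne h
    revert j
    exact Fin.forall_fin_two.2 ⟨fun _ _ => hne, fun _ h => (h rfl).elim⟩)
  have hne' : ∀ j : Fin 2, j ≠ 1 →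
      (if (Sum.inl j : EndIdx [x, b] [b]) = .inr 0 then 0 else -(P (.inl j) - P (.inl 1))⁻¹) ≠
      (if (Sum.inr (0 : Fin 1) : EndIdx [x, b] [b]) = .inr 0 then 0
        else -(P (.inr (0 : Fin 1)) - P (.inl 1))⁻¹) := by
    refine Fin.forall_fin_two.2 ⟨fun _ => ?_, fun h => (h rfl).elim⟩
    simpa using sub_ne_zero.2 hne
  obtain ⟨f, hf⟩ := hr.comp_cap he hne'
  exact ⟨_, f, hf⟩

theorem eq_inl_zero_of_ne {x y : Web} (e : EndIdx [x, y] []) (h : e ≠ .inl (1 : Fin 2)) :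
    e = .inl (0 : Fin 2) := by
  rcases e with j | j
  · revert j
    exact Fin.forall_fin_two.2 ⟨fun _ => rfl, fun h => (h rfl).elim⟩
  · exact j.elim0

/-- After capping the output, the second input can be taken as the root. A single leaf is left, so
the linear order of the inputs is forgotten; only their cyclic order survives. -/
theorem mult_counit_symm (x : Web) : ((mult x).comp (counit x)).Equivalent
    (((braid x x).comp (mult x)).comp (counit x)) := by
  obtain ⟨fm, hm⟩ := isModel_mult x
  obtain ⟨fb, hb⟩ := isModel_braid_mult x
  obtain ⟨P, f, hf⟩ := hm.comp_counit (by norm_num)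
  obtain ⟨P', f', hf'⟩ := hb.comp_counit (by norm_num)
  exact hf.equivalent_of_one hf' eq_inl_zero_of_ne rfl

/-- Both products show two circles at equal height in the upper half plane in the same horizontal
order: at `∓ℓ ^ 2 + i` on one side and at `∓1 + r * i` on the other. The two units are both discs
without leaves. -/
theorem isAlgebraHom_zipper : IsAlgebraHom (mult .circle) (unit .circle) (mult .biweb)
    (unit .biweb) zipper := by
  obtain ⟨fz, hz⟩ := isModel_zipper
  obtain ⟨fm, hm⟩ := isModel_mult .circle
  obtain ⟨fu, hu⟩ := isModel_unit .circle
  obtain ⟨fu', hu'⟩ := isModel_unit .biweb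
  have hne : ∀ j : Fin 1, j ≠ 0 → Complex.I ≠ Complex.I := fun j h =>
    absurd (Subsingleton.elim j 0) h
  constructor
  · obtain ⟨ℓ, ⟨hℓ, -⟩, f, hf⟩ := (eventually_sq_lt.and (hm.comp_right hz hne)).exists
    obtain ⟨r, hr, -, f', hf'⟩ := hz.tensor_comp_mult hz
    have p₀ : Complex.I + ((ℓ ^ 2 : ℝ) : ℂ) * (-1) = ⟨-ℓ ^ 2, 1⟩ := by
      apply Complex.ext <;> simp [-Complex.ofReal_pow]
    have p₁ : Complex.I + ((ℓ ^ 2 : ℝ) : ℂ) * 1 = ⟨ℓ ^ 2, 1⟩ := by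
      apply Complex.ext <;> simp [-Complex.ofReal_pow]
    have q₀ : -1 + (r : ℂ) * Complex.I = ⟨-1, r⟩ := by apply Complex.ext <;> simp
    have q₁ : 1 + (r : ℂ) * Complex.I = ⟨1, r⟩ := by apply Complex.ext <;> simp
    have hg := IsModel.congr (n := [.circle, .circle]) (m := [.biweb]) hf
      (P' := Sum.elim ![⟨-ℓ ^ 2, 1⟩, ⟨ℓ ^ 2, 1⟩] fun _ => 0) (by
        intro e h
        obtain ⟨j, rfl⟩ := EndIdx.eq_inl_of_ne h
        revert j
        exact Fin.forall_fin_two.2 ⟨fun _ => p₀.symm, fun _ => p₁.symm⟩)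
    have hg' := IsModel.congr (n := [.circle, .circle]) (m := [.biweb]) hf'
      (P' := Sum.elim ![⟨-1, r⟩, ⟨1, r⟩] fun _ => 0) (by
        intro e h
        obtain ⟨j, rfl⟩ := EndIdx.eq_inl_of_ne h
        revert j
        exact Fin.forall_fin_two.2 ⟨fun _ => q₀.symm, fun _ => q₁.symm⟩)
    refine IsModel.equivalent_of_two (n := [.circle, .circle]) (m := [.biweb]) hg hg'
      (e₁ := .inl (0 : Fin 2)) (e₂ := .inl (1 : Fin 2)) ?_ (by simp) one_pos rfl ?_ hr rfl ?_
    · intro e h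
      obtain ⟨j, rfl⟩ := EndIdx.eq_inl_of_ne h
      revert j
      exact Fin.forall_fin_two.2 ⟨fun _ => .inl rfl, fun _ => .inr rfl⟩
    · change -ℓ ^ 2 < ℓ ^ 2
      linarith
    · change (-1 : ℝ) < 1
      norm_num
  · obtain ⟨ℓ, f, hf⟩ := (hu.comp_right hz hne).exists
    refine (hf.congr (P' := fun _ => 0) fun e h => ?_).equivalent hu'
    obtain ⟨j, rfl⟩ := EndIdx.eq_inl_of_ne h
    exact j.elim0

/-- Both sides are annuli with the bi-web at infinity and a circle somewhere in the upper half
plane, which can be moved to `Complex.I`. On the left the multiplication and counit are bracketed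
first, since they form a pairing of circle kind that has to be placed as a whole inside the upper
half plane. -/
theorem cozipper_dual : (((cyl .circle).tensor cozipper).comp (mult .circle)).comp
    (counit .circle) |>.Equivalent
      (((zipper.tensor (cyl .biweb)).comp (mult .biweb)).comp (counit .biweb)) := by
  obtain ⟨fz, hz⟩ := isModel_zipper
  obtain ⟨fz', hz'⟩ := isModel_cozipper
  obtain ⟨fc, hc⟩ := isModel_cyl .circle
  obtain ⟨fc', hc'⟩ := isModel_cyl .biweb
  obtain ⟨fm, hm⟩ := isModel_mult .circle
  obtain ⟨PD, fD, hD⟩ := hm.comp_counit (by norm_num)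
  obtain ⟨p, f, hf⟩ := hc.comp_pairing hz' hD
  obtain ⟨r, -, -, g, hg⟩ := hz.tensor_comp_mult hc'
  have hne : -1 + (r : ℂ) * Complex.I ≠ 1 + (r : ℂ) * 0 := fun h => by
    have := congrArg Complex.re h
    norm_num at this
  obtain ⟨P', f', hf'⟩ := IsModel.comp_counit (x := .circle) (b := .biweb) hg hne
  obtain ⟨k, hk⟩ := hf.exists_one_circle (e₁ := .inl (0 : Fin 2)) (by simp) rfl eq_inl_zero_of_ne
  obtain ⟨k', hk'⟩ := hf'.exists_one_circle (e₁ := .inl (0 : Fin 2)) (by simp) rfl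
    eq_inl_zero_of_ne
  exact (equivalent_equivalence _ _).trans (comp_assoc _ _ _) (hk.equivalent hk')

/-- Both sides have a bi-web on the axis and a circle above it, and only the horizontal order
differs, which the circle can change. Rebracketing joins the braiding to the multiplication, so that
the zipper is inserted into the opposite multiplication. -/
theorem zipper_central : (((cyl .biweb).tensor zipper).comp (mult .biweb)).Equivalent
    ((((cyl .biweb).tensor zipper).comp (braid .biweb .biweb)).comp (mult .biweb)) := by
  obtain ⟨fz, hz⟩ := isModel_zipper
  obtain ⟨fc, hc⟩ := isModel_cyl .biweb
  obtain ⟨fb, hb⟩ := isModel_braid_mult .biweb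
  have hF : IsForest ((cyl .biweb).tensor zipper) .biweb (fun i => .inr i) _ _ :=
    hc.forest hz rfl rfl
  obtain ⟨r, -, -, f, hf⟩ := hc.tensor_comp_mult hz
  obtain ⟨ℓ, f', hf'⟩ := (hF.comp_right hb (by norm_num)).exists
  refine (equivalent_equivalence _ _).trans ?_
    ((equivalent_equivalence _ _).symm (comp_assoc _ _ _))
  refine IsModel.equivalent_of_central (n := [.biweb, .circle]) (m := [.biweb]) hf hf'
    (e₁ := .inl (0 : Fin 2)) (e₂ := .inl (1 : Fin 2)) ?_ (by simp)
    (hf.compat (.inl (0 : Fin 2)) Sum.inl_ne_inr) (hf.compat (.inl (1 : Fin 2)) Sum.inl_ne_inr)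
    (hf'.compat (.inl (0 : Fin 2)) Sum.inl_ne_inr) (hf'.compat (.inl (1 : Fin 2)) Sum.inl_ne_inr)
  intro e h
  obtain ⟨j, rfl⟩ := EndIdx.eq_inl_of_ne h
  revert j
  exact Fin.forall_fin_two.2 ⟨fun _ => .inl rfl, fun _ => .inr rfl⟩

/-! ### The local relations -/

theorem Mor.zipper_comp_cozipper (R : Type*) [CommRing R] (i : R) :
    Mor.comp R i _ _ _ (Mor.of R i zipper) (Mor.of R i cozipper) =
      (-i) • Mor.of R i (cyl .circle) :=
  (Mor.of_comp R i _ _).symm.trans ((Submodule.Quotient.eq _).2 IsNull.local_circle)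

theorem Mor.cozipper_comp_zipper (R : Type*) [CommRing R] (i : R) :
    Mor.comp R i _ _ _ (Mor.of R i cozipper) (Mor.of R i zipper) =
      (-i) • Mor.of R i (cyl .biweb) :=
  (Mor.of_comp R i _ _).symm.trans ((Submodule.Quotient.eq _).2 IsNull.local_biweb)

end SingCob

end

/-! ### Assembly of the six items -/

theorem mainTheorem6 (R : Type*) [CommRing R] (i : R) (hi : i ^ 2 = -1) :
    IsCommutativeFrobenius .circle (Cob.mult .circle) (Cob.unit .circle) (Cob.comult .circle)
      (Cob.counit .circle) ∧
    IsSymmetricFrobenius .biweb (Cob.mult .biweb) (Cob.unit .biweb) (Cob.comult .biweb)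
      (Cob.counit .biweb) ∧
    IsAlgebraHom (Cob.mult .circle) (Cob.unit .circle) (Cob.mult .biweb) (Cob.unit .biweb)
      Cob.zipper ∧
    (Cob.cyl .circle ⨿ₛ Cob.cozipper) ⨾ Cob.mult .circle ⨾ Cob.counit .circle ≅ₛ
      (Cob.zipper ⨿ₛ Cob.cyl .biweb) ⨾ Cob.mult .biweb ⨾ Cob.counit .biweb ∧
    (Cob.cyl .biweb ⨿ₛ Cob.zipper) ⨾ Cob.mult .biweb ≅ₛ
      (Cob.cyl .biweb ⨿ₛ Cob.zipper) ⨾ Cob.braid .biweb .biweb ⨾ Cob.mult .biweb ∧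
    Mor.comp R i _ _ _ (Mor.of R i Cob.zipper) (i • Mor.of R i Cob.cozipper) =
      Mor.of R i (Cob.cyl .circle) ∧
    Mor.comp R i _ _ _ (i • Mor.of R i Cob.cozipper) (Mor.of R i Cob.zipper) =
      Mor.of R i (Cob.cyl .biweb) := by
  have hi' : i * -i = 1 := by rw [mul_neg, ← sq, hi, neg_neg]
  refine ⟨⟨isFrobenius _, braid_mult_circle⟩, ⟨isFrobenius _, mult_counit_symm _⟩,
    isAlgebraHom_zipper, cozipper_dual, zipper_central, ?_, ?_⟩
  · rw [map_smul, Mor.zipper_comp_cozipper, smul_smul, hi', one_smul]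
  · rw [map_smul, LinearMap.smul_apply, Mor.cozipper_comp_zipper, smul_smul, hi', one_smul]
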